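/- **Setting.** Let $v_1:\mathbb R^3\to[0,\infty)$ be continuous, spherically symmetric, supported in the closed unit ball, with $v_1(0)>0$. For $R>0$ put $v_R(x)=R^{-3}v_1(x/R)$ and let $a$ be the scattering length of $v_R$: the equation $-\Delta f+\frac12 v_Rf=0$ on $\mathbb R^3$ has a solution with $f(x)=1-a/|x|$ outside the range of $v_R$. For an integer $M$ let $\zeta(y)=\cos(\pi y)$ for $|y|\le\frac12$ and $\zeta(y)=0$ otherwise, and $\chi(x)=C_M(\zeta(x_1)\zeta(x_2)\zeta(x_3))^{M+1}$ with $C_M>0$ such that $\int\chi^2=1$. Let $\rho,s,d,\ell,L,b>0$, $0<\varepsilon_T<1$, $0\le\varepsilon_0\le\frac12$. Boxes: $\Lambda=[-\frac L2,\frac L2]^3$, $\Lambda'=\Lambda+[-\frac\ell2,\frac\ell2]^3$, $\Lambda''=\Lambda+[-\ell,\ell]^3$; for $u,u'\in\mathbb R^3$, $B(u)=\ell(u+[-\frac12,\frac12]^3)$ and $B(u,u')=B(u)\cap d\ell(u'+[-\frac12,\frac12]^3)$. Put $\chi_u(x)=\chi(x/\ell-u)$, $\chi_{uu'}(x)=\chi_u(x)\chi(x/(d\ell)-u')$,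 $$W_b(x)=\frac{v_R(x)}{(\chi*\chi)(x/\ell)},\qquad W_s(x)=\frac{W_b(x)}{(\chi*\chi)(x/(d\ell))}$$ (both read as $0$ where $v_R$ vanishes), $w_{B(u)}(x,y)=\chi_u(x)W_b(x-y)\chi_u(y)$ and $w_{B(u,u')}(x,y)=\chi_{uu'}(x)W_s(x-y)\chi_{uu'}(y)$. Let $Q_u$, $Q_{uu'}$ be the orthogonal projections in $L^2(\mathbb R^3)$ onto the functions supported in $B(u)$, respectively $B(u,u')$, that are orthogonal to the constants there. Let $-\Delta_u^{\mathcal N}$ be the Neumann Laplacian on $B(u)$, i.e. the operator of the form $\int_{B(u)}|\nabla f|^2$, $f\in H^1(B(u))$; functions of it act on $L^2(B(u))$ and vanish on functions living outside $B(u)$. Put $$\widehat{\mathcal T}_u=\frac{\varepsilon_T}{(d\ell)^{2}}\frac{-\Delta_u^{\mathcal N}}{-\Delta_u^{\mathcal N}+(d\ell)^{-2}}+\frac b{\ell^{2}}Q_u+Q_u\chi_u\Big\{(1-\varepsilon_T)\big(\sqrt{-\Delta}-\tfrac1{2s\ell}\big)_+^2+\varepsilon_T\big(\sqrt{-\Delta}-\tfrac1{2ds\ell}\big)_+^2\Big\}\chi_uQ_u,$$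 $$\mathcal T_{uu'}=\frac{\varepsilon_T}{1+\pi^{-2}}\frac1{(d\ell)^{2}}Q_{uu'}+Q_{uu'}\chi_{uu'}\big(\sqrt{-\Delta}-\tfrac1{ds\ell}\big)_+^2\chi_{uu'}Q_{uu'}.$$ On the $N$-particle sector ($N\ge0$) of the bosonic Fock space over $\mathbb R^3$, with form domain the permutation symmetric functions in $H^1_0(\Lambda^N)$, define the quadratic forms $$H_\rho=\sum_{j=1}^N\Big(-\Delta_j-\rho\int v_R\Big)+\sum_{i<j}v_R(x_i-x_j)+\tfrac12\rho^2|\Lambda''|\int v_R,$$ $$H_u=\sum_{i=1}^N\Big((1-\varepsilon_0)\widehat{\mathcal T}_{u,i}-\rho\int w_{B(u)}(x_i,y)\,dy\Big)+\sum_{i<j}w_{B(u)}(x_i,x_j)+\tfrac12\rho^2\iint w_{B(u)},$$ and $H_{uu'}$ by the same formula as $H_u$ with $\mathcal T_{uu'}$ and $w_{B(u,u')}$ in place of $\widehat{\mathcal T}_u$ and $w_{B(u)}$. In the inequalities below, one-particle operators such as $-\Delta_u^{\mathcal N}$ and $Q_u$ stand for the corresponding sums over the particles, and $\int H\,du$ denotes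 the form $\Psi\mapsto\int\langle\Psi,H\Psi\rangle\,du$ (the integrals converge absolutely). **Theorem.** There is a universal constant $b_0>0$ such that for every $0<b\le b_0$, every integer $M\ge8$, every $v_1$ as above and every $\bar\varepsilon<\frac12$ there is $\delta\in(0,1)$ with the following property. Suppose that $a,R,\rho,s,d,\ell>0$ satisfy $$\frac aR<\delta,\quad \rho a^3<\delta,\quad \frac{\rho^{-1/3}}{ds\ell}<\delta,\quad s<\delta,\quad d\ell(\rho a)^{1/2}<\delta,\quad \frac R{ds\ell}<\delta,\quad \frac{(\rho a)^{-1/2}}{s\ell}<\delta,$$ and that $0<\varepsilon_T<\delta$ and $(s^{-2}+d^{-3})(ds)^{-2}s^M\le\delta$. Then, for all $0\le\varepsilon_0\le\frac12$, all $L>0$ and on every $N$-particle sector, $$H_\rho\ \ge\ \int_{\ell^{-1}\Lambda'}\big(-\varepsilon_0\Delta_u^{\mathcal N}+H_u\big)\,du,$$ and for all $u\in\mathbb R^3$ $$H_u-(1-\varepsilon_0)\frac b2\ell^{-2}Q_u\ \ge\ \int_{\mathbb R^3}H_{uu'}\,du';$$ if moreover $\varepsilon_0\le\bar\varepsilon$,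 then also $H_u-\frac b2\ell^{-2}Q_u\ge\int_{\mathbb R^3}H_{uu'}\,du'$ for all $u\in\mathbb R^3$. Finally, $\mathcal T_{uu'}\ge\varepsilon_T(1+\pi^{-2})^{-1}(d\ell)^{-2}Q_{uu'}$ for all $u,u'\in\mathbb R^3$ (the Neumann gap in the small boxes). -/

import Mathlib

open MeasureTheory Filter Topology
open scoped ContDiff FourierTransform Pointwise ComplexConjugate

noncomputable section

namespace BoseLoc

/-- Physical space. -/
abbrev E3 := EuclideanSpace ℝ (Fin 3)

/-- Configurations of `N` particles. -/
abbrev Config (N : ℕ) := Fin N → E3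

/-! ### Boxes -/

/-- The closed cube with centre `c` and side length `r`. -/
def cube (c : E3) (r : ℝ) : Set E3 := {x | ∀ k, |x k - c k| ≤ r / 2}

/-- The large box `B(u) = ℓ (u + [-1/2,1/2]³)`. -/
def bigBox (ℓ : ℝ) (u : E3) : Set E3 := cube (ℓ • u) ℓ

/-- The small box `B(u,u')`, the intersection of `B(u)` with `dℓ (u' + [-1/2,1/2]³)`. -/
def smallBox (d ℓ : ℝ) (u u' : E3) : Set E3 := bigBox ℓ u ∩ bigBox (d * ℓ) u'

/-- `Λ = [-L/2, L/2]³`. -/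
def Lam (L : ℝ) : Set E3 := cube 0 L

/-- `Λ' = Λ + [-ℓ/2, ℓ/2]³`. -/
def Lam' (L ℓ : ℝ) : Set E3 := Lam L + cube 0 ℓ

/-- `Λ'' = Λ + [-ℓ, ℓ]³`. -/
def Lam'' (L ℓ : ℝ) : Set E3 := Lam L + cube 0 (2 * ℓ)

/-! ### Localization functions -/

def zeta (y : ℝ) : ℝ := if |y| ≤ 1 / 2 then Real.cos (Real.pi * y) else 0

/-- The localization function before normalization. -/
def chiShape (M : ℕ) (x : E3) : ℝ := (zeta (x 0) * zeta (x 1) * zeta (x 2)) ^ (M + 1)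

/-- The constant `C_M`, chosen such that `∫ χ² = 1`. -/
def chiConst (M : ℕ) : ℝ := (√(∫ x, chiShape M x ^ 2))⁻¹

/-- The localization function `χ`. -/
def chi (M : ℕ) (x : E3) : ℝ := chiConst M * chiShape M x

/-- The convolution `χ * χ`. -/
def chiConv (M : ℕ) (x : E3) : ℝ := ∫ y, chi M y * chi M (x - y)

/-- `χ_u(x) = χ(x/ℓ - u)`, the localization function of the large box. -/
def chiBig (M : ℕ) (ℓ : ℝ) (u x : E3) : ℝ := chi M (ℓ⁻¹ • x - u)

/-- `χ(x/ℓ - u) χ(x/(dℓ) - u')`, the localization function of the small box. -/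
def chiSmall (M : ℕ) (d ℓ : ℝ) (u u' x : E3) : ℝ := chiBig M ℓ u x * chiBig M (d * ℓ) u' x

/-! ### Potentials -/

/-- The assumptions on the unscaled potential: nonnegative, spherically symmetric, continuous,
supported in the closed unit ball, and positive at the origin. -/
structure AdmissiblePotential (v₁ : E3 → ℝ) : Prop where
  nonneg : ∀ x, 0 ≤ v₁ x
  radial : ∀ x y, ‖x‖ = ‖y‖ → v₁ x = v₁ y
  continuous : Continuous v₁
  support : tsupport v₁ ⊆ Metric.closedBall 0 1
  pos_zero : 0 < v₁ 0

/-- The scaled potential `v_R(x) = R⁻³ v₁(x/R)`. -/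
def vR (v₁ : E3 → ℝ) (R : ℝ) (x : E3) : ℝ := (R ^ 3)⁻¹ * v₁ (R⁻¹ • x)

/-- `a` is the scattering length of the finite range potential `v`: the zero energy scattering
equation `-Δf + v f / 2 = 0` on `ℝ³` has a (distributional) solution `f` with
`f(x) = 1 - a/|x|` outside the range of `v`. -/
def IsScatteringLength (v : E3 → ℝ) (a : ℝ) : Prop :=
  ∃ f : E3 → ℝ, Continuous f ∧
    (∀ φ : E3 → ℝ, ContDiff ℝ ∞ φ → HasCompactSupport φ →
      ∫ x, (-(f x * Laplacian.laplacian φ x) + 1 / 2 * v x * f x * φ x) = 0) ∧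
    ∃ R₀ : ℝ, 0 < R₀ ∧ (∀ x, R₀ < ‖x‖ → v x = 0) ∧ (∀ x, R₀ < ‖x‖ → f x = 1 - a / ‖x‖)

/-- `W_b(x) = v_R(x) / (χ*χ)(x/ℓ)`. -/
def Wb (M : ℕ) (v₁ : E3 → ℝ) (R ℓ : ℝ) (x : E3) : ℝ := vR v₁ R x / chiConv M (ℓ⁻¹ • x)

/-- `W_s(x) = W_b(x) / (χ*χ)(x/(dℓ))`. -/
def Ws (M : ℕ) (v₁ : E3 → ℝ) (R d ℓ : ℝ) (x : E3) : ℝ :=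
  Wb M v₁ R ℓ x / chiConv M ((d * ℓ)⁻¹ • x)

/-- `w_{B(u)}(x,y)`. -/
def wBig (M : ℕ) (v₁ : E3 → ℝ) (R ℓ : ℝ) (u x y : E3) : ℝ :=
  chiBig M ℓ u x * Wb M v₁ R ℓ (x - y) * chiBig M ℓ u y

/-- `w_{B(u,u')}(x,y)`. -/
def wSmall (M : ℕ) (v₁ : E3 → ℝ) (R d ℓ : ℝ) (u u' x y : E3) : ℝ :=
  chiSmall M d ℓ u u' x * Ws M v₁ R d ℓ (x - y) * chiSmall M d ℓ u u' y

/-- The potential energy function of `N` particles in a box with interaction `w`,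
`-∑_j ρ ∫ w(x_j,y) dy + ∑_{i<j} w(x_i,x_j) + (ρ²/2) ∬ w`. -/
def boxPotential (ρ : ℝ) (w : E3 → E3 → ℝ) {N : ℕ} (x : Config N) : ℝ :=
  (∑ i, -(ρ * ∫ y, w (x i) y)) + (∑ i, ∑ j ∈ Finset.Ioi i, w (x i) (x j))
    + 1 / 2 * ρ ^ 2 * ∫ y, ∫ z, w y z

/-- The potential energy function of the background Hamiltonian,
with self-energy `(ρ²/2) |Λ''| ∫ v_R`. -/
def backgroundPotential (v₁ : E3 → ℝ) (R ρ ℓ L : ℝ) {N : ℕ} (x : Config N) : ℝ :=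
  (∑ _i : Fin N, -(ρ * ∫ y, vR v₁ R y)) + (∑ i, ∑ j ∈ Finset.Ioi i, vR v₁ R (x i - x j))
    + 1 / 2 * ρ ^ 2 * volume.real (Lam'' L ℓ) * ∫ y, vR v₁ R y

/-! ### One-particle quadratic forms -/

/-- `Q_S f = 1_S f - |S|⁻¹ ⟨1_S, f⟩ 1_S`, the projection onto the functions supported in `S` that
are orthogonal to the constants on `S`. -/
def projQ (S : Set E3) (f : E3 → ℂ) (x : E3) : ℂ :=
  S.indicator (fun y => f y - ((volume.real S)⁻¹ : ℝ) * ∫ z in S, f z) x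

/-- The quadratic form `⟨f, Q_S f⟩`. -/
def formQ (S : Set E3) (f : E3 → ℂ) : ℝ := (∫ x, conj (f x) * projQ S f x).re

/-- The quadratic form `⟨g, (√(-Δ) - t)₊² g⟩`. With the present normalization of the Fourier
transform, `√(-Δ)` is multiplication by `2π|ξ|` in Fourier space. -/
def dispersionForm (t : ℝ) (g : E3 → ℂ) : ℝ :=
  ∫ ξ, max (2 * Real.pi * ‖ξ‖ - t) 0 ^ 2 * ‖𝓕 g ξ‖ ^ 2

/-- `f` belongs to the Sobolev space `H¹(U)` and has weak gradient `G`. -/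
structure HasH1Gradient (U : Set E3) (f : E3 → ℂ) (G : E3 → EuclideanSpace ℂ (Fin 3)) : Prop where
  memLp : MemLp f 2 (volume.restrict U)
  memLp_grad : MemLp G 2 (volume.restrict U)
  weak : ∀ φ : E3 → ℝ, ContDiff ℝ ∞ φ → HasCompactSupport φ → tsupport φ ⊆ U → ∀ k : Fin 3,
    ∫ x in U, f x * ((fderiv ℝ φ x (EuclideanSpace.single k 1) : ℝ) : ℂ)
      = - ∫ x in U, G x k * ((φ x : ℝ) : ℂ)

open Classical in
/-- The Dirichlet integral `∫_U |∇f|²` of a function `f ∈ H¹(U)`. -/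
def gradEnergy (U : Set E3) (f : E3 → ℂ) : ℝ :=
  if h : ∃ G, HasH1Gradient U f G then ∫ x in U, ‖h.choose x‖ ^ 2 else 0

/-- The form of minus the Neumann Laplacian on the box `B(u)`. -/
def neumannForm (ℓ : ℝ) (u : E3) (f : E3 → ℂ) : ℝ := gradEnergy (interior (bigBox ℓ u)) f

/-- `g = (-Δ^N + μ)⁻¹ f` on `L²(U)`, where `-Δ^N` is the operator associated with the quadratic
form `∫_U |∇f|²` with domain `H¹(U)`. -/
def IsNeumannResolvent (U : Set E3) (μ : ℝ) (f g : E3 → ℂ) : Prop :=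
  ∃ G, HasH1Gradient U g G ∧ ∀ h H, HasH1Gradient U h H →
    (∫ x in U, inner ℂ (H x) (G x)) + (μ : ℂ) * (∫ x in U, conj (h x) * g x)
      = ∫ x in U, conj (h x) * f x

open Classical in
/-- The quadratic form `⟨f, (-Δ^N)/(-Δ^N + μ) f⟩ = ⟨f, f - μ (-Δ^N + μ)⁻¹ f⟩` on `L²(U)`. -/
def neumannRatioForm (U : Set E3) (μ : ℝ) (f : E3 → ℂ) : ℝ :=
  if h : ∃ g, IsNeumannResolvent U μ f g then
    (∫ x in U, conj (f x) * (f x - (μ : ℂ) * h.choose x)).re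
  else 0

/-- The localized kinetic energy of the large box `B(u)`. -/
def kinBig (M : ℕ) (b s d ℓ εT : ℝ) (u : E3) (f : E3 → ℂ) : ℝ :=
  εT * ((d * ℓ) ^ 2)⁻¹ * neumannRatioForm (interior (bigBox ℓ u)) ((d * ℓ) ^ 2)⁻¹ f
    + b * (ℓ ^ 2)⁻¹ * formQ (bigBox ℓ u) f
    + ((1 - εT) * dispersionForm (1 / 2 * (s * ℓ)⁻¹)
          (fun x => (chiBig M ℓ u x : ℂ) * projQ (bigBox ℓ u) f x)
      + εT * dispersionForm (1 / 2 * (d * s * ℓ)⁻¹)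
          (fun x => (chiBig M ℓ u x : ℂ) * projQ (bigBox ℓ u) f x))

/-- The localized kinetic energy of the small box `B(u,u')`. -/
def kinSmall (M : ℕ) (s d ℓ εT : ℝ) (u u' : E3) (f : E3 → ℂ) : ℝ :=
  εT * (1 + (Real.pi ^ 2)⁻¹)⁻¹ * ((d * ℓ) ^ 2)⁻¹ * formQ (smallBox d ℓ u u') f
    + dispersionForm (d * s * ℓ)⁻¹
        (fun x => (chiSmall M d ℓ u u' x : ℂ) * projQ (smallBox d ℓ u u') f x)

/-! ### Many-particle quadratic forms -/

/-- Insert the position `x` of the `i`-th particle into the positions of the others. -/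
def insertAt {N : ℕ} (i : Fin N) (x : E3) (X : {j : Fin N // j ≠ i} → E3) : Config N :=
  fun j => if h : j = i then x else X ⟨j, h⟩

/-- `∑ i, ⟨Ψ, A_i Ψ⟩` for a one-particle operator `A` with quadratic form `q`, where `A_i` acts on
the variable of the `i`-th particle. -/
def secondQuant (q : (E3 → ℂ) → ℝ) {N : ℕ} (Ψ : Config N → ℂ) : ℝ :=
  ∑ i : Fin N, ∫ X : {j : Fin N // j ≠ i} → E3, q (fun x => Ψ (insertAt i x X))

/-- `⟨Ψ, V Ψ⟩` for a multiplication operator `V`. -/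
def potentialForm {N : ℕ} (V : Config N → ℝ) (Ψ : Config N → ℂ) : ℝ := ∫ x, V x * ‖Ψ x‖ ^ 2

/-- The Sobolev space `H¹₀(U)`: the closure in `H¹` of the smooth functions with compact support
in the open set `U`. -/
def MemH10 {V : Type*} [NormedAddCommGroup V] [NormedSpace ℝ V] [MeasureSpace V]
    (U : Set V) (f : V → ℂ) : Prop :=
  MemLp f 2 volume ∧ ∃ G : V → (V →L[ℝ] ℂ), MemLp G 2 volume ∧ ∃ φ : ℕ → V → ℂ,
    (∀ n, ContDiff ℝ ∞ (φ n) ∧ HasCompactSupport (φ n) ∧ tsupport (φ n) ⊆ U) ∧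
    Tendsto (fun n => eLpNorm (φ n - f) 2 volume) atTop (𝓝 0) ∧
    Tendsto (fun n => eLpNorm (fderiv ℝ (φ n) - G) 2 volume) atTop (𝓝 0)

/-- The form domain in the `N`-particle sector of the bosonic Fock space: permutation symmetric
functions in `H¹₀(Λᴺ)`. -/
def BosonDomain (L : ℝ) {N : ℕ} (Ψ : Config N → ℂ) : Prop :=
  MemH10 (interior {x : Config N | ∀ i, x i ∈ Lam L}) Ψ ∧
    ∀ σ : Equiv.Perm (Fin N), ∀ᵐ x : Config N, Ψ (x ∘ σ) = Ψ x

/-- The background Hamiltonian `H_ρ` on the `N`-particle sector. -/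
def Hrho (v₁ : E3 → ℝ) (R ρ ℓ L : ℝ) {N : ℕ} (Ψ : Config N → ℂ) : ℝ :=
  secondQuant (gradEnergy Set.univ) Ψ + potentialForm (backgroundPotential v₁ R ρ ℓ L) Ψ

/-- The Hamiltonian `H_u` of the large box `B(u)` on the `N`-particle sector. -/
def Hbig (M : ℕ) (v₁ : E3 → ℝ) (b R ρ s d ℓ εT ε₀ : ℝ) (u : E3) {N : ℕ} (Ψ : Config N → ℂ) : ℝ :=
  (1 - ε₀) * secondQuant (kinBig M b s d ℓ εT u) Ψ
    + potentialForm (boxPotential ρ (wBig M v₁ R ℓ u)) Ψ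

/-- The Hamiltonian `H_{uu'}` of the small box `B(u,u')` on the `N`-particle sector. -/
def Hsmall (M : ℕ) (v₁ : E3 → ℝ) (R ρ s d ℓ εT ε₀ : ℝ) (u u' : E3) {N : ℕ} (Ψ : Config N → ℂ) :
    ℝ :=
  (1 - ε₀) * secondQuant (kinSmall M s d ℓ εT u u') Ψ
    + potentialForm (boxPotential ρ (wSmall M v₁ R d ℓ u u')) Ψ

/-! ### Conditions on the parameters -/

structure LengthScaleCondition (δ a R ρ s d ℓ : ℝ) : Prop where
  a_pos : 0 < a
  R_pos : 0 < R
  ρ_pos : 0 < ρ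
  s_pos : 0 < s
  d_pos : 0 < d
  ℓ_pos : 0 < ℓ
  a_div_R : a / R < δ
  dilute : ρ * a ^ 3 < δ
  spacing : ρ ^ (-(1 / 3) : ℝ) * (d * s * ℓ)⁻¹ < δ
  s_small : s < δ
  small_box : d * ℓ * (ρ * a) ^ (1 / 2 : ℝ) < δ
  range : R * (d * s * ℓ)⁻¹ < δ
  large_box : (ρ * a) ^ (-(1 / 2) : ℝ) * (s * ℓ)⁻¹ < δ

structure KineticCondition (δ : ℝ) (M : ℕ) (s d εT : ℝ) : Prop where
  εT_pos : 0 < εT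
  εT_small : εT < δ
  smooth : ((s ^ 2)⁻¹ + (d ^ 3)⁻¹) * ((d * s) ^ 2)⁻¹ * s ^ M ≤ δ

end BoseLoc

end

open BoseLoc MeasureTheory

noncomputable section

namespace BoseLoc

/-! Both localizations compare a Hamiltonian with an average of localized Hamiltonians over all
positions of a sliding box. Potential and kinetic energy are treated separately.

The potential energy is localized by an exact identity. As `χ` is even, the average of `χ_u(x)
χ_u(y)` over `u` is `(χ*χ)((x-y)/ℓ)` (`integral_chiBig_mul`), and the denominators in `W_b` and
`W_s` cancel precisely such factors. For the small boxes the one-body, two-body and constant terms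
are all reproduced (`integral_potentialForm_wSmall`). For the large boxes only the constants differ:
the boxes with `u` in `ℓ⁻¹Λ'` add up to `(L+ℓ)³ ∫ v_R`, which is at most `|Λ''| ∫ v_R`
(`integral_potentialForm_wBig_le`).

For the kinetic energy in the large boxes, translation covariance turns an average of local
quadratic forms into a Fourier multiplier, whose symbol at `k` is the local form evaluated on a
plane wave (`lintegral_dispersionL_shiftWindow`, `lintegral_formQ_bigBox`). The form of
`-Δ^N/(-Δ^N+μ)` is the minimum of `‖f-h‖² + μ⁻¹‖∇h‖²` over `h ∈ H¹`, as a squared distance to the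
closed graph of the gradient (`neumannRatioForm_eq`). A single trial function on the whole space, a
truncated free resolvent applied to `f`, bounds it in all boxes at once by a multiplier
(`lintegral_neumannRatioForm_le`). What remains is a scalar inequality in `|k|`
(`symbol_inequality`). It holds because the symbol of the localized dispersion is at most `(k-t)₊² +
Cℓ⁻²` and, thanks to the subtracted mean, also at most `C t⁻²(k⁴ + k²ℓ⁻²)`
(`exists_symbol_bound_mean`), with thresholds `t` far above `ℓ⁻¹` when `s` is small.

For the small boxes, the gap comes from the Poincaré inequality with optimal constant on cuboids of
side at most `dℓ`, applied to an arbitrary competitor `h` in the large box, averaged over `u'` and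
minimized over `h` (`lintegral_formQ_smallBox_le`). In the dispersion, `χ_{uu'} Q_{uu'} f` equals a
small window times `χ_u Q_u f`, up to a multiple of `χ_{uu'}`. Averaging the window costs half of
the threshold and a high power of `s` (`exists_lintegral_dispersionL_window_le`). The multiple of
`χ_{uu'}` is smooth, so only the tail of its Fourier transform enters. All these errors are of order
`s^(M-2) (dℓ)⁻²` times the form of `Q_u`, and a fraction `1-κ` of the term `b ℓ⁻² Q_u` pays for them
(`exists_lintegral_kinSmall_le`).

These are one-particle statements. For `N` particles they are applied to almost every slice `x ↦
Ψ(x, X)` and integrated. Slices of a function in `H¹₀(Λᴺ)` are almost always limits of test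
functions in `Λ` (`exists_slices`), hence integrable, with the Dirichlet energy bounding the first
Fourier moment. Averages are computed in `[0, ∞]` and converted to real numbers where finiteness is
known; measurability in the box position rests on writing the Neumann form as a countable infimum
(`exists_dense_trial`). -/

lemma lintegral_enorm_sq {α F : Type*} [MeasurableSpace α] [NormedAddCommGroup F]
    (μ : Measure α) (g : α → F) : ∫⁻ x, ‖g x‖ₑ ^ 2 ∂μ = eLpNorm g 2 μ ^ 2 := by
  have := eLpNorm_nnreal_pow_eq_lintegral (μ := μ) (f := g) (p := 2) (by norm_num)
  simpa using this.symm

lemma lintegral_enorm_sq_lt_top {α F : Type*} [MeasurableSpace α] [NormedAddCommGroup F]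
    {μ : Measure α} {g : α → F} (hg : MemLp g 2 μ) : ∫⁻ x, ‖g x‖ₑ ^ 2 ∂μ < ⊤ := by
  rw [lintegral_enorm_sq]
  exact ENNReal.pow_lt_top hg.2

lemma memLp_two_of_lintegral {α F : Type*} [MeasurableSpace α] [NormedAddCommGroup F]
    {μ : Measure α} {g : α → F} (hg : AEStronglyMeasurable g μ)
    (h : ∫⁻ x, ‖g x‖ₑ ^ 2 ∂μ < ⊤) : MemLp g 2 μ := by
  refine ⟨hg, ?_⟩
  rw [lintegral_enorm_sq] at h
  exact (ENNReal.pow_lt_top_iff.1 h).resolve_right (by norm_num)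

lemma memLp_two_of_bounded {α F : Type*} [MeasurableSpace α] [NormedAddCommGroup F]
    {μ : Measure α} {g : α → F} (hg : Integrable g μ) {C : ℝ} (hC : ∀ x, ‖g x‖ ≤ C) :
    MemLp g 2 μ := by
  have h : ∫⁻ x, ‖g x‖ₑ ^ 2 ∂μ ≤ ENNReal.ofReal C * ∫⁻ x, ‖g x‖ₑ ∂μ := by
    rw [← lintegral_const_mul' _ _ ENNReal.ofReal_ne_top]
    refine lintegral_mono fun x => ?_
    rw [sq]
    gcongr
    rw [← ofReal_norm]
    exact ENNReal.ofReal_le_ofReal (hC x)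
  exact memLp_two_of_lintegral hg.1 (h.trans_lt (ENNReal.mul_lt_top ENNReal.ofReal_lt_top hg.2))

/-! ### Plancherel's theorem for the Fourier integral -/

/-- Both transforms are locally integrable, and on smooth compactly supported test functions the
transform can be moved to the other side, where the two definitions coincide. -/
lemma memLp_toLp_fourier_ae {f : E3 → ℂ} (h1 : Integrable f volume) (h2 : MemLp f 2 volume) :
    (𝓕 (h2.toLp f) : Lp ℂ 2 (volume : Measure E3)) =ᵐ[volume] 𝓕 f := by
  have hc : Continuous (𝓕 f) := VectorFourier.fourierIntegral_continuous
    Real.continuous_fourierChar (by exact continuous_inner) h1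
  have hF : LocallyIntegrable (𝓕 f) volume := hc.locallyIntegrable
  have hL : LocallyIntegrable ((𝓕 (h2.toLp f) : Lp ℂ 2 (volume : Measure E3)) : E3 → ℂ) :=
    (Lp.memLp _).locallyIntegrable one_le_two
  refine ae_eq_of_integral_contDiff_smul_eq hL hF fun g hg hgc => ?_
  have hg₁ : HasCompactSupport (Complex.ofRealCLM ∘ g) := hgc.comp_left rfl
  have hg₂ : ContDiff ℝ ∞ (Complex.ofRealCLM ∘ g) := by fun_prop
  set φ : SchwartzMap E3 ℂ := hg₁.toSchwartzMap hg₂ with hφ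
  have hφg : ∀ x, φ x = (g x : ℂ) := fun x => by simp [hφ]
  have e1 := congrArg (fun T : TemperedDistribution E3 ℂ => T φ)
    (Lp.fourier_toTemperedDistribution_eq (h2.toLp f))
  simp only [TemperedDistribution.fourier_apply, Lp.toTemperedDistribution_apply] at e1
  have e2 : ∫ x, (𝓕 φ) x • (h2.toLp f : E3 → ℂ) x = ∫ x, (𝓕 (φ : E3 → ℂ)) x • f x := by
    refine integral_congr_ae ?_
    filter_upwards [h2.coeFn_toLp] with x hx
    rw [hx, SchwartzMap.fourier_coe]
  have e3 : ∫ x, (𝓕 (φ : E3 → ℂ)) x • f x = ∫ x, φ x • 𝓕 f x := by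
    simpa using! (VectorFourier.integral_fourierIntegral_smul_eq_flip (L := innerₗ E3)
      Real.continuous_fourierChar continuous_inner φ.integrable h1)
  rw [e2, e3] at e1
  simp only [hφg] at e1
  simpa [Complex.real_smul] using e1.symm

theorem memLp_fourier {f : E3 → ℂ} (h1 : Integrable f) (h2 : MemLp f 2) :
    MemLp (𝓕 f) 2 volume :=
  (Lp.memLp _).ae_eq (memLp_toLp_fourier_ae h1 h2)

theorem lintegral_fourier_sq {f : E3 → ℂ} (h1 : Integrable f) (h2 : MemLp f 2) :
    ∫⁻ ξ, ‖𝓕 f ξ‖ₑ ^ 2 = ∫⁻ x, ‖f x‖ₑ ^ 2 := by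
  have e := Lp.norm_fourier_eq (h2.toLp f)
  have e' : eLpNorm (𝓕 f) 2 volume = eLpNorm f 2 volume := by
    rw [← eLpNorm_congr_ae (memLp_toLp_fourier_ae h1 h2), ← eLpNorm_congr_ae h2.coeFn_toLp]
    rw [Lp.norm_def, Lp.norm_def] at e
    exact (ENNReal.toReal_eq_toReal_iff' (Lp.eLpNorm_ne_top _) (Lp.eLpNorm_ne_top _)).1 e
  rw [lintegral_enorm_sq, lintegral_enorm_sq, e']

theorem continuous_fourier {f : E3 → ℂ} (h1 : Integrable f) : Continuous (𝓕 f) :=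
  VectorFourier.fourierIntegral_continuous Real.continuous_fourierChar
    (by exact continuous_inner) h1


/-- `∫ |∫ f(x) g(x - y) dx|² dy` in Fourier space. -/
theorem lintegral_correlation_sq {f g : E3 → ℂ} (hf : Integrable f) (hg : Integrable g)
    {C : ℝ} (hC : ∀ x, ‖g x‖ ≤ C) :
    ∫⁻ y, ‖∫ x, f x * g (x - y)‖ₑ ^ 2 = ∫⁻ k, ‖𝓕 f k‖ₑ ^ 2 * ‖𝓕 g (-k)‖ₑ ^ 2 := by
  -- The correlation is the convolution of `f` with the reflected `g`. Boundedness of `g` makes it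
  -- bounded, so it is in `L²` and Plancherel applies to it.
  set g' : E3 → ℂ := fun z => g (-z) with hg'
  have hg'i : Integrable g' := hg.comp_neg
  set h : E3 → ℂ := convolution f g' (ContinuousLinearMap.mul ℂ ℂ) volume with hh
  have hhe : ∀ y, h y = ∫ x, f x * g (x - y) := fun y => by
    simp [hh, convolution, hg']
  have hhi : Integrable h := hf.integrable_convolution _ hg'i
  have hhb : ∀ y, ‖h y‖ ≤ C * ∫ x, ‖f x‖ := fun y => by
    rw [hhe, ← integral_const_mul]
    refine norm_integral_le_of_norm_le (hf.norm.const_mul _) (Eventually.of_forall fun x => ?_)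
    rw [norm_mul, mul_comm]
    exact mul_le_mul_of_nonneg_right (hC _) (norm_nonneg _)
  have hh2 : MemLp h 2 := memLp_two_of_bounded hhi hhb
  rw [← lintegral_congr fun y => by rw [← hhe y], ← lintegral_fourier_sq hhi hh2]
  refine lintegral_congr fun k => ?_
  rw [hh, Real.fourier_mul_convolution_eq hf hg'i, enorm_mul, mul_pow]
  congr 3
  rw [Real.fourier_eq, Real.fourier_eq, ← integral_neg_eq_self]
  simp [hg']

/-- Plancherel for the `j`-th derivative in one direction, whose transform carries the factor `(2πi
ξ_i)^j`. -/
theorem lintegral_coord_pow_fourier {g : E3 → ℂ} {j : ℕ} (hg : ContDiff ℝ j g)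
    (hc : HasCompactSupport g) (i : Fin 3) :
    ∫⁻ ξ, ENNReal.ofReal ((2 * Real.pi * |ξ i|) ^ (2 * j)) * ‖𝓕 g ξ‖ₑ ^ 2
      = ∫⁻ x, ‖iteratedFDeriv ℝ j g x (fun _ => EuclideanSpace.single i 1)‖ₑ ^ 2 := by
  have hcd : ∀ n ≤ j, Continuous (iteratedFDeriv ℝ n g) ∧ HasCompactSupport (iteratedFDeriv ℝ n g) :=
    fun n hn => ⟨hg.continuous_iteratedFDeriv (by exact_mod_cast hn), hc.iteratedFDeriv n⟩
  have hint : ∀ n : ℕ, (n : ℕ∞) ≤ j → Integrable (iteratedFDeriv ℝ n g) := fun n hn =>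
    (hcd n (by exact_mod_cast hn)).1.integrable_of_hasCompactSupport (hcd n (by exact_mod_cast hn)).2
  set G : E3 → ℂ := fun x => iteratedFDeriv ℝ j g x (fun _ => EuclideanSpace.single i 1) with hG
  have hGc : Continuous G := (continuous_eval_const (F := E3 [×j]→L[ℝ] ℂ) _).comp (hcd j le_rfl).1
  have hGs : HasCompactSupport G := (hcd j le_rfl).2.comp_left
    (g := fun (m : E3 [×j]→L[ℝ] ℂ) => m (fun _ => EuclideanSpace.single i 1)) rfl
  rw [← lintegral_fourier_sq (hGc.integrable_of_hasCompactSupport hGs)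
    (hGc.memLp_of_hasCompactSupport hGs)]
  refine lintegral_congr fun ξ => ?_
  have e : 𝓕 G ξ = 𝓕 (iteratedFDeriv ℝ j g) ξ (fun _ => EuclideanSpace.single i 1) :=
    (Real.fourier_continuousMultilinearMap_apply (hint j le_rfl)).symm
  rw [e, Real.fourier_iteratedFDeriv (N := j) (by exact_mod_cast hg) hint le_rfl]
  simp only [VectorFourier.fourierPowSMulRight_apply]
  rw [← ofReal_norm, ← ofReal_norm, ← ENNReal.ofReal_pow (by positivity),
    ← ENNReal.ofReal_pow (by positivity), ← ENNReal.ofReal_mul (by positivity)]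
  congr 1
  have e' : innerSL ℝ ξ (EuclideanSpace.single i 1) = ξ i := by
    rw [innerSL_apply_apply]
    simp [EuclideanSpace.inner_single_right]
  simp [abs_of_pos Real.pi_pos, e']
  ring

/-! ### The dispersion form with values in `[0, ∞]` -/

/-- `∫ (2π|ξ| - t)₊² |ĝ(ξ)|² dξ` with values in `[0, ∞]`. -/
def dispersionL (t : ℝ) (g : E3 → ℂ) : ENNReal :=
  ∫⁻ ξ, ENNReal.ofReal (max (2 * Real.pi * ‖ξ‖ - t) 0 ^ 2) * ‖𝓕 g ξ‖ₑ ^ 2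

/-- `∫ (2π|ξ|)^{2j} |ĝ(ξ)|² dξ` with values in `[0, ∞]`. -/
def momentL (j : ℕ) (g : E3 → ℂ) : ENNReal :=
  ∫⁻ ξ, ENNReal.ofReal ((2 * Real.pi * ‖ξ‖) ^ (2 * j)) * ‖𝓕 g ξ‖ₑ ^ 2

lemma ofReal_mul_enorm_sq {x : ℝ} (hx : 0 ≤ x) (z : ℂ) :
    ENNReal.ofReal x * ‖z‖ₑ ^ 2 = ENNReal.ofReal (x * ‖z‖ ^ 2) := by
  rw [← ofReal_norm, ← ENNReal.ofReal_pow (norm_nonneg _), ← ENNReal.ofReal_mul hx]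

lemma ofReal_integral_le_lintegral {α : Type*} [MeasurableSpace α] {μ : Measure α} {f : α → ℝ}
    (hf : ∀ x, 0 ≤ f x) : ENNReal.ofReal (∫ x, f x ∂μ) ≤ ∫⁻ x, ENNReal.ofReal (f x) ∂μ := by
  by_cases h : Integrable f μ
  · rw [ofReal_integral_eq_lintegral_ofReal h (Eventually.of_forall hf)]
  · simp [integral_undef h]

lemma dispersionForm_nonneg (t : ℝ) (g : E3 → ℂ) : 0 ≤ dispersionForm t g :=
  integral_nonneg fun _ => by positivity

/-- A Bochner integral that does not exist is `0`, so this direction is unconditional. The reverse,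
needed where the form stands on the larger side of an estimate, requires finiteness. -/
lemma ofReal_dispersionForm_le (t : ℝ) (g : E3 → ℂ) :
    ENNReal.ofReal (dispersionForm t g) ≤ dispersionL t g := by
  refine (ofReal_integral_le_lintegral fun _ => by positivity).trans_eq ?_
  exact lintegral_congr fun ξ => (ofReal_mul_enorm_sq (by positivity) _).symm

lemma ofReal_dispersionForm {t : ℝ} {g : E3 → ℂ} (hg : Integrable g) (h : dispersionL t g ≠ ⊤) :
    ENNReal.ofReal (dispersionForm t g) = dispersionL t g := by
  have hm : Continuous fun ξ => max (2 * Real.pi * ‖ξ‖ - t) 0 ^ 2 * ‖𝓕 g ξ‖ ^ 2 := by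
    have := continuous_fourier hg
    fun_prop
  have e : dispersionL t g
      = ∫⁻ ξ, ENNReal.ofReal (max (2 * Real.pi * ‖ξ‖ - t) 0 ^ 2 * ‖𝓕 g ξ‖ ^ 2) :=
    lintegral_congr fun ξ => ofReal_mul_enorm_sq (by positivity) _
  rw [e] at h ⊢
  rw [dispersionForm, ofReal_integral_eq_lintegral_ofReal _ (Eventually.of_forall fun _ => by positivity)]
  refine ⟨hm.aestronglyMeasurable, ?_⟩
  rw [hasFiniteIntegral_iff_ofReal (Eventually.of_forall fun _ => by positivity)]
  exact h.lt_top

lemma fourier_congr_ae {f g : E3 → ℂ} (h : f =ᵐ[volume] g) : 𝓕 f = 𝓕 g := by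
  ext ξ
  rw [Real.fourier_eq, Real.fourier_eq]
  refine integral_congr_ae ?_
  filter_upwards [h] with x hx
  rw [hx]

lemma norm_sq_eq_sum (ξ : E3) : ‖ξ‖ ^ 2 = ∑ i, |ξ i| ^ 2 := by
  rw [EuclideanSpace.norm_sq_eq]
  simp

/-- Comparison with the largest coordinate, `‖ξ‖² ≤ 3 max |ξ_i|²`. It reduces radial moments to pure
partial derivatives. -/
lemma norm_pow_le_sum (ξ : E3) (j : ℕ) :
    (2 * Real.pi * ‖ξ‖) ^ (2 * j) ≤ 3 ^ j * ∑ i, (2 * Real.pi * |ξ i|) ^ (2 * j) := by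
  obtain ⟨m, -, hm⟩ := Finset.exists_max_image Finset.univ (fun i => |ξ i|) ⟨0, Finset.mem_univ _⟩
  have h1 : ‖ξ‖ ^ 2 ≤ 3 * |ξ m| ^ 2 := by
    rw [norm_sq_eq_sum]
    calc ∑ i, |ξ i| ^ 2 ≤ ∑ _i : Fin 3, |ξ m| ^ 2 :=
          Finset.sum_le_sum fun i hi => pow_le_pow_left₀ (abs_nonneg _) (hm i hi) 2
      _ = _ := by simp
  calc (2 * Real.pi * ‖ξ‖) ^ (2 * j) = ((2 * Real.pi) ^ 2 * ‖ξ‖ ^ 2) ^ j := by rw [pow_mul]; ring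
    _ ≤ ((2 * Real.pi) ^ 2 * (3 * |ξ m| ^ 2)) ^ j := by gcongr
    _ = 3 ^ j * (2 * Real.pi * |ξ m|) ^ (2 * j) := by rw [pow_mul, ← mul_pow]; ring
    _ ≤ _ := by
      gcongr
      exact Finset.single_le_sum (f := fun i => (2 * Real.pi * |ξ i|) ^ (2 * j))
        (fun i _ => by positivity) (Finset.mem_univ m)

lemma measurable_coord (i : Fin 3) : Measurable fun ξ : E3 => ξ i := by fun_prop

lemma momentL_le {g : E3 → ℂ} {j : ℕ} (hg : ContDiff ℝ j g) (hc : HasCompactSupport g) :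
    momentL j g ≤ 3 ^ (j + 1) * ∫⁻ x, ‖iteratedFDeriv ℝ j g x‖ₑ ^ 2 := by
  have hm : Continuous (𝓕 g) :=
    continuous_fourier (hg.continuous.integrable_of_hasCompactSupport hc)
  calc momentL j g
      ≤ ∫⁻ ξ, ENNReal.ofReal (3 ^ j) * ∑ i : Fin 3,
          ENNReal.ofReal ((2 * Real.pi * |ξ i|) ^ (2 * j)) * ‖𝓕 g ξ‖ₑ ^ 2 := by
        refine lintegral_mono fun ξ => ?_
        rw [← Finset.sum_mul, ← mul_assoc, ← ENNReal.ofReal_sum_of_nonneg fun i _ => by positivity,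
          ← ENNReal.ofReal_mul (by positivity)]
        gcongr
        exact norm_pow_le_sum ξ j
    _ = ENNReal.ofReal (3 ^ j) * ∑ i : Fin 3,
          ∫⁻ ξ : E3, ENNReal.ofReal ((2 * Real.pi * |ξ i|) ^ (2 * j)) * ‖𝓕 g ξ‖ₑ ^ 2 := by
        rw [lintegral_const_mul' _ _ ENNReal.ofReal_ne_top, lintegral_finsetSum]
        intro i _
        have := measurable_coord i
        have := hm.measurable
        fun_prop
    _ ≤ ENNReal.ofReal (3 ^ j) * ∑ _i : Fin 3, ∫⁻ x, ‖iteratedFDeriv ℝ j g x‖ₑ ^ 2 := by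
        refine mul_le_mul_right (Finset.sum_le_sum fun i _ => ?_) _
        rw [lintegral_coord_pow_fourier hg hc]
        gcongr with x
        rw [← ofReal_norm, ← ofReal_norm]
        refine ENNReal.ofReal_le_ofReal ?_
        refine (ContinuousMultilinearMap.le_opNorm _ _).trans ?_
        simp
    _ = _ := by
        rw [pow_succ, ENNReal.ofReal_pow (by norm_num)]
        simp [mul_assoc]

lemma momentL_le_of_bound {g : E3 → ℂ} {j : ℕ} (hg : ContDiff ℝ j g) (hc : HasCompactSupport g)
    {C : ℝ} (hC : ∀ x, ‖iteratedFDeriv ℝ j g x‖ ≤ C) {S : Set E3} (hS : tsupport g ⊆ S) :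
    momentL j g ≤ ENNReal.ofReal (3 ^ (j + 1) * C ^ 2) * volume S := by
  refine (momentL_le hg hc).trans ?_
  have hC0 : 0 ≤ C := (norm_nonneg _).trans (hC 0)
  have h : ∫⁻ x, ‖iteratedFDeriv ℝ j g x‖ₑ ^ 2 ≤ ENNReal.ofReal (C ^ 2) * volume S := by
    have : ∀ x, ‖iteratedFDeriv ℝ j g x‖ₑ ^ 2
        ≤ (tsupport g).indicator (fun _ => ENNReal.ofReal (C ^ 2)) x := fun x => by
      by_cases hx : x ∈ tsupport g
      · rw [Set.indicator_of_mem hx, ← ofReal_norm, ENNReal.ofReal_pow hC0]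
        gcongr
        exact hC x
      · have : iteratedFDeriv ℝ j g x = 0 := by
          by_contra h
          exact hx (support_iteratedFDeriv_subset j h)
        simp [this]
    refine (lintegral_mono this).trans ?_
    rw [lintegral_indicator (isClosed_tsupport g).measurableSet, setLIntegral_const]
    gcongr
  rw [ENNReal.ofReal_mul (by positivity), ENNReal.ofReal_pow (by norm_num : (0 : ℝ) ≤ 3), mul_assoc]
  gcongr
  simp

/-- For the first moment nothing is lost, because the squares of the coordinates add up to `‖ξ‖²`.
The constant one is needed to recover exactly `-Δ` after localization. -/
lemma momentL_one {g : E3 → ℂ} (hg : ContDiff ℝ 1 g) (hc : HasCompactSupport g) :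
    momentL 1 g = ∫⁻ x, ∑ i, ‖fderiv ℝ g x (EuclideanSpace.single i 1)‖ₑ ^ 2 := by
  have hm : Continuous (𝓕 g) :=
    continuous_fourier (hg.continuous.integrable_of_hasCompactSupport hc)
  have hd : Continuous (fderiv ℝ g) := hg.continuous_fderiv (by norm_num)
  calc momentL 1 g = ∫⁻ ξ, ∑ i : Fin 3,
          ENNReal.ofReal ((2 * Real.pi * |ξ i|) ^ (2 * 1)) * ‖𝓕 g ξ‖ₑ ^ 2 := by
        refine lintegral_congr fun ξ => ?_
        rw [← Finset.sum_mul, ← ENNReal.ofReal_sum_of_nonneg fun i _ => by positivity]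
        congr 2
        simp only [mul_one, mul_pow]
        rw [norm_sq_eq_sum, Finset.mul_sum]
    _ = ∑ i : Fin 3,
          ∫⁻ ξ : E3, ENNReal.ofReal ((2 * Real.pi * |ξ i|) ^ (2 * 1)) * ‖𝓕 g ξ‖ₑ ^ 2 := by
        rw [lintegral_finsetSum]
        intro i _
        have := measurable_coord i
        have := hm.measurable
        fun_prop
    _ = ∑ i : Fin 3, ∫⁻ x, ‖fderiv ℝ g x (EuclideanSpace.single i 1)‖ₑ ^ 2 := by
        refine Finset.sum_congr rfl fun i _ => ?_
        rw [lintegral_coord_pow_fourier (j := 1) (by exact_mod_cast hg) hc]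
        simp only [iteratedFDeriv_one_apply]
    _ = _ := by
        rw [lintegral_finsetSum]
        intro i _
        have : Continuous fun x => fderiv ℝ g x (EuclideanSpace.single i 1) := by fun_prop
        have := this.measurable
        fun_prop

/-! ### Measurability in parameters -/

lemma stronglyMeasurable_fourier_param {α : Type*} [MeasurableSpace α] {F : α → E3 → ℂ}
    (hF : StronglyMeasurable (Function.uncurry F)) :
    StronglyMeasurable fun p : α × E3 => 𝓕 (F p.1) p.2 := by
  simp only [Real.fourier_eq]
  have h1 : StronglyMeasurable fun q : (α × E3) × E3 => F q.1.1 q.2 :=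
    hF.comp_measurable (by fun_prop : Measurable fun q : (α × E3) × E3 => (q.1.1, q.2))
  have h2 : Measurable fun q : (α × E3) × E3 => (-inner ℝ q.2 q.1.2 : ℝ) := by fun_prop
  have h3 : StronglyMeasurable fun q : (α × E3) × E3 =>
      Real.fourierChar (-inner ℝ q.2 q.1.2) • F q.1.1 q.2 := by
    have h4 : StronglyMeasurable fun q : (α × E3) × E3 =>
        ((Real.fourierChar (-inner ℝ q.2 q.1.2) : Circle) : ℂ) :=
      ((continuous_subtype_val.comp Real.continuous_fourierChar).measurable.comp h2).stronglyMeasurable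
    have h5 := h4.mul h1
    simp only [Circle.smul_def]
    exact h5
  exact h3.integral_prod_right

lemma measurable_dispersionL_param {α : Type*} [MeasurableSpace α] {F : α → E3 → ℂ}
    (hF : StronglyMeasurable (Function.uncurry F)) (t : ℝ) :
    Measurable fun a => dispersionL t (F a) := by
  have h := (stronglyMeasurable_fourier_param hF).measurable
  refine Measurable.lintegral_prod_right' (f := fun p : α × E3 =>
    ENNReal.ofReal (max (2 * Real.pi * ‖p.2‖ - t) 0 ^ 2) * ‖𝓕 (F p.1) p.2‖ₑ ^ 2) ?_
  exact (by fun_prop : Measurable fun p : α × E3 =>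
    ENNReal.ofReal (max (2 * Real.pi * ‖p.2‖ - t) 0 ^ 2)).mul (h.enorm.pow_const 2)

lemma stronglyMeasurable_dispersionForm_param {α : Type*} [MeasurableSpace α] {F : α → E3 → ℂ}
    (hF : StronglyMeasurable (Function.uncurry F)) (t : ℝ) :
    StronglyMeasurable fun a => dispersionForm t (F a) := by
  have h := stronglyMeasurable_fourier_param hF
  refine StronglyMeasurable.integral_prod_right (f := fun a (ξ : E3) =>
    max (2 * Real.pi * ‖ξ‖ - t) 0 ^ 2 * ‖𝓕 (F a) ξ‖ ^ 2) ?_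
  exact (by fun_prop : Measurable fun p : α × E3 =>
    (max (2 * Real.pi * ‖p.2‖ - t) 0 ^ 2)).stronglyMeasurable.mul (h.norm.pow 2)

/-! ### The symbol of a localized dispersion -/

/-- The plane wave `x ↦ exp(2πi⟨x,k⟩)`. -/
def planeWave (k x : E3) : ℂ := Real.fourierChar (inner ℝ x k)

lemma norm_planeWave (k x : E3) : ‖planeWave k x‖ = 1 := Circle.norm_coe _

lemma planeWave_add (k l x : E3) : planeWave (k + l) x = planeWave k x * planeWave l x := by
  simp [planeWave, inner_add_right, AddChar.map_add_eq_mul]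

lemma planeWave_add_right (k x y : E3) : planeWave k (x + y) = planeWave k x * planeWave k y := by
  simp [planeWave, inner_add_left, AddChar.map_add_eq_mul]

lemma planeWave_neg (k x : E3) : planeWave (-k) x = planeWave k (-x) := by
  simp [planeWave]

lemma continuous_planeWave : Continuous fun p : E3 × E3 => planeWave p.1 p.2 := by
  have : Continuous fun p : E3 × E3 => inner ℝ p.2 p.1 := by fun_prop
  exact (continuous_subtype_val.comp Real.continuous_fourierChar).comp this

lemma fourier_eq_planeWave (f : E3 → ℂ) (ξ : E3) : 𝓕 f ξ = ∫ x, planeWave (-ξ) x * f x := by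
  rw [Real.fourier_eq]
  simp [planeWave, Circle.smul_def]

/-- The function `w(x - ru) (f(x) - λ ∫_{S+ru} f)`. -/
def shiftWindow (w : E3 → ℂ) (S : Set E3) (lam : ℂ) (r : ℝ) (f : E3 → ℂ) (u x : E3) : ℂ :=
  w (x - r • u) * (f x - lam * ∫ z, f z * S.indicator 1 (z - r • u))

/-- A plane wave localized by the window. -/
def waveWindow (w : E3 → ℂ) (S : Set E3) (lam : ℂ) (k x : E3) : ℂ :=
  w x * (planeWave k x - lam * ∫ z in S, planeWave k z)

lemma lintegral_comp_smul_inv {r : ℝ} (hr : 0 < r) (h : E3 → ENNReal) :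
    ∫⁻ u, h (r • u) = ENNReal.ofReal (r⁻¹ ^ 3) * ∫⁻ y, h y := by
  have e := Measure.map_addHaar_smul (volume : Measure E3) hr.ne'
  have e2 := (MeasurableEquiv.smul₀ r hr.ne').measurableEmbedding.lintegral_map
    (μ := (volume : Measure E3)) h
  have e3 : ((MeasurableEquiv.smul₀ r hr.ne' : E3 ≃ᵐ E3) : E3 → E3) = (r • ·) := rfl
  rw [e3] at e2
  rw [← e2, e, lintegral_smul_measure, smul_eq_mul]
  congr 2
  simp [abs_of_pos hr]

section

variable {w : E3 → ℂ} {S : Set E3} {lam : ℂ} {r t : ℝ} {f : E3 → ℂ}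

lemma integrable_mul_of_bounded {f g : E3 → ℂ} (hf : Integrable f) (hg : AEStronglyMeasurable g)
    {C : ℝ} (hC : ∀ x, ‖g x‖ ≤ C) : Integrable fun x => f x * g x :=
  hf.mul_bdd (c := C) hg (Eventually.of_forall hC)

lemma stronglyMeasurable_shiftWindow (hw : Continuous w) (hS : MeasurableSet S)
    (hf : StronglyMeasurable f) :
    StronglyMeasurable (Function.uncurry (shiftWindow w S lam r f)) := by
  have h1 : StronglyMeasurable fun p : E3 × E3 => w (p.2 - r • p.1) :=
    (hw.comp (by fun_prop : Continuous fun p : E3 × E3 => p.2 - r • p.1)).stronglyMeasurable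
  have h2 : StronglyMeasurable fun p : E3 × E3 => f p.2 := hf.comp_measurable measurable_snd
  have h3 : StronglyMeasurable fun u : E3 => ∫ z, f z * S.indicator (1 : E3 → ℂ) (z - r • u) := by
    refine StronglyMeasurable.integral_prod_right
      (f := fun (u z : E3) => f z * S.indicator (1 : E3 → ℂ) (z - r • u)) ?_
    have h4 : Measurable fun p : E3 × E3 => S.indicator (1 : E3 → ℂ) (p.2 - r • p.1) :=
      (measurable_one.indicator hS).comp (by fun_prop)
    exact h2.mul h4.stronglyMeasurable
  exact h1.mul (h2.sub ((h3.comp_measurable measurable_fst).const_mul lam))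

lemma continuous_setIntegral_planeWave (hSb : volume S ≠ ⊤) :
    Continuous fun k => ∫ z in S, planeWave k z := by
  have : IsFiniteMeasure (volume.restrict S) := ⟨by simpa using hSb.lt_top⟩
  refine continuous_of_dominated (bound := fun _ => 1) (fun k => ?_)
    (fun k => Eventually.of_forall fun x => (norm_planeWave k x).le) (integrable_const _)
    (Eventually.of_forall fun x => ?_)
  · exact (continuous_planeWave.comp (by fun_prop : Continuous fun x : E3 => (k, x))).aestronglyMeasurable
  · exact continuous_planeWave.comp (by fun_prop : Continuous fun k : E3 => (k, x))

lemma continuous_waveWindow (hw : Continuous w) (hSb : volume S ≠ ⊤) :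
    Continuous (Function.uncurry (waveWindow w S lam)) := by
  exact (hw.comp continuous_snd).mul (continuous_planeWave.sub
    (((continuous_setIntegral_planeWave hSb).comp continuous_fst).const_mul lam))

/-- The localized dispersion, averaged over all positions of the window, is a Fourier
multiplier. -/
theorem lintegral_dispersionL_shiftWindow (hw : Continuous w) (hwc : HasCompactSupport w)
    (hS : MeasurableSet S) (hSb : volume S ≠ ⊤) (hr : 0 < r) (hfm : StronglyMeasurable f)
    (hf : Integrable f) :
    ∫⁻ u, dispersionL t (shiftWindow w S lam r f u)
      = ENNReal.ofReal (r⁻¹ ^ 3) * ∫⁻ k, ‖𝓕 f k‖ₑ ^ 2 * dispersionL t (waveWindow w S lam k) := by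
  obtain ⟨C, hC⟩ := hw.bounded_above_of_compact_support hwc
  have hwi : Integrable w := hw.integrable_of_hasCompactSupport hwc
  have hpw : ∀ k : E3, Continuous (planeWave k) := fun k =>
    continuous_planeWave.comp (by fun_prop : Continuous fun x : E3 => (k, x))
  have hind : Measurable (S.indicator (1 : E3 → ℂ)) := measurable_one.indicator hS
  have hindb : ∀ x, ‖S.indicator (1 : E3 → ℂ) x‖ ≤ 1 := fun x => by
    by_cases hx : x ∈ S <;> simp [hx]
  have hindi : Integrable (S.indicator (1 : E3 → ℂ)) := by
    have : IntegrableOn (1 : E3 → ℂ) S := integrableOn_const hSb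
    exact this.integrable_indicator hS
  have hm1 := (stronglyMeasurable_fourier_param (stronglyMeasurable_shiftWindow (lam := lam)
    (r := r) hw hS hfm)).measurable
  have hm2 := (stronglyMeasurable_fourier_param
    (continuous_waveWindow (lam := lam) hw hSb).stronglyMeasurable).measurable
  have hmf : Measurable (𝓕 f) := (continuous_fourier hf).measurable
  have key : ∀ ξ, ∫⁻ u, ‖𝓕 (shiftWindow w S lam r f u) ξ‖ₑ ^ 2
      = ENNReal.ofReal (r⁻¹ ^ 3) * ∫⁻ k, ‖𝓕 f k‖ₑ ^ 2 * ‖𝓕 (waveWindow w S lam k) ξ‖ₑ ^ 2 := by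
    intro ξ
    -- For fixed `ξ` the transform of the shifted window is, up to a phase, the correlation of `f`
    -- with this function, which does not depend on `u`. The integral over `u` is then known in
    -- Fourier space.
    set g : E3 → ℂ := fun z => planeWave (-ξ) z * w z - lam * 𝓕 w ξ * S.indicator 1 z with hg
    have hgi : Integrable g := by
      refine Integrable.sub ?_ (hindi.const_mul _)
      exact hwi.bdd_mul (c := 1) (hpw _).aestronglyMeasurable
        (Eventually.of_forall fun x => (norm_planeWave _ x).le)
    have hgb : ∀ z, ‖g z‖ ≤ C + ‖lam * 𝓕 w ξ‖ := fun z => by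
      refine (norm_sub_le _ _).trans (add_le_add ?_ ?_)
      · rw [norm_mul, norm_planeWave, one_mul]; exact hC z
      · rw [norm_mul]; exact mul_le_of_le_one_right (norm_nonneg _) (hindb z)
    have e1 : ∀ u, ‖𝓕 (shiftWindow w S lam r f u) ξ‖ₑ
        = ‖∫ x, f x * g (x - r • u)‖ₑ := fun u => by
      have : 𝓕 (shiftWindow w S lam r f u) ξ
          = planeWave (-ξ) (r • u) * ∫ x, f x * g (x - r • u) := by
        set c := ∫ z, f z * S.indicator (1 : E3 → ℂ) (z - r • u) with hc
        have i1 : Integrable fun x => planeWave (-ξ) (x - r • u) * w (x - r • u) := by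
          refine (hwi.comp_sub_right (r • u)).bdd_mul (c := 1) ?_
            (Eventually.of_forall fun x => (norm_planeWave _ _).le)
          exact ((hpw _).comp (by fun_prop)).aestronglyMeasurable
        have i2 : Integrable fun x => f x * (planeWave (-ξ) (x - r • u) * w (x - r • u)) := by
          refine integrable_mul_of_bounded hf i1.1 (C := C) fun x => ?_
          rw [norm_mul, norm_planeWave, one_mul]; exact hC _
        have i3 : Integrable fun x => f x * S.indicator (1 : E3 → ℂ) (x - r • u) :=
          integrable_mul_of_bounded hf (hind.comp (by fun_prop)).aestronglyMeasurable
            fun x => hindb _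
        have a1 : ∫ x, planeWave (-ξ) (x - r • u) * w (x - r • u) = 𝓕 w ξ := by
          rw [fourier_eq_planeWave,
            integral_sub_right_eq_self (fun x => planeWave (-ξ) x * w x) (r • u)]
        have a2 : ∫ x, f x * g (x - r • u)
            = (∫ x, f x * (planeWave (-ξ) (x - r • u) * w (x - r • u))) - lam * 𝓕 w ξ * c := by
          rw [hc, ← integral_const_mul, ← integral_sub i2 (i3.const_mul _)]
          refine integral_congr_ae (Eventually.of_forall fun x => ?_)
          simp only [hg]; ring
        rw [a2, ← a1, mul_assoc lam, mul_comm _ c, ← mul_assoc, ← integral_const_mul (lam * c),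
          ← integral_sub i2 (i1.const_mul _), ← integral_const_mul, fourier_eq_planeWave]
        refine integral_congr_ae (Eventually.of_forall fun x => ?_)
        have : planeWave (-ξ) x = planeWave (-ξ) (r • u) * planeWave (-ξ) (x - r • u) := by
          rw [← planeWave_add_right]; congr 1; abel
        simp only [shiftWindow, this]
        ring
      rw [this, enorm_mul]
      have : ‖planeWave (-ξ) (r • u)‖ₑ = 1 := by rw [← ofReal_norm, norm_planeWave]; simp
      rw [this, one_mul]
    -- The roles of `k` and `ξ` are exchanged: the transform of `g` in `k` is the transform in `ξ`
    -- of the localized plane wave of momentum `k`.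
    have e2 : ∀ k, 𝓕 g (-k) = 𝓕 (waveWindow w S lam k) ξ := fun k => by
      have i1 : Integrable fun x => planeWave k x * (planeWave (-ξ) x * w x) := by
        refine Integrable.bdd_mul (c := 1) ?_ (hpw _).aestronglyMeasurable
          (Eventually.of_forall fun x => (norm_planeWave _ x).le)
        exact hwi.bdd_mul (c := 1) (hpw _).aestronglyMeasurable
          (Eventually.of_forall fun x => (norm_planeWave _ x).le)
      have i2 : Integrable fun x => planeWave k x * S.indicator (1 : E3 → ℂ) x :=
        hindi.bdd_mul (c := 1) (hpw _).aestronglyMeasurable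
          (Eventually.of_forall fun x => (norm_planeWave _ x).le)
      have i3 : Integrable fun x => planeWave (-ξ) x * w x :=
        hwi.bdd_mul (c := 1) (hpw _).aestronglyMeasurable
          (Eventually.of_forall fun x => (norm_planeWave _ x).le)
      have a1 : ∫ x, planeWave k x * S.indicator (1 : E3 → ℂ) x = ∫ z in S, planeWave k z := by
        rw [← integral_indicator hS]
        refine integral_congr_ae (Eventually.of_forall fun x => ?_)
        by_cases hx : x ∈ S <;> simp [hx]
      rw [fourier_eq_planeWave, fourier_eq_planeWave, neg_neg]
      set c := ∫ z in S, planeWave k z with hc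
      calc ∫ x, planeWave k x * g x
          = ∫ x, (planeWave k x * (planeWave (-ξ) x * w x)
              - lam * 𝓕 w ξ * (planeWave k x * S.indicator 1 x)) := by
            refine integral_congr_ae (Eventually.of_forall fun x => ?_)
            simp only [hg]; ring
        _ = (∫ x, planeWave k x * (planeWave (-ξ) x * w x))
            - lam * c * ∫ x, planeWave (-ξ) x * w x := by
            rw [integral_sub i1 (i2.const_mul _), integral_const_mul, a1, fourier_eq_planeWave]
            ring
        _ = _ := by
            rw [← integral_const_mul, ← integral_sub i1 (i3.const_mul _)]
            refine integral_congr_ae (Eventually.of_forall fun x => ?_)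
            simp only [waveWindow, ← hc]; ring
    calc ∫⁻ u, ‖𝓕 (shiftWindow w S lam r f u) ξ‖ₑ ^ 2
        = ∫⁻ u, (fun y => ‖∫ x, f x * g (x - y)‖ₑ ^ 2) (r • u) :=
          lintegral_congr fun u => by rw [e1]
      _ = _ := by
          rw [lintegral_comp_smul_inv hr (fun y => ‖∫ x, f x * g (x - y)‖ₑ ^ 2),
            lintegral_correlation_sq hf hgi hgb]
          simp only [e2]
  have hK : Measurable fun ξ : E3 => ENNReal.ofReal (max (2 * Real.pi * ‖ξ‖ - t) 0 ^ 2) := by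
    fun_prop
  unfold dispersionL
  rw [lintegral_lintegral_swap]
  swap
  · exact ((hK.comp measurable_snd).mul (hm1.enorm.pow_const 2)).aemeasurable
  have hA : AEMeasurable (Function.uncurry fun (k ξ : E3) => ‖𝓕 f k‖ₑ ^ 2 *
      (ENNReal.ofReal (max (2 * Real.pi * ‖ξ‖ - t) 0 ^ 2) * ‖𝓕 (waveWindow w S lam k) ξ‖ₑ ^ 2))
      (volume.prod volume) :=
    (((hmf.comp measurable_fst).enorm.pow_const 2).mul
      ((hK.comp measurable_snd).mul (hm2.enorm.pow_const 2))).aemeasurable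
  simp_rw [← lintegral_const_mul' _ _ (ENNReal.pow_ne_top enorm_ne_top)]
  rw [lintegral_lintegral_swap hA, ← lintegral_const_mul' _ _ ENNReal.ofReal_ne_top]
  refine lintegral_congr fun ξ => ?_
  rw [lintegral_const_mul' _ _ ENNReal.ofReal_ne_top, key,
    ← mul_assoc, mul_comm (ENNReal.ofReal _) (ENNReal.ofReal _), mul_assoc,
    ← lintegral_const_mul' _ _ ENNReal.ofReal_ne_top]
  congr 2
  ext k
  ring

end

/-! ### Bounds on localized dispersions -/

lemma fourier_planeWave_mul (w : E3 → ℂ) (k ξ : E3) :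
    𝓕 (fun x => planeWave k x * w x) ξ = 𝓕 w (ξ - k) := by
  rw [fourier_eq_planeWave, fourier_eq_planeWave]
  refine integral_congr_ae (Eventually.of_forall fun x => ?_)
  have : planeWave (-(ξ - k)) x = planeWave (-ξ) x * planeWave k x := by
    rw [← planeWave_add]; congr 1; abel
  simp only [this]; ring

lemma fourier_even {w : E3 → ℂ} (hw : ∀ x, w (-x) = w x) (ξ : E3) : 𝓕 w (-ξ) = 𝓕 w ξ := by
  rw [fourier_eq_planeWave, fourier_eq_planeWave, ← integral_neg_eq_self]
  simp [planeWave_neg, hw]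

lemma waveWindow_zero (w : E3 → ℂ) (S : Set E3) (k : E3) :
    waveWindow w S 0 k = fun x => planeWave k x * w x := by
  ext x; simp [waveWindow, mul_comm]

/-- `(‖v‖ - t)₊` is the distance of `v` to the ball of radius `t`. If `z` is the point of the ball
closest to `p`, then `p ± q` have distance at most `‖p - z ± q‖`, and the parallelogram law removes
the cross terms. -/
lemma dispersion_parallelogram {t : ℝ} (ht : 0 ≤ t) (p q : E3) :
    max (‖p + q‖ - t) 0 ^ 2 + max (‖p - q‖ - t) 0 ^ 2 ≤ 2 * max (‖p‖ - t) 0 ^ 2 + 2 * ‖q‖ ^ 2 := by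
  obtain ⟨z, hz, hpz⟩ : ∃ z : E3, ‖z‖ ≤ t ∧ ‖p - z‖ = max (‖p‖ - t) 0 := by
    rcases le_or_gt ‖p‖ t with h | h
    · exact ⟨p, h, by simp [h]⟩
    · have hp : 0 < ‖p‖ := ht.trans_lt h
      refine ⟨(t / ‖p‖) • p, ?_, ?_⟩
      · rw [norm_smul, Real.norm_eq_abs, abs_of_nonneg (by positivity)]
        exact (div_mul_cancel₀ _ hp.ne').le
      · have e : p - (t / ‖p‖) • p = (1 - t / ‖p‖) • p := by rw [sub_smul, one_smul]
        have : 0 ≤ 1 - t / ‖p‖ := by rw [sub_nonneg, div_le_one hp]; exact h.le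
        rw [e, norm_smul, Real.norm_eq_abs, abs_of_nonneg this, max_eq_left (by linarith), sub_mul,
          div_mul_cancel₀ _ hp.ne', one_mul]
  have hN : ∀ v : E3, max (‖v‖ - t) 0 ^ 2 ≤ ‖v - z‖ ^ 2 := fun v => by
    refine pow_le_pow_left₀ (le_max_right _ _) (max_le ?_ (norm_nonneg _)) 2
    have := norm_sub_norm_le v z
    linarith
  have h1 := hN (p + q)
  have h2 := hN (p - q)
  have h3 := parallelogram_law_with_norm ℝ (p - z) q
  have e1 : p - z + q = p + q - z := by abel
  have e2 : p - z - q = p - q - z := by abel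
  rw [e1, e2] at h3
  rw [← hpz]
  nlinarith

lemma norm_two_pi_smul (ξ : E3) : ‖(2 * Real.pi) • ξ‖ = 2 * Real.pi * ‖ξ‖ := by
  rw [norm_smul, Real.norm_eq_abs, abs_of_pos (by positivity)]

lemma measurable_dispersion (t : ℝ) :
    Measurable fun ξ : E3 => ENNReal.ofReal (max (2 * Real.pi * ‖ξ‖ - t) 0 ^ 2) := by fun_prop

/-- The symbol averages the dispersion at `k + q` with the weight `|𝓕 w(q)|²`. For an even window
this weight is even, so `k + q` and `k - q` can be paired; by the parallelogram bound no term linear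
in `k` appears in the error. -/
lemma dispersionL_wave_le {w : E3 → ℂ} (hw : ∀ x, w (-x) = w x) (hi : Integrable w)
    (hi2 : MemLp w 2) {t : ℝ} (ht : 0 ≤ t) (S : Set E3) (k : E3) :
    dispersionL t (waveWindow w S 0 k)
      ≤ ENNReal.ofReal (max (2 * Real.pi * ‖k‖ - t) 0 ^ 2) * (∫⁻ x, ‖w x‖ₑ ^ 2) + momentL 1 w := by
  have hm : Measurable (𝓕 w) := (continuous_fourier hi).measurable
  set K : E3 → ENNReal := fun ξ => ENNReal.ofReal (max (2 * Real.pi * ‖ξ‖ - t) 0 ^ 2) with hK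
  have hKm : Measurable K := measurable_dispersion t
  have e1 : dispersionL t (waveWindow w S 0 k) = ∫⁻ q, K (k + q) * ‖𝓕 w q‖ₑ ^ 2 := by
    rw [waveWindow_zero, dispersionL, ← lintegral_add_right_eq_self _ k]
    refine lintegral_congr fun q => ?_
    rw [fourier_planeWave_mul, add_sub_cancel_right, add_comm q k]
  have e2 : dispersionL t (waveWindow w S 0 k) = ∫⁻ q, K (k - q) * ‖𝓕 w q‖ₑ ^ 2 := by
    rw [e1, ← lintegral_neg_eq_self]
    refine lintegral_congr fun q => ?_
    rw [fourier_even hw, sub_eq_add_neg]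
  have h2 : 2 * dispersionL t (waveWindow w S 0 k)
      ≤ 2 * (K k * (∫⁻ x, ‖w x‖ₑ ^ 2) + momentL 1 w) := by
    calc 2 * dispersionL t (waveWindow w S 0 k)
        = ∫⁻ q, (K (k + q) * ‖𝓕 w q‖ₑ ^ 2 + K (k - q) * ‖𝓕 w q‖ₑ ^ 2) := by
          rw [lintegral_add_left, ← e1, ← e2, two_mul]
          exact (hKm.comp (by fun_prop)).mul (hm.enorm.pow_const 2)
      _ ≤ ∫⁻ q, 2 * (K k * ‖𝓕 w q‖ₑ ^ 2
            + ENNReal.ofReal ((2 * Real.pi * ‖q‖) ^ (2 * 1)) * ‖𝓕 w q‖ₑ ^ 2) := by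
          refine lintegral_mono fun q => ?_
          rw [← add_mul, ← add_mul, ← mul_assoc]
          gcongr
          rw [hK]
          beta_reduce
          rw [← ENNReal.ofReal_add (by positivity) (by positivity),
            ← ENNReal.ofReal_add (by positivity) (by positivity), two_mul (ENNReal.ofReal _),
            ← ENNReal.ofReal_add (by positivity) (by positivity)]
          refine ENNReal.ofReal_le_ofReal ?_
          have := dispersion_parallelogram ht ((2 * Real.pi) • k) ((2 * Real.pi) • q)
          rw [← smul_add, ← smul_sub] at this
          simp only [norm_two_pi_smul] at this
          rw [mul_one]
          linarith
      _ = _ := by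
          rw [lintegral_const_mul' _ _ (by norm_num), lintegral_add_left
            (by exact (hm.enorm.pow_const 2).const_mul _),
            lintegral_const_mul' _ _ (by exact ENNReal.ofReal_ne_top), lintegral_fourier_sq hi hi2]
          rfl
  exact (ENNReal.mul_le_mul_iff_right (by norm_num) (by norm_num)).1 h2

/-- The dispersion vanishes unless `2π‖ξ‖ > t`, and then `2π‖ξ - k‖ ≥ t/4`. Thus only the tail of `𝓕
w` contributes, and it is traded for a high moment. -/
lemma dispersionL_wave_le_tail (w : E3 → ℂ) {t : ℝ} (ht : 0 < t) (S : Set E3) {k : E3}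
    (hk : 2 * Real.pi * ‖k‖ ≤ 3 / 4 * t) (j : ℕ) :
    dispersionL t (waveWindow w S 0 k)
      ≤ ENNReal.ofReal (16 * ((4 / t) ^ (2 * j))) * momentL (j + 1) w := by
  have e1 : momentL (j + 1) w
      = ∫⁻ ξ, ENNReal.ofReal ((2 * Real.pi * ‖ξ - k‖) ^ (2 * (j + 1))) * ‖𝓕 w (ξ - k)‖ₑ ^ 2 := by
    rw [lintegral_sub_right_eq_self
      (fun ξ => ENNReal.ofReal ((2 * Real.pi * ‖ξ‖) ^ (2 * (j + 1))) * ‖𝓕 w ξ‖ₑ ^ 2) k]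
    rfl
  rw [e1, ← lintegral_const_mul' _ _ ENNReal.ofReal_ne_top, waveWindow_zero]
  refine lintegral_mono fun ξ => ?_
  rw [fourier_planeWave_mul, ← mul_assoc]
  gcongr
  rw [← ENNReal.ofReal_mul (by positivity)]
  refine ENNReal.ofReal_le_ofReal ?_
  rcases le_or_gt (2 * Real.pi * ‖ξ‖) t with h | h
  · rw [max_eq_right (by linarith)]
    simp only [ne_eq, OfNat.ofNat_ne_zero, not_false_eq_true, zero_pow]
    positivity
  · rw [max_eq_left (by linarith)]
    have h1 : ‖ξ‖ ≤ ‖ξ - k‖ + ‖k‖ := by simpa using norm_add_le (ξ - k) k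
    set q := 2 * Real.pi * ‖ξ - k‖ with hq
    have h2 : 2 * Real.pi * ‖ξ‖ ≤ q + 3 / 4 * t := by
      have := mul_le_mul_of_nonneg_left h1 (by positivity : 0 ≤ 2 * Real.pi)
      linarith
    have h3 : 1 ≤ 4 / t * q := by
      rw [div_mul_eq_mul_div, le_div_iff₀ ht]; linarith
    have h4 : (2 * Real.pi * ‖ξ‖ - t) ^ 2 ≤ q ^ 2 :=
      pow_le_pow_left₀ (by linarith) (by linarith) 2
    calc (2 * Real.pi * ‖ξ‖ - t) ^ 2 ≤ 16 * 1 * q ^ 2 := by nlinarith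
      _ ≤ 16 * ((4 / t * q) ^ (2 * j)) * q ^ 2 := by
          gcongr
          exact one_le_pow₀ h3
      _ = _ := by rw [mul_pow]; ring

/-- Young's inequality for the cross term, weighted so that the additional cost on `a` is `η`,
independent of `K`. The price `K²/η` falls on `b`, which will be smooth with a rapidly decaying
transform. -/
lemma dispersion_sub_le {K η : ℝ} (hK : 0 ≤ K) (hη : 0 < η) (a b : ℂ) :
    K * ‖a - b‖ ^ 2 ≤ K * ‖a‖ ^ 2 + η * ‖a‖ ^ 2 + (K + K ^ 2 / η) * ‖b‖ ^ 2 := by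
  have h1 : ‖a - b‖ ^ 2 ≤ (‖a‖ + ‖b‖) ^ 2 :=
    pow_le_pow_left₀ (norm_nonneg _) (norm_sub_le _ _) 2
  have h2 : 2 * K * ‖a‖ * ‖b‖ ≤ η * ‖a‖ ^ 2 + K ^ 2 / η * ‖b‖ ^ 2 := by
    have e : η * ‖a‖ ^ 2 + K ^ 2 / η * ‖b‖ ^ 2 - 2 * K * ‖a‖ * ‖b‖
        = (η * ‖a‖ - K * ‖b‖) ^ 2 / η := by
      field_simp
      ring
    have : 0 ≤ (η * ‖a‖ - K * ‖b‖) ^ 2 / η := by positivity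
    linarith
  nlinarith [mul_le_mul_of_nonneg_left h1 hK]

lemma dispersionL_sub_le {a b : E3 → ℂ} (ha : Integrable a) (ha2 : MemLp a 2)
    (hb : Integrable b) {t η : ℝ} (hη : 0 < η) :
    dispersionL t (fun x => a x - b x) ≤ dispersionL t a + ENNReal.ofReal η * (∫⁻ x, ‖a x‖ₑ ^ 2)
      + ∫⁻ ξ, ENNReal.ofReal (max (2 * Real.pi * ‖ξ‖ - t) 0 ^ 2
          + (max (2 * Real.pi * ‖ξ‖ - t) 0 ^ 2) ^ 2 / η) * ‖𝓕 b ξ‖ₑ ^ 2 := by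
  have hma : Measurable (𝓕 a) := (continuous_fourier ha).measurable
  have hsub : ∀ ξ, 𝓕 (fun x => a x - b x) ξ = 𝓕 a ξ - 𝓕 b ξ := fun ξ => by
    rw [Real.fourier_eq, Real.fourier_eq, Real.fourier_eq, ← integral_sub]
    · simp only [smul_sub]
    · exact (Real.fourierIntegral_convergent_iff ξ).2 ha
    · exact (Real.fourierIntegral_convergent_iff ξ).2 hb
  calc dispersionL t (fun x => a x - b x)
      ≤ ∫⁻ ξ, (ENNReal.ofReal (max (2 * Real.pi * ‖ξ‖ - t) 0 ^ 2) * ‖𝓕 a ξ‖ₑ ^ 2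
          + ENNReal.ofReal η * ‖𝓕 a ξ‖ₑ ^ 2
          + ENNReal.ofReal (max (2 * Real.pi * ‖ξ‖ - t) 0 ^ 2
          + (max (2 * Real.pi * ‖ξ‖ - t) 0 ^ 2) ^ 2 / η) * ‖𝓕 b ξ‖ₑ ^ 2) := by
        refine lintegral_mono fun ξ => ?_
        simp only [hsub]
        rw [ofReal_mul_enorm_sq (by positivity), ofReal_mul_enorm_sq (by positivity),
          ofReal_mul_enorm_sq hη.le, ofReal_mul_enorm_sq (by positivity),
          ← ENNReal.ofReal_add (by positivity) (by positivity),
          ← ENNReal.ofReal_add (by positivity) (by positivity)]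
        exact ENNReal.ofReal_le_ofReal (dispersion_sub_le (by positivity) hη _ _)
    _ = _ := by
        have m1 := (measurable_dispersion t).mul (hma.enorm.pow_const 2)
        have m2 := (hma.enorm.pow_const 2).const_mul (ENNReal.ofReal η)
        rw [lintegral_add_left (by exact m1.add m2), lintegral_add_left (by exact m1),
          lintegral_const_mul' _ _ ENNReal.ofReal_ne_top, lintegral_fourier_sq ha ha2]
        rfl

lemma dispersion_le_sq {t p : ℝ} (ht : 0 ≤ t) (hp : 0 ≤ p) : max (p - t) 0 ^ 2 ≤ p ^ 2 :=
  pow_le_pow_left₀ (le_max_right _ _) (max_le (by linarith) hp) 2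

/-- Where the left side does not vanish, `p/t ≥ 1`, so powers of it may be inserted. -/
lemma dispersion_le_pow {t p : ℝ} (ht : 0 < t) (hp : 0 ≤ p) (j : ℕ) :
    max (p - t) 0 ^ 2 ≤ (t⁻¹) ^ (2 * j) * p ^ (2 * (j + 1)) := by
  rcases le_or_gt p t with h | h
  · rw [max_eq_right (by linarith)]
    simp only [ne_eq, OfNat.ofNat_ne_zero, not_false_eq_true, zero_pow]
    positivity
  · have h1 : 1 ≤ t⁻¹ * p := by rw [inv_mul_eq_div, le_div_iff₀ ht]; linarith
    calc max (p - t) 0 ^ 2 ≤ 1 * p ^ 2 := by rw [one_mul]; exact dispersion_le_sq ht.le hp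
      _ ≤ (t⁻¹ * p) ^ (2 * j) * p ^ 2 := by gcongr; exact one_le_pow₀ h1
      _ = _ := by rw [mul_pow]; ring

lemma dispersion_sq_le_pow {t p : ℝ} (ht : 0 < t) (hp : 0 ≤ p) (j : ℕ) :
    (max (p - t) 0 ^ 2) ^ 2 ≤ (t⁻¹) ^ (2 * j) * p ^ (2 * (j + 2)) := by
  rw [sq (max (p - t) 0 ^ 2)]
  calc max (p - t) 0 ^ 2 * max (p - t) 0 ^ 2
      ≤ ((t⁻¹) ^ (2 * j) * p ^ (2 * (j + 1))) * p ^ 2 := by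
        exact mul_le_mul (dispersion_le_pow ht hp j) (dispersion_le_sq ht.le hp) (by positivity)
          (by positivity)
    _ = _ := by ring

lemma dispersionL_le_momentL {t : ℝ} (ht : 0 < t) (j : ℕ) (g : E3 → ℂ) :
    dispersionL t g ≤ ENNReal.ofReal ((t⁻¹) ^ (2 * j)) * momentL (j + 1) g := by
  rw [momentL, ← lintegral_const_mul' _ _ ENNReal.ofReal_ne_top]
  refine lintegral_mono fun ξ => ?_
  rw [← mul_assoc, ← ENNReal.ofReal_mul (by positivity)]
  gcongr
  exact dispersion_le_pow ht (by positivity) j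

/-- The remainder of a localized dispersion, estimated by low moments. -/
lemma lintegral_remainder_le {t η : ℝ} (ht : 0 ≤ t) (hη : 0 < η) {b : E3 → ℂ} (hb : Integrable b) :
    ∫⁻ ξ, ENNReal.ofReal (max (2 * Real.pi * ‖ξ‖ - t) 0 ^ 2
          + (max (2 * Real.pi * ‖ξ‖ - t) 0 ^ 2) ^ 2 / η) * ‖𝓕 b ξ‖ₑ ^ 2
      ≤ momentL 1 b + ENNReal.ofReal η⁻¹ * momentL 2 b := by
  have hm : Measurable (𝓕 b) := (continuous_fourier hb).measurable
  rw [momentL, momentL, ← lintegral_const_mul' _ _ ENNReal.ofReal_ne_top, ← lintegral_add_left]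
  · refine lintegral_mono fun ξ => ?_
    rw [← mul_assoc, ← add_mul, ← ENNReal.ofReal_mul (by positivity),
      ← ENNReal.ofReal_add (by positivity) (by positivity)]
    refine mul_le_mul_left (ENNReal.ofReal_le_ofReal ?_) _
    have := dispersion_le_sq ht (by positivity : 0 ≤ 2 * Real.pi * ‖ξ‖)
    rw [div_eq_inv_mul]
    refine add_le_add (by simpa using this) ?_
    refine mul_le_mul_of_nonneg_left ?_ (by positivity)
    calc (max (2 * Real.pi * ‖ξ‖ - t) 0 ^ 2) ^ 2 ≤ ((2 * Real.pi * ‖ξ‖) ^ 2) ^ 2 := by gcongr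
      _ = _ := by ring
  · have : Measurable fun ξ : E3 => ENNReal.ofReal ((2 * Real.pi * ‖ξ‖) ^ (2 * 1)) := by fun_prop
    exact this.mul (hm.enorm.pow_const 2)

/-- The remainder of a localized dispersion, estimated by a high moment. -/
lemma lintegral_remainder_le_tail {t η : ℝ} (ht : 0 < t) (hη : 0 < η) (b : E3 → ℂ) (j : ℕ) :
    ∫⁻ ξ, ENNReal.ofReal (max (2 * Real.pi * ‖ξ‖ - t) 0 ^ 2
          + (max (2 * Real.pi * ‖ξ‖ - t) 0 ^ 2) ^ 2 / η) * ‖𝓕 b ξ‖ₑ ^ 2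
      ≤ ENNReal.ofReal ((t⁻¹) ^ (2 * (j + 1)) + (t⁻¹) ^ (2 * j) / η) * momentL (j + 2) b := by
  rw [momentL, ← lintegral_const_mul' _ _ ENNReal.ofReal_ne_top]
  refine lintegral_mono fun ξ => ?_
  rw [← mul_assoc, ← ENNReal.ofReal_mul (by positivity)]
  gcongr
  rw [add_mul, div_mul_eq_mul_div]
  have hp : 0 ≤ 2 * Real.pi * ‖ξ‖ := by positivity
  gcongr
  · exact dispersion_le_pow ht hp (j + 1)
  · exact dispersion_sq_le_pow ht hp j

/-! ### Cubes -/

lemma isClosed_cube (c : E3) (r : ℝ) : IsClosed (cube c r) := by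
  simp only [cube, Set.ofPred_forall]
  exact isClosed_iInter fun k => isClosed_le (by fun_prop) (by fun_prop)

lemma measurableSet_cube (c : E3) (r : ℝ) : MeasurableSet (cube c r) :=
  (isClosed_cube c r).measurableSet

lemma volume_cube (c : E3) {r : ℝ} (hr : 0 ≤ r) : volume (cube c r) = ENNReal.ofReal (r ^ 3) := by
  have h := (EuclideanSpace.volume_preserving_symm_measurableEquiv_toLp (Fin 3)).symm
  have e : cube c r = (MeasurableEquiv.toLp 2 (Fin 3 → ℝ)).symm ⁻¹'
      (Set.univ.pi fun k => Set.Icc (c k - r / 2) (c k + r / 2)) := by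
    ext x
    simp only [cube, Set.mem_ofPred_eq, Set.mem_preimage, Set.mem_univ_pi, Set.mem_Icc, abs_le]
    refine forall_congr' fun k => ?_
    change _ ↔ c k - r / 2 ≤ x k ∧ x k ≤ c k + r / 2
    constructor <;> rintro ⟨h1, h2⟩ <;> constructor <;> linarith
  rw [e, (EuclideanSpace.volume_preserving_symm_measurableEquiv_toLp (Fin 3)).measure_preimage
    (MeasurableSet.univ_pi fun k => measurableSet_Icc).nullMeasurableSet, volume_pi_pi]
  simp only [Real.volume_Icc]
  rw [← ENNReal.ofReal_prod_of_nonneg fun k _ => by linarith]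
  congr 1
  simp only [Fin.prod_univ_three]
  ring

lemma volume_cube_ne_top (c : E3) {r : ℝ} (hr : 0 ≤ r) : volume (cube c r) ≠ ⊤ := by
  rw [volume_cube c hr]; exact ENNReal.ofReal_ne_top

lemma volume_real_cube (c : E3) {r : ℝ} (hr : 0 ≤ r) : volume.real (cube c r) = r ^ 3 := by
  rw [Measure.real, volume_cube c hr, ENNReal.toReal_ofReal (by positivity)]

/-- The constant `2` is a convenient bound for `√3`. -/
lemma norm_le_of_abs_le {x : E3} {R : ℝ} (h : ∀ k, |x k| ≤ R) : ‖x‖ ≤ 2 * R := by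
  have hR : 0 ≤ R := (abs_nonneg _).trans (h 0)
  refine abs_le_of_sq_le_sq' ?_ (by positivity) |>.2
  rw [norm_sq_eq_sum]
  calc ∑ i, |x i| ^ 2 ≤ ∑ _i : Fin 3, R ^ 2 :=
        Finset.sum_le_sum fun i _ => pow_le_pow_left₀ (abs_nonneg _) (h i) 2
    _ ≤ (2 * R) ^ 2 := by simp; nlinarith [sq_nonneg R]

lemma isCompact_cube (c : E3) (r : ℝ) : IsCompact (cube c r) := by
  refine (isCompact_closedBall c (2 * (r / 2))).of_isClosed_subset (isClosed_cube c r) fun x hx => ?_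
  rw [Metric.mem_closedBall, dist_eq_norm]
  exact norm_le_of_abs_le fun k => by simpa using hx k

lemma mem_cube_sub (c v x : E3) (r : ℝ) : x ∈ cube (c + v) r ↔ x - v ∈ cube c r := by
  simp only [cube, Set.mem_ofPred_eq, PiLp.add_apply, PiLp.sub_apply]
  refine forall_congr' fun k => ?_
  rw [show x k - (c k + v k) = x k - v k - c k by ring]

/-! ### Regularity of the localization function -/

/-- `cos(πy)ⁿ g(y)` on `[-1/2, 1/2]`, extended by zero. -/
def cosCut (n : ℕ) (g : ℝ → ℝ) (y : ℝ) : ℝ :=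
  if |y| ≤ 1 / 2 then Real.cos (Real.pi * y) ^ n * g y else 0

lemma cosCut_of_le {n : ℕ} {g : ℝ → ℝ} {y : ℝ} (h : |y| ≤ 1 / 2) :
    cosCut n g y = Real.cos (Real.pi * y) ^ n * g y := if_pos h

lemma cosCut_of_lt {n : ℕ} {g : ℝ → ℝ} {y : ℝ} (h : 1 / 2 < |y|) : cosCut n g y = 0 :=
  if_neg (not_le.2 h)

lemma cos_eq_zero_of_abs {y : ℝ} (hy : |y| = 1 / 2) : Real.cos (Real.pi * y) = 0 := by
  rcases abs_eq (by norm_num : (0 : ℝ) ≤ 1 / 2) |>.1 hy with h | h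
  · rw [h, mul_one_div, Real.cos_pi_div_two]
  · rw [h, mul_neg, Real.cos_neg, mul_one_div, Real.cos_pi_div_two]

lemma continuous_cosCut (n : ℕ) {g : ℝ → ℝ} (hg : Continuous g) : Continuous (cosCut (n + 1) g) := by
  refine Continuous.if_le (by fun_prop) continuous_const continuous_abs continuous_const ?_
  intro y hy
  simp [cos_eq_zero_of_abs hy]

/-- At the end points `±1/2` one factor of the cosine is of the order of the distance to the end
point, and the remaining product still tends to zero, so the derivative is `0` there. The exponent
drops by exactly one and the form of the function is kept. -/
lemma hasDerivAt_cosCut (n : ℕ) {g g' : ℝ → ℝ} (hg : ∀ y, HasDerivAt g (g' y) y) (y : ℝ) :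
    HasDerivAt (cosCut (n + 2) g) (cosCut (n + 1)
      (fun y => -((n + 2) * Real.pi * Real.sin (Real.pi * y)) * g y
        + Real.cos (Real.pi * y) * g' y) y) y := by
  have hc : HasDerivAt (fun y => Real.cos (Real.pi * y)) (-Real.sin (Real.pi * y) * Real.pi) y := by
    simpa using ((hasDerivAt_id y).const_mul Real.pi).cos
  rcases lt_trichotomy |y| (1 / 2) with h | h | h
  · have h1 : cosCut (n + 2) g =ᶠ[𝓝 y] fun y => Real.cos (Real.pi * y) ^ (n + 2) * g y := by
      filter_upwards [continuous_abs.continuousAt.eventually_lt continuousAt_const h] with z hz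
      exact cosCut_of_le hz.le
    refine HasDerivAt.congr_of_eventuallyEq ?_ h1
    refine ((hc.pow (n + 2)).mul (hg y)).congr_deriv ?_
    rw [cosCut_of_le h.le]
    push_cast
    simp only [Pi.pow_apply]
    ring
  · have h0 : ∀ m g, cosCut (m + 1) g y = 0 := fun m g => by
      rw [cosCut_of_le h.le, cos_eq_zero_of_abs h]; simp
    have hcont : Tendsto (cosCut (n + 1) g) (𝓝 y) (𝓝 0) := by
      rw [← h0 n g]
      exact (continuous_cosCut n (continuous_iff_continuousAt.2 fun z => (hg z).continuousAt)).continuousAt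
    have e : cosCut (n + 2) g = fun z => Real.cos (Real.pi * z) * cosCut (n + 1) g z := by
      ext z
      rcases le_or_gt |z| (1 / 2) with hz | hz
      · rw [cosCut_of_le hz, cosCut_of_le hz]; ring
      · rw [cosCut_of_lt hz, cosCut_of_lt hz, mul_zero]
    rw [h0, hasDerivAt_iff_isLittleO, h0, e]
    have hO := hc.isBigO_sub
    rw [cos_eq_zero_of_abs h] at hO
    have := hO.mul_isLittleO ((Asymptotics.isLittleO_one_iff ℝ).2 hcont)
    simpa using this
  · have h1 : cosCut (n + 2) g =ᶠ[𝓝 y] fun _ => 0 := by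
      filter_upwards [continuousAt_const.eventually_lt continuous_abs.continuousAt h] with z hz
      exact cosCut_of_lt hz
    refine HasDerivAt.congr_of_eventuallyEq ?_ h1
    rw [cosCut_of_lt h]
    exact hasDerivAt_const _ _

/-- Induction on the exponent over all smooth `g` at once, since differentiation changes `g`. This
is why the power `M + 1` in `χ` gives `M` continuous derivatives. -/
lemma contDiff_cosCut (n : ℕ) : ∀ {g : ℝ → ℝ}, ContDiff ℝ ∞ g → ContDiff ℝ n (cosCut (n + 1) g) := by
  induction n with
  | zero => exact fun hg => contDiff_zero.2 (continuous_cosCut 0 hg.continuous)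
  | succ n ih =>
    intro g hg
    have hd : ∀ y, HasDerivAt g (deriv g y) y := fun y =>
      (hg.differentiable (by simp) y).hasDerivAt
    have hg' : ContDiff ℝ ∞ (deriv g) := (contDiff_infty_iff_deriv.1 hg).2
    have h := hasDerivAt_cosCut n hd
    rw [Nat.cast_add, Nat.cast_one, contDiff_succ_iff_deriv]
    refine ⟨fun y => (h y).differentiableAt, by simp, ?_⟩
    rw [show deriv (cosCut (n + 1 + 1) g) = _ from funext fun y => (h y).deriv]
    refine ih ?_
    have := Real.contDiff_sin (n := ∞)
    have := Real.contDiff_cos (n := ∞)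
    fun_prop

lemma zeta_pow (n : ℕ) : (fun y => zeta y ^ (n + 1)) = cosCut (n + 1) 1 := by
  ext y
  by_cases h : |y| ≤ 1 / 2 <;> simp [zeta, cosCut]

lemma contDiff_chiShape (M : ℕ) : ContDiff ℝ M (chiShape M) := by
  have h : ContDiff ℝ M (fun y => zeta y ^ (M + 1)) := by
    rw [zeta_pow]; exact contDiff_cosCut M contDiff_const
  have e : chiShape M = fun x : E3 => (fun y => zeta y ^ (M + 1)) (x 0) *
      (fun y => zeta y ^ (M + 1)) (x 1) * (fun y => zeta y ^ (M + 1)) (x 2) := by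
    ext x; simp [chiShape, mul_pow]
  rw [e]
  have hk : ∀ k : Fin 3, ContDiff ℝ M fun x : E3 => (fun y => zeta y ^ (M + 1)) (x k) := fun k =>
    h.comp (by fun_prop)
  exact ((hk 0).mul (hk 1)).mul (hk 2)

lemma contDiff_chi (M : ℕ) : ContDiff ℝ M (chi M) := contDiff_const.mul (contDiff_chiShape M)

lemma continuous_chi (M : ℕ) : Continuous (chi M) := (contDiff_chi M).continuous

lemma zeta_nonneg (y : ℝ) : 0 ≤ zeta y := by
  unfold zeta
  split_ifs with h
  · rw [abs_le] at h
    refine Real.cos_nonneg_of_neg_pi_div_two_le_of_le ?_ ?_ <;> nlinarith [Real.pi_pos]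
  · rfl

lemma zeta_pos {y : ℝ} (h : |y| < 1 / 2) : 0 < zeta y := by
  unfold zeta
  rw [if_pos h.le]
  rw [abs_lt] at h
  refine Real.cos_pos_of_mem_Ioo ⟨?_, ?_⟩ <;> nlinarith [Real.pi_pos]

lemma zeta_neg (y : ℝ) : zeta (-y) = zeta y := by simp [zeta]

lemma zeta_eq_zero {y : ℝ} (h : 1 / 2 < |y|) : zeta y = 0 := if_neg (not_le.2 h)

lemma chiShape_nonneg (M : ℕ) (x : E3) : 0 ≤ chiShape M x :=
  pow_nonneg (mul_nonneg (mul_nonneg (zeta_nonneg _) (zeta_nonneg _)) (zeta_nonneg _)) _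

lemma chiShape_eq_zero {M : ℕ} {x : E3} (h : x ∉ cube 0 1) : chiShape M x = 0 := by
  simp only [cube, Set.mem_ofPred_eq, not_forall, not_le, PiLp.zero_apply, sub_zero] at h
  obtain ⟨k, hk⟩ := h
  have := zeta_eq_zero hk
  fin_cases k <;> simp_all [chiShape]

lemma chi_eq_zero {M : ℕ} {x : E3} (h : x ∉ cube 0 1) : chi M x = 0 := by
  simp [chi, chiShape_eq_zero h]

lemma chi_neg (M : ℕ) (x : E3) : chi M (-x) = chi M x := by
  simp [chi, chiShape, zeta_neg]

lemma tsupport_chi (M : ℕ) : tsupport (chi M) ⊆ cube 0 1 :=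
  closure_minimal (fun _ hx => by_contra fun h => hx (chi_eq_zero h)) (isClosed_cube _ _)

lemma hasCompactSupport_chi (M : ℕ) : HasCompactSupport (chi M) :=
  (isCompact_cube 0 1).of_isClosed_subset (isClosed_tsupport _) (tsupport_chi M)

lemma integral_chiShape_sq_pos (M : ℕ) : 0 < ∫ x, chiShape M x ^ 2 := by
  have hc : HasCompactSupport fun x => chiShape M x ^ 2 := by
    refine HasCompactSupport.intro (isCompact_cube 0 1) fun _ hx => ?_
    simp [chiShape_eq_zero hx]
  refine Continuous.integral_pos_of_hasCompactSupport_nonneg_nonzero (x := 0)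
    ((contDiff_chiShape M).continuous.pow 2) hc (fun _ => sq_nonneg _) ?_
  simp [chiShape, zeta]

lemma chiConst_pos (M : ℕ) : 0 < chiConst M :=
  inv_pos.2 (Real.sqrt_pos.2 (integral_chiShape_sq_pos M))

lemma integral_chi_sq (M : ℕ) : ∫ x, chi M x ^ 2 = 1 := by
  simp only [chi, mul_pow]
  rw [integral_const_mul, chiConst, inv_pow, Real.sq_sqrt (integral_chiShape_sq_pos M).le]
  exact inv_mul_cancel₀ (integral_chiShape_sq_pos M).ne'

lemma chi_nonneg (M : ℕ) (x : E3) : 0 ≤ chi M x :=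
  mul_nonneg (chiConst_pos M).le (chiShape_nonneg M x)

lemma chi_pos {M : ℕ} {x : E3} (h : ∀ k, |x k| < 1 / 2) : 0 < chi M x :=
  mul_pos (chiConst_pos M) (pow_pos (mul_pos (mul_pos (zeta_pos (h 0)) (zeta_pos (h 1)))
    (zeta_pos (h 2))) _)

/-! ### The scaled localization function as a complex window -/

/-- The localization function of the cube of side length `r` centred at the origin. -/
def chiWin (M : ℕ) (r : ℝ) (x : E3) : ℂ := (chi M (r⁻¹ • x) : ℂ)

lemma contDiff_chiWin (M : ℕ) (r : ℝ) : ContDiff ℝ M (chiWin M r) :=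
  Complex.ofRealCLM.contDiff.comp ((contDiff_chi M).comp (by fun_prop))

lemma chiWin_sub (M : ℕ) {r : ℝ} (hr : r ≠ 0) (u x : E3) :
    chiWin M r (x - r • u) = (chiBig M r u x : ℂ) := by
  rw [chiWin, chiBig, smul_sub, smul_smul, inv_mul_cancel₀ hr, one_smul]

lemma chiWin_neg (M : ℕ) (r : ℝ) (x : E3) : chiWin M r (-x) = chiWin M r x := by
  simp [chiWin, chi_neg]

lemma chiWin_eq_zero {M : ℕ} {r : ℝ} (hr : 0 < r) {x : E3} (h : x ∉ cube 0 r) :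
    chiWin M r x = 0 := by
  rw [chiWin, chi_eq_zero, Complex.ofReal_zero]
  contrapose! h
  intro k
  have := h k
  simp only [PiLp.smul_apply, PiLp.zero_apply, sub_zero, smul_eq_mul, abs_mul, abs_inv,
    abs_of_pos hr] at this ⊢
  rw [inv_mul_eq_div, div_le_iff₀ hr] at this
  linarith

lemma tsupport_chiWin (M : ℕ) {r : ℝ} (hr : 0 < r) : tsupport (chiWin M r) ⊆ cube 0 r :=
  closure_minimal (fun _ hx => by_contra fun h => hx (chiWin_eq_zero hr h)) (isClosed_cube _ _)

lemma hasCompactSupport_chiWin (M : ℕ) {r : ℝ} (hr : 0 < r) : HasCompactSupport (chiWin M r) :=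
  (isCompact_cube 0 r).of_isClosed_subset (isClosed_tsupport _) (tsupport_chiWin M hr)

lemma continuous_chiWin (M : ℕ) (r : ℝ) : Continuous (chiWin M r) := (contDiff_chiWin M r).continuous

lemma lintegral_chiWin_sq (M : ℕ) {r : ℝ} (hr : 0 < r) :
    ∫⁻ x, ‖chiWin M r x‖ₑ ^ 2 = ENNReal.ofReal (r ^ 3) := by
  have h1 : ∫⁻ x : E3, ENNReal.ofReal (chi M x ^ 2) = 1 := by
    rw [← ofReal_integral_eq_lintegral_ofReal, integral_chi_sq, ENNReal.ofReal_one]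
    · refine ((continuous_chi M).pow 2).integrable_of_hasCompactSupport ?_
      exact HasCompactSupport.intro (isCompact_cube 0 1) fun x hx => by simp [chi_eq_zero hx]
    · exact Eventually.of_forall fun x => sq_nonneg _
  have h2 := lintegral_comp_smul_inv (inv_pos.2 hr) (fun x => ENNReal.ofReal (chi M x ^ 2))
  rw [h1, inv_inv, mul_one] at h2
  rw [← h2]
  refine lintegral_congr fun x => ?_
  rw [chiWin, ← ofReal_norm, ← ENNReal.ofReal_pow (norm_nonneg _)]
  simp

/-- The derivatives of the scaled localization functions. -/
theorem exists_bound_iteratedFDeriv_chiWin (M : ℕ) : ∃ C : ℝ, 1 ≤ C ∧ ∀ j ≤ M, ∀ r : ℝ, 0 < r →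
    ∀ x, ‖iteratedFDeriv ℝ j (chiWin M r) x‖ ≤ C * r⁻¹ ^ j := by
  -- Bounds at scale one suffice, as each derivative scales with `r⁻¹`. Making the bound vacuous for
  -- `j > M` allows a choice for every `j`.
  have hb : ∀ j, ∃ C : ℝ, j ≤ M → ∀ x, ‖iteratedFDeriv ℝ j (chiWin M 1) x‖ ≤ C := fun j => by
    by_cases hj : j ≤ M
    · obtain ⟨C, hC⟩ := ((contDiff_chiWin M 1).continuous_iteratedFDeriv
        (by exact_mod_cast hj : (j : ℕ∞ω) ≤ M)).bounded_above_of_compact_support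
        ((hasCompactSupport_chiWin M one_pos).iteratedFDeriv j)
      exact ⟨C, fun _ => hC⟩
    · exact ⟨0, fun h => absurd h hj⟩
  choose C hC using hb
  refine ⟨1 + ∑ j ∈ Finset.range (M + 1), |C j|, ?_, fun j hj r hr x => ?_⟩
  · have : 0 ≤ ∑ j ∈ Finset.range (M + 1), |C j| := Finset.sum_nonneg fun _ _ => abs_nonneg _
    linarith
  · have e : chiWin M r = fun x => chiWin M 1 (r⁻¹ • x) := by
      ext x; simp [chiWin]
    have h1 : ContDiff ℝ j (chiWin M 1) := (contDiff_chiWin M 1).of_le (by exact_mod_cast hj)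
    rw [e, iteratedFDeriv_comp_const_smul r⁻¹ h1]
    rw [norm_smul, norm_pow, Real.norm_eq_abs, abs_of_pos (inv_pos.2 hr), mul_comm]
    gcongr
    refine (hC j hj _).trans ((le_abs_self _).trans ?_)
    have := Finset.single_le_sum (f := fun j => |C j|) (fun _ _ => abs_nonneg _)
      (Finset.mem_range.2 (Nat.lt_succ_of_le hj))
    linarith

lemma momentL_chiWin_le (M : ℕ) {C : ℝ} {j : ℕ} (hj : j ≤ M) {r : ℝ} (hr : 0 < r)
    (hC : ∀ x, ‖iteratedFDeriv ℝ j (chiWin M r) x‖ ≤ C * r⁻¹ ^ j) :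
    momentL j (chiWin M r) ≤ ENNReal.ofReal (3 ^ (j + 1) * (C * r⁻¹ ^ j) ^ 2 * r ^ 3) := by
  rw [ENNReal.ofReal_mul (by positivity), ← volume_cube 0 hr.le]
  exact momentL_le_of_bound ((contDiff_chiWin M r).of_le (by exact_mod_cast hj))
    (hasCompactSupport_chiWin M hr) hC (tsupport_chiWin M hr)

/-! ### Bounds on the symbol -/

lemma planeWave_eq_exp (k x : E3) :
    planeWave k x = Complex.exp (2 * Real.pi * Complex.I * (inner ℝ k x : ℝ)) := by
  rw [planeWave, Real.fourierChar_apply, real_inner_comm]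
  congr 1
  push_cast
  ring

lemma norm_planeWave_sub_le (k x z : E3) :
    ‖planeWave k x - planeWave k z‖ ≤ 2 * Real.pi * ‖k‖ * ‖x - z‖ := by
  have e : planeWave k x - planeWave k z = planeWave k z * (planeWave k (x - z) - 1) := by
    rw [mul_sub, ← planeWave_add_right, mul_one]; congr 2; abel
  rw [e, norm_mul, norm_planeWave, one_mul, planeWave_eq_exp]
  have := Real.norm_exp_I_mul_ofReal_sub_one_le (x := 2 * Real.pi * inner ℝ k (x - z))
  have e2 : (2 * Real.pi * Complex.I * (inner ℝ k (x - z) : ℝ) : ℂ)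
      = Complex.I * ((2 * Real.pi * inner ℝ k (x - z) : ℝ) : ℂ) := by push_cast; ring
  rw [e2]
  refine this.trans ?_
  rw [norm_mul, Real.norm_eq_abs (2 * Real.pi), abs_of_pos (by positivity), mul_assoc (2 * Real.pi)]
  gcongr
  exact norm_inner_le_norm _ _

lemma iteratedDeriv_exp_mul_I (n : ℕ) :
    iteratedDeriv n (fun s : ℝ => Complex.exp (2 * Real.pi * Complex.I * s))
      = fun s : ℝ => (2 * Real.pi * Complex.I) ^ n * Complex.exp (2 * Real.pi * Complex.I * s) := by
  induction n with
  | zero => simp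
  | succ n ih =>
    rw [iteratedDeriv_succ, ih]
    ext s
    have h : HasDerivAt (fun s : ℝ => Complex.exp (2 * Real.pi * Complex.I * s))
        (Complex.exp (2 * Real.pi * Complex.I * s) * (2 * Real.pi * Complex.I * 1)) s :=
      ((Complex.ofRealCLM.hasDerivAt (x := s)).const_mul (2 * Real.pi * Complex.I)).cexp
    rw [(h.const_mul _).deriv]
    ring

lemma contDiff_planeWave (k : E3) : ContDiff ℝ ∞ (planeWave k) := by
  have e : planeWave k = fun x => Complex.exp (2 * Real.pi * Complex.I * (inner ℝ k x : ℝ)) :=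
    funext (planeWave_eq_exp k)
  rw [e]
  have : ContDiff ℝ ∞ fun x : E3 => ((inner ℝ k x : ℝ) : ℂ) :=
    Complex.ofRealCLM.contDiff.comp (contDiff_const.inner ℝ contDiff_id)
  exact (contDiff_const.mul this).cexp

lemma norm_iteratedFDeriv_planeWave_le (k x : E3) (n : ℕ) :
    ‖iteratedFDeriv ℝ n (planeWave k) x‖ ≤ (2 * Real.pi * ‖k‖) ^ n := by
  set h : ℝ → ℂ := fun s : ℝ => Complex.exp (2 * Real.pi * Complex.I * s) with hh
  have e : planeWave k = h ∘ (innerSL ℝ k) := by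
    ext x; rw [planeWave_eq_exp]; simp [hh]
  have hc : ContDiff ℝ n h := by
    have : ContDiff ℝ n fun s : ℝ => (s : ℂ) := Complex.ofRealCLM.contDiff
    exact (contDiff_const.mul this).cexp
  rw [e, ContinuousLinearMap.iteratedFDeriv_comp_right _ hc _ le_rfl]
  refine (ContinuousMultilinearMap.norm_compContinuousLinearMap_le _ _).trans ?_
  rw [norm_iteratedFDeriv_eq_norm_iteratedDeriv, iteratedDeriv_exp_mul_I, norm_mul]
  have e2 : ∀ s : ℝ, ‖Complex.exp (2 * Real.pi * Complex.I * s)‖ = 1 := fun s => by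
    rw [show (2 * Real.pi * Complex.I * s : ℂ) = ((2 * Real.pi * s : ℝ) : ℂ) * Complex.I by
      push_cast; ring, Complex.norm_exp_ofReal_mul_I]
  rw [e2, norm_pow, mul_pow]
  simp [abs_of_pos Real.pi_pos]

/-- The mean value over the centred cube, as a factor. -/
def cubeInv (r : ℝ) : ℂ := ((r ^ 3)⁻¹ : ℝ)

lemma norm_mean_planeWave_le {r : ℝ} (hr : 0 < r) (k : E3) :
    ‖cubeInv r * ∫ z in cube 0 r, planeWave k z‖ ≤ 1 := by
  rw [norm_mul, cubeInv, Complex.norm_real, Real.norm_eq_abs, abs_of_pos (by positivity)]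
  have h := norm_setIntegral_le_of_norm_le_const (μ := volume) (s := cube 0 r) (C := 1)
    (f := planeWave k) (volume_cube_ne_top 0 hr.le).lt_top fun x _ => (norm_planeWave k x).le
  rw [volume_real_cube 0 hr.le, one_mul] at h
  rw [inv_mul_le_iff₀ (by positivity), mul_one]
  exact h

lemma norm_planeWave_sub_mean_le {r : ℝ} (hr : 0 < r) (k : E3) {x : E3} (hx : x ∈ cube 0 r) :
    ‖planeWave k x - cubeInv r * ∫ z in cube 0 r, planeWave k z‖ ≤ 2 * Real.pi * ‖k‖ * (2 * r) := by
  have hv := volume_real_cube 0 hr.le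
  have hi : IntegrableOn (planeWave k) (cube 0 r) :=
    (contDiff_planeWave k).continuous.continuousOn.integrableOn_compact (isCompact_cube 0 r)
  have hic : IntegrableOn (fun _ : E3 => planeWave k x) (cube 0 r) :=
    integrableOn_const (volume_cube_ne_top 0 hr.le)
  have e : planeWave k x - cubeInv r * ∫ z in cube 0 r, planeWave k z
      = cubeInv r * ∫ z in cube 0 r, (planeWave k x - planeWave k z) := by
    rw [integral_sub hic hi, setIntegral_const, hv, mul_sub, cubeInv]
    congr 1
    rw [Complex.real_smul, ← mul_assoc, ← Complex.ofReal_mul, inv_mul_cancel₀ (by positivity)]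
    simp
  rw [e, norm_mul, cubeInv, Complex.norm_real, Real.norm_eq_abs, abs_of_pos (by positivity),
    inv_mul_le_iff₀ (by positivity)]
  have h := norm_setIntegral_le_of_norm_le_const (μ := volume) (s := cube 0 r)
    (C := 2 * Real.pi * ‖k‖ * (2 * r)) (f := fun z => planeWave k x - planeWave k z)
    (volume_cube_ne_top 0 hr.le).lt_top fun z hz => by
      refine (norm_planeWave_sub_le k x z).trans ?_
      gcongr
      refine norm_le_of_abs_le fun i => ?_
      have h1 := hx i
      have h2 := hz i
      simp only [PiLp.zero_apply, sub_zero, PiLp.sub_apply] at *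
      have := abs_sub (x i) (z i)
      linarith
  rw [hv] at h
  linarith

/-- The symbol without subtraction of the mean: comparison with the dispersion at half the
threshold. -/
theorem exists_symbol_bound_zero (M : ℕ) (hM : 1 ≤ M) : ∃ C : ℝ, 1 ≤ C ∧ ∀ r t : ℝ, 0 < r → 0 < t →
    C ≤ (t * r) ^ 2 → ∀ (S : Set E3) (k : E3), dispersionL t (waveWindow (chiWin M r) S 0 k)
      ≤ ENNReal.ofReal (r ^ 3 * (max (2 * Real.pi * ‖k‖ - t / 2) 0 ^ 2
          + C * (t * r)⁻¹ ^ (2 * (M - 1)) * r⁻¹ ^ 2)) := by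
  obtain ⟨C, hC1, hC⟩ := exists_bound_iteratedFDeriv_chiWin M
  refine ⟨16 * (9 * C ^ 2) + 16 * 4 ^ (2 * (M - 1)) * (3 ^ (M + 1) * C ^ 2), ?_,
    fun r t hr ht htr S k => ?_⟩
  · have : 0 ≤ 16 * 4 ^ (2 * (M - 1)) * (3 ^ (M + 1) * C ^ 2) := by positivity
    nlinarith
  set K := max (2 * Real.pi * ‖k‖ - t) 0 ^ 2 with hK
  set K2 := max (2 * Real.pi * ‖k‖ - t / 2) 0 ^ 2 with hK2
  have hpos : 0 ≤ 16 * 4 ^ (2 * (M - 1)) * (3 ^ (M + 1) * C ^ 2) := by positivity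
  -- Below `3t/4` the whole symbol is a Fourier tail of the window. Above it, halving the threshold
  -- gains at least `t²/16`, which absorbs the error `9C²r⁻²` because `tr` is large.
  rcases le_or_gt (2 * Real.pi * ‖k‖) (3 / 4 * t) with h | h
  · refine (dispersionL_wave_le_tail _ ht S h (M - 1)).trans ?_
    rw [Nat.sub_add_cancel hM]
    refine (mul_le_mul_right (momentL_chiWin_le M le_rfl hr (hC M le_rfl r hr)) _).trans ?_
    rw [← ENNReal.ofReal_mul (by positivity)]
    refine ENNReal.ofReal_le_ofReal ?_
    have e : r⁻¹ ^ M = r⁻¹ ^ (M - 1) * r⁻¹ := by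
      conv_lhs => rw [← Nat.sub_add_cancel hM, pow_succ]
    calc 16 * (4 / t) ^ (2 * (M - 1)) * (3 ^ (M + 1) * (C * r⁻¹ ^ M) ^ 2 * r ^ 3)
        = r ^ 3 * (16 * 4 ^ (2 * (M - 1)) * (3 ^ (M + 1) * C ^ 2) * (t * r)⁻¹ ^ (2 * (M - 1))
            * r⁻¹ ^ 2) := by
          rw [e, mul_inv, mul_pow (t⁻¹), div_eq_mul_inv, mul_pow 4 (t⁻¹)]
          ring
      _ ≤ _ := by
          gcongr
          refine le_add_of_nonneg_of_le (by positivity) ?_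
          gcongr
          linarith [show 0 ≤ 16 * (9 * C ^ 2) by positivity]
  · refine (dispersionL_wave_le (chiWin_neg M r)
      ((continuous_chiWin M r).integrable_of_hasCompactSupport (hasCompactSupport_chiWin M hr))
      ((continuous_chiWin M r).memLp_of_hasCompactSupport (hasCompactSupport_chiWin M hr))
      ht.le S k).trans ?_
    refine (add_le_add_right (momentL_chiWin_le M hM hr (hC 1 hM r hr)) _).trans ?_
    rw [lintegral_chiWin_sq M hr, ← ENNReal.ofReal_mul (by positivity),
      ← ENNReal.ofReal_add (by positivity) (by positivity)]
    refine ENNReal.ofReal_le_ofReal ?_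
    have h1 : K + t ^ 2 / 16 ≤ K2 := by
      rw [hK, hK2, max_eq_left (by linarith : 0 ≤ 2 * Real.pi * ‖k‖ - t / 2)]
      rcases le_or_gt (2 * Real.pi * ‖k‖) t with h' | h'
      · rw [max_eq_right (by linarith)]; nlinarith
      · rw [max_eq_left (by linarith)]; nlinarith
    have h2 : 9 * C ^ 2 * r⁻¹ ^ 2 ≤ t ^ 2 / 16 := by
      rw [inv_pow, ← div_eq_mul_inv, div_le_iff₀ (by positivity)]
      nlinarith
    calc K * r ^ 3 + 3 ^ (1 + 1) * (C * r⁻¹ ^ 1) ^ 2 * r ^ 3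
        = r ^ 3 * (K + 9 * C ^ 2 * r⁻¹ ^ 2) := by ring
      _ ≤ r ^ 3 * (K2 + 0) := mul_le_mul_of_nonneg_left (by linarith) (by positivity)
      _ ≤ _ := by
          gcongr
          positivity

/-- The symbol with subtraction of the mean. -/
theorem exists_symbol_bound_mean (M : ℕ) (hM : 2 ≤ M) : ∃ C : ℝ, 1 ≤ C ∧ ∀ r t : ℝ, 0 < r → 0 < t →
    ∀ k : E3,
      dispersionL t (waveWindow (chiWin M r) (cube 0 r) (cubeInv r) k)
        ≤ ENNReal.ofReal (r ^ 3 * (max (2 * Real.pi * ‖k‖ - t) 0 ^ 2 + C * r⁻¹ ^ 2)) ∧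
      dispersionL t (waveWindow (chiWin M r) (cube 0 r) (cubeInv r) k)
        ≤ ENNReal.ofReal (r ^ 3 * (C * t⁻¹ ^ 2 * ((2 * Real.pi * ‖k‖) ^ 4
            + (2 * Real.pi * ‖k‖) ^ 2 * r⁻¹ ^ 2))) := by
  obtain ⟨C, hC1, hC⟩ := exists_bound_iteratedFDeriv_chiWin M
  refine ⟨1 + 9 * C ^ 2 + 9 * C ^ 2 + 27 * C ^ 2 + 27 * 2 * (16 * C ^ 2), by nlinarith,
    fun r t hr ht k => ⟨?_, ?_⟩⟩
  · set κ := 2 * Real.pi * ‖k‖ with hκ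
    set w := chiWin M r with hw
    set c := cubeInv r * ∫ z in cube 0 r, planeWave k z with hc
    have hcn : ‖c‖ ≤ 1 := norm_mean_planeWave_le hr k
    have hwc : Continuous w := continuous_chiWin M r
    have hws : HasCompactSupport w := hasCompactSupport_chiWin M hr
    have hpc : Continuous (planeWave k) := (contDiff_planeWave k).continuous
    -- The modulated window minus a multiple of the window with `‖c‖ ≤ 1`. Splitting with `η = r⁻²`
    -- makes every error a multiple of `r⁻²`.
    have e : waveWindow w (cube 0 r) (cubeInv r) k = fun x => planeWave k x * w x - c * w x := by
      ext x; simp only [waveWindow, ← hc]; ring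
    have hmom : ∀ j, momentL j (fun x => c * w x) ≤ momentL j w := fun j => by
      refine lintegral_mono fun ξ => ?_
      have : 𝓕 (fun x => c * w x) ξ = c * 𝓕 w ξ := by
        rw [fourier_eq_planeWave, fourier_eq_planeWave, ← integral_const_mul]
        exact integral_congr_ae (Eventually.of_forall fun x => by ring)
      rw [this, enorm_mul]
      have h1 : ‖c‖ₑ ≤ 1 := by
        rw [← ofReal_norm]
        exact ENNReal.ofReal_le_one.2 hcn
      gcongr
      calc ‖c‖ₑ * ‖𝓕 w ξ‖ₑ ≤ 1 * ‖𝓕 w ξ‖ₑ := by gcongr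
        _ = _ := one_mul _
    have i1 : Integrable fun x => planeWave k x * w x :=
      (hpc.mul hwc).integrable_of_hasCompactSupport hws.mul_left
    have i2 : Integrable fun x => c * w x := (hwc.integrable_of_hasCompactSupport hws).const_mul c
    have n1 : ∫⁻ x, ‖planeWave k x * w x‖ₑ ^ 2 = ENNReal.ofReal (r ^ 3) := by
      rw [← lintegral_chiWin_sq M hr]
      refine lintegral_congr fun x => ?_
      rw [enorm_mul, ← ofReal_norm (planeWave k x), norm_planeWave]; simp [hw]
    rw [e]
    refine (dispersionL_sub_le i1 ((hpc.mul hwc).memLp_of_hasCompactSupport hws.mul_left) i2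
      (η := r⁻¹ ^ 2) (by positivity)).trans ?_
    rw [n1]
    have b0 := dispersionL_wave_le (chiWin_neg M r) (hwc.integrable_of_hasCompactSupport hws)
      (hwc.memLp_of_hasCompactSupport hws) ht.le (cube 0 r) k
    rw [waveWindow_zero, lintegral_chiWin_sq M hr] at b0
    have b1 := lintegral_remainder_le ht.le (η := r⁻¹ ^ 2) (by positivity) i2
    have m1 := momentL_chiWin_le M (by omega) hr (hC 1 (by omega) r hr)
    have m2 := momentL_chiWin_le M hM hr (hC 2 hM r hr)
    calc _ ≤ (ENNReal.ofReal (max (κ - t) 0 ^ 2) * ENNReal.ofReal (r ^ 3)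
            + ENNReal.ofReal (3 ^ (1 + 1) * (C * r⁻¹ ^ 1) ^ 2 * r ^ 3))
          + ENNReal.ofReal (r⁻¹ ^ 2) * ENNReal.ofReal (r ^ 3)
          + (ENNReal.ofReal (3 ^ (1 + 1) * (C * r⁻¹ ^ 1) ^ 2 * r ^ 3)
            + ENNReal.ofReal (r⁻¹ ^ 2)⁻¹ * ENNReal.ofReal (3 ^ (2 + 1) * (C * r⁻¹ ^ 2) ^ 2 * r ^ 3)) := by
          refine add_le_add (add_le_add ?_ le_rfl) (b1.trans (add_le_add ((hmom 1).trans m1)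
            (mul_le_mul_right ((hmom 2).trans m2) _)))
          exact b0.trans (add_le_add le_rfl m1)
      _ ≤ _ := by
          rw [← ENNReal.ofReal_mul (by positivity), ← ENNReal.ofReal_mul (by positivity),
            ← ENNReal.ofReal_mul (by positivity), ← ENNReal.ofReal_add (by positivity) (by positivity),
            ← ENNReal.ofReal_add (by positivity) (by positivity),
            ← ENNReal.ofReal_add (by positivity) (by positivity),
            ← ENNReal.ofReal_add (by positivity) (by positivity)]
          refine ENNReal.ofReal_le_ofReal ?_
          have e3 : (r⁻¹ ^ 2)⁻¹ * (3 ^ (2 + 1) * (C * r⁻¹ ^ 2) ^ 2 * r ^ 3)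
              = r ^ 3 * (27 * C ^ 2 * r⁻¹ ^ 2) := by
            field_simp
            norm_num
          rw [e3]
          have : 0 ≤ r ^ 3 * (27 * 2 * (16 * C ^ 2) * r⁻¹ ^ 2) := by positivity
          calc _ = r ^ 3 * (max (κ - t) 0 ^ 2
                  + (1 + 9 * C ^ 2 + 9 * C ^ 2 + 27 * C ^ 2) * r⁻¹ ^ 2) := by ring
            _ ≤ _ := by
                refine mul_le_mul_of_nonneg_left (add_le_add le_rfl
                  (mul_le_mul_of_nonneg_right ?_ (by positivity))) (by positivity)
                linarith [show 0 ≤ 27 * 2 * (16 * C ^ 2) by positivity]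
  · set κ := 2 * Real.pi * ‖k‖ with hκ
    have hκ0 : 0 ≤ κ := by positivity
    set w := chiWin M r with hw
    set c := cubeInv r * ∫ z in cube 0 r, planeWave k z with hc
    have hwd : ContDiff ℝ 2 w := (contDiff_chiWin M r).of_le (by exact_mod_cast hM)
    have hws : HasCompactSupport w := hasCompactSupport_chiWin M hr
    have hgd : ContDiff ℝ 2 fun x => planeWave k x - c :=
      (contDiff_infty.1 (contDiff_planeWave k) 2).sub contDiff_const
    have hsupp : tsupport (waveWindow w (cube 0 r) (cubeInv r) k) ⊆ cube 0 r :=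
      closure_minimal (fun x hx => by_contra fun h => hx (by
        simp [waveWindow, hw, chiWin_eq_zero hr h])) (isClosed_cube _ _)
    -- By the Leibniz rule every term carries a factor `κ`: the undifferentiated `planeWave k - c`
    -- is of order `κr`, because `c` is the mean value. Hence the symbol vanishes at `k = 0`.
    have hbd : ∀ x, ‖iteratedFDeriv ℝ 2 (waveWindow w (cube 0 r) (cubeInv r) k) x‖
        ≤ 4 * C * (κ * r⁻¹ + κ ^ 2) := fun x => by
      have e : waveWindow w (cube 0 r) (cubeInv r) k = fun x => w x * (planeWave k x - c) := rfl
      rw [e]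
      by_cases hx : x ∈ cube 0 r
      · refine (norm_iteratedFDeriv_mul_le hwd hgd x (n := 2) le_rfl).trans ?_
        have d : ∀ n : ℕ, n ≠ 0 → (n : ℕ∞ω) ≤ 2 →
            ‖iteratedFDeriv ℝ n (fun x => planeWave k x - c) x‖ ≤ κ ^ n := fun n hn hn2 => by
          have : iteratedFDeriv ℝ n (fun x => planeWave k x - c) x
              = iteratedFDeriv ℝ n (planeWave k) x := by
            rw [show (fun x => planeWave k x - c) = planeWave k - fun _ => c from rfl,
              iteratedFDeriv_sub_apply (contDiff_infty.1 (contDiff_planeWave k) n).contDiffAt contDiffAt_const,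
              iteratedFDeriv_const_of_ne hn]
            simp
          rw [this]
          exact norm_iteratedFDeriv_planeWave_le k x n
        have d0 : ‖iteratedFDeriv ℝ 0 (fun x => planeWave k x - c) x‖ ≤ κ * (2 * r) := by
          rw [norm_iteratedFDeriv_zero]
          exact norm_planeWave_sub_mean_le hr k hx
        have d1 := d 1 (by norm_num) (by norm_num)
        have d2 := d 2 (by norm_num) le_rfl
        have c0 := hC 0 (by omega) r hr x
        have c1 := hC 1 (by omega) r hr x
        have c2 := hC 2 hM r hr x
        simp only [Finset.sum_range_succ, Finset.range_zero, Finset.sum_empty, zero_add,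
          Nat.choose_zero_right, Nat.choose_self, Nat.cast_one, one_mul, Nat.choose_one_right,
          Nat.sub_zero, Nat.cast_ofNat]
        calc _ ≤ (C * r⁻¹ ^ 0) * κ ^ 2 + 2 * (C * r⁻¹ ^ 1) * κ ^ 1 + (C * r⁻¹ ^ 2) * (κ * (2 * r)) := by
              gcongr
          _ = C * κ ^ 2 + 4 * C * (κ * r⁻¹) := by
              field_simp
              ring
          _ ≤ _ := by nlinarith [mul_nonneg (by linarith : 0 ≤ C) (sq_nonneg κ)]
      · have : iteratedFDeriv ℝ 2 (waveWindow w (cube 0 r) (cubeInv r) k) x = 0 := by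
          by_contra h
          exact hx (hsupp (support_iteratedFDeriv_subset 2 h))
        rw [e] at this
        rw [this, norm_zero]
        positivity
    refine (dispersionL_le_momentL ht 1 _).trans ?_
    refine (mul_le_mul_right (momentL_le_of_bound (hwd.mul hgd) hws.mul_right hbd hsupp) _).trans ?_
    rw [volume_cube 0 hr.le, ← ENNReal.ofReal_mul (by positivity), ← ENNReal.ofReal_mul (by positivity)]
    refine ENNReal.ofReal_le_ofReal ?_
    have h1 : (κ * r⁻¹ + κ ^ 2) ^ 2 ≤ 2 * (κ ^ 4 + κ ^ 2 * r⁻¹ ^ 2) := by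
      nlinarith [sq_nonneg (κ * r⁻¹ - κ ^ 2)]
    calc t⁻¹ ^ (2 * 1) * (3 ^ (2 + 1) * (4 * C * (κ * r⁻¹ + κ ^ 2)) ^ 2 * r ^ 3)
        = r ^ 3 * (27 * (16 * C ^ 2) * t⁻¹ ^ 2 * (κ * r⁻¹ + κ ^ 2) ^ 2) := by ring
      _ ≤ r ^ 3 * (27 * (16 * C ^ 2) * t⁻¹ ^ 2 * (2 * (κ ^ 4 + κ ^ 2 * r⁻¹ ^ 2))) := by gcongr
      _ = r ^ 3 * (27 * 2 * (16 * C ^ 2) * t⁻¹ ^ 2 * (κ ^ 4 + κ ^ 2 * r⁻¹ ^ 2)) := by ring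
      _ ≤ _ := by
          gcongr
          linarith [show 0 ≤ 9 * C ^ 2 by positivity, show 0 ≤ 27 * C ^ 2 by positivity]

/-! ### The variance in terms of pairs -/

/-- Expansion of the square. The pair form of the variance contains no mean value, so it tensorizes
and passes to limits by Fatou's lemma. -/
theorem integral_pair_sq {α : Type*} [MeasurableSpace α] {μ : Measure α} [IsFiniteMeasure μ]
    {f : α → ℂ} (hf : MemLp f 2 μ) :
    ∫⁻ x, ∫⁻ y, ‖f x - f y‖ₑ ^ 2 ∂μ ∂μ
      = ENNReal.ofReal (2 * (μ.real Set.univ * (∫ x, ‖f x‖ ^ 2 ∂μ) - ‖∫ x, f x ∂μ‖ ^ 2)) := by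
  have hi : Integrable f μ := hf.integrable (by norm_num)
  have hi2 : Integrable (fun x => ‖f x‖ ^ 2) μ := hf.integrable_norm_pow (by norm_num)
  set A := ∫ x, ‖f x‖ ^ 2 ∂μ with hA
  set m := ∫ x, f x ∂μ with hm
  set V := μ.real Set.univ with hV
  have e : ∀ x y, ‖f x - f y‖ ^ 2 = ‖f x‖ ^ 2 + ‖f y‖ ^ 2 - 2 * (f x * conj (f y)).re := fun x y => by
    rw [Complex.sq_norm, Complex.sq_norm, Complex.sq_norm, Complex.normSq_sub]
  have hcr : ∀ z : ℂ, Integrable (fun y => (z * conj (f y)).re) μ := fun z => by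
    have h2 : Integrable (fun y => conj (f y)) μ :=
      (Complex.conjCLE.toContinuousLinearMap.integrable_comp hi)
    exact Complex.reCLM.integrable_comp (h2.const_mul z)
  have hin : ∀ x, Integrable (fun y => ‖f x - f y‖ ^ 2) μ := fun x => by
    simp only [e]
    exact ((integrable_const _).add hi2).sub ((hcr _).const_mul 2)
  have hine : ∀ x, ∫ y, ‖f x - f y‖ ^ 2 ∂μ = V * ‖f x‖ ^ 2 + A - 2 * (f x * conj m).re := fun x => by
    simp only [e]
    have hs : Integrable (fun y => ‖f x‖ ^ 2 + ‖f y‖ ^ 2) μ := (integrable_const _).add hi2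
    rw [integral_sub hs ((hcr _).const_mul 2),
      integral_add (integrable_const _) hi2, integral_const, integral_const_mul, smul_eq_mul]
    congr 2
    have h2 : Integrable (fun y => conj (f y)) μ :=
      (Complex.conjCLE.toContinuousLinearMap.integrable_comp hi)
    have h3 : ∫ y, (f x * conj (f y)).re ∂μ = (∫ y, f x * conj (f y) ∂μ).re :=
      Complex.reCLM.integral_comp_comm (h2.const_mul (f x))
    rw [h3, integral_const_mul, integral_conj]
  have hre : Integrable (fun x => (f x * conj m).re) μ :=
    Complex.reCLM.integrable_comp (hi.mul_const _)
  have hout : Integrable (fun x => V * ‖f x‖ ^ 2 + A - 2 * (f x * conj m).re) μ :=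
    ((hi2.const_mul V).add (integrable_const _)).sub (hre.const_mul 2)
  have h1 : ∀ x, ∫⁻ y, ‖f x - f y‖ₑ ^ 2 ∂μ
      = ENNReal.ofReal (V * ‖f x‖ ^ 2 + A - 2 * (f x * conj m).re) := fun x => by
    rw [← hine, ofReal_integral_eq_lintegral_ofReal (hin x) (Eventually.of_forall fun y => by positivity)]
    refine lintegral_congr fun y => ?_
    rw [← ofReal_norm, ENNReal.ofReal_pow (norm_nonneg _)]
  rw [lintegral_congr h1, ← ofReal_integral_eq_lintegral_ofReal hout]
  · have hs : Integrable (fun x => V * ‖f x‖ ^ 2 + A) μ := (hi2.const_mul V).add (integrable_const _)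
    rw [integral_sub hs (hre.const_mul 2),
      integral_add (hi2.const_mul V) (integrable_const _), integral_const, integral_const_mul,
      integral_const_mul, smul_eq_mul]
    have h3 : ∫ x, (f x * conj m).re ∂μ = (∫ x, f x * conj m ∂μ).re :=
      Complex.reCLM.integral_comp_comm (hi.mul_const _)
    rw [h3, integral_mul_const, Complex.mul_conj, Complex.ofReal_re, ← Complex.sq_norm]
    congr 1
    ring
  · refine Eventually.of_forall fun x => ?_
    simp only [Pi.zero_apply]
    rw [← hine]
    exact integral_nonneg fun y => by positivity

/-! ### The Poincaré inequality on an interval -/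

/-- The Poincaré–Wirtinger inequality with the optimal constant. -/
theorem wirtinger {f f' : ℝ → ℂ} {h : ℝ} (hh : 0 < h) (hf : ∀ x, HasDerivAt f (f' x) x)
    (hf' : Continuous f') :
    h * (∫ x in (0)..h, ‖f x‖ ^ 2) - ‖∫ x in (0)..h, f x‖ ^ 2
      ≤ h * ((h / Real.pi) ^ 2 * ∫ x in (0)..h, ‖f' x‖ ^ 2) := by
  have hfc : Continuous f := continuous_iff_continuousAt.2 fun x => (hf x).continuousAt
  -- Even reflection to `[-h, h]`: as `F h = F (-h)`, the boundary terms in the Fourier coefficients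
  -- cancel without any boundary condition on `f`, and the period `2h` gives the factor `h/(π|n|)`.
  set F : ℝ → ℂ := fun x => f |x| with hF
  set F' : ℝ → ℂ := fun x => if 0 ≤ x then f' x else -f' (-x) with hF'
  have hFc : Continuous F := hfc.comp continuous_abs
  have hab : -h < h := by linarith
  have hm : StronglyMeasurable F' :=
    StronglyMeasurable.ite measurableSet_Ici hf'.stronglyMeasurable
      (hf'.comp continuous_neg).neg.stronglyMeasurable
  have hnorm : ∀ x, ‖F' x‖ = ‖f' |x|‖ := fun x => by
    simp only [hF']
    split_ifs with hx
    · rw [abs_of_nonneg hx]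
    · rw [norm_neg, abs_of_neg (not_le.1 hx)]
  have hL2 : ∀ g : ℝ → ℂ, StronglyMeasurable g → ∀ g₀ : ℝ → ℂ, Continuous g₀ →
      (∀ x, ‖g x‖ = ‖g₀ |x|‖) → MemLp g 2 (volume.restrict (Set.Ioc (-h) h)) := by
    intro g hg g₀ hg₀ hgg
    obtain ⟨C, hC⟩ := (isCompact_Icc (a := -h) (b := h)).exists_bound_of_continuousOn
      (hg₀.comp continuous_abs).continuousOn
    refine MemLp.of_bound hg.aestronglyMeasurable C ?_
    refine ae_restrict_of_forall_mem measurableSet_Ioc fun x hx => ?_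
    rw [hgg]
    exact hC x (Set.Ioc_subset_Icc_self hx)
  have hLF := hL2 F hFc.stronglyMeasurable f hfc fun _ => rfl
  have hLF' := hL2 F' hm f' hf' hnorm
  have s1 := hasSum_sq_fourierCoeffOn hab hLF
  have s2 := hasSum_sq_fourierCoeffOn hab hLF'
  -- At the kink in `0` the reflected function has in general only one-sided derivatives; the right
  -- derivative is enough for the formula for the coefficients.
  have hderiv : ∀ x ∈ Set.Ioo (min (-h) h) (max (-h) h), HasDerivWithinAt F (F' x) (Set.Ioi x) x := by
    intro x _
    rcases le_or_gt 0 x with hx | hx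
    · have h1 : HasDerivWithinAt f (f' x) (Set.Ioi x) x := (hf x).hasDerivWithinAt
      simp only [hF', if_pos hx]
      refine h1.congr (fun y hy => ?_) ?_
      · simp only [hF]; rw [abs_of_nonneg (hx.trans (le_of_lt hy))]
      · simp only [hF]; rw [abs_of_nonneg hx]
    · simp only [hF', if_neg (not_le.2 hx)]
      refine HasDerivAt.hasDerivWithinAt ?_
      have h1 : HasDerivAt (fun y => f (-y)) (-f' (-x)) x := by
        have h2 := (hf (-x)).scomp x (hasDerivAt_neg x)
        rw [neg_smul, one_smul] at h2
        exact h2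
      refine h1.congr_of_eventuallyEq ?_
      filter_upwards [gt_mem_nhds hx] with y hy
      simp only [hF]; rw [abs_of_neg hy]
  have hint : IntervalIntegrable F' volume (-h) h := by
    rw [intervalIntegrable_iff_integrableOn_Ioc_of_le hab.le]
    exact hLF'.integrable (by norm_num)
  have hcoef : ∀ n : ℤ, n ≠ 0 →
      ‖fourierCoeffOn hab F n‖ ^ 2 ≤ (h / Real.pi) ^ 2 * ‖fourierCoeffOn hab F' n‖ ^ 2 := by
    intro n hn
    rw [fourierCoeffOn_of_hasDeriv_right hab hn hFc.continuousOn hderiv hint]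
    have e : F h - F (-h) = 0 := by simp [hF]
    rw [e, mul_zero, zero_sub, norm_mul, norm_neg, norm_mul, mul_pow, mul_pow, ← mul_assoc]
    gcongr
    have e2 : ‖((h : ℂ) - ((-h : ℝ) : ℂ))‖ = 2 * h := by
      rw [← Complex.ofReal_sub, Complex.norm_real, Real.norm_eq_abs, abs_of_pos (by linarith)]; ring
    rw [e2, norm_div, norm_mul, norm_mul]
    simp only [norm_one, norm_neg, norm_mul, Complex.norm_I, Complex.norm_real, Real.norm_eq_abs,
      abs_of_pos Real.pi_pos, Complex.norm_ofNat, mul_one, Complex.norm_intCast]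
    rw [← mul_pow]
    refine pow_le_pow_left₀ (by positivity) ?_ 2
    have h1 : (1 : ℝ) ≤ |(n : ℝ)| := by
      rw [← Int.cast_abs]; exact_mod_cast Int.one_le_abs hn
    rw [one_div_mul_eq_div, div_le_div_iff₀ (by positivity) Real.pi_pos]
    nlinarith [mul_le_mul_of_nonneg_left h1 (by positivity : 0 ≤ 2 * h * Real.pi)]
  have heven : ∀ g : ℝ → ℝ, Continuous g → ∫ x in (-h)..h, g |x| = 2 * ∫ x in (0)..h, g x := by
    intro g hg
    have hgc : Continuous fun x => g |x| := hg.comp continuous_abs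
    rw [← intervalIntegral.integral_add_adjacent_intervals
      (hgc.intervalIntegrable (-h) 0) (hgc.intervalIntegrable 0 h)]
    have h1 : ∫ x in (-h)..0, g |x| = ∫ x in (0)..h, g x := by
      have := intervalIntegral.integral_comp_neg (a := (0 : ℝ)) (b := h) (fun x => g |x|)
      simp only [abs_neg, neg_zero] at this
      rw [← this]
      refine intervalIntegral.integral_congr fun x hx => ?_
      rw [Set.uIcc_of_le hh.le] at hx
      simp only [abs_of_nonneg hx.1]
    have h2 : ∫ x in (0)..h, g |x| = ∫ x in (0)..h, g x := by
      refine intervalIntegral.integral_congr fun x hx => ?_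
      rw [Set.uIcc_of_le hh.le] at hx
      simp only [abs_of_nonneg hx.1]
    rw [h1, h2]; ring
  have hevenC : ∫ x in (-h)..h, F x = 2 * ∫ x in (0)..h, f x := by
    rw [← intervalIntegral.integral_add_adjacent_intervals
      (hFc.intervalIntegrable (-h) 0) (hFc.intervalIntegrable 0 h)]
    have h1 : ∫ x in (-h)..0, F x = ∫ x in (0)..h, f x := by
      have := intervalIntegral.integral_comp_neg (a := (0 : ℝ)) (b := h) F
      simp only [neg_zero] at this
      rw [← this]
      refine intervalIntegral.integral_congr fun x hx => ?_
      rw [Set.uIcc_of_le hh.le] at hx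
      simp only [hF, abs_neg, abs_of_nonneg hx.1]
    have h2 : ∫ x in (0)..h, F x = ∫ x in (0)..h, f x := by
      refine intervalIntegral.integral_congr fun x hx => ?_
      rw [Set.uIcc_of_le hh.le] at hx
      simp only [hF, abs_of_nonneg hx.1]
    rw [h1, h2]; ring
  have i1 : ∫ x in (-h)..h, ‖F x‖ ^ 2 = 2 * ∫ x in (0)..h, ‖f x‖ ^ 2 :=
    heven (fun x => ‖f x‖ ^ 2) (by fun_prop)
  have i2 : ∫ x in (-h)..h, ‖F' x‖ ^ 2 = 2 * ∫ x in (0)..h, ‖f' x‖ ^ 2 := by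
    rw [← heven (fun x => ‖f' x‖ ^ 2) (by fun_prop)]
    simp only [hnorm]
  have hc0 : fourierCoeffOn hab F 0 = (h⁻¹ : ℝ) • ∫ x in (0)..h, f x := by
    rw [fourierCoeffOn_eq_integral]
    simp only [neg_zero, fourier_zero, one_smul]
    rw [hevenC, Complex.real_smul, Complex.real_smul, ← mul_assoc]
    congr 1
    push_cast
    field_simp
    ring
  rw [i1] at s1
  rw [i2] at s2
  have key : (h - -h)⁻¹ • (2 * ∫ x in (0)..h, ‖f x‖ ^ 2) - ‖fourierCoeffOn hab F 0‖ ^ 2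
      ≤ (h / Real.pi) ^ 2 * ((h - -h)⁻¹ • (2 * ∫ x in (0)..h, ‖f' x‖ ^ 2)) := by
    -- Parseval for `F` and `F'`. Subtracting the mean removes the coefficient `n = 0`, the only one
    -- not controlled by the derivative.
    have s3 := s1.sub (hasSum_ite_eq (0 : ℤ) (‖fourierCoeffOn hab F 0‖ ^ 2))
    refine hasSum_le (fun n => ?_) s3 (s2.mul_left _)
    by_cases hn : n = 0
    · subst hn; simp only [if_true, sub_self]; positivity
    · simp only [if_neg hn, sub_zero]; exact hcoef n hn
  rw [hc0, norm_smul, Real.norm_eq_abs, abs_of_pos (inv_pos.2 hh), smul_eq_mul, smul_eq_mul] at key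
  have e1 : (h - -h)⁻¹ = (2 * h)⁻¹ := by congr 1; ring
  rw [e1] at key
  have := mul_le_mul_of_nonneg_left key (by positivity : 0 ≤ h ^ 2)
  have l1 : h ^ 2 * ((2 * h)⁻¹ * (2 * ∫ x in (0)..h, ‖f x‖ ^ 2) - (h⁻¹ * ‖∫ x in (0)..h, f x‖) ^ 2)
      = h * (∫ x in (0)..h, ‖f x‖ ^ 2) - ‖∫ x in (0)..h, f x‖ ^ 2 := by
    field_simp
  have l2 : h ^ 2 * ((h / Real.pi) ^ 2 * ((2 * h)⁻¹ * (2 * ∫ x in (0)..h, ‖f' x‖ ^ 2)))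
      = h * ((h / Real.pi) ^ 2 * ∫ x in (0)..h, ‖f' x‖ ^ 2) := by
    field_simp
  rwa [l1, l2] at this

/-! ### The Poincaré inequality on a cuboid -/

/-- The double integral `∬ |f(x) - f(y)|²`. -/
def pairVar {α : Type*} [MeasurableSpace α] (μ : Measure α) (f : α → ℂ) : ENNReal :=
  ∫⁻ x, ∫⁻ y, ‖f x - f y‖ₑ ^ 2 ∂μ ∂μ

lemma enorm_sq_eq_ofReal (z : ℂ) : ‖z‖ₑ ^ 2 = ENNReal.ofReal (‖z‖ ^ 2) := by
  rw [← ofReal_norm, ENNReal.ofReal_pow (norm_nonneg _)]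

lemma pairVar_interval {f f' : ℝ → ℂ} (hf : ∀ x, HasDerivAt f (f' x) x) (hf' : Continuous f')
    {a b r : ℝ} (hab : b - a ≤ r) :
    pairVar (volume.restrict (Set.Icc a b)) f
      ≤ ENNReal.ofReal (2 * (r / Real.pi) ^ 2) * (volume (Set.Icc a b) *
        ∫⁻ x in Set.Icc a b, ‖f' x‖ₑ ^ 2) := by
  have hfc : Continuous f := continuous_iff_continuousAt.2 fun x => (hf x).continuousAt
  rcases le_or_gt b a with h | h
  · have : volume.restrict (Set.Icc a b) = 0 := by
      rw [Measure.restrict_eq_zero, Real.volume_Icc]; simpa using h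
    simp [pairVar, this]
  have hh : 0 < b - a := sub_pos.2 h
  have hw := wirtinger (f := fun x => f (x + a)) (f' := fun x => f' (x + a)) hh
    (fun x => (hf (x + a)).comp_add_const x a) (hf'.comp (by fun_prop))
  rw [intervalIntegral.integral_comp_add_right (fun x => ‖f x‖ ^ 2),
    intervalIntegral.integral_comp_add_right f,
    intervalIntegral.integral_comp_add_right (fun x => ‖f' x‖ ^ 2)] at hw
  simp only [zero_add, sub_add_cancel, intervalIntegral.integral_of_le h.le,
    ← integral_Icc_eq_integral_Ioc] at hw
  have hL : MemLp f 2 (volume.restrict (Set.Icc a b)) := by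
    obtain ⟨C, hC⟩ := (isCompact_Icc (a := a) (b := b)).exists_bound_of_continuousOn hfc.continuousOn
    exact MemLp.of_bound hfc.aestronglyMeasurable C (ae_restrict_of_forall_mem measurableSet_Icc hC)
  have hi : IntegrableOn (fun x => ‖f' x‖ ^ 2) (Set.Icc a b) :=
    (by fun_prop : Continuous fun x => ‖f' x‖ ^ 2).continuousOn.integrableOn_Icc
  have e2 : ∫⁻ x in Set.Icc a b, ‖f' x‖ₑ ^ 2 = ENNReal.ofReal (∫ x in Set.Icc a b, ‖f' x‖ ^ 2) := by
    rw [ofReal_integral_eq_lintegral_ofReal hi (Eventually.of_forall fun x => by positivity)]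
    exact lintegral_congr fun x => enorm_sq_eq_ofReal _
  have hI0 : 0 ≤ ∫ x in Set.Icc a b, ‖f' x‖ ^ 2 := integral_nonneg fun x => by positivity
  rw [pairVar, integral_pair_sq hL, e2, Real.volume_Icc, ← ENNReal.ofReal_mul hh.le,
    ← ENNReal.ofReal_mul (by positivity)]
  refine ENNReal.ofReal_le_ofReal ?_
  have e3 : (volume.restrict (Set.Icc a b)).real Set.univ = b - a := by
    simp [Measure.real, hh.le]
  rw [e3]
  calc _ ≤ 2 * ((b - a) * (((b - a) / Real.pi) ^ 2 * ∫ x in Set.Icc a b, ‖f' x‖ ^ 2)) := by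
        linarith
    _ ≤ 2 * ((b - a) * ((r / Real.pi) ^ 2 * ∫ x in Set.Icc a b, ‖f' x‖ ^ 2)) := by gcongr
    _ = _ := by ring

/-- The sides exceed the diagonals by `|A - B + C - D|²`. -/
lemma enorm_quadrilateral (A B C D : ℂ) : ‖A - C‖ₑ ^ 2 + ‖B - D‖ₑ ^ 2
    ≤ ‖A - B‖ₑ ^ 2 + ‖B - C‖ₑ ^ 2 + ‖C - D‖ₑ ^ 2 + ‖D - A‖ₑ ^ 2 := by
  simp only [enorm_sq_eq_ofReal]
  rw [← ENNReal.ofReal_add (by positivity) (by positivity),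
    ← ENNReal.ofReal_add (by positivity) (by positivity),
    ← ENNReal.ofReal_add (by positivity) (by positivity),
    ← ENNReal.ofReal_add (by positivity) (by positivity)]
  refine ENNReal.ofReal_le_ofReal ?_
  simp only [Complex.sq_norm, Complex.normSq_apply, Complex.sub_re, Complex.sub_im]
  nlinarith [sq_nonneg (A.re - B.re + C.re - D.re), sq_nonneg (A.im - B.im + C.im - D.im)]

/-- The quadrilateral inequality at the corners `(x,y)`, `(x',y)`, `(x',y')`, `(x,y')`. Both
diagonals have the same integral, and opposite sides too, so no factor is lost and the
one-dimensional Poincaré constant survives in the product. -/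
theorem pairVar_prod_le {α β : Type*} [MeasurableSpace α] [MeasurableSpace β] (μ : Measure α)
    (ν : Measure β) [SFinite μ] [SFinite ν] {g : α × β → ℂ} (hg : Measurable g) :
    pairVar (μ.prod ν) g ≤ ν Set.univ * ∫⁻ y, pairVar μ (fun x => g (x, y)) ∂ν
      + μ Set.univ * ∫⁻ x, pairVar ν (fun y => g (x, y)) ∂μ := by
  set Φ : α → α → ENNReal := fun x x' => ∫⁻ y, ∫⁻ y', ‖g (x, y) - g (x', y')‖ₑ ^ 2 ∂ν ∂ν with hΦ
  have m4 : Measurable fun p : ((α × α) × β) × β => ‖g (p.1.1.1, p.1.2) - g (p.1.1.2, p.2)‖ₑ ^ 2 := by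
    fun_prop
  have m3 : Measurable fun p : (α × α) × β => ∫⁻ y', ‖g (p.1.1, p.2) - g (p.1.2, y')‖ₑ ^ 2 ∂ν :=
    m4.lintegral_prod_right'
  have m2 : Measurable fun p : α × α => Φ p.1 p.2 := m3.lintegral_prod_right'
  have h1 : pairVar (μ.prod ν) g = ∫⁻ x, ∫⁻ x', Φ x x' ∂μ ∂μ := by
    have mg : Measurable fun p : (α × β) × (α × β) => ‖g p.1 - g p.2‖ₑ ^ 2 := by fun_prop
    rw [pairVar, lintegral_prod _ mg.lintegral_prod_right'.aemeasurable]
    refine lintegral_congr fun x => ?_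
    have : ∀ y, ∫⁻ q, ‖g (x, y) - g q‖ₑ ^ 2 ∂μ.prod ν
        = ∫⁻ x', ∫⁻ y', ‖g (x, y) - g (x', y')‖ₑ ^ 2 ∂ν ∂μ := fun y =>
      lintegral_prod _ (by fun_prop : Measurable fun q => ‖g (x, y) - g q‖ₑ ^ 2).aemeasurable
    simp_rw [this]
    rw [lintegral_lintegral_swap]
    have a : Measurable fun p : β × α => ∫⁻ y', ‖g (x, p.1) - g (p.2, y')‖ₑ ^ 2 ∂ν :=
      m3.comp (g := fun p : (α × α) × β => ∫⁻ y', ‖g (p.1.1, p.2) - g (p.1.2, y')‖ₑ ^ 2 ∂ν)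
        (f := fun p : β × α => ((x, p.2), p.1)) (by fun_prop)
    exact a.aemeasurable
  have h2 : pairVar (μ.prod ν) g = ∫⁻ x, ∫⁻ x', Φ x' x ∂μ ∂μ := by
    rw [h1, lintegral_lintegral_swap m2.aemeasurable]
  have h3 : ∀ x x', Φ x x' + Φ x' x ≤ 2 * (ν Set.univ * ∫⁻ y, ‖g (x, y) - g (x', y)‖ₑ ^ 2 ∂ν)
      + (pairVar ν (fun y => g (x', y)) + pairVar ν (fun y => g (x, y))) := fun x x' => by
    have m5 : ∀ z, Measurable fun p : β × β => ‖g (z, p.1) - g (z, p.2)‖ₑ ^ 2 := fun z => by fun_prop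
    have m6 : Measurable fun y => ‖g (x, y) - g (x', y)‖ₑ ^ 2 := by fun_prop
    calc Φ x x' + Φ x' x
        = ∫⁻ y, ∫⁻ y', (‖g (x, y) - g (x', y')‖ₑ ^ 2 + ‖g (x', y) - g (x, y')‖ₑ ^ 2) ∂ν ∂ν := by
          have : ∀ y, ∫⁻ y', (‖g (x, y) - g (x', y')‖ₑ ^ 2 + ‖g (x', y) - g (x, y')‖ₑ ^ 2) ∂ν
              = (∫⁻ y', ‖g (x, y) - g (x', y')‖ₑ ^ 2 ∂ν)
                + ∫⁻ y', ‖g (x', y) - g (x, y')‖ₑ ^ 2 ∂ν := fun y =>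
            lintegral_add_left (by fun_prop) _
          simp_rw [this]
          rw [lintegral_add_left]
          exact m3.comp (g := fun p : (α × α) × β => ∫⁻ y', ‖g (p.1.1, p.2) - g (p.1.2, y')‖ₑ ^ 2 ∂ν)
            (f := fun y : β => ((x, x'), y)) (by fun_prop)
      _ ≤ ∫⁻ y, ∫⁻ y', ((‖g (x, y) - g (x', y)‖ₑ ^ 2 + ‖g (x, y') - g (x', y')‖ₑ ^ 2)
            + (‖g (x', y) - g (x', y')‖ₑ ^ 2 + ‖g (x, y) - g (x, y')‖ₑ ^ 2)) ∂ν ∂ν := by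
          refine lintegral_mono fun y => lintegral_mono fun y' => ?_
          refine (enorm_quadrilateral (g (x, y)) (g (x', y)) (g (x', y')) (g (x, y'))).trans_eq ?_
          rw [enorm_sub_rev (g (x', y')) (g (x, y')), enorm_sub_rev (g (x, y')) (g (x, y))]
          ring
      _ = ∫⁻ y, ((ν Set.univ * ‖g (x, y) - g (x', y)‖ₑ ^ 2
              + ∫⁻ y', ‖g (x, y') - g (x', y')‖ₑ ^ 2 ∂ν)
            + ((∫⁻ y', ‖g (x', y) - g (x', y')‖ₑ ^ 2 ∂ν)
              + ∫⁻ y', ‖g (x, y) - g (x, y')‖ₑ ^ 2 ∂ν)) ∂ν := by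
          refine lintegral_congr fun y => ?_
          rw [lintegral_add_left (by fun_prop), lintegral_add_left (by fun_prop),
            lintegral_add_left (by fun_prop), lintegral_const, mul_comm]
      _ = _ := by
          rw [lintegral_add_left ((m6.const_mul _).add_const _),
            lintegral_add_left (m6.const_mul _), lintegral_const_mul _ m6,
            lintegral_add_left (m5 x').lintegral_prod_right', lintegral_const]
          rw [two_mul, mul_comm (∫⁻ y', ‖g (x, y') - g (x', y')‖ₑ ^ 2 ∂ν)]
          rfl
  have m7 : Measurable fun x => pairVar ν (fun y => g (x, y)) := by
    have a : Measurable fun p : (α × β) × β => ‖g (p.1.1, p.1.2) - g (p.1.1, p.2)‖ₑ ^ 2 := by fun_prop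
    exact (Measurable.lintegral_prod_right' a.lintegral_prod_right')
  have m8 : Measurable fun p : (α × α) × β => ‖g (p.1.1, p.2) - g (p.1.2, p.2)‖ₑ ^ 2 := by fun_prop
  have m9 : Measurable fun p : α × α => ∫⁻ y, ‖g (p.1, y) - g (p.2, y)‖ₑ ^ 2 ∂ν :=
    m8.lintegral_prod_right'
  have h4 : ∫⁻ x, ∫⁻ x', ∫⁻ y, ‖g (x, y) - g (x', y)‖ₑ ^ 2 ∂ν ∂μ ∂μ
      = ∫⁻ y, pairVar μ (fun x => g (x, y)) ∂ν := by
    simp only [pairVar]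
    have : ∀ x, ∫⁻ x', ∫⁻ y, ‖g (x, y) - g (x', y)‖ₑ ^ 2 ∂ν ∂μ
        = ∫⁻ y, ∫⁻ x', ‖g (x, y) - g (x', y)‖ₑ ^ 2 ∂μ ∂ν := fun x =>
      lintegral_lintegral_swap (m8.comp
        (by fun_prop : Measurable fun p : α × β => ((x, p.1), p.2))).aemeasurable
    simp_rw [this]
    refine lintegral_lintegral_swap ?_
    have a : Measurable fun p : (α × β) × α => ‖g (p.1.1, p.1.2) - g (p.2, p.1.2)‖ₑ ^ 2 := by fun_prop
    exact a.lintegral_prod_right'.aemeasurable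
  have h5 : 2 * pairVar (μ.prod ν) g ≤ 2 * (ν Set.univ * ∫⁻ y, pairVar μ (fun x => g (x, y)) ∂ν
      + μ Set.univ * ∫⁻ x, pairVar ν (fun y => g (x, y)) ∂μ) := by
    calc 2 * pairVar (μ.prod ν) g = ∫⁻ x, ∫⁻ x', (Φ x x' + Φ x' x) ∂μ ∂μ := by
          have : ∀ x, ∫⁻ x', (Φ x x' + Φ x' x) ∂μ = (∫⁻ x', Φ x x' ∂μ) + ∫⁻ x', Φ x' x ∂μ := fun x =>
            lintegral_add_left (m2.comp (by fun_prop : Measurable fun x' : α => (x, x'))) _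
          simp_rw [this]
          rw [lintegral_add_left m2.lintegral_prod_right', ← h1, ← h2, two_mul]
      _ ≤ ∫⁻ x, ∫⁻ x', (2 * (ν Set.univ * ∫⁻ y, ‖g (x, y) - g (x', y)‖ₑ ^ 2 ∂ν)
          + (pairVar ν (fun y => g (x', y)) + pairVar ν (fun y => g (x, y)))) ∂μ ∂μ :=
          lintegral_mono fun x => lintegral_mono fun x' => h3 x x'
      _ = ∫⁻ x, (2 * (ν Set.univ * ∫⁻ x', ∫⁻ y, ‖g (x, y) - g (x', y)‖ₑ ^ 2 ∂ν ∂μ)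
          + ((∫⁻ x', pairVar ν (fun y => g (x', y)) ∂μ)
            + μ Set.univ * pairVar ν (fun y => g (x, y)))) ∂μ := by
          refine lintegral_congr fun x => ?_
          have a := m9.comp (by fun_prop : Measurable fun x' : α => (x, x'))
          rw [lintegral_add_left (by exact (a.const_mul _).const_mul _), lintegral_add_left m7,
            lintegral_const, lintegral_const_mul _ (by exact a.const_mul _),
            lintegral_const_mul _ (by exact a), mul_comm (pairVar _ _)]
      _ = _ := by
          have a : Measurable fun x => ∫⁻ x', ∫⁻ y, ‖g (x, y) - g (x', y)‖ₑ ^ 2 ∂ν ∂μ :=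
            m9.lintegral_prod_right'
          rw [lintegral_add_left ((a.const_mul _).const_mul _), lintegral_add_left measurable_const,
            lintegral_const_mul _ (a.const_mul _), lintegral_const_mul _ a, h4, lintegral_const,
            lintegral_const_mul _ m7, mul_comm (lintegral _ _) (μ Set.univ), ← two_mul, ← mul_add]
  exact (ENNReal.mul_le_mul_iff_right (by norm_num) (by norm_num)).1 h5

/-- The coordinates of `E3` as a measurable equivalence. -/
def coordEquiv : E3 ≃ᵐ ℝ × ℝ × ℝ :=
  ((MeasurableEquiv.toLp 2 (Fin 3 → ℝ)).symm.trans
    (MeasurableEquiv.piFinSuccAbove (fun _ : Fin 3 => ℝ) 0)).trans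
    ((MeasurableEquiv.refl ℝ).prodCongr MeasurableEquiv.finTwoArrow)

lemma coordEquiv_apply (x : E3) : coordEquiv x = (x 0, x 1, x 2) := rfl

lemma measurePreserving_coordEquiv : MeasurePreserving coordEquiv := by
  have h1 := EuclideanSpace.volume_preserving_symm_measurableEquiv_toLp (Fin 3)
  have h2 := volume_preserving_piFinSuccAbove (fun _ : Fin 3 => ℝ) 0
  have h3 := (MeasurePreserving.id (volume : Measure ℝ)).prod (volume_preserving_finTwoArrow ℝ)
  exact h3.comp (h2.comp h1)

/-- The closed cuboid with corners `a` and `b`. -/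
def cuboid (a b : Fin 3 → ℝ) : Set E3 := {x | ∀ k, x k ∈ Set.Icc (a k) (b k)}

lemma cuboid_eq_preimage (a b : Fin 3 → ℝ) : cuboid a b = coordEquiv ⁻¹'
    (Set.Icc (a 0) (b 0) ×ˢ (Set.Icc (a 1) (b 1) ×ˢ Set.Icc (a 2) (b 2))) := by
  ext x
  simp only [cuboid, Set.mem_ofPred_eq, Fin.forall_fin_succ, Set.mem_preimage, coordEquiv_apply,
    Set.mem_prod]
  simp

lemma measurePreserving_cuboid (a b : Fin 3 → ℝ) :
    MeasurePreserving coordEquiv (volume.restrict (cuboid a b))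
      ((volume.restrict (Set.Icc (a 0) (b 0))).prod ((volume.restrict (Set.Icc (a 1) (b 1))).prod
        (volume.restrict (Set.Icc (a 2) (b 2))))) := by
  rw [cuboid_eq_preimage, Measure.prod_restrict, Measure.prod_restrict]
  exact measurePreserving_coordEquiv.restrict_preimage_emb coordEquiv.measurableEmbedding _

lemma coordEquiv_symm_add (k : Fin 3) (x y z t : ℝ) :
    coordEquiv.symm (x + if k = 0 then t else 0, y + if k = 1 then t else 0,
      z + if k = 2 then t else 0)
      = coordEquiv.symm (x, y, z) + t • EuclideanSpace.single k (1 : ℝ) := by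
  rw [MeasurableEquiv.symm_apply_eq]
  have h : ∀ i : Fin 3, (coordEquiv.symm (x, y, z) + t • EuclideanSpace.single k (1 : ℝ)) i
      = coordEquiv.symm (x, y, z) i + if k = i then t else 0 := fun i => by
    by_cases hki : k = i
    · subst hki; simp
    · simp [hki, Ne.symm hki]
  have e := coordEquiv.apply_symm_apply (x, y, z)
  rw [coordEquiv_apply] at e ⊢
  simp only [Prod.mk.injEq] at e ⊢
  obtain ⟨e0, e1, e2⟩ := e
  refine ⟨?_, ?_, ?_⟩
  · rw [h, e0]
  · rw [h, e1]
  · rw [h, e2]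

/-- Tensorization is used twice, for the first coordinate against the other two and then for these
two. Each direction contributes its own partial derivative, with the same constant. -/
theorem pairVar_cuboid_smooth {g : E3 → ℂ} (hg : ContDiff ℝ 1 g) {a b : Fin 3 → ℝ} {r : ℝ}
    (hr : ∀ k, b k - a k ≤ r) :
    pairVar (volume.restrict (cuboid a b)) g
      ≤ ENNReal.ofReal (2 * (r / Real.pi) ^ 2) * (volume (cuboid a b) *
        ∫⁻ x in cuboid a b, ∑ k, ‖fderiv ℝ g x (EuclideanSpace.single k 1)‖ₑ ^ 2) := by
  set c := ENNReal.ofReal (2 * (r / Real.pi) ^ 2) with hc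
  set I : Fin 3 → Measure ℝ := fun k => volume.restrict (Set.Icc (a k) (b k)) with hI
  have hmp : MeasurePreserving coordEquiv (volume.restrict (cuboid a b))
      ((I 0).prod ((I 1).prod (I 2))) := measurePreserving_cuboid a b
  have hemb := coordEquiv.measurableEmbedding
  have hlin : ∀ F : ℝ × ℝ × ℝ → ENNReal, ∫⁻ x in cuboid a b, F (coordEquiv x)
      = ∫⁻ p, F p ∂((I 0).prod ((I 1).prod (I 2))) := fun F => hmp.lintegral_comp_emb hemb F
  set G : ℝ × ℝ × ℝ → ℂ := fun p => g (coordEquiv.symm p) with hG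
  have hGm : Measurable G := hg.continuous.measurable.comp coordEquiv.symm.measurable
  set D : Fin 3 → ℝ × ℝ × ℝ → ℂ := fun k p =>
    fderiv ℝ g (coordEquiv.symm p) (EuclideanSpace.single k 1) with hD
  have hDc : ∀ k, Continuous fun x => fderiv ℝ g x (EuclideanSpace.single k 1) := fun k =>
    (hg.continuous_fderiv (by norm_num)).clm_apply continuous_const
  have hDm : ∀ k, Measurable (D k) := fun k =>
    (hDc k).measurable.comp coordEquiv.symm.measurable
  have hline : ∀ (k : Fin 3) (x y z : ℝ) (t : ℝ), HasDerivAt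
      (fun t => g (coordEquiv.symm (x, y, z) + t • EuclideanSpace.single k (1 : ℝ)))
      (fderiv ℝ g (coordEquiv.symm (x, y, z) + t • EuclideanSpace.single k (1 : ℝ))
        (EuclideanSpace.single k 1)) t := fun k x y z t => by
    have h1 : HasDerivAt (fun t : ℝ => coordEquiv.symm (x, y, z) + t • EuclideanSpace.single k (1 : ℝ))
        (EuclideanSpace.single k (1 : ℝ)) t := by
      simpa using ((hasDerivAt_id t).smul_const (EuclideanSpace.single k (1 : ℝ))).const_add
        (coordEquiv.symm (x, y, z))
    exact ((hg.differentiable (by norm_num) _).hasFDerivAt).comp_hasDerivAt t h1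
  have hcont : ∀ (k : Fin 3) (x y z : ℝ), Continuous fun t : ℝ =>
      fderiv ℝ g (coordEquiv.symm (x, y, z) + t • EuclideanSpace.single k (1 : ℝ))
        (EuclideanSpace.single k 1) := fun k x y z => (hDc k).comp (by fun_prop)
  have v0 : ∀ y z, pairVar (I 0) (fun x => G (x, y, z))
      ≤ c * (volume (Set.Icc (a 0) (b 0)) * ∫⁻ x, ‖D 0 (x, y, z)‖ₑ ^ 2 ∂I 0) := fun y z => by
    have := pairVar_interval (hline 0 0 y z) (hcont 0 0 y z) (hr 0)
    simp only [← coordEquiv_symm_add] at this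
    simp only [Fin.reduceEq, if_true, if_false, add_zero, zero_add, zero_ne_one] at this
    exact this
  have v1 : ∀ x z, pairVar (I 1) (fun y => G (x, y, z))
      ≤ c * (volume (Set.Icc (a 1) (b 1)) * ∫⁻ y, ‖D 1 (x, y, z)‖ₑ ^ 2 ∂I 1) := fun x z => by
    have := pairVar_interval (hline 1 x 0 z) (hcont 1 x 0 z) (hr 1)
    simp only [← coordEquiv_symm_add] at this
    simp only [Fin.reduceEq, if_true, if_false, add_zero, zero_add, one_ne_zero] at this
    exact this
  have v2 : ∀ x y, pairVar (I 2) (fun z => G (x, y, z))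
      ≤ c * (volume (Set.Icc (a 2) (b 2)) * ∫⁻ z, ‖D 2 (x, y, z)‖ₑ ^ 2 ∂I 2) := fun x y => by
    have := pairVar_interval (hline 2 x y 0) (hcont 2 x y 0) (hr 2)
    simp only [← coordEquiv_symm_add] at this
    simp only [Fin.reduceEq, if_true, if_false, add_zero, zero_add] at this
    exact this
  have e1 : pairVar (volume.restrict (cuboid a b)) g = pairVar ((I 0).prod ((I 1).prod (I 2))) G := by
    rw [pairVar, pairVar, ← hlin]
    refine lintegral_congr fun x => ?_
    rw [← hlin]
    simp [hG]
  have e2 : ∫⁻ x in cuboid a b, ∑ k, ‖fderiv ℝ g x (EuclideanSpace.single k 1)‖ₑ ^ 2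
      = ∫⁻ p, ∑ k, ‖D k p‖ₑ ^ 2 ∂((I 0).prod ((I 1).prod (I 2))) := by
    rw [← hlin]; simp [hD]
  have e3 : volume (cuboid a b) = volume (Set.Icc (a 0) (b 0)) *
      (volume (Set.Icc (a 1) (b 1)) * volume (Set.Icc (a 2) (b 2))) := by
    have := hlin 1
    simp only [Pi.one_apply, lintegral_one, Measure.restrict_apply_univ] at this
    rw [this, ← Set.univ_prod_univ, Measure.prod_prod, ← Set.univ_prod_univ, Measure.prod_prod]
    simp only [hI, Measure.restrict_apply_univ]
  have mI : ∀ k, I k Set.univ = volume (Set.Icc (a k) (b k)) := fun k => by simp [hI]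
  have mD := fun k => (hDm k).enorm.pow_const 2
  have fin : ∀ k, volume (Set.Icc (a k) (b k)) ≠ ⊤ := fun k => by simp
  have w12 : ∀ x, pairVar ((I 1).prod (I 2)) (fun q => G (x, q))
      ≤ c * (volume (Set.Icc (a 1) (b 1)) * volume (Set.Icc (a 2) (b 2)) *
        ∫⁻ q, (‖D 1 (x, q)‖ₑ ^ 2 + ‖D 2 (x, q)‖ₑ ^ 2) ∂((I 1).prod (I 2))) := fun x => by
    refine (pairVar_prod_le (I 1) (I 2) (g := fun q => G (x, q)) (by fun_prop)).trans ?_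
    have a1 : Measurable fun q : ℝ × ℝ => ‖D 1 (x, q)‖ₑ ^ 2 := by fun_prop
    have a2 : Measurable fun q : ℝ × ℝ => ‖D 2 (x, q)‖ₑ ^ 2 := by fun_prop
    rw [lintegral_add_left a1, lintegral_prod_symm' _ a1, lintegral_prod _ a2.aemeasurable, mI, mI]
    calc _ ≤ volume (Set.Icc (a 2) (b 2)) * (∫⁻ z, c * (volume (Set.Icc (a 1) (b 1)) *
            ∫⁻ y, ‖D 1 (x, y, z)‖ₑ ^ 2 ∂I 1) ∂I 2)
          + volume (Set.Icc (a 1) (b 1)) * (∫⁻ y, c * (volume (Set.Icc (a 2) (b 2)) *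
            ∫⁻ z, ‖D 2 (x, y, z)‖ₑ ^ 2 ∂I 2) ∂I 1) := by
          gcongr with z y
          · exact v1 x z
          · exact v2 x y
      _ = _ := by
          rw [lintegral_const_mul' _ _ ENNReal.ofReal_ne_top, lintegral_const_mul' _ _ (fin 1),
            lintegral_const_mul' _ _ ENNReal.ofReal_ne_top, lintegral_const_mul' _ _ (fin 2)]
          ring
  rw [e1, e2, e3]
  refine (pairVar_prod_le (I 0) ((I 1).prod (I 2)) hGm).trans ?_
  have a12 : Measurable fun p => ‖D 1 p‖ₑ ^ 2 + ‖D 2 p‖ₑ ^ 2 := (mD 1).add (mD 2)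
  have e4 : ∫⁻ p, ∑ k, ‖D k p‖ₑ ^ 2 ∂((I 0).prod ((I 1).prod (I 2)))
      = (∫⁻ q, ∫⁻ x, ‖D 0 (x, q)‖ₑ ^ 2 ∂I 0 ∂((I 1).prod (I 2)))
        + ∫⁻ x, ∫⁻ q, (‖D 1 (x, q)‖ₑ ^ 2 + ‖D 2 (x, q)‖ₑ ^ 2) ∂((I 1).prod (I 2)) ∂I 0 := by
    rw [← lintegral_prod_symm' _ (mD 0), ← lintegral_prod _ a12.aemeasurable,
      ← lintegral_add_left (mD 0)]
    refine lintegral_congr fun p => ?_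
    rw [Fin.sum_univ_three, add_assoc]
  have e5 : ((I 1).prod (I 2)) Set.univ
      = volume (Set.Icc (a 1) (b 1)) * volume (Set.Icc (a 2) (b 2)) := by
    rw [← Set.univ_prod_univ, Measure.prod_prod, mI, mI]
  rw [e4, e5, mI]
  calc _ ≤ volume (Set.Icc (a 1) (b 1)) * volume (Set.Icc (a 2) (b 2)) *
          (∫⁻ q, c * (volume (Set.Icc (a 0) (b 0)) *
            ∫⁻ x, ‖D 0 (x, q)‖ₑ ^ 2 ∂I 0) ∂((I 1).prod (I 2)))
        + volume (Set.Icc (a 0) (b 0)) * (∫⁻ x, c * (volume (Set.Icc (a 1) (b 1)) *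
          volume (Set.Icc (a 2) (b 2)) *
            ∫⁻ q, (‖D 1 (x, q)‖ₑ ^ 2 + ‖D 2 (x, q)‖ₑ ^ 2) ∂((I 1).prod (I 2))) ∂I 0) := by
        gcongr with q x
        · exact v0 q.1 q.2
        · exact w12 x
    _ = _ := by
        rw [lintegral_const_mul' _ _ ENNReal.ofReal_ne_top, lintegral_const_mul' _ _ (fin 0),
          lintegral_const_mul' _ _ ENNReal.ofReal_ne_top,
          lintegral_const_mul' _ _ (ENNReal.mul_ne_top (fin 1) (fin 2))]
        ring

/-! ### Mollification and the Poincaré inequality for weak gradients -/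

/-- Cauchy–Schwarz for the factors `√w` and `√w f`. -/
lemma sq_lintegral_mul_le {α : Type*} [MeasurableSpace α] {μ : Measure α} {w f : α → ENNReal}
    (hw : AEMeasurable w μ) (hf : AEMeasurable f μ) (h1 : ∫⁻ x, w x ∂μ ≤ 1) :
    (∫⁻ x, w x * f x ∂μ) ^ 2 ≤ ∫⁻ x, w x * f x ^ 2 ∂μ := by
  have h := ENNReal.lintegral_mul_le_Lp_mul_Lq μ (p := 2) (q := 2) Real.HolderConjugate.two_two
    (f := fun x => w x ^ (1 / 2 : ℝ)) (g := fun x => w x ^ (1 / 2 : ℝ) * f x)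
    (hw.pow_const _) ((hw.pow_const _).mul hf)
  have e1 : ∀ x, w x ^ (1 / 2 : ℝ) * (w x ^ (1 / 2 : ℝ) * f x) = w x * f x := fun x => by
    rw [← mul_assoc, ← ENNReal.rpow_add_of_nonneg _ _ (by norm_num) (by norm_num)]
    norm_num
  have e2 : ∀ x, (w x ^ (1 / 2 : ℝ)) ^ (2 : ℝ) = w x := fun x => by
    rw [← ENNReal.rpow_mul]; norm_num
  have e3 : ∀ x, (w x ^ (1 / 2 : ℝ) * f x) ^ (2 : ℝ) = w x * f x ^ 2 := fun x => by
    rw [ENNReal.mul_rpow_of_nonneg _ _ (by norm_num), e2, ENNReal.rpow_two]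
  simp only [Pi.mul_apply, e1, e2, e3] at h
  have h2 : (∫⁻ x, w x * f x ∂μ) ≤ (∫⁻ x, w x * f x ^ 2 ∂μ) ^ (1 / 2 : ℝ) :=
    h.trans (mul_le_of_le_one_left' (ENNReal.rpow_le_one h1 (by norm_num)))
  calc _ ≤ ((∫⁻ x, w x * f x ^ 2 ∂μ) ^ (1 / 2 : ℝ)) ^ 2 := pow_le_pow_left' h2 2
    _ = _ := by rw [← ENNReal.rpow_two, ← ENNReal.rpow_mul]; norm_num

/-- The convolution of `h` with a real function `ρ`. -/
def mollify (ρ : E3 → ℝ) (h : E3 → ℂ) (x : E3) : ℂ := ∫ y, (ρ (x - y) : ℂ) * h y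

lemma mollify_eq_convolution (ρ : E3 → ℝ) (h : E3 → ℂ) :
    mollify ρ h = convolution h ρ (ContinuousLinearMap.lsmul ℝ ℝ).flip volume := by
  ext x
  simp [mollify, convolution_def]

lemma contDiff_mollify {ρ : E3 → ℝ} {h : E3 → ℂ} (hρ : ContDiff ℝ ∞ ρ) (hc : HasCompactSupport ρ)
    (hh : LocallyIntegrable h) : ContDiff ℝ ∞ (mollify ρ h) := by
  rw [mollify_eq_convolution]
  exact hc.contDiff_convolution_right _ hh hρ

lemma fderiv_mollify {ρ : E3 → ℝ} {h : E3 → ℂ} (hρ : ContDiff ℝ ∞ ρ) (hc : HasCompactSupport ρ)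
    (hh : LocallyIntegrable h) (x v : E3) :
    fderiv ℝ (mollify ρ h) x v = mollify (fun y => fderiv ℝ ρ y v) h x := by
  have hρ1 : ContDiff ℝ 1 ρ := hρ.of_le (by exact_mod_cast le_top)
  rw [mollify_eq_convolution, mollify_eq_convolution,
    (hc.hasFDerivAt_convolution_right _ hh hρ1 x).fderiv,
    convolution_precompR_apply _ hh (hc.fderiv ℝ) (hρ1.continuous_fderiv (by norm_num))]

lemma enorm_mollify_sq_le {ρ : E3 → ℝ} {h : E3 → ℂ} (hρ : Continuous ρ) (hρ0 : ∀ x, 0 ≤ ρ x)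
    (hρi : Integrable ρ) (h1 : ∫ x, ρ x = 1) (hh : AEStronglyMeasurable h) (x : E3) :
    ‖mollify ρ h x‖ₑ ^ 2 ≤ ∫⁻ y, ENNReal.ofReal (ρ (x - y)) * ‖h y‖ₑ ^ 2 := by
  have hw : ∫⁻ y, ENNReal.ofReal (ρ (x - y)) = 1 := by
    rw [← ofReal_integral_eq_lintegral_ofReal (hρi.comp_sub_left x)
      (Eventually.of_forall fun y => hρ0 _), integral_sub_left_eq_self, h1, ENNReal.ofReal_one]
  refine le_trans (pow_le_pow_left' ?_ 2) (sq_lintegral_mul_le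
    (hρ.comp (by fun_prop : Continuous fun y => x - y)).measurable.ennreal_ofReal.aemeasurable
    hh.enorm hw.le)
  refine (enorm_integral_le_lintegral_enorm _).trans_eq (lintegral_congr fun y => ?_)
  rw [enorm_mul]
  congr 1
  rw [← ofReal_norm, Complex.norm_real, Real.norm_of_nonneg (hρ0 _)]

lemma lintegral_mollify_le {ρ : E3 → ℝ} (hρ : Continuous ρ) (hρ0 : ∀ x, 0 ≤ ρ x)
    (hρi : Integrable ρ) (h1 : ∫ x, ρ x = 1) {F : E3 → ENNReal} (hF : AEMeasurable F) (B : Set E3) :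
    ∫⁻ x in B, ∫⁻ y, ENNReal.ofReal (ρ (x - y)) * F y ≤ ∫⁻ y, F y := by
  calc _ ≤ ∫⁻ x, ∫⁻ y, ENNReal.ofReal (ρ (x - y)) * F y := setLIntegral_le_lintegral _ _
    _ = ∫⁻ y, ∫⁻ x, ENNReal.ofReal (ρ (x - y)) * F y := by
        refine lintegral_lintegral_swap (AEMeasurable.mul ?_ hF.comp_snd)
        exact (hρ.comp (by fun_prop : Continuous fun p : E3 × E3 => p.1 - p.2)).measurable.ennreal_ofReal.aemeasurable
    _ = ∫⁻ y, F y := by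
        refine lintegral_congr fun y => ?_
        have hm : Measurable fun x => ENNReal.ofReal (ρ (x - y)) :=
          (hρ.comp (by fun_prop : Continuous fun x => x - y)).measurable.ennreal_ofReal
        rw [lintegral_mul_const _ hm,
          ← ofReal_integral_eq_lintegral_ofReal (hρi.comp_sub_right y)
          (Eventually.of_forall fun y => hρ0 _), integral_sub_right_eq_self, h1, ENNReal.ofReal_one,
          one_mul]

lemma sum_enorm_sq_grad (G : E3 → EuclideanSpace ℂ (Fin 3)) :
    ∀ x, ∑ k, ‖G x k‖ₑ ^ 2 = ‖G x‖ₑ ^ 2 := fun x => by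
  rw [← ofReal_norm (G x), ← ENNReal.ofReal_pow (norm_nonneg _), EuclideanSpace.norm_sq_eq,
    ENNReal.ofReal_sum_of_nonneg (fun _ _ => by positivity)]
  exact Finset.sum_congr rfl fun k _ => enorm_sq_eq_ofReal _

lemma HasH1Gradient.mono {U V : Set E3} {f : E3 → ℂ} {G : E3 → EuclideanSpace ℂ (Fin 3)}
    (h : HasH1Gradient U f G) (hVU : V ⊆ U) (hU : MeasurableSet U) :
    HasH1Gradient V f G := by
  refine ⟨h.memLp.mono_measure (Measure.restrict_mono hVU le_rfl),
    h.memLp_grad.mono_measure (Measure.restrict_mono hVU le_rfl), fun φ h1 h2 h3 k => ?_⟩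
  have h0 : ∀ x, x ∉ V → φ x = 0 := fun x hx => image_eq_zero_of_notMem_tsupport fun h => hx (h3 h)
  have h0' : ∀ x, x ∉ V → fderiv ℝ φ x = 0 := fun x hx => image_eq_zero_of_notMem_tsupport
    fun h => hx (h3 (tsupport_fderiv_subset ℝ h))
  rw [← setIntegral_eq_of_subset_of_forall_sdiff_eq_zero hU hVU,
    ← setIntegral_eq_of_subset_of_forall_sdiff_eq_zero hU hVU]
  · exact h.weak φ h1 h2 (h3.trans hVU) k
  · intro x hx; simp [h0 x hx.2]
  · intro x hx; simp [h0' x hx.2]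

/-- The difference of two weak gradients integrates to zero against all test functions. Consequently
the gradient chosen in `gradEnergy` does not matter. -/
lemma HasH1Gradient.ae_unique {U : Set E3} (hU : IsOpen U) {f : E3 → ℂ}
    {G G' : E3 → EuclideanSpace ℂ (Fin 3)}
    (h : HasH1Gradient U f G) (h' : HasH1Gradient U f G') : G =ᵐ[volume.restrict U] G' := by
  have key : ∀ k, ∀ᵐ x, x ∈ U → G x k - G' x k = 0 := fun k => by
    have m1 : MemLp (fun x => G x k) 2 (volume.restrict U) := h.memLp_grad.eval_piLp k
    have m2 : MemLp (fun x => G' x k) 2 (volume.restrict U) := h'.memLp_grad.eval_piLp k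
    refine hU.ae_eq_zero_of_integral_contDiff_smul_eq_zero ?_ fun φ h1 h2 h3 => ?_
    · have := (m1.sub m2).locallyIntegrable (by norm_num)
      exact locallyIntegrableOn_of_locallyIntegrable_restrict this
    · have b : MemLp (fun x => (φ x : ℂ)) 2 (volume.restrict U) :=
        ((Complex.continuous_ofReal.comp h1.continuous).memLp_of_hasCompactSupport
          (h2.comp_left Complex.ofReal_zero)).restrict U
      have i1 := m1.integrable_mul b
      have i2 := m2.integrable_mul b
      have e : ∫ x, φ x • (G x k - G' x k) = ∫ x in U, (G x k * φ x - G' x k * φ x) := by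
        rw [← setIntegral_eq_integral_of_forall_compl_eq_zero (s := U)]
        · refine integral_congr_ae (Eventually.of_forall fun x => ?_)
          simp only [Complex.real_smul]; ring
        · intro x hx
          rw [image_eq_zero_of_notMem_tsupport fun h => hx (h3 h), zero_smul]
      rw [e]
      have := h.weak φ h1 h2 h3 k
      rw [h'.weak φ h1 h2 h3 k, neg_inj] at this
      refine (integral_sub i1 i2).trans ?_
      simp only [Pi.mul_apply]
      rw [← this, sub_self]
  rw [Filter.EventuallyEq, ae_restrict_iff' hU.measurableSet]
  filter_upwards [ae_all_iff.2 key] with x hx hxU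
  ext k
  exact sub_eq_zero.1 (hx k hxU)

lemma HasH1Gradient.gradEnergy_eq {U : Set E3} (hU : IsOpen U) {f : E3 → ℂ}
    {G : E3 → EuclideanSpace ℂ (Fin 3)} (h : HasH1Gradient U f G) :
    gradEnergy U f = ∫ x in U, ‖G x‖ ^ 2 := by
  have hex : ∃ G, HasH1Gradient U f G := ⟨G, h⟩
  rw [gradEnergy, dif_pos hex]
  refine integral_congr_ae ?_
  filter_upwards [HasH1Gradient.ae_unique hU hex.choose_spec h] with x hx
  rw [hx]

/-- The open cuboid with corners `a` and `b`. -/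
def openCuboid (a b : Fin 3 → ℝ) : Set E3 := {x | ∀ k, x k ∈ Set.Ioo (a k) (b k)}

lemma isOpen_openCuboid (a b : Fin 3 → ℝ) : IsOpen (openCuboid a b) := by
  have : openCuboid a b = ⋂ k, (fun x : E3 => x k) ⁻¹' Set.Ioo (a k) (b k) := by
    ext x; simp [openCuboid]
  rw [this]
  exact isOpen_iInter_of_finite fun k => isOpen_Ioo.preimage (by fun_prop)

/-- As long as the support of `y ↦ ρ(x - y)` stays in `U`, this function is itself admissible in the
definition of the weak gradient. -/
lemma mollify_grad {U : Set E3} {f : E3 → ℂ} {G : E3 → EuclideanSpace ℂ (Fin 3)}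
    (hU : MeasurableSet U) (h : HasH1Gradient U f G) {ρ : E3 → ℝ} (hρ : ContDiff ℝ ∞ ρ)
    (hc : HasCompactSupport ρ) {x : E3} (hx : ∀ y, x - y ∈ tsupport ρ → y ∈ U) (k : Fin 3) :
    mollify (fun y => fderiv ℝ ρ y (EuclideanSpace.single k 1)) (U.indicator f) x
      = mollify ρ (U.indicator fun y => G y k) x := by
  have hφc : HasCompactSupport fun y => ρ (x - y) := hc.comp_homeomorph (Homeomorph.subLeft x)
  have hts : tsupport (fun y => ρ (x - y)) ⊆ U := fun y hy => hx y <|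
    tsupport_comp_subset_preimage ρ (by fun_prop : Continuous fun y => x - y) hy
  have hw := h.weak (fun y => ρ (x - y)) (hρ.comp (by fun_prop)) hφc hts k
  have hd : ∀ y, fderiv ℝ (fun y => ρ (x - y)) y (EuclideanSpace.single k 1)
      = - fderiv ℝ ρ (x - y) (EuclideanSpace.single k 1) := fun y => by
    have h1 : HasFDerivAt (fun y : E3 => x - y) (-ContinuousLinearMap.id ℝ E3) y := by
      simpa using (hasFDerivAt_id y).const_sub x
    have := (((hρ.differentiable (by norm_num)) (x - y)).hasFDerivAt).comp y h1
    rw [show (fun y => ρ (x - y)) = ρ ∘ fun y => x - y from rfl, this.fderiv]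
    simp
  have e : ∀ (w : E3 → ℝ) (F : E3 → ℂ), mollify w (U.indicator F) x
      = ∫ y in U, F y * (w (x - y) : ℝ) := fun w F => by
    rw [← integral_indicator hU, mollify]
    refine integral_congr_ae (Eventually.of_forall fun y => ?_)
    by_cases hy : y ∈ U <;> simp [hy, mul_comm]
  rw [e, e, ← neg_inj, ← hw, ← integral_neg]
  refine integral_congr_ae (Eventually.of_forall fun y => ?_)
  simp [hd]

/-- A sequence of mollifiers. -/
def bump (n : ℕ) : ContDiffBump (0 : E3) where
  rIn := 1 / (4 * (n + 1))
  rOut := 1 / (2 * (n + 1))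
  rIn_pos := by positivity
  rIn_lt_rOut := by
    apply one_div_lt_one_div_of_lt <;> nlinarith [n.cast_nonneg (α := ℝ)]

lemma tendsto_mollify_bump {h : E3 → ℂ} (hh : LocallyIntegrable h) :
    ∀ᵐ x, Tendsto (fun n => mollify ((bump n).normed volume) h x) atTop (𝓝 (h x)) := by
  have h0 : Tendsto (fun n => (bump n).rOut) atTop (𝓝 0) := by
    have := (tendsto_one_div_add_atTop_nhds_zero_nat (𝕜 := ℝ)).const_mul (1 / 2)
    rw [mul_zero] at this
    refine this.congr fun n => ?_
    simp only [bump]; field_simp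
  have h1 : ∀ᶠ n in atTop, (bump n).rOut ≤ 2 * (bump n).rIn := by
    filter_upwards with n
    simp only [bump]; apply le_of_eq; field_simp; norm_num
  filter_upwards [ContDiffBump.ae_convolution_tendsto_right_of_locallyIntegrable h0 h1 hh] with x hx
  refine hx.congr fun n => ?_
  rw [mollify_eq_convolution, convolution_flip]

/-- Mollifications are smooth, satisfy the inequality on slightly smaller cuboids, and have no
larger gradient norm there than `G` on `U`, since the mollifier is a probability density. They
converge almost everywhere, so Fatou's lemma gives the claim for the pair form. -/
theorem pairVar_openCuboid_le {a b : Fin 3 → ℝ} {r : ℝ} (hr : ∀ k, b k - a k ≤ r) {g : E3 → ℂ}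
    {G : E3 → EuclideanSpace ℂ (Fin 3)} (h : HasH1Gradient (openCuboid a b) g G) :
    pairVar (volume.restrict (openCuboid a b)) g
      ≤ ENNReal.ofReal (2 * (r / Real.pi) ^ 2) * (volume (openCuboid a b) *
        ∫⁻ x in openCuboid a b, ‖G x‖ₑ ^ 2) := by
  set U := openCuboid a b with hUd
  have hUo : IsOpen U := isOpen_openCuboid a b
  have hUm := hUo.measurableSet
  have hloc : LocallyIntegrable (U.indicator g) :=
    (memLp_indicator_iff_restrict hUm |>.2 h.memLp).locallyIntegrable (by norm_num)
  -- Twice the outer radius of the `n`-th mollifier, so the mollification on the shrunk cuboid sees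
  -- only points of `U`.
  set e : ℕ → ℝ := fun n => 1 / ((n : ℝ) + 1) with he
  have he0 : ∀ n, 0 < e n := fun n => by positivity
  set B : ℕ → Set E3 := fun n => cuboid (fun k => a k + e n) (fun k => b k - e n) with hB
  have hBU : ∀ n, B n ⊆ U := fun n x hx k => by
    have := hx k
    exact ⟨by linarith [this.1, he0 n], by linarith [this.2, he0 n]⟩
  have hBm : ∀ n, MeasurableSet (B n) := fun n => by
    have : B n = ⋂ k, (fun x : E3 => x k) ⁻¹' Set.Icc (a k + e n) (b k - e n) := by
      ext x; simp [hB, cuboid]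
    rw [this]
    exact MeasurableSet.iInter fun k => measurableSet_Icc.preimage (by fun_prop)
  set ρ : ℕ → E3 → ℝ := fun n => (bump n).normed volume with hρ
  have ρs : ∀ n, ContDiff ℝ ∞ (ρ n) := fun n => (bump n).contDiff_normed
  have ρc : ∀ n, HasCompactSupport (ρ n) := fun n => (bump n).hasCompactSupport_normed
  set gn : ℕ → E3 → ℂ := fun n => mollify (ρ n) (U.indicator g) with hgn
  have gs : ∀ n, ContDiff ℝ ∞ (gn n) := fun n => contDiff_mollify (ρs n) (ρc n) hloc
  set C := ENNReal.ofReal (2 * (r / Real.pi) ^ 2) * (volume U * ∫⁻ x in U, ‖G x‖ₑ ^ 2) with hC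
  have hGm : ∀ k, MemLp (U.indicator fun y => G y k) 2 volume := fun k =>
    (memLp_indicator_iff_restrict hUm).2 (h.memLp_grad.eval_piLp k)
  have hb : ∀ n, pairVar (volume.restrict (B n)) (gn n) ≤ C := fun n => by
    refine (pairVar_cuboid_smooth ((gs n).of_le (by exact_mod_cast le_top)) (r := r)
      fun k => by linarith [hr k, he0 n]).trans ?_
    refine mul_le_mul_right (mul_le_mul' (measure_mono (hBU n)) ?_) _
    calc _ ≤ ∫⁻ x in B n, ∫⁻ y, ENNReal.ofReal (ρ n (x - y)) * U.indicator (fun y => ‖G y‖ₑ ^ 2) y := by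
          refine setLIntegral_mono' (hBm n) fun x hx => ?_
          calc _ ≤ ∑ k, ∫⁻ y, ENNReal.ofReal (ρ n (x - y)) * ‖U.indicator (fun y => G y k) y‖ₑ ^ 2 := by
                refine Finset.sum_le_sum fun k _ => ?_
                rw [fderiv_mollify (ρs n) (ρc n) hloc, mollify_grad hUm h (ρs n) (ρc n)]
                · exact enorm_mollify_sq_le (ρs n).continuous (bump n).nonneg_normed
                    (bump n).integrable_normed (bump n).integral_normed (hGm k).1 x
                · intro y hy j
                  rw [hρ, ContDiffBump.tsupport_normed_eq, mem_closedBall_zero_iff] at hy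
                  have h1 : |x j - y j| ≤ e n / 2 := by
                    refine (PiLp.norm_apply_le (x - y) j).trans (hy.trans_eq ?_)
                    simp only [bump, he]; field_simp
                  have := hx j
                  rw [abs_le] at h1
                  exact ⟨by linarith [this.1, he0 n], by linarith [this.2, he0 n]⟩
            _ = _ := by
                rw [← lintegral_finsetSum']
                · refine lintegral_congr fun y => ?_
                  rw [← Finset.mul_sum]
                  by_cases hy : y ∈ U
                  · simp [hy, sum_enorm_sq_grad]
                  · simp [hy]
                · intro k _
                  exact ((ρs n).continuous.comp
                    (by fun_prop : Continuous fun y => x - y)).measurable.ennreal_ofReal.aemeasurable.mul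
                    ((hGm k).1.enorm.pow_const 2)
      _ ≤ ∫⁻ y, U.indicator (fun y => ‖G y‖ₑ ^ 2) y :=
          lintegral_mollify_le (ρs n).continuous (bump n).nonneg_normed
            (bump n).integrable_normed (bump n).integral_normed
            ((aemeasurable_indicator_iff hUm).2 (h.memLp_grad.1.enorm.pow_const 2)) _
      _ = _ := lintegral_indicator hUm _
  have hev : ∀ x ∈ U, ∀ᶠ n in atTop, x ∈ B n := fun x hx => by
    have h0 : Tendsto e atTop (𝓝 0) := tendsto_one_div_add_atTop_nhds_zero_nat
    have : ∀ k, ∀ᶠ n in atTop, e n < min (x k - a k) (b k - x k) := fun k =>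
      h0.eventually (gt_mem_nhds (lt_min (by linarith [(hx k).1]) (by linarith [(hx k).2])))
    filter_upwards [eventually_all.2 this] with n hn k
    have := lt_min_iff.1 (hn k)
    exact ⟨by linarith [this.1], by linarith [this.2]⟩
  set F : ℕ → E3 → E3 → ENNReal := fun n x y =>
    (B n).indicator (fun x => (B n).indicator (fun y => ‖gn n x - gn n y‖ₑ ^ 2) y) x with hF
  have hFm : ∀ n, Measurable fun p : E3 × E3 => F n p.1 p.2 := fun n => by
    have h1 : Measurable fun p : E3 × E3 => ‖gn n p.1 - gn n p.2‖ₑ ^ 2 := by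
      have := (gs n).continuous; fun_prop
    have := (h1.indicator ((hBm n).preimage measurable_snd)).indicator ((hBm n).preimage measurable_fst)
    have e : (fun p : E3 × E3 => F n p.1 p.2) = (Prod.fst ⁻¹' B n).indicator
        ((Prod.snd ⁻¹' B n).indicator fun p => ‖gn n p.1 - gn n p.2‖ₑ ^ 2) := by
      ext p
      by_cases h1 : p.1 ∈ B n <;> by_cases h2 : p.2 ∈ B n <;> simp [hF, Set.indicator, h1, h2]
    rw [e]
    exact this
  have hlim := tendsto_mollify_bump hloc
  have hFint : ∀ n, ∫⁻ x in U, ∫⁻ y in U, F n x y ≤ C := fun n => by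
    refine le_trans ?_ (hb n)
    rw [pairVar, ← lintegral_indicator (hBm n)]
    refine (setLIntegral_le_lintegral _ _).trans (lintegral_mono fun x => ?_)
    by_cases hx : x ∈ B n
    · simp only [hF, Set.indicator_of_mem hx]
      rw [← lintegral_indicator (hBm n)]
      exact setLIntegral_le_lintegral _ _
    · simp [hF, hx]
  calc pairVar (volume.restrict U) g
      ≤ ∫⁻ x in U, ∫⁻ y in U, liminf (fun n => F n x y) atTop := by
        refine lintegral_mono_ae ?_
        filter_upwards [ae_restrict_of_ae hlim, ae_restrict_mem hUm] with x hx hxU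
        refine lintegral_mono_ae ?_
        filter_upwards [ae_restrict_of_ae hlim, ae_restrict_mem hUm] with y hy hyU
        rw [Set.indicator_of_mem hxU] at hx
        rw [Set.indicator_of_mem hyU] at hy
        have : Tendsto (fun n => F n x y) atTop (𝓝 (‖g x - g y‖ₑ ^ 2)) := by
          refine ((ENNReal.continuous_pow 2).tendsto _ |>.comp
            (continuous_enorm.tendsto _ |>.comp (hx.sub hy))).congr' ?_
          filter_upwards [hev x hxU, hev y hyU] with n h1 h2
          simp [hF, h1, h2, hgn, hρ]
        rw [this.liminf_eq]
    _ ≤ ∫⁻ x in U, liminf (fun n => ∫⁻ y in U, F n x y) atTop :=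
        lintegral_mono fun x => lintegral_liminf_le fun n => (hFm n).comp measurable_prodMk_left
    _ ≤ liminf (fun n => ∫⁻ x in U, ∫⁻ y in U, F n x y) atTop :=
        lintegral_liminf_le fun n => (hFm n).lintegral_prod_right'
    _ ≤ liminf (fun _ => C) atTop := liminf_le_liminf (Eventually.of_forall hFint)
    _ = C := liminf_const _

/-! ### The variational principle for the Neumann resolvent -/

/-- The Hilbert space of pairs of a function and a gradient on `U`. -/
abbrev GradPair (U : Set E3) : Type :=
  WithLp 2 (Lp ℂ 2 (volume.restrict U : Measure E3) ×
    Lp (EuclideanSpace ℂ (Fin 3)) 2 (volume.restrict U : Measure E3))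

/-- The vectors `(∂_k φ, √μ φ e_k)`, to which the graph of the weak gradient is orthogonal. -/
def gradTest (U : Set E3) (μ : ℝ) : Set (GradPair U) :=
  {w | ∃ φ : E3 → ℝ, ContDiff ℝ ∞ φ ∧ HasCompactSupport φ ∧ tsupport φ ⊆ U ∧ ∃ k : Fin 3,
    (w.fst =ᵐ[volume.restrict U]
      fun x => ((fderiv ℝ φ x (EuclideanSpace.single k 1) : ℝ) : ℂ)) ∧
    (w.snd =ᵐ[volume.restrict U] fun x => EuclideanSpace.single k ((√μ * φ x : ℝ) : ℂ))}

/-- The graph of the weak gradient, as a closed subspace. -/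
def gradGraph (U : Set E3) (μ : ℝ) : Submodule ℂ (GradPair U) :=
  (Submodule.span ℂ (gradTest U μ))ᗮ

lemma hasOrthogonalProjection_orthogonal {H : Type*} [NormedAddCommGroup H] [InnerProductSpace ℂ H]
    [CompleteSpace H] (K : Submodule ℂ H) : Kᗮ.HasOrthogonalProjection := inferInstance

instance (U : Set E3) (μ : ℝ) : (gradGraph U μ).HasOrthogonalProjection :=
  hasOrthogonalProjection_orthogonal _

lemma mem_gradGraph_iff {U : Set E3} {μ : ℝ} (v : GradPair U) :
    v ∈ gradGraph U μ ↔ ∀ w ∈ gradTest U μ, inner ℂ w v = 0 := by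
  refine ⟨fun h w hw => (Submodule.mem_orthogonal _ _).1 h w (Submodule.subset_span hw), fun h =>
    (Submodule.mem_orthogonal _ _).2 fun w hw => ?_⟩
  induction hw using Submodule.span_induction with
  | mem x hx => exact h x hx
  | zero => exact inner_zero_left _
  | add x y _ _ hx hy => rw [inner_add_left, hx, hy, add_zero]
  | smul c x _ hx => rw [inner_smul_left, hx, mul_zero]

lemma inner_gradPair {U : Set E3} (v w : GradPair U) {f g : E3 → ℂ}
    {F G : E3 → EuclideanSpace ℂ (Fin 3)} (hf : v.fst =ᵐ[volume.restrict U] f)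
    (hF : v.snd =ᵐ[volume.restrict U] F) (hg : w.fst =ᵐ[volume.restrict U] g)
    (hG : w.snd =ᵐ[volume.restrict U] G) :
    inner ℂ v w = (∫ x in U, conj (f x) * g x) + ∫ x in U, inner ℂ (F x) (G x) := by
  rw [WithLp.prod_inner_apply, L2.inner_def, L2.inner_def]
  congr 1
  · refine integral_congr_ae ?_
    filter_upwards [hf, hg] with x h1 h2
    have h1' : (v.ofLp.1 : E3 → ℂ) x = f x := h1
    have h2' : (w.ofLp.1 : E3 → ℂ) x = g x := h2
    rw [h1', h2', RCLike.inner_apply, mul_comm]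
  · refine integral_congr_ae ?_
    filter_upwards [hF, hG] with x h1 h2
    have h1' : (v.ofLp.2 : E3 → EuclideanSpace ℂ (Fin 3)) x = F x := h1
    have h2' : (w.ofLp.2 : E3 → EuclideanSpace ℂ (Fin 3)) x = G x := h2
    rw [h1', h2']

lemma memLp_real_of_compact {φ : E3 → ℝ} (h1 : Continuous φ) (h2 : HasCompactSupport φ)
    (U : Set E3) : MemLp (fun x => (φ x : ℂ)) 2 (volume.restrict U) :=
  ((Complex.continuous_ofReal.comp h1).memLp_of_hasCompactSupport
    (h2.comp_left Complex.ofReal_zero)).restrict U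

/-- The inner product with a test vector is exactly the defect in the weak gradient identity;
closedness of the graph thus needs no argument. Scaling the gradient by `μ^(-1/2)` turns the norm of
a pair into `‖h‖² + μ⁻¹‖∇h‖²`. -/
lemma mem_gradGraph {U : Set E3} {μ : ℝ} (hμ : 0 < μ) (v : GradPair U) {f : E3 → ℂ}
    {G : E3 → EuclideanSpace ℂ (Fin 3)} (hf : v.fst =ᵐ[volume.restrict U] f)
    (hG : v.snd =ᵐ[volume.restrict U] fun x => ((√μ)⁻¹ : ℝ) • G x) :
    v ∈ gradGraph U μ ↔ HasH1Gradient U f G := by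
  have hs : (√μ) ≠ 0 := (Real.sqrt_pos.2 hμ).ne'
  have hfm : MemLp f 2 (volume.restrict U) := (Lp.memLp v.fst).ae_eq hf
  have hGm : MemLp G 2 (volume.restrict U) := by
    have := ((Lp.memLp v.snd).ae_eq hG).const_smul (√μ)
    refine this.ae_eq (Eventually.of_forall fun x => ?_)
    simp [smul_smul, hs]
  have key : ∀ (w : GradPair U) (φ : E3 → ℝ) (k : Fin 3),
      (w.fst =ᵐ[volume.restrict U]
        fun x => ((fderiv ℝ φ x (EuclideanSpace.single k 1) : ℝ) : ℂ)) →
      (w.snd =ᵐ[volume.restrict U] fun x => EuclideanSpace.single k ((√μ * φ x : ℝ) : ℂ)) →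
      inner ℂ w v = (∫ x in U, f x * ((fderiv ℝ φ x (EuclideanSpace.single k 1) : ℝ) : ℂ))
        + ∫ x in U, G x k * ((φ x : ℝ) : ℂ) := fun w φ k h1 h2 => by
    rw [inner_gradPair w v h1 h2 hf hG]
    congr 1
    · refine integral_congr_ae (Eventually.of_forall fun x => ?_)
      simp [mul_comm]
    · refine integral_congr_ae (Eventually.of_forall fun x => ?_)
      have hs' : ((√μ : ℝ) : ℂ) ≠ 0 := by exact_mod_cast hs
      simp only [EuclideanSpace.inner_single_left, PiLp.smul_apply,
        Complex.real_smul, Complex.ofReal_mul, Complex.ofReal_inv, map_mul, Complex.conj_ofReal]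
      field_simp
  rw [mem_gradGraph_iff]
  constructor
  · refine fun h => ⟨hfm, hGm, fun φ h1 h2 h3 k => ?_⟩
    have m1 := memLp_real_of_compact (U := U)
      ((h1.continuous_fderiv (by norm_num)).clm_apply
        (continuous_const (y := EuclideanSpace.single k (1 : ℝ)))) (h2.fderiv_apply ℝ _)
    have m2 : MemLp (fun x => (EuclideanSpace.single k ((√μ * φ x : ℝ) : ℂ) :
        EuclideanSpace ℂ (Fin 3))) 2 (volume.restrict U) := by
      refine (Continuous.memLp_of_hasCompactSupport ?_ ?_).restrict U
      · have := h1.continuous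
        refine (PiLp.continuous_toLp 2 _).comp (continuous_pi fun i => ?_)
        by_cases hi : i = k
        · subst hi; simp only [Pi.single_eq_same]; fun_prop
        · simp only [Pi.single_eq_of_ne hi]; fun_prop
      · refine h2.mono fun x hx hx0 => hx ?_
        simp [hx0]
    set w : GradPair U := WithLp.toLp 2 (m1.toLp _, m2.toLp _)
    have := h w ⟨φ, h1, h2, h3, k, m1.coeFn_toLp, m2.coeFn_toLp⟩
    rw [key w φ k m1.coeFn_toLp m2.coeFn_toLp] at this
    exact eq_neg_of_add_eq_zero_left this
  · rintro h w ⟨φ, h1, h2, h3, k, e1, e2⟩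
    rw [key w φ k e1 e2, h.weak φ h1 h2 h3 k, neg_add_cancel]

/-- The energy `‖f - h‖² + μ⁻¹ ‖H‖²` on `U`, to be minimized over `H¹(U)`. -/
def trialEnergy (U : Set E3) (μ : ℝ) (f h : E3 → ℂ) (H : E3 → EuclideanSpace ℂ (Fin 3)) : ENNReal :=
  (∫⁻ x in U, ‖f x - h x‖ₑ ^ 2) + ENNReal.ofReal μ⁻¹ * ∫⁻ x in U, ‖H x‖ₑ ^ 2

/-- The vector `(f, 0)`. -/
def sourceVec {U : Set E3} {f : E3 → ℂ} (hf : MemLp f 2 (volume.restrict U)) : GradPair U :=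
  WithLp.toLp 2 (hf.toLp f, 0)

lemma ofReal_norm_Lp_sq {E : Type*} [NormedAddCommGroup E] {ν : Measure E3} (a : Lp E 2 ν)
    {f : E3 → E} (h : a =ᵐ[ν] f) : ENNReal.ofReal (‖a‖ ^ 2) = ∫⁻ x, ‖f x‖ₑ ^ 2 ∂ν := by
  rw [ENNReal.ofReal_pow (norm_nonneg _), ofReal_norm, Lp.enorm_def, eLpNorm_congr_ae h,
    lintegral_enorm_sq]

lemma ofReal_norm_sub_sq {U : Set E3} {μ : ℝ} (hμ : 0 < μ) {f : E3 → ℂ}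
    (hf : MemLp f 2 (volume.restrict U)) (v : GradPair U) {h : E3 → ℂ}
    {H : E3 → EuclideanSpace ℂ (Fin 3)} (hh : v.fst =ᵐ[volume.restrict U] h)
    (hH : v.snd =ᵐ[volume.restrict U] fun x => ((√μ)⁻¹ : ℝ) • H x) :
    ENNReal.ofReal (‖sourceVec hf - v‖ ^ 2) = trialEnergy U μ f h H := by
  rw [WithLp.prod_norm_sq_eq_of_L2, ENNReal.ofReal_add (by positivity) (by positivity)]
  have h1 : (sourceVec hf - v).fst =ᵐ[volume.restrict U] fun x => f x - h x := by
    change (hf.toLp f - v.fst : Lp ℂ 2 _) =ᵐ[volume.restrict U] _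
    filter_upwards [Lp.coeFn_sub (hf.toLp f) v.fst, hf.coeFn_toLp, hh] with x h1 h2 h3
    rw [h1, Pi.sub_apply, h2, h3]
  have h2 : (sourceVec hf - v).snd =ᵐ[volume.restrict U] fun x => - (((√μ)⁻¹ : ℝ) • H x) := by
    change (0 - v.snd : Lp (EuclideanSpace ℂ (Fin 3)) 2 _) =ᵐ[volume.restrict U] _
    rw [zero_sub]
    filter_upwards [Lp.coeFn_neg v.snd, hH] with x h1 h2
    rw [h1, Pi.neg_apply, h2]
  rw [ofReal_norm_Lp_sq _ h1, ofReal_norm_Lp_sq _ h2, trialEnergy]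
  congr 1
  rw [← lintegral_const_mul' _ _ ENNReal.ofReal_ne_top]
  refine lintegral_congr fun x => ?_
  rw [enorm_neg, enorm_smul, mul_pow]
  congr 1
  rw [Real.enorm_eq_ofReal (by positivity), ← ENNReal.ofReal_pow (by positivity), inv_pow,
    Real.sq_sqrt hμ.le]

lemma HasH1Gradient.const_smul {U : Set E3} {f : E3 → ℂ} {G : E3 → EuclideanSpace ℂ (Fin 3)}
    (h : HasH1Gradient U f G) (c : ℝ) :
    HasH1Gradient U (fun x => (c : ℂ) * f x) fun x => c • G x := by
  refine ⟨h.memLp.const_mul _, h.memLp_grad.const_smul c, fun φ h1 h2 h3 k => ?_⟩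
  simp only [mul_assoc, PiLp.smul_apply, Complex.real_smul]
  rw [integral_const_mul, integral_const_mul, h.weak φ h1 h2 h3 k, mul_neg]

/-- The resolvent equation for `g` says that the pair formed by `μg` and its scaled gradient is the
orthogonal projection of `(f, 0)` onto the graph. So a resolvent exists, its choice is irrelevant,
and the form is a squared distance. -/
theorem neumannRatioForm_eq {U : Set E3} {μ : ℝ} (hμ : 0 < μ) {f : E3 → ℂ}
    (hf : MemLp f 2 (volume.restrict U)) :
    neumannRatioForm U μ f
      = ‖sourceVec hf - (gradGraph U μ).starProjection (sourceVec hf)‖ ^ 2 := by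
  have hs0 := Real.sqrt_pos.2 hμ
  have hs : (√μ) ≠ 0 := hs0.ne'
  have hsq : √μ * √μ = μ := Real.mul_self_sqrt hμ.le
  have hμc : (μ : ℂ) ≠ 0 := by exact_mod_cast hμ.ne'
  set w := sourceVec hf with hw
  set V := gradGraph U μ
  have w1 : w.fst =ᵐ[volume.restrict U] f := hf.coeFn_toLp
  have w2 : w.snd =ᵐ[volume.restrict U] fun _ => 0 := Lp.coeFn_zero _ _ _
  -- The first component of the projection, divided by `μ`; orthogonality of the remainder to the
  -- graph is the weak resolvent equation.
  have hex : ∃ g, IsNeumannResolvent U μ f g := by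
    set p := V.starProjection w with hp
    have hpV : p ∈ V := V.starProjection_apply_mem w
    have p2 : p.snd =ᵐ[volume.restrict U] fun x => ((√μ)⁻¹ : ℝ) • (√μ • p.snd x) :=
      Eventually.of_forall fun x => by simp [smul_smul, hs]
    have hH := (mem_gradGraph hμ p (EventuallyEq.refl _ _) p2).1 hpV
    refine ⟨_, _, hH.const_smul μ⁻¹, fun h H hhH => ?_⟩
    have m1 := hhH.memLp
    have m2 := hhH.memLp_grad.const_smul ((√μ)⁻¹)
    set v : GradPair U := WithLp.toLp 2 (m1.toLp _, m2.toLp _) with hv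
    have v1 : v.fst =ᵐ[volume.restrict U] h := m1.coeFn_toLp
    have v2 : v.snd =ᵐ[volume.restrict U] fun x => ((√μ)⁻¹ : ℝ) • H x := m2.coeFn_toLp
    have hvV : v ∈ V := (mem_gradGraph hμ v v1 v2).2 hhH
    have ho : inner ℂ v (w - p) = 0 := (Submodule.mem_orthogonal _ _).1
      (Submodule.sub_starProjection_mem_orthogonal (K := V) w) v hvV
    rw [inner_sub_right, inner_gradPair v w v1 v2 w1 w2,
      inner_gradPair v p v1 v2 (EventuallyEq.refl _ _) p2] at ho
    simp only [inner_zero_right, integral_zero, add_zero] at ho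
    rw [sub_eq_zero] at ho
    rw [ho, add_comm]
    congr 1
    · rw [← integral_const_mul]
      refine integral_congr_ae (Eventually.of_forall fun x => ?_)
      simp only [Complex.ofReal_inv]
      field_simp
    · refine integral_congr_ae (Eventually.of_forall fun x => ?_)
      simp only [inner_smul_left_eq_smul, inner_smul_right_eq_smul, smul_smul]
      congr 1
      field_simp
      rw [Real.sq_sqrt hμ.le]
  rw [neumannRatioForm, dif_pos hex]
  obtain ⟨G, hgG, hres⟩ := hex.choose_spec
  set g := hex.choose with hg
  have hμg := hgG.const_smul μ
  have m1 := hμg.memLp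
  have m2 := hμg.memLp_grad.const_smul ((√μ)⁻¹)
  set p : GradPair U := WithLp.toLp 2 (m1.toLp _, m2.toLp _) with hp
  have p1 : p.fst =ᵐ[volume.restrict U] fun x => (μ : ℂ) * g x := m1.coeFn_toLp
  have p2 : p.snd =ᵐ[volume.restrict U] fun x => ((√μ)⁻¹ : ℝ) • (μ • G x) := m2.coeFn_toLp
  have hpV : p ∈ V := (mem_gradGraph hμ p p1 p2).2 hμg
  have hperp : w - p ∈ Vᗮ := by
    refine (Submodule.mem_orthogonal _ _).2 fun v hv => ?_
    have v2 : v.snd =ᵐ[volume.restrict U] fun x => ((√μ)⁻¹ : ℝ) • (√μ • v.snd x) :=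
      Eventually.of_forall fun x => by simp [smul_smul, hs]
    have hH := (mem_gradGraph hμ v (EventuallyEq.refl _ _) v2).1 hv
    rw [inner_sub_right, inner_gradPair v w (EventuallyEq.refl _ _) v2 w1 w2,
      inner_gradPair v p (EventuallyEq.refl _ _) v2 p1 p2]
    simp only [inner_zero_right, integral_zero, add_zero]
    rw [sub_eq_zero, ← hres _ _ hH, add_comm]
    congr 1
    · rw [← integral_const_mul]
      refine integral_congr_ae (Eventually.of_forall fun x => ?_)
      simp only []
      ring
    · refine integral_congr_ae (Eventually.of_forall fun x => ?_)
      simp only [inner_smul_left_eq_smul, inner_smul_right_eq_smul, smul_smul]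
      congr 1
      field_simp
      rw [Real.sq_sqrt hμ.le]
  rw [Submodule.eq_starProjection_of_mem_orthogonal hpV hperp]
  have h0 : inner ℂ p (w - p) = 0 := (Submodule.mem_orthogonal _ _).1 hperp p hpV
  have h1 : ((‖w - p‖ ^ 2 : ℝ) : ℂ) = inner ℂ w (w - p) := by
    have := inner_self_eq_norm_sq_to_K (𝕜 := ℂ) (w - p)
    rw [inner_sub_left, h0, sub_zero] at this
    rw [this]; norm_cast
  rw [inner_sub_right, inner_gradPair w w w1 w2 w1 w2, inner_gradPair w p w1 w2 p1 p2] at h1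
  simp only [inner_zero_left, integral_zero, add_zero] at h1
  have i1 : Integrable (fun x => conj (f x) * f x) (volume.restrict U) :=
    hf.star.integrable_mul hf
  have i2 : Integrable (fun x => conj (f x) * ((μ : ℂ) * g x)) (volume.restrict U) :=
    hf.star.integrable_mul m1
  rw [← integral_sub i1 i2] at h1
  simp only [mul_sub]
  rw [← h1, Complex.ofReal_re]

theorem neumannRatioForm_nonneg {U : Set E3} {μ : ℝ} (hμ : 0 < μ) {f : E3 → ℂ}
    (hf : MemLp f 2 (volume.restrict U)) : 0 ≤ neumannRatioForm U μ f := by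
  rw [neumannRatioForm_eq hμ hf]; positivity

/-- The distance to a subspace is at most the distance to any of its points. -/
theorem ofReal_neumannRatioForm_le {U : Set E3} {μ : ℝ} (hμ : 0 < μ) {f h : E3 → ℂ}
    {H : E3 → EuclideanSpace ℂ (Fin 3)} (hf : MemLp f 2 (volume.restrict U))
    (hH : HasH1Gradient U h H) :
    ENNReal.ofReal (neumannRatioForm U μ f) ≤ trialEnergy U μ f h H := by
  have m1 := hH.memLp
  have m2 := hH.memLp_grad.const_smul ((√μ)⁻¹)
  set v : GradPair U := WithLp.toLp 2 (m1.toLp _, m2.toLp _) with hv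
  have v1 : v.fst =ᵐ[volume.restrict U] h := m1.coeFn_toLp
  have v2 : v.snd =ᵐ[volume.restrict U] fun x => ((√μ)⁻¹ : ℝ) • H x := m2.coeFn_toLp
  have hvV : v ∈ gradGraph U μ := (mem_gradGraph hμ v v1 v2).2 hH
  rw [neumannRatioForm_eq hμ hf, ← ofReal_norm_sub_sq hμ hf v v1 v2,
    Submodule.starProjection_minimal]
  refine ENNReal.ofReal_le_ofReal (pow_le_pow_left₀ (Real.iInf_nonneg fun _ => norm_nonneg _) ?_ 2)
  exact ciInf_le ⟨0, by rintro _ ⟨x, rfl⟩; exact norm_nonneg _⟩ (⟨v, hvV⟩ : gradGraph U μ)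

/-- By separability of `L²` the distance to the graph is an infimum over a countable dense subset.
One sequence serves all `f`, which yields measurability in parameters and lets bounds valid for each
trial function pass to the form. -/
theorem exists_dense_trial (U : Set E3) {μ : ℝ} (hμ : 0 < μ) :
    ∃ (h : ℕ → E3 → ℂ) (H : ℕ → E3 → EuclideanSpace ℂ (Fin 3)),
      (∀ j, StronglyMeasurable (h j)) ∧ (∀ j, StronglyMeasurable (H j)) ∧
      (∀ j, HasH1Gradient U (h j) (H j)) ∧ ∀ f, MemLp f 2 (volume.restrict U) →
        ENNReal.ofReal (neumannRatioForm U μ f) = ⨅ j, trialEnergy U μ f (h j) (H j) := by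
  have : Fact ((2 : ENNReal) ≠ ⊤) := ⟨by norm_num⟩
  have : SecondCountableTopology (Lp ℂ 2 (volume.restrict U : Measure E3)) :=
    Lp.SecondCountableTopology
  have : SecondCountableTopology (Lp (EuclideanSpace ℂ (Fin 3)) 2 (volume.restrict U : Measure E3)) :=
    Lp.SecondCountableTopology
  have : SecondCountableTopology (GradPair U) :=
    (WithLp.prodContinuousLinearEquiv 2 ℂ (Lp ℂ 2 (volume.restrict U : Measure E3))
      (Lp (EuclideanSpace ℂ (Fin 3)) 2
        (volume.restrict U : Measure E3))).toHomeomorph.isInducing.secondCountableTopology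
  set V := gradGraph U μ
  have : TopologicalSpace.SeparableSpace V := inferInstance
  have hs : (√μ) ≠ 0 := (Real.sqrt_pos.2 hμ).ne'
  set v : ℕ → V := TopologicalSpace.denseSeq V
  have v2 : ∀ p : GradPair U, p.snd =ᵐ[volume.restrict U] fun x => ((√μ)⁻¹ : ℝ) • (√μ • p.snd x) :=
    fun p => Eventually.of_forall fun x => by simp [smul_smul, hs]
  have hH : ∀ j, HasH1Gradient U (v j).1.fst fun x => √μ • (v j).1.snd x := fun j =>
    (mem_gradGraph hμ (v j).1 (EventuallyEq.refl _ _) (v2 _)).1 (v j).2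
  refine ⟨fun j => (v j).1.fst, fun j x => √μ • (v j).1.snd x, fun j => Lp.stronglyMeasurable _,
    fun j => (Lp.stronglyMeasurable (v j).1.snd).const_smul (√μ), hH, fun f hf => le_antisymm
    (le_iInf fun j => ofReal_neumannRatioForm_le hμ hf (hH j)) (le_of_forall_gt fun c hc => ?_)⟩
  rw [neumannRatioForm_eq hμ hf] at hc
  set w := sourceVec hf
  have ho : IsOpen {p : V | ENNReal.ofReal (‖w - (p : GradPair U)‖ ^ 2) < c} :=
    isOpen_lt (ENNReal.continuous_ofReal.comp (by fun_prop)) continuous_const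
  obtain ⟨j, hj⟩ := (TopologicalSpace.denseRange_denseSeq V).exists_mem_open ho
    ⟨⟨V.starProjection w, V.starProjection_apply_mem w⟩, hc⟩
  refine (iInf_le _ j).trans_lt ?_
  rw [← ofReal_norm_sub_sq hμ hf (v j).1 (EventuallyEq.refl _ _) (v2 _)]
  exact hj

/-! ### Cuboids and the box projections -/

lemma cuboid_eq_iInter (a b : Fin 3 → ℝ) :
    cuboid a b = ⋂ k, (fun x : E3 => x k) ⁻¹' Set.Icc (a k) (b k) := by
  ext x; simp [cuboid]

lemma isClosed_cuboid (a b : Fin 3 → ℝ) : IsClosed (cuboid a b) := by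
  rw [cuboid_eq_iInter]
  exact isClosed_iInter fun k => isClosed_Icc.preimage (by fun_prop)

lemma interior_cuboid (a b : Fin 3 → ℝ) : interior (cuboid a b) = openCuboid a b := by
  rw [cuboid_eq_iInter, interior_iInter_of_finite]
  ext x
  simp only [openCuboid, Set.mem_iInter, Set.mem_ofPred_eq]
  refine forall_congr' fun k => ?_
  have ho : IsOpenMap fun x : E3 => x k := by
    have hs : Function.Surjective (EuclideanSpace.proj k : E3 →L[ℝ] ℝ) := fun t =>
      ⟨EuclideanSpace.single k t, by simp⟩
    exact (EuclideanSpace.proj k : E3 →L[ℝ] ℝ).isOpenMap hs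
  rw [← ho.preimage_interior_eq_interior_preimage (by fun_prop), interior_Icc, Set.mem_preimage]

lemma convex_cuboid (a b : Fin 3 → ℝ) : Convex ℝ (cuboid a b) := by
  rw [cuboid_eq_iInter]
  refine convex_iInter fun k => ?_
  exact (convex_Icc (a k) (b k)).linear_preimage (EuclideanSpace.proj k : E3 →L[ℝ] ℝ).toLinearMap

/-- The boundary of a convex set is a null set. -/
lemma restrict_openCuboid (a b : Fin 3 → ℝ) :
    volume.restrict (openCuboid a b) = volume.restrict (cuboid a b) := by
  rw [← interior_cuboid]
  refine Measure.restrict_congr_set ?_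
  have h := (convex_cuboid a b).addHaar_frontier volume
  rw [(isClosed_cuboid a b).frontier_eq] at h
  exact (ae_eq_set.2 ⟨by rw [Set.sdiff_eq_empty.2 interior_subset, measure_empty], h⟩)

lemma cube_eq_cuboid (c : E3) (r : ℝ) :
    cube c r = cuboid (fun k => c k - r / 2) fun k => c k + r / 2 := by
  ext x
  simp only [cube, cuboid, Set.mem_ofPred_eq, abs_le, Set.mem_Icc]
  refine forall_congr' fun k => ⟨fun h => ⟨by linarith, by linarith⟩, fun h => ⟨by linarith, by linarith⟩⟩

lemma smallBox_eq_cuboid (d ℓ : ℝ) (u u' : E3) : smallBox d ℓ u u' =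
    cuboid (fun k => max ((ℓ • u) k - ℓ / 2) (((d * ℓ) • u') k - d * ℓ / 2))
      fun k => min ((ℓ • u) k + ℓ / 2) (((d * ℓ) • u') k + d * ℓ / 2) := by
  rw [smallBox, bigBox, bigBox, cube_eq_cuboid, cube_eq_cuboid]
  ext x
  simp only [cuboid, Set.mem_inter_iff, Set.mem_ofPred_eq, Set.mem_Icc, max_le_iff, le_min_iff,
    ← forall_and]
  exact forall_congr' fun k => by tauto

lemma restrict_interior_cube (c : E3) (r : ℝ) :
    volume.restrict (interior (cube c r)) = volume.restrict (cube c r) := by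
  rw [cube_eq_cuboid, interior_cuboid, restrict_openCuboid]

lemma measurableSet_bigBox (r : ℝ) (u : E3) : MeasurableSet (bigBox r u) := measurableSet_cube _ _

lemma measurableSet_smallBox (d ℓ : ℝ) (u u' : E3) : MeasurableSet (smallBox d ℓ u u') :=
  (measurableSet_bigBox _ _).inter (measurableSet_bigBox _ _)

lemma volume_smallBox_ne_top (d : ℝ) {ℓ : ℝ} (hℓ : 0 ≤ ℓ) (u u' : E3) : volume (smallBox d ℓ u u') ≠ ⊤ :=
  measure_ne_top_of_subset Set.inter_subset_left (volume_cube_ne_top _ hℓ)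

lemma measurableSet_setOf_mem_bigBox (r : ℝ) :
    MeasurableSet {p : E3 × E3 | p.2 ∈ bigBox r p.1} := by
  have : {p : E3 × E3 | p.2 ∈ bigBox r p.1}
      = ⋂ k, {p : E3 × E3 | |p.2 k - (r • p.1) k| ≤ r / 2} := by
    ext p; simp [bigBox, cube]
  rw [this]
  exact MeasurableSet.iInter fun k => measurableSet_le (by fun_prop) measurable_const

lemma volume_setOf_mem_bigBox {r : ℝ} (hr : 0 < r) (x : E3) :
    volume {u : E3 | x ∈ bigBox r u} = 1 := by
  have : {u : E3 | x ∈ bigBox r u} = cube (r⁻¹ • x) 1 := by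
    ext u
    simp only [bigBox, cube, Set.mem_ofPred_eq, PiLp.smul_apply, smul_eq_mul]
    refine forall_congr' fun k => ?_
    have : x k - r * u k = -(r * (u k - r⁻¹ * x k)) := by field_simp; ring
    rw [this, abs_neg, abs_mul, abs_of_pos hr]
    constructor <;> intro h <;> nlinarith
  rw [this, volume_cube _ (by norm_num)]
  simp

/-- Tonelli: a point lies in the boxes of a set of positions of measure one. -/
theorem lintegral_lintegral_bigBox {r : ℝ} (hr : 0 < r) {w : E3 → ENNReal} (hw : AEMeasurable w) :
    ∫⁻ u, ∫⁻ x in bigBox r u, w x = ∫⁻ x, w x := by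
  have h1 : ∀ u, ∫⁻ x in bigBox r u, w x
      = ∫⁻ x, {p : E3 × E3 | p.2 ∈ bigBox r p.1}.indicator 1 (u, x) * w x := fun u => by
    rw [← lintegral_indicator (measurableSet_bigBox r u)]
    refine lintegral_congr fun x => ?_
    by_cases hx : x ∈ bigBox r u <;> simp [hx]
  have hm : Measurable ({p : E3 × E3 | p.2 ∈ bigBox r p.1}.indicator (1 : E3 × E3 → ENNReal)) :=
    measurable_one.indicator (measurableSet_setOf_mem_bigBox r)
  simp_rw [h1]
  rw [lintegral_lintegral_swap (hm.aemeasurable.mul hw.comp_snd)]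
  refine lintegral_congr fun x => ?_
  have hm' : Measurable fun u => {p : E3 × E3 | p.2 ∈ bigBox r p.1}.indicator
      (1 : E3 × E3 → ENNReal) (u, x) := hm.comp (by fun_prop : Measurable fun u : E3 => (u, x))
  rw [lintegral_mul_const _ hm']
  have : ∫⁻ u, {p : E3 × E3 | p.2 ∈ bigBox r p.1}.indicator (1 : E3 × E3 → ENNReal) (u, x)
      = volume {u : E3 | x ∈ bigBox r u} := by
    exact lintegral_indicator_one ((measurableSet_setOf_mem_bigBox r).preimage
      (by fun_prop : Measurable fun u : E3 => (u, x)))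
  rw [this, volume_setOf_mem_bigBox hr, one_mul]

lemma formQ_eq {S : Set E3} (hS : MeasurableSet S) (hS' : volume S ≠ ⊤) {f : E3 → ℂ}
    (hf : MemLp f 2 (volume.restrict S)) :
    formQ S f = (∫ x in S, ‖f x‖ ^ 2) - (volume.real S)⁻¹ * ‖∫ x in S, f x‖ ^ 2 := by
  have : IsFiniteMeasure (volume.restrict S) := ⟨by simpa using hS'.lt_top⟩
  have hi : Integrable f (volume.restrict S) := hf.integrable (by norm_num)
  set c : ℂ := ((volume.real S)⁻¹ : ℝ) * ∫ z in S, f z with hc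
  have e1 : ∫ x, conj (f x) * projQ S f x = ∫ x in S, (conj (f x) * f x - conj (f x) * c) := by
    rw [← integral_indicator hS]
    refine integral_congr_ae (Eventually.of_forall fun x => ?_)
    by_cases hx : x ∈ S <;> simp [projQ, hx, mul_sub, hc]
  have i1 : Integrable (fun x => conj (f x) * f x) (volume.restrict S) := hf.star.integrable_mul hf
  have i2 : Integrable (fun x => conj (f x) * c) (volume.restrict S) :=
    (hf.star.integrable (by norm_num)).mul_const c
  have e2 : ∫ x in S, conj (f x) * c = ((volume.real S)⁻¹ : ℝ) * ((‖∫ x in S, f x‖ ^ 2 : ℝ) : ℂ) := by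
    rw [integral_mul_const, integral_conj, hc, Complex.ofReal_pow, ← Complex.conj_mul']
    ring
  have e3 : ∫ x in S, conj (f x) * f x = ((∫ x in S, ‖f x‖ ^ 2 : ℝ) : ℂ) := by
    rw [← integral_complex_ofReal]
    refine integral_congr_ae (Eventually.of_forall fun x => ?_)
    simp only [Complex.conj_mul']; norm_cast
  rw [formQ, e1, integral_sub i1 i2, e2, e3, ← Complex.ofReal_mul, ← Complex.ofReal_sub,
    Complex.ofReal_re]

/-- This includes null boxes, where the inverse volume is `0` by convention and both sides vanish;
small boxes may be degenerate intersections. -/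
lemma pairVar_eq_formQ {S : Set E3} (hS : MeasurableSet S) (hS' : volume S ≠ ⊤) {f : E3 → ℂ}
    (hf : MemLp f 2 (volume.restrict S)) :
    pairVar (volume.restrict S) f = ENNReal.ofReal (2 * (volume.real S * formQ S f)) := by
  have : IsFiniteMeasure (volume.restrict S) := ⟨by simpa using hS'.lt_top⟩
  rw [pairVar, integral_pair_sq hf, formQ_eq hS hS' hf, measureReal_restrict_apply_univ]
  congr 2
  rcases eq_or_ne (volume.real S) 0 with h | h
  · have : volume.restrict S = 0 := Measure.restrict_eq_zero.2
      (((measureReal_eq_zero_iff hS').1 h))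
    simp [this, h]
  · field_simp

lemma norm_setIntegral_sq_le {S : Set E3} (hS' : volume S ≠ ⊤) {f : E3 → ℂ}
    (hf : MemLp f 2 (volume.restrict S)) :
    ‖∫ x in S, f x‖ ^ 2 ≤ volume.real S * ∫ x in S, ‖f x‖ ^ 2 := by
  rcases eq_or_ne (volume S) 0 with hv0 | hv0
  · simp [Measure.restrict_eq_zero.2 hv0]
  have e := enorm_integral_le_lintegral_enorm (μ := volume.restrict S) f
  have e2 : (∫⁻ x in S, ‖f x‖ₑ) ^ 2 ≤ volume S * ∫⁻ x in S, ‖f x‖ₑ ^ 2 := by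
    have := sq_lintegral_mul_le (μ := volume.restrict S) (w := fun _ => (volume S)⁻¹)
      (f := fun x => ‖f x‖ₑ) aemeasurable_const hf.1.enorm (by
        rw [lintegral_const, Measure.restrict_apply_univ]; exact ENNReal.inv_mul_le_one _)
    rw [lintegral_const_mul' _ _ (ENNReal.inv_ne_top.2 hv0),
      lintegral_const_mul' _ _ (ENNReal.inv_ne_top.2 hv0), mul_pow] at this
    calc (∫⁻ x in S, ‖f x‖ₑ) ^ 2 = volume S ^ 2 * ((volume S)⁻¹ ^ 2 * (∫⁻ x in S, ‖f x‖ₑ) ^ 2) := by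
          rw [← mul_assoc, ← mul_pow, ENNReal.mul_inv_cancel hv0 hS', one_pow, one_mul]
      _ ≤ volume S ^ 2 * ((volume S)⁻¹ * ∫⁻ x in S, ‖f x‖ₑ ^ 2) := mul_le_mul_right this _
      _ = _ := by
          rw [← mul_assoc, sq, mul_assoc (volume S), ENNReal.mul_inv_cancel hv0 hS', mul_one]
  have e3 : ENNReal.ofReal (‖∫ x in S, f x‖ ^ 2)
      ≤ ENNReal.ofReal (volume.real S * ∫ x in S, ‖f x‖ ^ 2) := by
    rw [ENNReal.ofReal_mul measureReal_nonneg, ofReal_measureReal hS',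
      ofReal_integral_eq_lintegral_ofReal (hf.integrable_norm_pow (by norm_num))
        (Eventually.of_forall fun _ => by positivity)]
    simp_rw [← enorm_sq_eq_ofReal]
    exact (pow_le_pow_left' e 2).trans e2
  exact (ENNReal.ofReal_le_ofReal_iff (by positivity)).1 e3

lemma formQ_nonneg {S : Set E3} (hS : MeasurableSet S) (hS' : volume S ≠ ⊤) {f : E3 → ℂ}
    (hf : MemLp f 2 (volume.restrict S)) : 0 ≤ formQ S f := by
  rw [formQ_eq hS hS' hf]
  rcases eq_or_ne (volume.real S) 0 with h | h
  · simp only [h, inv_zero, zero_mul, sub_zero]; positivity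
  have h2 : 0 < volume.real S := lt_of_le_of_ne measureReal_nonneg (Ne.symm h)
  rw [sub_nonneg, inv_mul_le_iff₀ h2]
  exact norm_setIntegral_sq_le hS' hf

lemma enorm_add_sq_le (z w : ℂ) {η : ℝ} (hη : 0 < η) : ‖z + w‖ₑ ^ 2
    ≤ ENNReal.ofReal (1 + η⁻¹) * ‖z‖ₑ ^ 2 + ENNReal.ofReal (1 + η) * ‖w‖ₑ ^ 2 := by
  simp only [enorm_sq_eq_ofReal]
  rw [← ENNReal.ofReal_mul (by positivity), ← ENNReal.ofReal_mul (by positivity),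
    ← ENNReal.ofReal_add (by positivity) (by positivity)]
  refine ENNReal.ofReal_le_ofReal ?_
  have h1 : ‖z + w‖ ^ 2 ≤ (‖z‖ + ‖w‖) ^ 2 := pow_le_pow_left₀ (norm_nonneg _) (norm_add_le z w) 2
  have h2 : 0 ≤ η⁻¹ * (‖z‖ - η * ‖w‖) ^ 2 := by positivity
  have h3 : η⁻¹ * (‖z‖ - η * ‖w‖) ^ 2 = η⁻¹ * ‖z‖ ^ 2 - 2 * (‖z‖ * ‖w‖) + η * ‖w‖ ^ 2 := by
    field_simp; ring
  nlinarith

/-- The variance of `f` is split into that of `h`, to which the Poincaré inequality applies, and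
that of `f - h`, which is at most the `L²` norm. A small box is a cuboid with sides at most `dℓ`,
also when it is cut by the large box. -/
lemma ofReal_formQ_smallBox_le {d ℓ : ℝ} (hd : 0 < d) (hℓ : 0 < ℓ) (u u' : E3) {f h : E3 → ℂ}
    {H : E3 → EuclideanSpace ℂ (Fin 3)} (hf : MemLp f 2 (volume.restrict (bigBox ℓ u)))
    (hH : HasH1Gradient (interior (bigBox ℓ u)) h H) :
    ENNReal.ofReal (formQ (smallBox d ℓ u u') f) ≤ ENNReal.ofReal (1 + (Real.pi ^ 2)⁻¹) *
      ∫⁻ x in smallBox d ℓ u u', (‖f x - h x‖ₑ ^ 2 + ENNReal.ofReal ((d * ℓ) ^ 2) * ‖H x‖ₑ ^ 2) := by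
  set S := smallBox d ℓ u u' with hSd
  have hS : MeasurableSet S := measurableSet_smallBox d ℓ u u'
  have hS' : volume S ≠ ⊤ := volume_smallBox_ne_top d hℓ.le u u'
  have hSu : S ⊆ bigBox ℓ u := Set.inter_subset_left
  have hh : MemLp h 2 (volume.restrict S) := by
    have := hH.memLp
    rw [bigBox, restrict_interior_cube] at this
    exact this.mono_measure (Measure.restrict_mono hSu le_rfl)
  have hfS : MemLp f 2 (volume.restrict S) := hf.mono_measure (Measure.restrict_mono hSu le_rfl)
  obtain ⟨a, b, hab, hr⟩ : ∃ a b : Fin 3 → ℝ, S = cuboid a b ∧ ∀ k, b k - a k ≤ d * ℓ := by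
    refine ⟨_, _, smallBox_eq_cuboid d ℓ u u', fun k => ?_⟩
    have h1 := min_le_right ((ℓ • u) k + ℓ / 2) (((d * ℓ) • u') k + d * ℓ / 2)
    have h2 := le_max_right ((ℓ • u) k - ℓ / 2) (((d * ℓ) • u') k - d * ℓ / 2)
    linarith
  have hres : volume.restrict (openCuboid a b) = volume.restrict S := by
    rw [restrict_openCuboid, hab]
  have hp := pairVar_openCuboid_le hr (hH.mono (V := openCuboid a b) (by
    rw [← interior_cuboid, ← hab]; exact interior_mono hSu) isOpen_interior.measurableSet)
  have hvol : volume (openCuboid a b) = volume S := by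
    rw [← Measure.restrict_apply_univ (openCuboid a b), hres, Measure.restrict_apply_univ]
  rw [hres, hvol] at hp
  have hp2 : pairVar (volume.restrict S) (fun x => f x - h x)
      ≤ 2 * (volume S * ∫⁻ x in S, ‖f x - h x‖ₑ ^ 2) := by
    have hm := hfS.sub hh
    have := pairVar_eq_formQ hS hS' hm
    change pairVar (volume.restrict S) (f - h) ≤ _
    rw [this, ENNReal.ofReal_mul (by norm_num), ENNReal.ofReal_mul measureReal_nonneg,
      ofReal_measureReal hS', ENNReal.ofReal_ofNat]
    refine mul_le_mul_right (mul_le_mul_right ?_ _) _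
    rw [formQ_eq hS hS' hm]
    refine (ENNReal.ofReal_le_ofReal (sub_le_self _ (by positivity))).trans_eq ?_
    rw [ofReal_integral_eq_lintegral_ofReal (hm.integrable_norm_pow (by norm_num))
        (Eventually.of_forall fun _ => by positivity)]
    simp_rw [← enorm_sq_eq_ofReal]
    rfl
  -- This weight gives both parts the same prefactor, as `(1 + η⁻¹)/π² = 1 + η`. It is the origin of
  -- the constant `1 + π⁻²`.
  set η := (Real.pi ^ 2)⁻¹ with hη
  have hη0 : 0 < η := by positivity
  have hηi : η⁻¹ = Real.pi ^ 2 := inv_inv _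
  have mfh : AEMeasurable (fun x => ‖f x - h x‖ₑ ^ 2) (volume.restrict S) :=
    (hfS.sub hh).1.enorm.pow_const 2
  have hp3 : pairVar (volume.restrict S) f ≤ ENNReal.ofReal (1 + η⁻¹) * pairVar (volume.restrict S) h
      + ENNReal.ofReal (1 + η) * pairVar (volume.restrict S) (fun x => f x - h x) := by
    have m1 : AEMeasurable (fun p : E3 × E3 => ‖h p.1 - h p.2‖ₑ ^ 2)
        ((volume.restrict S).prod (volume.restrict S)) :=
      (hh.1.comp_fst.sub hh.1.comp_snd).enorm.pow_const 2
    simp only [pairVar]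
    rw [← lintegral_const_mul' _ _ ENNReal.ofReal_ne_top, ← lintegral_const_mul' _ _ ENNReal.ofReal_ne_top,
      ← lintegral_add_left' (m1.lintegral_prod_right'.const_mul _)]
    refine lintegral_mono fun x => ?_
    have m2 : AEMeasurable (fun y => ENNReal.ofReal (1 + η⁻¹) * ‖h x - h y‖ₑ ^ 2)
        (volume.restrict S) := ((aestronglyMeasurable_const.sub hh.1).enorm.pow_const 2).const_mul _
    simp only []
    rw [← lintegral_const_mul' _ _ ENNReal.ofReal_ne_top, ← lintegral_const_mul' _ _ ENNReal.ofReal_ne_top,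
      ← lintegral_add_left' m2]
    refine lintegral_mono fun y => ?_
    refine le_trans (le_of_eq ?_) (enorm_add_sq_le _ _ hη0)
    congr 2; ring
  rcases eq_or_ne (volume S) 0 with hv0 | hv0
  · have : formQ S f = 0 := by
      rw [formQ_eq hS hS' hfS]; simp [Measure.restrict_eq_zero.2 hv0]
    rw [this]; simp
  have h2v : 2 * volume S ≠ 0 := mul_ne_zero (by norm_num) hv0
  have h2v' : 2 * volume S ≠ ⊤ := ENNReal.mul_ne_top (by norm_num) hS'
  refine (ENNReal.mul_le_mul_iff_right h2v h2v').1 ?_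
  have hq : 2 * volume S * ENNReal.ofReal (formQ S f) = pairVar (volume.restrict S) f := by
    rw [pairVar_eq_formQ hS hS' hfS, ENNReal.ofReal_mul (by norm_num),
      ENNReal.ofReal_mul measureReal_nonneg, ofReal_measureReal hS', ENNReal.ofReal_ofNat, mul_assoc]
  have hc : ENNReal.ofReal (1 + η⁻¹) * ENNReal.ofReal (2 * (d * ℓ / Real.pi) ^ 2)
      = 2 * (ENNReal.ofReal (1 + η) * ENNReal.ofReal ((d * ℓ) ^ 2)) := by
    have hh2 : (2 : ENNReal) = ENNReal.ofReal 2 := by simp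
    rw [hh2, ← ENNReal.ofReal_mul (by positivity), ← ENNReal.ofReal_mul (by positivity),
      ← ENNReal.ofReal_mul (by norm_num)]
    congr 1
    rw [hη]
    field_simp; ring
  rw [hq]
  refine hp3.trans ((add_le_add (mul_le_mul_right hp _) (mul_le_mul_right hp2 _)).trans_eq ?_)
  rw [lintegral_add_left' mfh, lintegral_const_mul' _ _ ENNReal.ofReal_ne_top, ← mul_assoc, hc]
  ring

/-- The same competitor on the large box is used in all small boxes, where the estimate is an
integral over the small box. Averaging over `u'` therefore gives the trial energy of the large box
without localization error, and the infimum over competitors is the Neumann form. -/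
theorem lintegral_formQ_smallBox_le {d ℓ : ℝ} (hd : 0 < d) (hℓ : 0 < ℓ) (u : E3) {f : E3 → ℂ}
    (hf : MemLp f 2 (volume.restrict (bigBox ℓ u))) :
    ∫⁻ u', ENNReal.ofReal (formQ (smallBox d ℓ u u') f) ≤ ENNReal.ofReal (1 + (Real.pi ^ 2)⁻¹) *
      ENNReal.ofReal (neumannRatioForm (interior (bigBox ℓ u)) ((d * ℓ) ^ 2)⁻¹ f) := by
  have hres : volume.restrict (interior (bigBox ℓ u)) = volume.restrict (bigBox ℓ u) :=
    restrict_interior_cube _ _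
  obtain ⟨h, H, -, -, hH, hinf⟩ := exists_dense_trial (interior (bigBox ℓ u))
    (μ := ((d * ℓ) ^ 2)⁻¹) (by positivity)
  rw [hinf f (by rwa [hres]), ENNReal.mul_iInf_of_ne (by simp; positivity) ENNReal.ofReal_ne_top]
  refine le_iInf fun j => ?_
  have hB := measurableSet_bigBox ℓ u
  have h1 : MemLp (h j) 2 (volume.restrict (bigBox ℓ u)) := hres ▸ (hH j).memLp
  have h2 : MemLp (H j) 2 (volume.restrict (bigBox ℓ u)) := hres ▸ (hH j).memLp_grad
  have mfh : AEMeasurable (fun x => ‖f x - h j x‖ₑ ^ 2) (volume.restrict (bigBox ℓ u)) :=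
    (hf.1.sub h1.1).enorm.pow_const 2
  have hw : AEMeasurable (fun x => ‖f x - h j x‖ₑ ^ 2
      + ENNReal.ofReal ((d * ℓ) ^ 2) * ‖H j x‖ₑ ^ 2) (volume.restrict (bigBox ℓ u)) :=
    mfh.add ((h2.1.enorm.pow_const 2).const_mul _)
  calc _ ≤ ∫⁻ u', ENNReal.ofReal (1 + (Real.pi ^ 2)⁻¹) * ∫⁻ x in smallBox d ℓ u u',
          (‖f x - h j x‖ₑ ^ 2 + ENNReal.ofReal ((d * ℓ) ^ 2) * ‖H j x‖ₑ ^ 2) :=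
        lintegral_mono fun u' => ofReal_formQ_smallBox_le hd hℓ u u' hf (hH j)
    _ = ENNReal.ofReal (1 + (Real.pi ^ 2)⁻¹) * ∫⁻ u', ∫⁻ x in bigBox (d * ℓ) u',
          (bigBox ℓ u).indicator (fun x => ‖f x - h j x‖ₑ ^ 2
            + ENNReal.ofReal ((d * ℓ) ^ 2) * ‖H j x‖ₑ ^ 2) x := by
        rw [lintegral_const_mul' _ _ ENNReal.ofReal_ne_top]
        congr 1
        refine lintegral_congr fun u' => ?_
        rw [lintegral_indicator hB, Measure.restrict_restrict hB]
        rfl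
    _ = _ := by
        rw [lintegral_lintegral_bigBox (by positivity) ((aemeasurable_indicator_iff hB).2 hw),
          lintegral_indicator hB, trialEnergy, inv_inv, hres,
          lintegral_add_left' mfh,
          lintegral_const_mul' _ _ ENNReal.ofReal_ne_top]

/-! ### Translations of the Neumann problem and measurability in parameters -/

lemma measurePreserving_restrict_sub (U : Set E3) (v : E3) :
    MeasurePreserving (fun x : E3 => x - v) (volume.restrict ((fun x => x - v) ⁻¹' U))
      (volume.restrict U) :=
  (measurePreserving_sub_right volume v).restrict_preimage_emb
    (measurableEmbedding_subRight v) U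

lemma HasH1Gradient.translate {U : Set E3} {f : E3 → ℂ} {G : E3 → EuclideanSpace ℂ (Fin 3)}
    (h : HasH1Gradient U f G) (v : E3) :
    HasH1Gradient ((fun x => x - v) ⁻¹' U) (fun x => f (x - v)) fun x => G (x - v) := by
  have hm := measurePreserving_restrict_sub U v
  have he := measurableEmbedding_subRight v
  refine ⟨h.memLp.comp_measurePreserving hm, h.memLp_grad.comp_measurePreserving hm,
    fun φ h1 h2 h3 k => ?_⟩
  have hts : tsupport (fun x => φ (x + v)) ⊆ U := fun x hx => by
    have := tsupport_comp_subset_preimage φ (by fun_prop : Continuous fun x : E3 => x + v) hx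
    simpa using h3 this
  have := h.weak (fun x => φ (x + v)) (h1.comp (by fun_prop))
    (h2.comp_homeomorph (Homeomorph.addRight v)) hts k
  have e1 := hm.integral_comp he fun x => f x * ((fderiv ℝ φ (x + v) (EuclideanSpace.single k 1) : ℝ) : ℂ)
  have e2 := hm.integral_comp he fun x => G x k * ((φ (x + v) : ℝ) : ℂ)
  simp only [sub_add_cancel] at e1 e2
  rw [e1, e2, ← this]
  simp only [fderiv_comp_add_right]

lemma neumannRatioForm_translate_le {U : Set E3} {μ : ℝ} (hμ : 0 < μ) {f : E3 → ℂ}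
    (hf : MemLp f 2 (volume.restrict U)) (v : E3) :
    ENNReal.ofReal (neumannRatioForm ((fun x => x - v) ⁻¹' U) μ fun x => f (x - v))
      ≤ ENNReal.ofReal (neumannRatioForm U μ f) := by
  obtain ⟨h, H, -, -, hH, hinf⟩ := exists_dense_trial U hμ
  rw [hinf f hf]
  have hm := measurePreserving_restrict_sub U v
  have he := measurableEmbedding_subRight v
  have hft : MemLp (fun x => f (x - v)) 2 (volume.restrict ((fun x => x - v) ⁻¹' U)) :=
    hf.comp_measurePreserving hm
  refine le_iInf fun j => (ofReal_neumannRatioForm_le hμ hft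
    ((hH j).translate v)).trans_eq ?_
  rw [trialEnergy, trialEnergy, hm.lintegral_comp_emb he fun x => ‖f x - h j x‖ₑ ^ 2,
    hm.lintegral_comp_emb he fun x => ‖H j x‖ₑ ^ 2]

lemma neumannRatioForm_translate {U : Set E3} {μ : ℝ} (hμ : 0 < μ) {f : E3 → ℂ} (v : E3)
    (hf : MemLp f 2 (volume.restrict ((fun x => x - v) ⁻¹' U))) :
    ENNReal.ofReal (neumannRatioForm ((fun x => x - v) ⁻¹' U) μ f)
      = ENNReal.ofReal (neumannRatioForm U μ fun x => f (x + v)) := by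
  have h1 := neumannRatioForm_translate_le hμ hf (-v)
  have e : (fun x => x - -v) ⁻¹' ((fun x : E3 => x - v) ⁻¹' U) = U := by ext x; simp
  rw [e] at h1
  simp only [sub_neg_eq_add] at h1
  have hf' : MemLp (fun x => f (x + v)) 2 (volume.restrict U) := by
    have := hf.comp_measurePreserving (measurePreserving_restrict_sub _ (-v))
    rw [e] at this
    simpa [Function.comp_def] using this
  have h2 := neumannRatioForm_translate_le hμ hf' v
  simp only [sub_add_cancel] at h2
  exact le_antisymm h2 h1

lemma interior_bigBox_eq (ℓ : ℝ) (u : E3) :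
    interior (bigBox ℓ u) = (fun x => x - ℓ • u) ⁻¹' interior (bigBox ℓ 0) := by
  have h : bigBox ℓ u = (Homeomorph.subRight (ℓ • u)) ⁻¹' bigBox ℓ 0 := by
    ext x
    have := mem_cube_sub 0 (ℓ • u) x ℓ
    rw [zero_add] at this
    simpa [bigBox] using this
  rw [h, ← Homeomorph.preimage_interior]
  rfl

/-- Translation to the box at the origin makes the trial functions independent of the parameter, so
the form is a countable infimum of measurable functions. A substitute `R` is needed because the form
itself is controlled only where `F a` is square integrable. -/
theorem exists_measurable_neumannRatio {α : Type*} [MeasurableSpace α] {ℓ μ : ℝ} (hμ : 0 < μ)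
    {v : α → E3} (hv : Measurable v) {F : α → E3 → ℂ} (hF : StronglyMeasurable (Function.uncurry F)) :
    ∃ R : α → ENNReal, Measurable R ∧ ∀ a, MemLp (F a) 2 volume →
      ENNReal.ofReal (neumannRatioForm (interior (bigBox ℓ (v a))) μ (F a)) = R a := by
  obtain ⟨h, H, hh, -, -, hinf⟩ := exists_dense_trial (interior (bigBox ℓ 0)) hμ
  refine ⟨fun a => ⨅ j, trialEnergy (interior (bigBox ℓ 0)) μ (fun x => F a (x + ℓ • v a)) (h j) (H j),
    Measurable.iInf fun j => ?_, fun a ha => ?_⟩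
  · unfold trialEnergy
    refine Measurable.add_const ?_ _
    have hm : Measurable fun p : α × E3 => (p.1, p.2 + ℓ • v p.1) := by fun_prop
    have h1 : Measurable fun p : α × E3 => F p.1 (p.2 + ℓ • v p.1) := hF.measurable.comp hm
    have h2 : Measurable fun p : α × E3 => h j p.2 := (hh j).measurable.comp measurable_snd
    exact Measurable.lintegral_prod_right' (f := fun p : α × E3 =>
      ‖F p.1 (p.2 + ℓ • v p.1) - h j p.2‖ₑ ^ 2) ((h1.sub h2).enorm.pow_const 2)
  · rw [interior_bigBox_eq, neumannRatioForm_translate hμ _ (ha.restrict _), hinf]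
    exact (ha.comp_measurePreserving (measurePreserving_add_right volume _)).restrict _

/-! ### Band-limited trial functions -/

lemma memLp_toLp_fourierInv_ae {p : E3 → ℂ} (h1 : Integrable p volume) (h2 : MemLp p 2 volume) :
    (𝓕⁻ (h2.toLp p) : Lp ℂ 2 (volume : Measure E3)) =ᵐ[volume] 𝓕⁻ p := by
  have hneg : 𝓕⁻ p = 𝓕 fun x => p (-x) := by
    ext x; rw [Real.fourierInv_eq_fourier_comp_neg]
  have h1' : Integrable (fun x => p (-x)) := h1.comp_neg
  have hF : LocallyIntegrable (𝓕⁻ p) volume := by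
    rw [hneg]; exact (continuous_fourier h1').locallyIntegrable
  have hL : LocallyIntegrable ((𝓕⁻ (h2.toLp p) : Lp ℂ 2 (volume : Measure E3)) : E3 → ℂ) :=
    (Lp.memLp _).locallyIntegrable one_le_two
  refine ae_eq_of_integral_contDiff_smul_eq hL hF fun g hg hgc => ?_
  have hg₁ : HasCompactSupport (Complex.ofRealCLM ∘ g) := hgc.comp_left rfl
  have hg₂ : ContDiff ℝ ∞ (Complex.ofRealCLM ∘ g) := by fun_prop
  set φ : SchwartzMap E3 ℂ := hg₁.toSchwartzMap hg₂ with hφ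
  have hφg : ∀ x, φ x = (g x : ℂ) := fun x => by simp [hφ]
  have e1 := congrArg (fun T : TemperedDistribution E3 ℂ => T φ)
    (Lp.fourierInv_toTemperedDistribution_eq (h2.toLp p))
  simp only [TemperedDistribution.fourierInv_apply, Lp.toTemperedDistribution_apply] at e1
  have e2 : ∫ x, (𝓕⁻ φ) x • (h2.toLp p : E3 → ℂ) x = ∫ x, (𝓕 (φ : E3 → ℂ)) x • p (-x) := by
    rw [← integral_neg_eq_self]
    refine integral_congr_ae ?_
    have := (Measure.measurePreserving_neg (volume : Measure E3)).quasiMeasurePreserving.ae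
      h2.coeFn_toLp
    filter_upwards [this] with x hx
    rw [hx, SchwartzMap.fourierInv_coe, Real.fourierInv_eq_fourier_neg, neg_neg]
  have e3 : ∫ x, (𝓕 (φ : E3 → ℂ)) x • p (-x) = ∫ x, φ x • 𝓕⁻ p x := by
    rw [hneg]
    simpa using! (VectorFourier.integral_fourierIntegral_smul_eq_flip (L := innerₗ E3)
      Real.continuous_fourierChar continuous_inner φ.integrable h1')
  rw [e2, e3] at e1
  simp only [hφg] at e1
  simpa [Complex.real_smul] using e1.symm

/-- Plancherel has to be used in `L²` here: `𝓕⁻ p` need not be integrable, so the difference has no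
Fourier integral. -/
lemma lintegral_sub_fourierInv_sq {f p : E3 → ℂ} (hf1 : Integrable f) (hf2 : MemLp f 2 volume)
    (h1 : Integrable p) (h2 : MemLp p 2 volume) :
    ∫⁻ x, ‖f x - 𝓕⁻ p x‖ₑ ^ 2 = ∫⁻ ξ, ‖𝓕 f ξ - p ξ‖ₑ ^ 2 := by
  have e := Lp.norm_fourier_eq (hf2.toLp f - 𝓕⁻ (h2.toLp p))
  have e0 : 𝓕 (hf2.toLp f - 𝓕⁻ (h2.toLp p)) = 𝓕 (hf2.toLp f) - h2.toLp p := by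
    rw [sub_eq_add_neg, FourierTransform.fourier_add, FourierTransform.fourier_neg, ← sub_eq_add_neg, FourierTransform.fourier_fourierInv_eq]
  rw [e0] at e
  have e1 : (hf2.toLp f - 𝓕⁻ (h2.toLp p) : Lp ℂ 2 (volume : Measure E3)) =ᵐ[volume]
      fun x => f x - 𝓕⁻ p x := by
    filter_upwards [Lp.coeFn_sub (hf2.toLp f) (𝓕⁻ (h2.toLp p)), hf2.coeFn_toLp,
      memLp_toLp_fourierInv_ae h1 h2] with x a b c
    rw [a, Pi.sub_apply, b, c]
  have e2 : (𝓕 (hf2.toLp f) - h2.toLp p : Lp ℂ 2 (volume : Measure E3)) =ᵐ[volume]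
      fun x => 𝓕 f x - p x := by
    filter_upwards [Lp.coeFn_sub (𝓕 (hf2.toLp f)) (h2.toLp p), h2.coeFn_toLp,
      memLp_toLp_fourier_ae hf1 hf2] with x a b c
    rw [a, Pi.sub_apply, b, c]
  rw [← ofReal_norm_Lp_sq _ e1, ← ofReal_norm_Lp_sq _ e2, e]

/-- The integrable first moment allows differentiation under the Fourier integral. The classical
gradient is the weak one by partial integration, and its norm follows from Plancherel in each
component. -/
theorem exists_gradient_fourierInv {p : E3 → ℂ} (h1 : Integrable p) (h2 : MemLp p 2 volume)
    (h1' : Integrable fun ξ => ‖ξ‖ * ‖p ξ‖) (h2' : MemLp (fun ξ => ((2 * Real.pi * ‖ξ‖ : ℝ) : ℂ) * p ξ) 2 volume) :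
    ∃ G, HasH1Gradient Set.univ (𝓕⁻ p) G ∧
      ∫⁻ x, ‖G x‖ₑ ^ 2 = ∫⁻ ξ, ENNReal.ofReal ((2 * Real.pi * ‖ξ‖) ^ 2) * ‖p ξ‖ₑ ^ 2 := by
  set q : E3 → ℂ := fun x => p (-x) with hq
  have q1 : Integrable q := h1.comp_neg
  have q2 : MemLp q 2 volume :=
    h2.comp_measurePreserving (Measure.measurePreserving_neg (volume : Measure E3))
  have q1' : Integrable fun ξ => ‖ξ‖ * ‖q ξ‖ := by simpa [hq] using h1'.comp_neg
  have hneg : 𝓕⁻ p = 𝓕 q := by ext x; rw [Real.fourierInv_eq_fourier_comp_neg]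
  set D : Fin 3 → E3 → ℂ := fun i ξ => -(2 * Real.pi * Complex.I * ξ i) * q ξ with hD
  have hDn : ∀ i ξ, ‖D i ξ‖ₑ ^ 2 = ENNReal.ofReal ((2 * Real.pi * |ξ i|) ^ 2) * ‖q ξ‖ₑ ^ 2 := fun i ξ => by
    rw [enorm_sq_eq_ofReal, enorm_sq_eq_ofReal, ← ENNReal.ofReal_mul (by positivity)]
    congr 1
    simp [hD, mul_pow, abs_of_pos Real.pi_pos]
  have hDsum : ∀ ξ, ∑ i, ‖D i ξ‖ₑ ^ 2 = ENNReal.ofReal ((2 * Real.pi * ‖ξ‖) ^ 2) * ‖q ξ‖ₑ ^ 2 := fun ξ => by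
    simp_rw [hDn]
    rw [← Finset.sum_mul, ← ENNReal.ofReal_sum_of_nonneg fun _ _ => by positivity, mul_pow,
      norm_sq_eq_sum, Finset.mul_sum]
    simp_rw [mul_pow]
  have hDm : ∀ i, AEStronglyMeasurable (D i) := fun i =>
    (by fun_prop : Continuous fun ξ : E3 => -(2 * Real.pi * Complex.I * ξ i)).aestronglyMeasurable.mul q1.1
  have D1 : ∀ i, Integrable (D i) := fun i => by
    refine (q1'.const_mul (2 * Real.pi)).mono' (hDm i) (Eventually.of_forall fun ξ => ?_)
    have : |ξ i| ≤ ‖ξ‖ := PiLp.norm_apply_le ξ i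
    simp only [hD, norm_mul, norm_neg, Complex.norm_ofNat, Complex.norm_real, Real.norm_eq_abs,
      abs_of_pos Real.pi_pos, Complex.norm_I, mul_one]
    rw [mul_assoc (2 * Real.pi)]
    gcongr
  have hfin : ∫⁻ ξ, ENNReal.ofReal ((2 * Real.pi * ‖ξ‖) ^ 2) * ‖q ξ‖ₑ ^ 2 < ⊤ := by
    have := lintegral_enorm_sq_lt_top
      (h2'.comp_measurePreserving (Measure.measurePreserving_neg (volume : Measure E3)))
    refine lt_of_eq_of_lt (lintegral_congr fun ξ => ?_) this
    simp only [Function.comp, enorm_mul, mul_pow, norm_neg, hq]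
    congr 1
    rw [enorm_sq_eq_ofReal, Complex.norm_real, Real.norm_eq_abs, sq_abs]
    simp [mul_pow]
  have D2 : ∀ i, MemLp (D i) 2 volume := fun i => by
    refine memLp_two_of_lintegral (hDm i) (lt_of_le_of_lt (lintegral_mono fun ξ => ?_) hfin)
    rw [← hDsum]
    exact Finset.single_le_sum (f := fun i => ‖D i ξ‖ₑ ^ 2) (fun _ _ => zero_le) (Finset.mem_univ i)
  have hfd : ∀ x i, fderiv ℝ (𝓕 q) x (EuclideanSpace.single i 1) = 𝓕 (D i) x := fun x i => by
    have hint : Integrable (VectorFourier.fourierSMulRight (innerSL ℝ) q) := by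
      refine (q1'.const_mul (2 * Real.pi * ‖(innerSL ℝ : E3 →L[ℝ] E3 →L[ℝ] ℝ)‖)).mono'
        q1.1.fourierSMulRight (Eventually.of_forall fun ξ => ?_)
      refine (VectorFourier.norm_fourierSMulRight_le _ _ _).trans_eq (by ring)
    rw [Real.fderiv_fourier q1 q1', Real.fourier_continuousLinearMap_apply hint]
    have e : (fun ξ => VectorFourier.fourierSMulRight (innerSL ℝ) q ξ (EuclideanSpace.single i 1))
        = D i := by
      ext ξ
      have h3 : (innerSL ℝ ξ) (EuclideanSpace.single i (1 : ℝ)) = ξ i := by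
        rw [innerSL_apply_apply, EuclideanSpace.inner_single_right]; simp
      simp only [hD, VectorFourier.fourierSMulRight_apply, h3, Complex.real_smul, smul_eq_mul]
      ring
    rw [e]
  have hdiff : Differentiable ℝ (𝓕 q) := fun x => (Real.hasFDerivAt_fourier q1 q1' x).differentiableAt
  have hcq : Continuous (𝓕 q) := continuous_fourier q1
  have m2 : ∀ i, MemLp (𝓕 (D i)) 2 volume := fun i => memLp_fourier (D1 i) (D2 i)
  set G : E3 → EuclideanSpace ℂ (Fin 3) := fun x => WithLp.toLp 2 fun i => 𝓕 (D i) x with hG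
  have hGsum : ∫⁻ x, ‖G x‖ₑ ^ 2 = ∫⁻ ξ, ENNReal.ofReal ((2 * Real.pi * ‖ξ‖) ^ 2) * ‖q ξ‖ₑ ^ 2 := by
    simp_rw [← sum_enorm_sq_grad, ← hDsum]
    rw [lintegral_finsetSum' _ fun i _ => ((D2 i).1.enorm.pow_const 2),
      lintegral_finsetSum' _ fun i _ => ((m2 i).1.enorm.pow_const 2)]
    exact Finset.sum_congr rfl fun i _ => lintegral_fourier_sq (D1 i) (D2 i)
  have hGc : Continuous G := (PiLp.continuous_toLp 2 _).comp
    (continuous_pi fun i => continuous_fourier (D1 i))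
  refine ⟨G, ⟨?_, ?_, fun φ p1 p2 _ k => ?_⟩, ?_⟩
  · rw [Measure.restrict_univ, hneg]; exact memLp_fourier q1 q2
  · rw [Measure.restrict_univ]
    exact memLp_two_of_lintegral hGc.aestronglyMeasurable (hGsum ▸ hfin)
  · rw [Measure.restrict_univ, hneg]
    have hφd : ∀ x, HasFDerivAt (fun x => (φ x : ℂ)) (Complex.ofRealCLM.comp (fderiv ℝ φ x)) x :=
      fun x => Complex.ofRealCLM.hasFDerivAt.comp x ((p1.differentiable (by norm_num)) x).hasFDerivAt
    have hφc : Continuous fun x => ((fderiv ℝ φ x (EuclideanSpace.single k 1) : ℝ) : ℂ) :=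
      Complex.continuous_ofReal.comp
        ((p1.continuous_fderiv (by norm_num)).clm_apply continuous_const)
    have s1 : HasCompactSupport fun x => (φ x : ℂ) := p2.comp_left Complex.ofReal_zero
    have s2 : HasCompactSupport fun x => ((fderiv ℝ φ x (EuclideanSpace.single k 1) : ℝ) : ℂ) :=
      (p2.fderiv_apply ℝ _).comp_left Complex.ofReal_zero
    have c1 : Continuous fun x => (φ x : ℂ) := Complex.continuous_ofReal.comp p1.continuous
    have := integral_mul_fderiv_eq_neg_fderiv_mul_of_integrable (μ := (volume : Measure E3))
      (f := 𝓕 q) (g := fun x => (φ x : ℂ)) (v := EuclideanSpace.single k 1) ?_ ?_ ?_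
      (fun x _ => hdiff x) (fun x _ => (hφd x).differentiableAt)
    · simp only [(hφd _).fderiv, hfd] at this
      exact this
    · simp only [hfd]
      exact ((continuous_fourier (D1 k)).mul c1).integrable_of_hasCompactSupport s1.mul_left
    · simp only [(hφd _).fderiv]
      exact (hcq.mul hφc).integrable_of_hasCompactSupport s2.mul_left
    · exact (hcq.mul c1).integrable_of_hasCompactSupport s1.mul_left
  · rw [hGsum]
    have := (Measure.measurePreserving_neg (volume : Measure E3)).lintegral_comp_emb
      (Homeomorph.neg E3).measurableEmbedding
      (fun ξ => ENNReal.ofReal ((2 * Real.pi * ‖ξ‖) ^ 2) * ‖p ξ‖ₑ ^ 2)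
    rw [← this]
    simp [hq]

/-! ### The symbol inequality for the large boxes -/

/-- The squared mean of a plane wave over the cube of side `r` is close to one. -/
lemma one_sub_mean_planeWave_sq_le {r : ℝ} (hr : 0 < r) (k : E3) :
    1 - ‖cubeInv r * ∫ z in cube 0 r, planeWave k z‖ ^ 2 ≤ 2 * (2 * Real.pi * ‖k‖) ^ 2 * r ^ 2 := by
  have hS := measurableSet_cube 0 r
  have hS' := volume_cube_ne_top 0 hr.le
  have hc : Continuous (planeWave k) :=
    continuous_planeWave.comp (by fun_prop : Continuous fun x : E3 => (k, x))
  have : IsFiniteMeasure (volume.restrict (cube 0 r)) := ⟨by simpa using hS'.lt_top⟩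
  have hf : MemLp (planeWave k) 2 (volume.restrict (cube 0 r)) :=
    MemLp.of_bound hc.aestronglyMeasurable 1 (Eventually.of_forall fun x => (norm_planeWave k x).le)
  -- One minus the squared modulus of the mean is the variance of a function of modulus one, and the
  -- pair form bounds it by the squared oscillation over the cube.
  have h1 := pairVar_eq_formQ hS hS' hf
  rw [formQ_eq hS hS' hf, volume_real_cube 0 hr.le] at h1
  simp only [norm_planeWave, one_pow, integral_const, measureReal_restrict_apply_univ,
    volume_real_cube 0 hr.le, smul_eq_mul, mul_one] at h1
  have h2 : pairVar (volume.restrict (cube 0 r)) (planeWave k)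
      ≤ ENNReal.ofReal ((2 * Real.pi * ‖k‖ * (2 * r)) ^ 2 * (r ^ 3 * r ^ 3)) := by
    calc _ ≤ ∫⁻ x in cube 0 r, ∫⁻ y in cube 0 r, ENNReal.ofReal ((2 * Real.pi * ‖k‖ * (2 * r)) ^ 2) := by
          refine setLIntegral_mono' hS fun x hx => setLIntegral_mono' hS fun y hy => ?_
          rw [enorm_sq_eq_ofReal]
          refine ENNReal.ofReal_le_ofReal (pow_le_pow_left₀ (norm_nonneg _) ?_ 2)
          refine (norm_planeWave_sub_le k x y).trans (mul_le_mul_of_nonneg_left ?_ (by positivity))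
          refine norm_le_of_abs_le fun i => ?_
          have a := abs_le.1 (hx i)
          have b := abs_le.1 (hy i)
          simp only [PiLp.zero_apply, sub_zero, PiLp.sub_apply] at a b ⊢
          exact abs_le.2 ⟨by linarith, by linarith⟩
      _ = _ := by
          simp only [lintegral_const, Measure.restrict_apply_univ, volume_cube 0 hr.le]
          rw [mul_assoc, ← ENNReal.ofReal_mul (by positivity), ← ENNReal.ofReal_mul (by positivity)]
  rw [h1, ENNReal.ofReal_le_ofReal_iff (by positivity)] at h2
  have h3 : ‖cubeInv r * ∫ z in cube 0 r, planeWave k z‖ ^ 2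
      = (r ^ 3)⁻¹ ^ 2 * ‖∫ z in cube 0 r, planeWave k z‖ ^ 2 := by
    rw [norm_mul, mul_pow, cubeInv, Complex.norm_real, Real.norm_of_nonneg (by positivity)]
  rw [h3]
  have h4 : 0 < r ^ 3 * r ^ 3 := by positivity
  refine le_of_mul_le_mul_left ?_ h4
  have h5 : r ^ 3 * r ^ 3 * (1 - (r ^ 3)⁻¹ ^ 2 * ‖∫ z in cube 0 r, planeWave k z‖ ^ 2)
      = r ^ 3 * (r ^ 3 - (r ^ 3)⁻¹ * ‖∫ z in cube 0 r, planeWave k z‖ ^ 2) := by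
    field_simp
  rw [h5]
  nlinarith [h2]

/-- The energy symbol of the band-limited trial function. -/
def trialSymbol (μ A k : ℝ) : ℝ := if k ≤ A then k ^ 2 * μ / (k ^ 2 + μ) else μ

set_option maxHeartbeats 1000000 in
-- There are three regimes, separated by `κt` and `κt'`. For small `k` every term is a fraction of
-- `k²`. In the middle the gain of `(k-t)₊²` over `k²` pays for the gap `bℓ⁻²`, while the Neumann
-- symbol leaves room for `F'`. For large `k` both dispersions have gained enough, and the Neumann
-- symbol is at most `μ`.
theorem symbol_inequality {C s d ℓ εT b k F F' q : ℝ} (hC : 1 ≤ C) (hs : 0 < s) (hd : 0 < d)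
    (hℓ : 0 < ℓ) (hd1 : d ≤ 1) (hεT : 0 < εT) (hεT' : εT ≤ 1 / 2) (hb : 0 < b) (hb' : b ≤ 1 / 8)
    (hsC : 512 * C ^ 2 * s ^ 2 ≤ 1) (hk : 0 ≤ k)
    (hF1 : F ≤ max (k - 1 / 2 * (s * ℓ)⁻¹) 0 ^ 2 + C * ℓ⁻¹ ^ 2)
    (hF2 : F ≤ C * (1 / 2 * (s * ℓ)⁻¹)⁻¹ ^ 2 * (k ^ 4 + k ^ 2 * ℓ⁻¹ ^ 2))
    (hF1' : F' ≤ max (k - 1 / 2 * (d * s * ℓ)⁻¹) 0 ^ 2 + C * ℓ⁻¹ ^ 2)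
    (hF2' : F' ≤ C * (1 / 2 * (d * s * ℓ)⁻¹)⁻¹ ^ 2 * (k ^ 4 + k ^ 2 * ℓ⁻¹ ^ 2))
    (hq1 : q ≤ 1) (hq2 : q ≤ 2 * k ^ 2 * ℓ ^ 2) :
    εT * trialSymbol ((d * ℓ) ^ 2)⁻¹ ((4 * √C)⁻¹ * (1 / 2 * (d * s * ℓ)⁻¹)) k + b * (ℓ ^ 2)⁻¹ * q
      + ((1 - εT) * F + εT * F') ≤ k ^ 2 := by
  -- Chosen such that `Cκ² = 1/16`: then the quartic bounds on `F` and `F'` are at most `k²/8` up to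
  -- `κ` times the threshold.
  set κ := (4 * √C)⁻¹ with hκ
  have hC0 : 0 < C := by linarith
  have hsq : √C ^ 2 = C := Real.sq_sqrt hC0.le
  have hsqp : 0 < √C := Real.sqrt_pos.2 hC0
  have hκ0 : 0 < κ := by positivity
  have hκ2 : κ ^ 2 = (16 * C)⁻¹ := by rw [hκ, inv_pow, mul_pow, hsq]; norm_num
  have hκC : C * κ ^ 2 = 1 / 16 := by rw [hκ2]; field_simp
  have hκ1 : κ ≤ 1 := by
    have : κ ^ 2 ≤ 1 := by rw [hκ2]; exact inv_le_one_of_one_le₀ (by linarith)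
    exact (pow_le_one_iff_of_nonneg hκ0.le (by norm_num)).1 this
  set t := 1 / 2 * (s * ℓ)⁻¹ with ht
  set t' := 1 / 2 * (d * s * ℓ)⁻¹ with ht'
  set μ := ((d * ℓ) ^ 2)⁻¹ with hμ
  set P := (ℓ ^ 2)⁻¹ with hP
  have hP' : ℓ⁻¹ ^ 2 = P := by rw [inv_pow]
  rw [hP'] at hF1 hF2 hF1' hF2'
  have hP0 : 0 < P := by positivity
  have ht0 : 0 < t := by positivity
  have ht0' : 0 < t' := by positivity
  have hμ0 : 0 < μ := by positivity
  have hPℓ : P * ℓ ^ 2 = 1 := by rw [hP]; field_simp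
  have ht2' : t⁻¹ ^ 2 * P = 4 * s ^ 2 := by rw [ht, hP]; field_simp; norm_num
  have ht3 : t'⁻¹ ^ 2 * μ = 4 * s ^ 2 := by rw [ht', hμ]; field_simp; norm_num
  have hPμ : P ≤ μ := by
    rw [hP, hμ, mul_pow]
    refine inv_anti₀ (by positivity) ?_
    exact mul_le_of_le_one_left (sq_nonneg ℓ) (pow_le_one₀ hd.le hd1)
  -- This fixes the number `512 = 64 · 8` in the hypothesis on `s`: the right side is `P/(64Cs²)`
  -- and must dominate eight times the localization error `CP`.
  have hκt : P * 8 * C ≤ κ ^ 2 * t ^ 2 := by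
    have e : κ ^ 2 * t ^ 2 = P * (64 * C * s ^ 2)⁻¹ := by
      rw [hκ2, ht, hP]; field_simp; norm_num
    rw [e, mul_assoc]
    refine mul_le_mul_of_nonneg_left ?_ hP0.le
    rw [le_inv_comm₀ (by positivity) (by positivity), ← one_div, le_div_iff₀ (by positivity)]
    have : 64 * C * s ^ 2 * (8 * C) = 512 * C ^ 2 * s ^ 2 := by ring
    linarith
  have hκt' : μ * 8 * C ≤ κ ^ 2 * t' ^ 2 := by
    have e : κ ^ 2 * t' ^ 2 = μ * (64 * C * s ^ 2)⁻¹ := by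
      rw [hκ2, ht', hμ]; field_simp; norm_num
    rw [e, mul_assoc]
    refine mul_le_mul_of_nonneg_left ?_ hμ0.le
    rw [le_inv_comm₀ (by positivity) (by positivity), ← one_div, le_div_iff₀ (by positivity)]
    have : 64 * C * s ^ 2 * (8 * C) = 512 * C ^ 2 * s ^ 2 := by ring
    linarith
  -- The threshold `τ` lowers `k²` by at least `κ²τ²` as soon as `k ≥ κτ`. This is the only source
  -- of energy for paying the errors at larger momenta.
  have hK : ∀ {τ : ℝ}, 0 < τ → κ * τ ≤ k → max (k - τ) 0 ^ 2 + κ ^ 2 * τ ^ 2 ≤ k ^ 2 := by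
    intro τ hτ h
    rcases le_total k τ with h1 | h1
    · rw [max_eq_right (by linarith)]
      have := pow_le_pow_left₀ (by positivity) h 2
      rw [mul_pow] at this
      linarith
    · rw [max_eq_left (by linarith)]
      have : κ ^ 2 * τ ^ 2 ≤ τ ^ 2 :=
        mul_le_of_le_one_left (sq_nonneg τ) (pow_le_one₀ hκ0.le hκ1)
      have : 0 ≤ (k - τ) * τ := mul_nonneg (by linarith) hτ.le
      linarith [(by ring : (k - τ) ^ 2 = k ^ 2 - 2 * ((k - τ) * τ) - τ ^ 2)]
  have hs4 : C * (4 * s ^ 2) ≤ 1 / 128 := by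
    have : C * s ^ 2 ≤ C ^ 2 * s ^ 2 := by gcongr; nlinarith
    linarith
  have htt : t ≤ t' := by
    rw [ht, ht']
    refine mul_le_mul_of_nonneg_left (inv_anti₀ (by positivity) ?_) (by norm_num)
    rw [mul_assoc]
    exact mul_le_of_le_one_left (by positivity) hd1
  have hbP : b * P * q ≤ b * P := mul_le_of_le_one_right (by positivity) hq1
  -- the regime where the second bounds are effective
  have low : ∀ {τ : ℝ}, 0 < τ → τ⁻¹ ^ 2 * P ≤ 4 * s ^ 2 → k ≤ κ * τ →
      C * τ⁻¹ ^ 2 * (k ^ 4 + k ^ 2 * P) ≤ k ^ 2 / 8 := by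
    intro τ hτ h1 h2
    have h3 : τ⁻¹ ^ 2 * k ^ 2 ≤ κ ^ 2 := by
      rw [← mul_pow]
      refine pow_le_pow_left₀ (by positivity) ?_ 2
      rw [inv_mul_le_iff₀ hτ]; linarith
    have h4 : C * (τ⁻¹ ^ 2 * k ^ 2) ≤ 1 / 16 := by rw [← hκC]; gcongr
    have h5 : C * (τ⁻¹ ^ 2 * P) ≤ 1 / 128 := le_trans (by gcongr) hs4
    calc C * τ⁻¹ ^ 2 * (k ^ 4 + k ^ 2 * P)
        = (C * (τ⁻¹ ^ 2 * k ^ 2)) * k ^ 2 + (C * (τ⁻¹ ^ 2 * P)) * k ^ 2 := by ring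
      _ ≤ 1 / 16 * k ^ 2 + 1 / 128 * k ^ 2 := by gcongr
      _ ≤ k ^ 2 / 8 := by linarith [sq_nonneg k]
  have ht2'' : t'⁻¹ ^ 2 * P ≤ 4 * s ^ 2 := by
    rw [← ht3]; gcongr
  have hc1 : k ^ 2 * μ / (k ^ 2 + μ) ≤ k ^ 2 := by
    rw [div_le_iff₀ (by positivity)]
    exact mul_le_mul_of_nonneg_left (by linarith [sq_nonneg k]) (sq_nonneg k)
  -- In the first regime the shares are `1/2` for the Neumann term, `1/4` for the gap term by the
  -- quadratic bound on `q`, and `1/8` for the convex combination of `F` and `F'`.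
  rcases le_or_gt k (κ * t) with hA | hA
  · have hA' : k ≤ κ * t' := hA.trans (by gcongr)
    rw [trialSymbol, if_pos hA']
    have l1 := low ht0 ht2'.le hA
    have l2 := low ht0' ht2'' hA'
    have l3 : b * P * q ≤ k ^ 2 / 4 := by
      calc b * P * q ≤ b * P * (2 * k ^ 2 * ℓ ^ 2) := by gcongr
        _ = 2 * b * k ^ 2 * (P * ℓ ^ 2) := by ring
        _ ≤ _ := by
            rw [hPℓ]
            have : b * k ^ 2 ≤ 1 / 8 * k ^ 2 := by gcongr
            linarith
    have l4 : (1 - εT) * F ≤ (1 - εT) * (k ^ 2 / 8) :=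
      mul_le_mul_of_nonneg_left (hF2.trans l1) (by linarith)
    have l5 : εT * F' ≤ εT * (k ^ 2 / 8) := mul_le_mul_of_nonneg_left (hF2'.trans l2) hεT.le
    have l6 : εT * (k ^ 2 * μ / (k ^ 2 + μ)) ≤ 1 / 2 * k ^ 2 :=
      mul_le_mul hεT' hc1 (by positivity) (by norm_num)
    linarith [sq_nonneg k]
  · have hK1 := hK ht0 hA.le
    have l1 : (1 - εT) * F + b * P ≤ (1 - εT) * k ^ 2 := by
      have : (1 - εT) * F ≤ (1 - εT) * (k ^ 2 - P * 8 * C + C * P) :=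
        mul_le_mul_of_nonneg_left (by linarith) (by linarith)
      have h1 : P * 1 ≤ P * C := mul_le_mul_of_nonneg_left hC hP0.le
      have h2 : (1 - εT) * (P * C * 7) ≥ 1 / 2 * (P * C * 7) :=
        mul_le_mul_of_nonneg_right (by linarith) (by positivity)
      have h3 : b * P ≤ 1 / 8 * P := mul_le_mul_of_nonneg_right hb' hP0.le
      linarith [(by ring : (1 - εT) * (k ^ 2 - P * 8 * C + C * P)
        = (1 - εT) * k ^ 2 - (1 - εT) * (P * C * 7))]
    rcases le_or_gt k (κ * t') with hB | hB
    · rw [trialSymbol, if_pos hB]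
      -- The Neumann symbol misses `k²` by `k⁴/(k² + μ)`, and `F'` must fit there. For `k² ≤ μ` this
      -- is of order `k⁴/μ`, so the quartic bound is needed, with `P ≤ k²` known in this regime; for
      -- `k² ≥ μ` the bound `k²/8` is enough.
      have l2 : k ^ 2 * μ / (k ^ 2 + μ) + F' ≤ k ^ 2 := by
        have e : k ^ 2 * μ / (k ^ 2 + μ) = k ^ 2 - k ^ 4 / (k ^ 2 + μ) := by
          field_simp; ring
        rw [e]
        suffices F' ≤ k ^ 4 / (k ^ 2 + μ) by linarith
        rcases le_total (k ^ 2) μ with h | h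
        · have h1 : k ^ 4 / (2 * μ) ≤ k ^ 4 / (k ^ 2 + μ) := by
            gcongr; linarith
          refine le_trans (hF2'.trans ?_) h1
          rw [le_div_iff₀ (by positivity)]
          have hPk : P ≤ k ^ 2 := by
            have := pow_le_pow_left₀ (by positivity) hA.le 2
            rw [mul_pow] at this
            have h2 : P * 1 ≤ P * C := mul_le_mul_of_nonneg_left hC hP0.le
            linarith
          calc C * t'⁻¹ ^ 2 * (k ^ 4 + k ^ 2 * P) * (2 * μ)
              = 2 * (C * (t'⁻¹ ^ 2 * μ)) * (k ^ 4 + k ^ 2 * P) := by ring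
            _ ≤ 2 * (1 / 128) * (k ^ 4 + k ^ 2 * k ^ 2) := by rw [ht3]; gcongr
            _ ≤ k ^ 4 := by
                have e4 : k ^ 2 * k ^ 2 = k ^ 4 := by ring
                have p4 : 0 ≤ k ^ 4 := by positivity
                rw [e4]; linarith
        · have h1 : k ^ 2 / 8 ≤ k ^ 4 / (k ^ 2 + μ) := by
            rw [le_div_iff₀ (by positivity)]
            have : k ^ 2 * μ ≤ k ^ 2 * k ^ 2 := mul_le_mul_of_nonneg_left h (sq_nonneg k)
            have e4 : k ^ 2 * k ^ 2 = k ^ 4 := by ring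
            have p4 : 0 ≤ k ^ 4 := by positivity
            rw [e4] at this
            calc k ^ 2 / 8 * (k ^ 2 + μ) = (k ^ 4 + k ^ 2 * μ) / 8 := by ring
              _ ≤ k ^ 4 := by linarith
          exact (hF2'.trans (low ht0' ht2'' hB)).trans h1
      have l3 : εT * (k ^ 2 * μ / (k ^ 2 + μ) + F') ≤ εT * k ^ 2 :=
        mul_le_mul_of_nonneg_left l2 hεT.le
      linarith
    · have hK2 := hK ht0' hB.le
      rw [trialSymbol, if_neg (by linarith)]
      have : εT * (μ + F') ≤ εT * k ^ 2 := by
        refine mul_le_mul_of_nonneg_left ?_ hεT.le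
        have h1 : μ * 1 ≤ μ * C := mul_le_mul_of_nonneg_left hC hμ0.le
        have h2 : C * P ≤ C * μ := mul_le_mul_of_nonneg_left hPμ hC0.le
        linarith
      linarith

/-! ### Joint measurability of the localized forms -/

section

variable {α : Type*} [MeasurableSpace α] {T : Set (α × E3)} {F : α → E3 → ℂ}

lemma stronglyMeasurable_projQ (hT : MeasurableSet T) (hF : StronglyMeasurable (Function.uncurry F)) :
    StronglyMeasurable (Function.uncurry fun a => projQ {x | (a, x) ∈ T} (F a)) := by
  have h1 : StronglyMeasurable fun a => ∫ x in {x | (a, x) ∈ T}, F a x := by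
    have h := StronglyMeasurable.integral_prod_right (ν := (volume : Measure E3))
      (f := fun a x => T.indicator (Function.uncurry F) (a, x)) (hF.indicator hT)
    refine (congrArg StronglyMeasurable (funext fun a => ?_)).mp h
    have hmT : MeasurableSet {x | (a, x) ∈ T} := hT.preimage measurable_prodMk_left
    rw [← integral_indicator hmT]
    rfl
  have h2 : Measurable fun a => volume.real {x | (a, x) ∈ T} :=
    (measurable_measure_prodMk_left hT).ennreal_toReal
  have h3 : StronglyMeasurable fun p : α × E3 => T.indicator (fun p => F p.1 p.2
      - ((volume.real {x | (p.1, x) ∈ T})⁻¹ : ℝ) * ∫ z in {x | (p.1, x) ∈ T}, F p.1 z) p := by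
    refine StronglyMeasurable.indicator (hF.sub (StronglyMeasurable.mul ?_
      (h1.comp_measurable measurable_fst))) hT
    exact (Complex.measurable_ofReal.comp (h2.inv.comp measurable_fst)).stronglyMeasurable
  exact h3

lemma stronglyMeasurable_formQ (hT : MeasurableSet T) (hF : StronglyMeasurable (Function.uncurry F)) :
    StronglyMeasurable fun a => formQ {x | (a, x) ∈ T} (F a) := by
  have h := StronglyMeasurable.integral_prod_right (ν := (volume : Measure E3))
    (f := fun a x => conj (F a x) * projQ {x | (a, x) ∈ T} (F a) x)
    ((Complex.continuous_conj.comp_stronglyMeasurable hF).mul (stronglyMeasurable_projQ hT hF))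
  exact (Complex.measurable_re.comp h.measurable).stronglyMeasurable

end

lemma measurableSet_bigBox_param {α : Type*} [MeasurableSpace α] {v : α → E3} (hv : Measurable v)
    (r : ℝ) : MeasurableSet {p : α × E3 | p.2 ∈ bigBox r (v p.1)} :=
  (measurableSet_setOf_mem_bigBox r).preimage
    (by fun_prop : Measurable fun p : α × E3 => (v p.1, p.2))

lemma measurable_chiBig_param {α : Type*} [MeasurableSpace α] {v : α → E3} (hv : Measurable v)
    (M : ℕ) (r : ℝ) : Measurable fun p : α × E3 => (chiBig M r (v p.1) p.2 : ℂ) := by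
  unfold chiBig
  have := (continuous_chi M).measurable
  fun_prop

/-- Outside the box `χ_u` vanishes, so the indicator in the projection may be dropped. What is left
is a translate of one fixed window with subtracted mean, to which the multiplier formula applies. -/
lemma chiBig_mul_projQ (M : ℕ) {ℓ : ℝ} (hℓ : 0 < ℓ) (u : E3) (f : E3 → ℂ) :
    (fun x => (chiBig M ℓ u x : ℂ) * projQ (bigBox ℓ u) f x)
      = shiftWindow (chiWin M ℓ) (cube 0 ℓ) (cubeInv ℓ) ℓ f u := by
  have hmem : ∀ z, z - ℓ • u ∈ cube 0 ℓ ↔ z ∈ bigBox ℓ u := fun z => by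
    have := mem_cube_sub 0 (ℓ • u) z ℓ
    rw [zero_add] at this
    exact this.symm
  have hint : ∫ z, f z * (cube 0 ℓ).indicator 1 (z - ℓ • u) = ∫ z in bigBox ℓ u, f z := by
    rw [← integral_indicator (measurableSet_bigBox ℓ u)]
    refine integral_congr_ae (Eventually.of_forall fun z => ?_)
    by_cases hz : z ∈ bigBox ℓ u
    · simp [hz, (hmem z).2 hz]
    · simp [hz, mt (hmem z).1 hz]
  ext x
  rw [shiftWindow, hint, chiWin_sub M hℓ.ne']
  by_cases hx : x ∈ bigBox ℓ u
  · rw [projQ, Set.indicator_of_mem hx, bigBox, volume_real_cube _ hℓ.le]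
    rfl
  · have : chiWin M ℓ (x - ℓ • u) = 0 := chiWin_eq_zero hℓ (mt (hmem x).1 hx)
    rw [chiWin_sub M hℓ.ne'] at this
    rw [this, zero_mul, zero_mul]

lemma kinBig_nonneg (M : ℕ) {b s d ℓ εT : ℝ} (hb : 0 ≤ b) (hd : 0 < d) (hℓ : 0 < ℓ) (hε : 0 ≤ εT)
    (hε1 : εT ≤ 1) (u : E3) {f : E3 → ℂ} (hf : MemLp f 2 volume) : 0 ≤ kinBig M b s d ℓ εT u f := by
  have h1 := neumannRatioForm_nonneg (U := interior (bigBox ℓ u)) (μ := ((d * ℓ) ^ 2)⁻¹)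
    (by positivity) (hf.restrict _)
  have h2 := formQ_nonneg (measurableSet_bigBox ℓ u) (volume_cube_ne_top _ hℓ.le) (hf.restrict _)
  have h3 := fun t g => dispersionForm_nonneg t g
  have h4 : 0 ≤ 1 - εT := by linarith
  unfold kinBig
  have := h3 (1 / 2 * (s * ℓ)⁻¹) (fun x => (chiBig M ℓ u x : ℂ) * projQ (bigBox ℓ u) f x)
  have := h3 (1 / 2 * (d * s * ℓ)⁻¹) (fun x => (chiBig M ℓ u x : ℂ) * projQ (bigBox ℓ u) f x)
  positivity

/-! ### Averages over the large boxes -/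

/-- The form of `Q_u` plus the mean term is the local `L²` norm. The latter two average to the
multipliers `|θ|²` and `1`, and the mean term can be cancelled because its average is finite. -/
lemma lintegral_formQ_bigBox {ℓ : ℝ} (hℓ : 0 < ℓ) {f : E3 → ℂ} (hfm : StronglyMeasurable f)
    (hf1 : Integrable f) (hf2 : MemLp f 2 volume) :
    ∫⁻ u, ENNReal.ofReal (formQ (bigBox ℓ u) f) = ∫⁻ k, ENNReal.ofReal
      (1 - ‖cubeInv ℓ * ∫ z in cube 0 ℓ, planeWave k z‖ ^ 2) * ‖𝓕 f k‖ₑ ^ 2 := by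
  set θ : E3 → ℂ := fun k => cubeInv ℓ * ∫ z in cube 0 ℓ, planeWave k z with hθ
  have hS := measurableSet_cube 0 ℓ
  have hS' := volume_cube_ne_top 0 hℓ.le
  have hθc : Continuous θ := (continuous_setIntegral_planeWave hS').const_mul _
  have hθ1 : ∀ k, ‖θ k‖ ≤ 1 := norm_mean_planeWave_le hℓ
  have hmem : ∀ u z, z - ℓ • u ∈ cube 0 ℓ ↔ z ∈ bigBox ℓ u := fun u z => by
    have := mem_cube_sub 0 (ℓ • u) z ℓ
    rw [zero_add] at this
    exact this.symm
  set g : E3 → ℂ := (cube 0 ℓ).indicator 1 with hg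
  have hint : ∀ u, ∫ z in bigBox ℓ u, f z = ∫ z, f z * g (z - ℓ • u) := fun u => by
    rw [← integral_indicator (measurableSet_bigBox ℓ u)]
    refine integral_congr_ae (Eventually.of_forall fun z => ?_)
    by_cases hz : z ∈ bigBox ℓ u
    · simp [hg, hz, (hmem u z).2 hz]
    · simp [hg, hz, mt (hmem u z).1 hz]
  have hgi : Integrable g := by
    have : IntegrableOn (1 : E3 → ℂ) (cube 0 ℓ) := integrableOn_const hS'
    exact this.integrable_indicator hS
  have hgb : ∀ x, ‖g x‖ ≤ 1 := fun x => by
    by_cases hx : x ∈ cube 0 ℓ <;> simp [hg, hx]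
  have hgF : ∀ k, 𝓕 g (-k) = ∫ z in cube 0 ℓ, planeWave k z := fun k => by
    rw [fourier_eq_planeWave, neg_neg, ← integral_indicator hS]
    refine integral_congr_ae (Eventually.of_forall fun z => ?_)
    by_cases hz : z ∈ cube 0 ℓ <;> simp [hg, hz]
  have hpt : ∀ u, ENNReal.ofReal (formQ (bigBox ℓ u) f)
      + ENNReal.ofReal ((ℓ ^ 3)⁻¹) * ‖∫ z, f z * g (z - ℓ • u)‖ₑ ^ 2
        = ∫⁻ x in bigBox ℓ u, ‖f x‖ₑ ^ 2 := fun u => by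
    have hB := measurableSet_bigBox ℓ u
    have hB' : volume (bigBox ℓ u) ≠ ⊤ := volume_cube_ne_top _ hℓ.le
    have hfB := hf2.restrict (bigBox ℓ u)
    have h1 := formQ_eq hB hB' hfB
    rw [bigBox, volume_real_cube _ hℓ.le, ← bigBox, hint] at h1
    rw [enorm_sq_eq_ofReal, ← ENNReal.ofReal_mul (by positivity),
      ← ENNReal.ofReal_add (formQ_nonneg hB hB' hfB) (by positivity), h1, sub_add_cancel,
      ofReal_integral_eq_lintegral_ofReal (hfB.integrable_norm_pow (by norm_num))
        (Eventually.of_forall fun _ => by positivity)]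
    simp_rw [← enorm_sq_eq_ofReal]
  have hcorr : ∫⁻ u, ENNReal.ofReal ((ℓ ^ 3)⁻¹) * ‖∫ z, f z * g (z - ℓ • u)‖ₑ ^ 2
      = ∫⁻ k, ‖θ k‖ₑ ^ 2 * ‖𝓕 f k‖ₑ ^ 2 := by
    rw [lintegral_const_mul' _ _ ENNReal.ofReal_ne_top,
      lintegral_comp_smul_inv hℓ fun y => ‖∫ z, f z * g (z - y)‖ₑ ^ 2,
      lintegral_correlation_sq hf1 hgi hgb, ← lintegral_const_mul' _ _ ENNReal.ofReal_ne_top,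
      ← lintegral_const_mul' _ _ ENNReal.ofReal_ne_top]
    refine lintegral_congr fun k => ?_
    rw [hgF, hθ]
    simp only [enorm_mul, mul_pow]
    have : ‖cubeInv ℓ‖ₑ = ENNReal.ofReal ((ℓ ^ 3)⁻¹) := by
      rw [← ofReal_norm, cubeInv, Complex.norm_real, Real.norm_of_nonneg (by positivity)]
    rw [this, inv_pow]
    ring
  have hsum : (∫⁻ u, ENNReal.ofReal (formQ (bigBox ℓ u) f)) + ∫⁻ k, ‖θ k‖ₑ ^ 2 * ‖𝓕 f k‖ₑ ^ 2
      = (∫⁻ k, ENNReal.ofReal (1 - ‖θ k‖ ^ 2) * ‖𝓕 f k‖ₑ ^ 2)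
        + ∫⁻ k, ‖θ k‖ₑ ^ 2 * ‖𝓕 f k‖ₑ ^ 2 := by
    have hq : Measurable fun u => ENNReal.ofReal (formQ (bigBox ℓ u) f) :=
      (stronglyMeasurable_formQ (T := {p : E3 × E3 | p.2 ∈ bigBox ℓ p.1}) (F := fun _ => f)
        (measurableSet_setOf_mem_bigBox ℓ)
        (hfm.comp_measurable measurable_snd)).measurable.ennreal_ofReal
    have hmF : Measurable (𝓕 f) := (continuous_fourier hf1).measurable
    have hm1 : Measurable fun k => ENNReal.ofReal (1 - ‖θ k‖ ^ 2) * ‖𝓕 f k‖ₑ ^ 2 :=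
      ((hθc.norm.pow 2).measurable.const_sub 1).ennreal_ofReal.mul (hmF.enorm.pow_const 2)
    rw [← hcorr, ← lintegral_add_left hq]
    simp_rw [hpt]
    rw [lintegral_lintegral_bigBox hℓ (hf2.1.enorm.pow_const 2), hcorr, ← lintegral_add_left hm1,
      ← lintegral_fourier_sq hf1 hf2]
    refine lintegral_congr fun k => ?_
    rw [← add_mul, enorm_sq_eq_ofReal (θ k), ← ENNReal.ofReal_add _ (by positivity), sub_add_cancel,
      ENNReal.ofReal_one, one_mul]
    have := pow_le_one₀ (n := 2) (norm_nonneg _) (hθ1 k)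
    linarith
  refine (ENNReal.add_left_inj (ne_of_lt (lt_of_le_of_lt (lintegral_mono fun k => ?_)
    (lintegral_enorm_sq_lt_top (memLp_fourier hf1 hf2))))).1 hsum
  refine mul_le_of_le_one_left' ?_
  rw [enorm_sq_eq_ofReal]
  exact ENNReal.ofReal_le_one.2 (pow_le_one₀ (norm_nonneg _) (hθ1 k))

/-- The cut-off resolvent multiplier. -/
def trialMultiplier (μ A k : ℝ) : ℝ := if k ≤ A then μ / (k ^ 2 + μ) else 0

lemma measurable_trialMultiplier (μ A : ℝ) : Measurable (trialMultiplier μ A) := by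
  unfold trialMultiplier
  exact Measurable.ite measurableSet_Iic (by fun_prop) measurable_const

lemma measurable_trialSymbol (μ A : ℝ) : Measurable (trialSymbol μ A) := by
  unfold trialSymbol
  exact Measurable.ite measurableSet_Iic (by fun_prop) measurable_const

/-- The trial function `𝓕⁻(m 𝓕 f)` on the whole space is used in every box. Here `m = μ/(k²+μ)`
minimizes `(1-m)² + μ⁻¹k²m²` pointwise, and is replaced by `0` above `A`. The cut-off gives bounded
momentum support, so that the trial function has a classical gradient although `f` is only in `L¹ ∩
L²`. -/
theorem lintegral_neumannRatioForm_le {ℓ μ A : ℝ} (hℓ : 0 < ℓ) (hμ : 0 < μ) {f : E3 → ℂ}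
    (hf1 : Integrable f) (hf2 : MemLp f 2 volume) :
    ∫⁻ u, ENNReal.ofReal (neumannRatioForm (interior (bigBox ℓ u)) μ f)
      ≤ ∫⁻ k, ENNReal.ofReal (μ⁻¹ * trialSymbol μ A (2 * Real.pi * ‖k‖)) * ‖𝓕 f k‖ₑ ^ 2 := by
  set m : E3 → ℝ := fun k => trialMultiplier μ A (2 * Real.pi * ‖k‖) with hm
  have hmm : Measurable m := (measurable_trialMultiplier μ A).comp (by fun_prop)
  have hm0 : ∀ k, 0 ≤ m k := fun k => by
    simp only [hm, trialMultiplier]; split_ifs <;> positivity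
  have hm1 : ∀ k, m k ≤ 1 := fun k => by
    simp only [hm, trialMultiplier]; split_ifs
    · exact (div_le_one (by positivity)).2 (by linarith [sq_nonneg (2 * Real.pi * ‖k‖)])
    · norm_num
  have hmA : ∀ k, m k ≠ 0 → 2 * Real.pi * ‖k‖ ≤ A := fun k h => by
    by_contra h'; exact h (by simp [hm, trialMultiplier, h'])
  set C := ∫ x, ‖f x‖ with hC
  have hFb : ∀ k, ‖𝓕 f k‖ ≤ C := fun k => VectorFourier.norm_fourierIntegral_le_integral_norm _ _ _ _ _
  set p : E3 → ℂ := fun k => (m k : ℂ) * 𝓕 f k with hp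
  have hpm : AEStronglyMeasurable p volume :=
    ((Complex.measurable_ofReal.comp hmm).mul (continuous_fourier hf1).measurable).aestronglyMeasurable
  have hpn : ∀ k, ‖p k‖ = m k * ‖𝓕 f k‖ := fun k => by
    rw [hp]; simp only [norm_mul, Complex.norm_real, Real.norm_of_nonneg (hm0 k)]
  have hpb : ∀ k, ‖p k‖ ≤ C := fun k => by
    rw [hpn]; exact (mul_le_of_le_one_left (norm_nonneg _) (hm1 k)).trans (hFb k)
  have hC0 : 0 ≤ C := (norm_nonneg _).trans (hpb 0)
  have hball : ∀ k, p k ≠ 0 → ‖k‖ ≤ A := fun k h => by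
    have h1 := hmA k fun h0 => h (by simp [hp, h0])
    have h2 := Real.pi_gt_three
    nlinarith [norm_nonneg k]
  have hind : ∀ B : ℝ, Integrable ((Metric.closedBall (0 : E3) A).indicator fun _ => B) := fun B =>
    (integrableOn_const (measure_closedBall_lt_top.ne)).integrable_indicator
      Metric.isClosed_closedBall.measurableSet
  have hp1 : Integrable p := (hind C).mono' hpm (Eventually.of_forall fun k => by
    by_cases h : p k = 0
    · rw [h, norm_zero]; exact Set.indicator_nonneg (fun _ _ => hC0) _
    · rw [Set.indicator_of_mem (by simpa using hball k h)]; exact hpb k)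
  have hp2 : MemLp p 2 volume := memLp_two_of_bounded hp1 hpb
  have hkb : ∀ k, ‖k‖ * ‖p k‖ ≤ (Metric.closedBall (0 : E3) A).indicator (fun _ => A * C) k := fun k => by
    by_cases h : p k = 0
    · rw [h, norm_zero, mul_zero]
      by_cases hk : k ∈ Metric.closedBall (0 : E3) A
      · rw [Set.indicator_of_mem hk]
        exact mul_nonneg ((norm_nonneg k).trans (by simpa using hk)) hC0
      · rw [Set.indicator_of_notMem hk]
    · rw [Set.indicator_of_mem (by simpa using hball k h)]
      exact mul_le_mul (hball k h) (hpb k) (norm_nonneg _) ((norm_nonneg k).trans (hball k h))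
  have hp1' : Integrable fun k => ‖k‖ * ‖p k‖ := (hind (A * C)).mono'
    (continuous_norm.aestronglyMeasurable.mul hpm.norm) (Eventually.of_forall fun k => by
      rw [Real.norm_of_nonneg (by positivity)]; exact hkb k)
  have hp2' : MemLp (fun k => ((2 * Real.pi * ‖k‖ : ℝ) : ℂ) * p k) 2 volume := by
    have hn : ∀ k, ‖((2 * Real.pi * ‖k‖ : ℝ) : ℂ) * p k‖ = 2 * Real.pi * (‖k‖ * ‖p k‖) := fun k => by
      rw [norm_mul, Complex.norm_real, Real.norm_of_nonneg (by positivity)]; ring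
    refine memLp_two_of_bounded (C := 2 * Real.pi * |A * C|) ?_ fun k => ?_
    · refine (hp1'.const_mul (2 * Real.pi)).mono' (AEStronglyMeasurable.mul ?_ hpm)
        (Eventually.of_forall fun k => (hn k).le)
      exact (by fun_prop : Continuous fun k : E3 => ((2 * Real.pi * ‖k‖ : ℝ) : ℂ)).aestronglyMeasurable
    · rw [hn]
      refine mul_le_mul_of_nonneg_left ((hkb k).trans ?_) (by positivity)
      by_cases hk : k ∈ Metric.closedBall (0 : E3) A
      · rw [Set.indicator_of_mem hk]; exact le_abs_self _
      · rw [Set.indicator_of_notMem hk]; positivity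
  obtain ⟨G, hG, hGn⟩ := exists_gradient_fourierInv hp1 hp2 hp1' hp2'
  have hres : ∀ u, volume.restrict (interior (bigBox ℓ u)) = volume.restrict (bigBox ℓ u) := fun u =>
    restrict_interior_cube _ _
  have hg2 : MemLp (𝓕⁻ p) 2 volume := by simpa using hG.memLp
  have hG2 : MemLp G 2 volume := by simpa using hG.memLp_grad
  have hmw : AEMeasurable (fun x => ‖f x - 𝓕⁻ p x‖ₑ ^ 2) := (hf2.1.sub hg2.1).enorm.pow_const 2
  have hmw2 : AEMeasurable (fun x => ‖f x - 𝓕⁻ p x‖ₑ ^ 2 + ENNReal.ofReal μ⁻¹ * ‖G x‖ₑ ^ 2) :=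
    hmw.add ((hG2.1.enorm.pow_const 2).const_mul _)
  calc _ ≤ ∫⁻ u, ∫⁻ x in bigBox ℓ u, (‖f x - 𝓕⁻ p x‖ₑ ^ 2 + ENNReal.ofReal μ⁻¹ * ‖G x‖ₑ ^ 2) := by
        refine lintegral_mono fun u => ?_
        refine (ofReal_neumannRatioForm_le hμ (hf2.restrict _)
          (hG.mono (Set.subset_univ _) MeasurableSet.univ)).trans_eq ?_
        rw [trialEnergy, hres, lintegral_add_left' hmw.restrict,
          lintegral_const_mul' _ _ ENNReal.ofReal_ne_top]
    _ = (∫⁻ x, ‖f x - 𝓕⁻ p x‖ₑ ^ 2) + ENNReal.ofReal μ⁻¹ * ∫⁻ x, ‖G x‖ₑ ^ 2 := by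
        rw [lintegral_lintegral_bigBox hℓ hmw2,
          lintegral_add_left' hmw, lintegral_const_mul' _ _ ENNReal.ofReal_ne_top]
    _ = ∫⁻ k, (‖𝓕 f k - p k‖ₑ ^ 2
          + ENNReal.ofReal μ⁻¹ * (ENNReal.ofReal ((2 * Real.pi * ‖k‖) ^ 2) * ‖p k‖ₑ ^ 2)) := by
        rw [lintegral_sub_fourierInv_sq hf1 hf2 hp1 hp2, hGn,
          ← lintegral_const_mul' _ _ ENNReal.ofReal_ne_top, lintegral_add_left']
        exact ((continuous_fourier hf1).aestronglyMeasurable.sub hpm).enorm.pow_const 2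
    _ = _ := by
        refine lintegral_congr fun k => ?_
        have e1 : ‖𝓕 f k - p k‖ = (1 - m k) * ‖𝓕 f k‖ := by
          rw [hp, show 𝓕 f k - (m k : ℂ) * 𝓕 f k = ((1 - m k : ℝ) : ℂ) * 𝓕 f k by push_cast; ring,
            norm_mul, Complex.norm_real, Real.norm_of_nonneg (by linarith [hm1 k])]
        simp only [enorm_sq_eq_ofReal]
        rw [e1, hpn]
        rw [← ENNReal.ofReal_mul (by positivity), ← ENNReal.ofReal_mul (by positivity),
          ← ENNReal.ofReal_add (by positivity) (by positivity), ← ENNReal.ofReal_mul]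
        · congr 1
          simp only [hm, trialMultiplier, trialSymbol]
          split_ifs
          · field_simp; ring
          · field_simp; ring
        · simp only [trialSymbol]; split_ifs <;> positivity

/-! ### Kinetic energy localization into the large boxes -/

/-- Each of the four terms averages to a Fourier multiplier or is bounded by one, and the sum of the
symbols is at most `(2π‖k‖)²`. The constant depends only on `M`, while the bound on `b` is
universal. -/
theorem exists_lintegral_kinBig_le (M : ℕ) (hM : 2 ≤ M) : ∃ C : ℝ, 1 ≤ C ∧
    ∀ b s d ℓ εT : ℝ, 0 < b → b ≤ 1 / 8 → 0 < s → 0 < d → d ≤ 1 → 0 < ℓ → 0 < εT → εT ≤ 1 / 2 →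
    512 * C ^ 2 * s ^ 2 ≤ 1 → ∀ f : E3 → ℂ, StronglyMeasurable f → Integrable f →
    MemLp f 2 volume → ∫⁻ u, ENNReal.ofReal (kinBig M b s d ℓ εT u f) ≤ momentL 1 f := by
  obtain ⟨C, hC1, hC⟩ := exists_symbol_bound_mean M hM
  refine ⟨C, hC1, fun b s d ℓ εT hb hb' hs hd hd1 hℓ hεT hεT' hsC f hfm hf1 hf2 => ?_⟩
  set μ := ((d * ℓ) ^ 2)⁻¹ with hμ
  have hμ0 : 0 < μ := by positivity
  set A := (4 * √C)⁻¹ * (1 / 2 * (d * s * ℓ)⁻¹) with hA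
  set W : E3 → E3 → ℂ := waveWindow (chiWin M ℓ) (cube 0 ℓ) (cubeInv ℓ) with hW
  set Z : E3 → E3 → ℂ := shiftWindow (chiWin M ℓ) (cube 0 ℓ) (cubeInv ℓ) ℓ f with hZ
  have hcw : Continuous (chiWin M ℓ) := continuous_chiWin M ℓ
  have hcs : HasCompactSupport (chiWin M ℓ) := hasCompactSupport_chiWin M hℓ
  have hS := measurableSet_cube 0 ℓ
  have hS' := volume_cube_ne_top 0 hℓ.le
  have hmF : Measurable (𝓕 f) := (continuous_fourier hf1).measurable
  have hmW : ∀ t, Measurable fun k => dispersionL t (W k) := fun t =>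
    measurable_dispersionL_param (continuous_waveWindow (lam := cubeInv ℓ) hcw hS').stronglyMeasurable t
  have hmZ : ∀ t, Measurable fun u => dispersionL t (Z u) := fun t =>
    measurable_dispersionL_param (stronglyMeasurable_shiftWindow hcw hS hfm) t
  have hmQ : Measurable fun u => ENNReal.ofReal (formQ (bigBox ℓ u) f) :=
    (stronglyMeasurable_formQ (T := {p : E3 × E3 | p.2 ∈ bigBox ℓ p.1}) (F := fun _ => f)
      (measurableSet_setOf_mem_bigBox ℓ)
      (hfm.comp_measurable measurable_snd)).measurable.ennreal_ofReal
  set θ : E3 → ℂ := fun k => cubeInv ℓ * ∫ z in cube 0 ℓ, planeWave k z with hθ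
  have hθc : Continuous θ := (continuous_setIntegral_planeWave hS').const_mul _
  set t := 1 / 2 * (s * ℓ)⁻¹ with ht
  set t' := 1 / 2 * (d * s * ℓ)⁻¹ with ht'
  have ht0 : 0 < t := by positivity
  have ht0' : 0 < t' := by positivity
  have h1εT : 0 ≤ 1 - εT := by linarith
  have hmD : Measurable fun u => ENNReal.ofReal (1 - εT) * dispersionL t (Z u)
      + ENNReal.ofReal εT * dispersionL t' (Z u) :=
    ((hmZ t).const_mul _).add ((hmZ t').const_mul _)
  have hmQ' : Measurable fun u => ENNReal.ofReal (b * (ℓ ^ 2)⁻¹) * ENNReal.ofReal (formQ (bigBox ℓ u) f) :=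
    hmQ.const_mul _
  have hmD1 : Measurable fun u => ENNReal.ofReal (1 - εT) * dispersionL t (Z u) := (hmZ t).const_mul _
  have hpt : ∀ u, ENNReal.ofReal (kinBig M b s d ℓ εT u f)
      ≤ ENNReal.ofReal (εT * μ) * ENNReal.ofReal (neumannRatioForm (interior (bigBox ℓ u)) μ f)
        + ENNReal.ofReal (b * (ℓ ^ 2)⁻¹) * ENNReal.ofReal (formQ (bigBox ℓ u) f)
        + (ENNReal.ofReal (1 - εT) * dispersionL t (Z u)
          + ENNReal.ofReal εT * dispersionL t' (Z u)) := fun u => by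
    rw [kinBig, chiBig_mul_projQ M hℓ u f]
    refine ENNReal.ofReal_add_le.trans (add_le_add (ENNReal.ofReal_add_le.trans (add_le_add
      (ENNReal.ofReal_mul (by positivity)).le (ENNReal.ofReal_mul (by positivity)).le))
      (ENNReal.ofReal_add_le.trans (add_le_add ?_ ?_)))
    · rw [ENNReal.ofReal_mul h1εT]
      exact mul_le_mul_right (ofReal_dispersionForm_le _ _) _
    · rw [ENNReal.ofReal_mul hεT.le]
      exact mul_le_mul_right (ofReal_dispersionForm_le _ _) _
  have hZi : ∀ t, ∫⁻ u, dispersionL t (Z u)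
      = ∫⁻ k, ENNReal.ofReal (ℓ⁻¹ ^ 3) * (‖𝓕 f k‖ₑ ^ 2 * dispersionL t (W k)) := fun t => by
    rw [lintegral_dispersionL_shiftWindow hcw hcs hS hS' hℓ hfm hf1,
      lintegral_const_mul' _ _ ENNReal.ofReal_ne_top]
  have hm2 : Measurable fun k => ‖𝓕 f k‖ₑ ^ 2 := hmF.enorm.pow_const 2
  have hmk : ∀ t, Measurable fun k => ENNReal.ofReal (ℓ⁻¹ ^ 3) * (‖𝓕 f k‖ₑ ^ 2 * dispersionL t (W k)) :=
    fun t => (hm2.mul (hmW t)).const_mul _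
  have hm3 : Measurable fun k => ENNReal.ofReal (εT * μ)
      * (ENNReal.ofReal (μ⁻¹ * trialSymbol μ A (2 * Real.pi * ‖k‖)) * ‖𝓕 f k‖ₑ ^ 2) :=
    ((((measurable_trialSymbol μ A).comp (by fun_prop : Measurable fun k : E3 =>
      2 * Real.pi * ‖k‖)).const_mul _).ennreal_ofReal.mul hm2).const_mul _
  have hm4 : Measurable fun k => ENNReal.ofReal (b * (ℓ ^ 2)⁻¹)
      * (ENNReal.ofReal (1 - ‖θ k‖ ^ 2) * ‖𝓕 f k‖ₑ ^ 2) :=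
    (((hθc.norm.pow 2).measurable.const_sub 1).ennreal_ofReal.mul hm2).const_mul _
  have hm34 : Measurable fun k => ENNReal.ofReal (εT * μ)
      * (ENNReal.ofReal (μ⁻¹ * trialSymbol μ A (2 * Real.pi * ‖k‖)) * ‖𝓕 f k‖ₑ ^ 2)
      + ENNReal.ofReal (b * (ℓ ^ 2)⁻¹) * (ENNReal.ofReal (1 - ‖θ k‖ ^ 2) * ‖𝓕 f k‖ₑ ^ 2) :=
    hm3.add hm4
  have hm5 : Measurable fun k => ENNReal.ofReal (1 - εT)
      * (ENNReal.ofReal (ℓ⁻¹ ^ 3) * (‖𝓕 f k‖ₑ ^ 2 * dispersionL t (W k))) := (hmk t).const_mul _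
  calc _ ≤ ∫⁻ u, (ENNReal.ofReal (εT * μ) * ENNReal.ofReal (neumannRatioForm (interior (bigBox ℓ u)) μ f)
        + ENNReal.ofReal (b * (ℓ ^ 2)⁻¹) * ENNReal.ofReal (formQ (bigBox ℓ u) f)
        + (ENNReal.ofReal (1 - εT) * dispersionL t (Z u)
          + ENNReal.ofReal εT * dispersionL t' (Z u))) := lintegral_mono hpt
    _ = ENNReal.ofReal (εT * μ) * (∫⁻ u, ENNReal.ofReal (neumannRatioForm (interior (bigBox ℓ u)) μ f))
        + ENNReal.ofReal (b * (ℓ ^ 2)⁻¹) * (∫⁻ u, ENNReal.ofReal (formQ (bigBox ℓ u) f))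
        + (ENNReal.ofReal (1 - εT) * (∫⁻ u, dispersionL t (Z u))
          + ENNReal.ofReal εT * (∫⁻ u, dispersionL t' (Z u))) := by
        rw [lintegral_add_right _ hmD, lintegral_add_right _ hmQ', lintegral_add_left hmD1]
        simp_rw [lintegral_const_mul' _ _ ENNReal.ofReal_ne_top]
    _ ≤ ENNReal.ofReal (εT * μ) * (∫⁻ k, ENNReal.ofReal (μ⁻¹ * trialSymbol μ A (2 * Real.pi * ‖k‖)) * ‖𝓕 f k‖ₑ ^ 2)
        + ENNReal.ofReal (b * (ℓ ^ 2)⁻¹) * (∫⁻ k, ENNReal.ofReal (1 - ‖θ k‖ ^ 2) * ‖𝓕 f k‖ₑ ^ 2)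
        + (ENNReal.ofReal (1 - εT) * (∫⁻ k, ENNReal.ofReal (ℓ⁻¹ ^ 3) * (‖𝓕 f k‖ₑ ^ 2 * dispersionL t (W k)))
          + ENNReal.ofReal εT * (∫⁻ k, ENNReal.ofReal (ℓ⁻¹ ^ 3) * (‖𝓕 f k‖ₑ ^ 2 * dispersionL t' (W k)))) := by
        rw [hZi, hZi, lintegral_formQ_bigBox hℓ hfm hf1 hf2]
        exact add_le_add_left (add_le_add_left (mul_le_mul_right
          (lintegral_neumannRatioForm_le hℓ hμ0 hf1 hf2) _) _) _
    _ = ∫⁻ k, (ENNReal.ofReal (εT * μ) * (ENNReal.ofReal (μ⁻¹ * trialSymbol μ A (2 * Real.pi * ‖k‖)) * ‖𝓕 f k‖ₑ ^ 2)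
        + ENNReal.ofReal (b * (ℓ ^ 2)⁻¹) * (ENNReal.ofReal (1 - ‖θ k‖ ^ 2) * ‖𝓕 f k‖ₑ ^ 2)
        + (ENNReal.ofReal (1 - εT) * (ENNReal.ofReal (ℓ⁻¹ ^ 3) * (‖𝓕 f k‖ₑ ^ 2 * dispersionL t (W k)))
          + ENNReal.ofReal εT * (ENNReal.ofReal (ℓ⁻¹ ^ 3) * (‖𝓕 f k‖ₑ ^ 2 * dispersionL t' (W k))))) := by
        rw [lintegral_add_left hm34, lintegral_add_left hm3, lintegral_add_left hm5]
        simp_rw [lintegral_const_mul' _ _ ENNReal.ofReal_ne_top]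
    _ ≤ momentL 1 f := by
        refine lintegral_mono fun k => ?_
        -- The averaging factor `ℓ⁻³` removes the volume of the box from both symbol bounds.
        have hcoef : ∀ t, 0 < t → ∃ F : ℝ, 0 ≤ F ∧ ENNReal.ofReal (ℓ⁻¹ ^ 3) * dispersionL t (W k) = ENNReal.ofReal F
            ∧ F ≤ max (2 * Real.pi * ‖k‖ - t) 0 ^ 2 + C * ℓ⁻¹ ^ 2
            ∧ F ≤ C * t⁻¹ ^ 2 * ((2 * Real.pi * ‖k‖) ^ 4 + (2 * Real.pi * ‖k‖) ^ 2 * ℓ⁻¹ ^ 2) := by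
          intro t ht
          obtain ⟨h1, h2⟩ := hC ℓ t hℓ ht k
          have hne : dispersionL t (W k) ≠ ⊤ := ne_top_of_le_ne_top ENNReal.ofReal_ne_top h1
          have hl : ℓ⁻¹ ^ 3 * ℓ ^ 3 = 1 := by field_simp
          have key : ∀ x : ℝ, 0 ≤ x → dispersionL t (W k) ≤ ENNReal.ofReal (ℓ ^ 3 * x) →
              ℓ⁻¹ ^ 3 * (dispersionL t (W k)).toReal ≤ x := fun x hx h => by
            have := ENNReal.toReal_le_of_le_ofReal (by positivity) h
            calc _ ≤ ℓ⁻¹ ^ 3 * (ℓ ^ 3 * x) := mul_le_mul_of_nonneg_left this (by positivity)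
              _ = x := by rw [← mul_assoc, hl, one_mul]
          refine ⟨ℓ⁻¹ ^ 3 * (dispersionL t (W k)).toReal, by positivity, ?_, key _ (by positivity) h1,
            key _ (by positivity) h2⟩
          rw [ENNReal.ofReal_mul (by positivity), ENNReal.ofReal_toReal hne]
        obtain ⟨F, hF0, hFe, hF1, hF2⟩ := hcoef t ht0
        obtain ⟨F', hF0', hFe', hF1', hF2'⟩ := hcoef t' ht0'
        have hq := one_sub_mean_planeWave_sq_le hℓ k
        have hθ0 : 0 ≤ 1 - ‖θ k‖ ^ 2 := by
          have := pow_le_one₀ (n := 2) (norm_nonneg _) (norm_mean_planeWave_le hℓ k)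
          simp only [hθ]
          linarith
        have hsym := symbol_inequality hC1 hs hd hℓ hd1 hεT hεT' hb hb' hsC (k := 2 * Real.pi * ‖k‖)
          (by positivity) hF1 hF2 hF1' hF2' (q := 1 - ‖θ k‖ ^ 2)
          (by linarith [sq_nonneg ‖θ k‖]) hq
        have hts : 0 ≤ trialSymbol μ A (2 * Real.pi * ‖k‖) := by
          simp only [trialSymbol]; split_ifs <;> positivity
        calc _ = (ENNReal.ofReal (εT * μ) * ENNReal.ofReal (μ⁻¹ * trialSymbol μ A (2 * Real.pi * ‖k‖))
              + ENNReal.ofReal (b * (ℓ ^ 2)⁻¹) * ENNReal.ofReal (1 - ‖θ k‖ ^ 2)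
              + (ENNReal.ofReal (1 - εT) * (ENNReal.ofReal (ℓ⁻¹ ^ 3) * dispersionL t (W k))
                + ENNReal.ofReal εT * (ENNReal.ofReal (ℓ⁻¹ ^ 3) * dispersionL t' (W k)))) * ‖𝓕 f k‖ₑ ^ 2 := by
              ring
          _ ≤ _ := by
              refine mul_le_mul_left ?_ _
              rw [hFe, hFe', ← ENNReal.ofReal_mul (by positivity), ← ENNReal.ofReal_mul (by positivity),
                ← ENNReal.ofReal_mul h1εT, ← ENNReal.ofReal_mul hεT.le,
                ← ENNReal.ofReal_add (by positivity) (by positivity),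
                ← ENNReal.ofReal_add (by positivity) (by positivity),
                ← ENNReal.ofReal_add (by positivity) (by positivity)]
              refine ENNReal.ofReal_le_ofReal ?_
              have e : εT * μ * (μ⁻¹ * trialSymbol μ A (2 * Real.pi * ‖k‖))
                  = εT * trialSymbol μ A (2 * Real.pi * ‖k‖) := by
                field_simp
              rw [e]
              exact hsym

/-! ### Kinetic energy localization of a large box into small boxes -/

lemma isClosed_bigBox (r : ℝ) (u : E3) : IsClosed (bigBox r u) := isClosed_cube _ _

lemma chiBig_eq_zero {M : ℕ} {r : ℝ} (hr : 0 < r) {u x : E3} (h : x ∉ bigBox r u) :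
    chiBig M r u x = 0 := by
  have h1 : x - r • u ∉ cube 0 r := by
    rwa [← mem_cube_sub, zero_add]
  have h2 := chiWin_eq_zero (M := M) hr h1
  rw [chiWin_sub M hr.ne'] at h2
  exact_mod_cast h2

lemma contDiff_chiBig (M : ℕ) (r : ℝ) (u : E3) : ContDiff ℝ M fun x => (chiBig M r u x : ℂ) :=
  Complex.ofRealCLM.contDiff.comp ((contDiff_chi M).comp (by fun_prop))

lemma norm_iteratedFDeriv_chiBig_le {M j : ℕ} {C r : ℝ} (hr : 0 < r)
    (h : ∀ x, ‖iteratedFDeriv ℝ j (chiWin M r) x‖ ≤ C) (u x : E3) :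
    ‖iteratedFDeriv ℝ j (fun x => (chiBig M r u x : ℂ)) x‖ ≤ C := by
  have e : (fun x => (chiBig M r u x : ℂ)) = fun x => chiWin M r (x - r • u) :=
    funext fun x => (chiWin_sub M hr.ne' u x).symm
  rw [e, iteratedFDeriv_comp_sub]
  exact h _

/-- Leibniz rule: a derivative costs `ℓ⁻¹` or `(dℓ)⁻¹`, hence at most `(dℓ)⁻¹`. Keeping the volume
of the actual intersection instead of `(dℓ)³` matters for boxes cut by the boundary of `B(u)`: it
will multiply the square of a mean over that same set. -/
theorem exists_momentL_chiSmall_le (M : ℕ) : ∃ C : ℝ, 1 ≤ C ∧ ∀ d ℓ : ℝ, 0 < d → d ≤ 1 → 0 < ℓ →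
    ∀ u u' : E3, momentL M (fun x => (chiSmall M d ℓ u u' x : ℂ))
      ≤ ENNReal.ofReal (C * (d * ℓ)⁻¹ ^ (2 * M)) * volume (smallBox d ℓ u u') := by
  obtain ⟨C, hC1, hC⟩ := exists_bound_iteratedFDeriv_chiWin M
  refine ⟨3 ^ (M + 1) * (2 ^ M * C ^ 2) ^ 2, ?_, fun d ℓ hd hd1 hℓ u u' => ?_⟩
  · have h1 : 1 ≤ C ^ 2 := one_le_pow₀ hC1
    have h2 : (1 : ℝ) ≤ 2 ^ M := one_le_pow₀ (by norm_num)
    have h3 : (1 : ℝ) ≤ 3 ^ (M + 1) := one_le_pow₀ (by norm_num)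
    have h4 : 1 ≤ 2 ^ M * C ^ 2 := one_le_mul_of_one_le_of_one_le h2 h1
    exact one_le_mul_of_one_le_of_one_le h3 (one_le_pow₀ h4)
  · have hr : 0 < d * ℓ := by positivity
    have hinv : ℓ⁻¹ ≤ (d * ℓ)⁻¹ := inv_anti₀ hr (mul_le_of_le_one_left hℓ.le hd1)
    have e : (fun x => (chiSmall M d ℓ u u' x : ℂ))
        = fun x => (chiBig M ℓ u x : ℂ) * (chiBig M (d * ℓ) u' x : ℂ) := by
      ext x; simp [chiSmall]
    have hzero : ∀ x, x ∉ smallBox d ℓ u u' →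
        (fun x => (chiBig M ℓ u x : ℂ) * (chiBig M (d * ℓ) u' x : ℂ)) x = 0 := fun x hx => by
      rw [smallBox, Set.mem_inter_iff, not_and_or] at hx
      rcases hx with hx | hx
      · simp [chiBig_eq_zero hℓ hx]
      · simp [chiBig_eq_zero hr hx]
    have hcl : IsClosed (smallBox d ℓ u u') := (isClosed_bigBox _ _).inter (isClosed_bigBox _ _)
    have hts : tsupport (fun x => (chiBig M ℓ u x : ℂ) * (chiBig M (d * ℓ) u' x : ℂ))
        ⊆ smallBox d ℓ u u' :=
      closure_minimal (fun x hx => by_contra fun h => hx (hzero x h)) hcl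
    have hcs : HasCompactSupport (fun x => (chiBig M ℓ u x : ℂ) * (chiBig M (d * ℓ) u' x : ℂ)) :=
      (isCompact_cube _ _).of_isClosed_subset (isClosed_tsupport _) (hts.trans Set.inter_subset_left)
    have hbd : ∀ x, ‖iteratedFDeriv ℝ M (fun x => (chiBig M ℓ u x : ℂ) * (chiBig M (d * ℓ) u' x : ℂ)) x‖
        ≤ 2 ^ M * C ^ 2 * (d * ℓ)⁻¹ ^ M := fun x => by
      refine (norm_iteratedFDeriv_mul_le (contDiff_chiBig M ℓ u) (contDiff_chiBig M (d * ℓ) u') x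
        le_rfl).trans ?_
      calc _ ≤ ∑ i ∈ Finset.range (M + 1), (M.choose i : ℝ) * (C ^ 2 * (d * ℓ)⁻¹ ^ M) := by
            refine Finset.sum_le_sum fun i hi => ?_
            have hiM : i ≤ M := Nat.lt_succ_iff.1 (Finset.mem_range.1 hi)
            rw [mul_assoc]
            refine mul_le_mul_of_nonneg_left ?_ (by positivity)
            have h1 := norm_iteratedFDeriv_chiBig_le hℓ (hC i hiM ℓ hℓ) u x
            have h2 := norm_iteratedFDeriv_chiBig_le hr (hC (M - i) (Nat.sub_le _ _) _ hr) u' x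
            have h3 : ℓ⁻¹ ^ i ≤ (d * ℓ)⁻¹ ^ i := pow_le_pow_left₀ (by positivity) hinv _
            have h4 : (d * ℓ)⁻¹ ^ M = (d * ℓ)⁻¹ ^ i * (d * ℓ)⁻¹ ^ (M - i) := by
              rw [← pow_add, Nat.add_sub_cancel' hiM]
            rw [h4]
            calc _ ≤ (C * ℓ⁻¹ ^ i) * (C * (d * ℓ)⁻¹ ^ (M - i)) :=
                  mul_le_mul h1 h2 (norm_nonneg _) (by positivity)
              _ ≤ (C * (d * ℓ)⁻¹ ^ i) * (C * (d * ℓ)⁻¹ ^ (M - i)) := by gcongr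
              _ = _ := by ring
        _ = _ := by
            rw [← Finset.sum_mul]
            have : (∑ i ∈ Finset.range (M + 1), (M.choose i : ℝ)) = 2 ^ M := by
              exact_mod_cast Nat.sum_range_choose M
            rw [this]; ring
    rw [e]
    refine (momentL_le_of_bound ((contDiff_chiBig M ℓ u).mul (contDiff_chiBig M (d * ℓ) u')) hcs hbd
      hts).trans_eq ?_
    congr 2
    rw [mul_pow (2 ^ M * C ^ 2), ← pow_mul, mul_comm M 2]
    ring

/-- The multiplier formula without subtraction of a mean, at the threshold `t = (sr)⁻¹`. Then
`(tr)⁻¹ = s` is the small parameter of the symbol bound, and `C s² ≤ 1` is its hypothesis. -/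
theorem exists_lintegral_dispersionL_window_le (M : ℕ) (hM : 1 ≤ M) : ∃ C : ℝ, 1 ≤ C ∧
    ∀ r s : ℝ, 0 < r → 0 < s → C * s ^ 2 ≤ 1 → ∀ h : E3 → ℂ, StronglyMeasurable h → Integrable h →
    MemLp h 2 volume → ∫⁻ u, dispersionL (s * r)⁻¹ (fun x => (chiBig M r u x : ℂ) * h x)
      ≤ dispersionL (1 / 2 * (s * r)⁻¹) h
        + ENNReal.ofReal (C * s ^ (2 * (M - 1)) * (r ^ 2)⁻¹) * ∫⁻ x, ‖h x‖ₑ ^ 2 := by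
  obtain ⟨C, hC1, hC⟩ := exists_symbol_bound_zero M hM
  refine ⟨C, hC1, fun r s hr hs hCs h hm hi hi2 => ?_⟩
  have ht : (0 : ℝ) < (s * r)⁻¹ := by positivity
  have htr : (s * r)⁻¹ * r = s⁻¹ := by field_simp
  have hS := measurableSet_cube (0 : E3) r
  have hS' := volume_cube_ne_top (0 : E3) hr.le
  have e : ∀ u, (fun x => (chiBig M r u x : ℂ) * h x) = shiftWindow (chiWin M r) (cube 0 r) 0 r h u :=
    fun u => by
      ext x
      rw [shiftWindow, chiWin_sub M hr.ne', zero_mul, sub_zero]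
  have hmF : Measurable (𝓕 h) := (continuous_fourier hi).measurable
  have hm1 : Measurable fun k => ENNReal.ofReal (max (2 * Real.pi * ‖k‖ - 1 / 2 * (s * r)⁻¹) 0 ^ 2)
      * ‖𝓕 h k‖ₑ ^ 2 := (measurable_dispersion _).mul (hmF.enorm.pow_const 2)
  simp_rw [e]
  rw [lintegral_dispersionL_shiftWindow (continuous_chiWin M r) (hasCompactSupport_chiWin M hr) hS hS'
    hr hm hi, ← lintegral_fourier_sq hi hi2, dispersionL, ← lintegral_const_mul' _ _ ENNReal.ofReal_ne_top,
    ← lintegral_const_mul' _ _ ENNReal.ofReal_ne_top, ← lintegral_add_left hm1]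
  refine lintegral_mono fun k => ?_
  have h1 := hC r (s * r)⁻¹ hr ht (by
    rw [htr, inv_pow, le_inv_comm₀ (by positivity) (by positivity)]
    rw [← one_div, le_div_iff₀ (by positivity)]; linarith) (cube 0 r) k
  rw [← add_mul, ← ENNReal.ofReal_add (by positivity) (by positivity)]
  calc _ ≤ ENNReal.ofReal (r⁻¹ ^ 3) * (‖𝓕 h k‖ₑ ^ 2 * _) := mul_le_mul_right (mul_le_mul_right h1 _) _
    _ = ENNReal.ofReal (r⁻¹ ^ 3) * ENNReal.ofReal (r ^ 3 * (max (2 * Real.pi * ‖k‖ - (s * r)⁻¹ / 2) 0 ^ 2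
          + C * ((s * r)⁻¹ * r)⁻¹ ^ (2 * (M - 1)) * r⁻¹ ^ 2)) * ‖𝓕 h k‖ₑ ^ 2 := by ring
    _ = _ := by
      rw [← ENNReal.ofReal_mul (by positivity), ← mul_assoc, htr, inv_inv]
      have : r⁻¹ ^ 3 * r ^ 3 = 1 := by field_simp
      rw [this, one_mul, inv_pow, div_eq_inv_mul, one_div]

lemma lintegral_projQ_sq {S : Set E3} (hS : MeasurableSet S) (hS' : volume S ≠ ⊤)
    (hS0 : volume.real S ≠ 0) {f : E3 → ℂ} (hf : MemLp f 2 (volume.restrict S)) :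
    ∫⁻ x, ‖projQ S f x‖ₑ ^ 2 = ENNReal.ofReal (formQ S f) := by
  have : IsFiniteMeasure (volume.restrict S) := ⟨by simpa using hS'.lt_top⟩
  have hi : Integrable f (volume.restrict S) := hf.integrable (by norm_num)
  set c : ℂ := ((volume.real S)⁻¹ : ℝ) * ∫ z in S, f z with hc
  have hfc : MemLp (fun x => f x - c) 2 (volume.restrict S) := hf.sub (memLp_const c)
  have e1 : ∫⁻ x, ‖projQ S f x‖ₑ ^ 2 = ∫⁻ x in S, ‖f x - c‖ₑ ^ 2 := by
    rw [← lintegral_indicator hS]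
    refine lintegral_congr fun x => ?_
    by_cases hx : x ∈ S <;> simp [projQ, hx, hc]
  rw [e1, formQ_eq hS hS' hf]
  simp_rw [enorm_sq_eq_ofReal]
  rw [← ofReal_integral_eq_lintegral_ofReal (hfc.integrable_norm_pow (by norm_num))
    (Eventually.of_forall fun _ => by positivity)]
  congr 1
  have e2 : ∀ x, ‖f x - c‖ ^ 2 = ‖f x‖ ^ 2 - 2 * (conj c * f x).re + ‖c‖ ^ 2 := fun x => by
    rw [← Complex.normSq_eq_norm_sq, ← Complex.normSq_eq_norm_sq, ← Complex.normSq_eq_norm_sq,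
      Complex.normSq_sub, mul_comm (f x)]
    ring
  have hre : Integrable (fun x => (conj c * f x).re) (volume.restrict S) := (hi.const_mul _).re
  have hre2 : Integrable (fun x => 2 * (conj c * f x).re) (volume.restrict S) := hre.const_mul _
  have hn : Integrable (fun x => ‖f x‖ ^ 2) (volume.restrict S) := hf.integrable_norm_pow (by norm_num)
  have e3 : ∫ x in S, (conj c * f x).re = (conj c * ∫ x in S, f x).re := by
    rw [← integral_const_mul]
    exact integral_re (hi.const_mul _)
  have hnr : Integrable (fun x => ‖f x‖ ^ 2 - 2 * (conj c * f x).re) (volume.restrict S) := hn.sub hre2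
  simp_rw [e2]
  rw [integral_add hnr (integrable_const _), integral_sub hn hre2, integral_const_mul, e3,
    integral_const, measureReal_restrict_apply_univ, smul_eq_mul]
  set V := volume.real S
  set I := ∫ x in S, f x
  have e4 : (conj c * I).re = V⁻¹ * ‖I‖ ^ 2 := by
    rw [hc, map_mul, Complex.conj_ofReal, mul_assoc, ← Complex.normSq_eq_conj_mul_self,
      ← Complex.ofReal_mul, Complex.ofReal_re, Complex.normSq_eq_norm_sq]
  have e5 : ‖c‖ ^ 2 = V⁻¹ ^ 2 * ‖I‖ ^ 2 := by
    rw [hc, norm_mul, mul_pow, Complex.norm_real, Real.norm_eq_abs, sq_abs]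
  rw [e4, e5]
  field_simp
  ring

lemma momentL_const_mul (j : ℕ) (c : ℂ) (g : E3 → ℂ) :
    momentL j (fun x => c * g x) = ‖c‖ₑ ^ 2 * momentL j g := by
  have h : ∀ ξ, 𝓕 (fun x => c * g x) ξ = c * 𝓕 g ξ := fun ξ => by
    rw [fourier_eq_planeWave, fourier_eq_planeWave, ← integral_const_mul]
    exact integral_congr_ae (Eventually.of_forall fun x => by ring)
  rw [momentL, momentL, ← lintegral_const_mul' _ _ (by finiteness)]
  refine lintegral_congr fun ξ => ?_
  rw [h, enorm_mul, mul_pow]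
  ring

lemma dispersionL_anti {t t' : ℝ} (h : t ≤ t') (g : E3 → ℂ) : dispersionL t' g ≤ dispersionL t g := by
  refine lintegral_mono fun ξ => mul_le_mul_left (ENNReal.ofReal_le_ofReal ?_) _
  exact pow_le_pow_left₀ (le_max_right _ _) (max_le_max (by linarith) le_rfl) 2

lemma stronglyMeasurable_projQ_const {S : Set E3} (hS : MeasurableSet S) {f : E3 → ℂ}
    (hf : StronglyMeasurable f) : StronglyMeasurable (projQ S f) :=
  (hf.sub stronglyMeasurable_const).indicator hS

lemma projQ_eq_zero {S : Set E3} (f : E3 → ℂ) {x : E3} (hx : x ∉ S) : projQ S f x = 0 :=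
  Set.indicator_of_notMem hx _

/-- The localized function of a small box in terms of the localized function of the large box. -/
lemma chiSmall_mul_projQ (M : ℕ) {d ℓ : ℝ} (hd : 0 < d) (hℓ : 0 < ℓ) (u u' : E3) {f : E3 → ℂ}
    (hf : IntegrableOn f (bigBox ℓ u)) : ∃ c : ℂ,
      (fun x => (chiSmall M d ℓ u u' x : ℂ) * projQ (smallBox d ℓ u u') f x)
        = (fun x => (chiBig M (d * ℓ) u' x : ℂ) * ((chiBig M ℓ u x : ℂ) * projQ (bigBox ℓ u) f x)
            - c * (chiSmall M d ℓ u u' x : ℂ)) ∧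
      (volume.real (smallBox d ℓ u u') ≠ 0 → c = ((volume.real (smallBox d ℓ u u'))⁻¹ : ℝ)
        * ∫ x in smallBox d ℓ u u', projQ (bigBox ℓ u) f x) := by
  set S := smallBox d ℓ u u' with hS
  set B := bigBox ℓ u with hB
  have hSB : S ⊆ B := Set.inter_subset_left
  have hSm : MeasurableSet S := measurableSet_smallBox d ℓ u u'
  have hS' : volume S ≠ ⊤ := volume_smallBox_ne_top d hℓ.le u u'
  set m : ℂ := ((volume.real B)⁻¹ : ℝ) * ∫ z in B, f z with hm
  -- The difference of the means of `f` over the small and the large box, which is the mean of `Q_u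
  -- f` over a small box of positive volume.
  refine ⟨((volume.real S)⁻¹ : ℝ) * (∫ z in S, f z) - m, funext fun x => ?_, fun h0 => ?_⟩
  · by_cases hx : x ∈ S
    · rw [projQ, projQ, Set.indicator_of_mem hx, Set.indicator_of_mem (hSB hx), chiSmall, hm]
      push_cast
      ring
    · have h0 : (chiSmall M d ℓ u u' x : ℂ) = 0 := by
        rw [hS, smallBox, Set.mem_inter_iff, not_and_or] at hx
        rw [chiSmall]
        rcases hx with hx | hx
        · rw [chiBig_eq_zero hℓ hx, zero_mul, Complex.ofReal_zero]
        · rw [chiBig_eq_zero (by positivity) hx, mul_zero, Complex.ofReal_zero]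
      have h1 : (chiBig M (d * ℓ) u' x : ℂ) * ((chiBig M ℓ u x : ℂ) * projQ B f x) = 0 := by
        rw [← mul_assoc, ← Complex.ofReal_mul, mul_comm (chiBig M (d * ℓ) u' x)]
        rw [chiSmall] at h0
        rw [h0, zero_mul]
      rw [h0, h1]
      ring
  · have e : ∫ x in S, projQ B f x = ∫ x in S, (f x - m) :=
      setIntegral_congr_fun hSm fun x hx => by rw [projQ, Set.indicator_of_mem (hSB hx)]
    have : IsFiniteMeasure (volume.restrict S) := ⟨by simpa using hS'.lt_top⟩
    rw [e, integral_sub (hf.mono_set hSB) (integrable_const _), integral_const,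
      measureReal_restrict_apply_univ, mul_sub, Complex.real_smul, ← mul_assoc, ← Complex.ofReal_mul,
      inv_mul_cancel₀ h0, Complex.ofReal_one, one_mul]

/-- The Neumann term gives the gaps of the small boxes. The dispersion at `1/(dsℓ)` in the small
boxes averages to the one at half the threshold in the large box, up to errors of order `s^(M-2)
(dℓ)⁻²` times the form of `Q_u`; the fraction `1-κ` of the gap term pays for them. Finiteness of the
large dispersion is assumed because it appears on the larger side as a real number. -/
theorem exists_lintegral_kinSmall_le (M : ℕ) (hM : 2 ≤ M) : ∃ C : ℝ, 1 ≤ C ∧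
    ∀ b s d ℓ εT κ : ℝ, 0 < b → 0 < s → 0 < d → d ≤ 1 → 0 < ℓ → 0 < εT → εT ≤ 1 → C * s ^ 2 ≤ 1 →
    C * s ^ (M - 2) * (d ^ 2)⁻¹ ≤ (1 - κ) * b → ∀ (u : E3) (f : E3 → ℂ), StronglyMeasurable f →
    MemLp f 2 volume →
    dispersionL (1 / 2 * (s * ℓ)⁻¹) (fun x => (chiBig M ℓ u x : ℂ) * projQ (bigBox ℓ u) f x) ≠ ⊤ →
    ∫⁻ u', ENNReal.ofReal (kinSmall M s d ℓ εT u u' f)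
      ≤ ENNReal.ofReal (kinBig M b s d ℓ εT u f - κ * b * (ℓ ^ 2)⁻¹ * formQ (bigBox ℓ u) f) := by
  obtain ⟨C₁, hC₁, hw⟩ := exists_lintegral_dispersionL_window_le M (by omega)
  obtain ⟨C₂, hC₂, hsm⟩ := exists_momentL_chiSmall_le M
  obtain ⟨C₃, hC₃, hbd⟩ := exists_bound_iteratedFDeriv_chiWin M
  refine ⟨C₁ * C₃ ^ 2 + C₃ ^ 4 + 2 * C₂, by nlinarith [sq_nonneg (C₃ ^ 2), sq_nonneg C₃],
    fun b s d ℓ εT κ hb hs hd hd1 hℓ hεT hεT1 hCs hCκ u f hfm hf2 hfin => ?_⟩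
  have hr : 0 < d * ℓ := by positivity
  have hC₃2 : 1 ≤ C₃ ^ 2 := one_le_pow₀ hC₃
  have hCs1 : C₁ * s ^ 2 ≤ 1 := by
    refine le_trans (mul_le_mul_of_nonneg_right ?_ (sq_nonneg s)) hCs
    nlinarith [sq_nonneg (C₃ ^ 2)]
  have hs1 : s ≤ 1 := by
    have h : s ^ 2 ≤ 1 := le_trans (le_mul_of_one_le_left (sq_nonneg s) hC₁) hCs1
    exact (pow_le_one_iff_of_nonneg hs.le (by norm_num)).1 h
  have hBm := measurableSet_bigBox ℓ u
  have hB' : volume (bigBox ℓ u) ≠ ⊤ := volume_cube_ne_top _ hℓ.le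
  have hB0 : volume.real (bigBox ℓ u) ≠ 0 := by rw [bigBox, volume_real_cube _ hℓ.le]; positivity
  have : IsFiniteMeasure (volume.restrict (bigBox ℓ u)) := ⟨by simpa using hB'.lt_top⟩
  have hfB : MemLp f 2 (volume.restrict (bigBox ℓ u)) := hf2.restrict _
  have hfi : IntegrableOn f (bigBox ℓ u) := hfB.integrable (by norm_num)
  set g := projQ (bigBox ℓ u) f with hg
  set h : E3 → ℂ := fun x => (chiBig M ℓ u x : ℂ) * g x with hh
  have hgm : StronglyMeasurable g := stronglyMeasurable_projQ_const hBm hfm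
  set P := ENNReal.ofReal (formQ (bigBox ℓ u) f) with hP
  have hgP : ∫⁻ x, ‖g x‖ₑ ^ 2 = P := lintegral_projQ_sq hBm hB' hB0 hfB
  have hg2 : MemLp g 2 volume := memLp_two_of_lintegral hgm.aestronglyMeasurable
    (by rw [hgP]; exact ENNReal.ofReal_lt_top)
  have hgi : Integrable g := by
    have h1 : Integrable g (volume.restrict (bigBox ℓ u)) := (hg2.restrict _).integrable (by norm_num)
    have h2 : IntegrableOn g (bigBox ℓ u) := h1
    exact (integrableOn_iff_integrable_of_support_subset fun x hx => by
      by_contra hc; exact hx (projQ_eq_zero f hc)).1 h2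
  have hχb : ∀ (r : ℝ), 0 < r → ∀ v x : E3, ‖(chiBig M r v x : ℂ)‖ ≤ C₃ := fun r hr v x => by
    have := hbd 0 (Nat.zero_le _) r hr (x - r • v)
    rwa [norm_iteratedFDeriv_zero, pow_zero, mul_one, chiWin_sub M hr.ne'] at this
  have hχm : ∀ r v, Continuous fun x => (chiBig M r v x : ℂ) := fun r v => (contDiff_chiBig M r v).continuous
  have hhm : StronglyMeasurable h := (hχm ℓ u).stronglyMeasurable.mul hgm
  have hhi : Integrable h := by
    have := integrable_mul_of_bounded hgi (hχm ℓ u).aestronglyMeasurable (hχb ℓ hℓ u)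
    exact this.congr (Eventually.of_forall fun x => mul_comm _ _)
  have hpt : ∀ r, 0 < r → ∀ v x : E3, ∀ z : ℂ, ‖(chiBig M r v x : ℂ) * z‖ₑ ^ 2
      ≤ ENNReal.ofReal (C₃ ^ 2) * ‖z‖ₑ ^ 2 := fun r hr v x z => by
    rw [ofReal_mul_enorm_sq (by positivity), enorm_sq_eq_ofReal, norm_mul, mul_pow]
    refine ENNReal.ofReal_le_ofReal (mul_le_mul_of_nonneg_right ?_ (by positivity))
    exact pow_le_pow_left₀ (norm_nonneg _) (hχb r hr v x) 2
  have hhP : ∫⁻ x, ‖h x‖ₑ ^ 2 ≤ ENNReal.ofReal (C₃ ^ 2) * P := by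
    rw [← hgP, ← lintegral_const_mul' _ _ ENNReal.ofReal_ne_top]
    exact lintegral_mono fun x => hpt ℓ hℓ u x _
  have hh2 : MemLp h 2 volume := memLp_two_of_lintegral hhm.aestronglyMeasurable
    (hhP.trans_lt (ENNReal.mul_lt_top ENNReal.ofReal_lt_top ENNReal.ofReal_lt_top))
  -- This value balances the loss `η` on the main part with the remainder of the rank-one part: the
  -- moment bound, with the factor `η⁻¹`, is again of size `η`.
  set η := s ^ (M - 2) * ((d * ℓ) ^ 2)⁻¹ with hη
  have hη0 : 0 < η := by positivity
  set t := (d * s * ℓ)⁻¹ with ht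
  have ht0 : 0 < t := by positivity
  have ht' : (s * (d * ℓ))⁻¹ = t := by rw [ht]; congr 1; ring
  -- one small box
  have hone : ∀ u', dispersionL t (fun x => (chiSmall M d ℓ u u' x : ℂ) * projQ (smallBox d ℓ u u') f x)
      ≤ dispersionL t (fun x => (chiBig M (d * ℓ) u' x : ℂ) * h x)
        + (ENNReal.ofReal η * (ENNReal.ofReal (C₃ ^ 2) * ∫⁻ x in bigBox (d * ℓ) u', ‖h x‖ₑ ^ 2)
          + ENNReal.ofReal (2 * C₂ * η) * ∫⁻ x in bigBox (d * ℓ) u', ‖g x‖ₑ ^ 2) := by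
    intro u'
    obtain ⟨c, hc, hc'⟩ := chiSmall_mul_projQ M hd hℓ u u' hfi
    rw [hc]
    set S := smallBox d ℓ u u' with hS
    have hSm : MeasurableSet S := measurableSet_smallBox d ℓ u u'
    have hS' : volume S ≠ ⊤ := volume_smallBox_ne_top d hℓ.le u u'
    have hai : Integrable fun x => (chiBig M (d * ℓ) u' x : ℂ) * h x := by
      have := integrable_mul_of_bounded hhi (hχm (d * ℓ) u').aestronglyMeasurable (hχb _ hr u')
      exact this.congr (Eventually.of_forall fun x => mul_comm _ _)
    have hale : ∫⁻ x, ‖(chiBig M (d * ℓ) u' x : ℂ) * h x‖ₑ ^ 2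
        ≤ ENNReal.ofReal (C₃ ^ 2) * ∫⁻ x in bigBox (d * ℓ) u', ‖h x‖ₑ ^ 2 := by
      rw [← lintegral_const_mul' _ _ ENNReal.ofReal_ne_top,
        ← lintegral_indicator (measurableSet_bigBox _ _)]
      refine lintegral_mono fun x => ?_
      by_cases hx : x ∈ bigBox (d * ℓ) u'
      · rw [Set.indicator_of_mem hx]; exact hpt _ hr u' x _
      · rw [chiBig_eq_zero hr hx]; simp
    have ha2 : MemLp (fun x => (chiBig M (d * ℓ) u' x : ℂ) * h x) 2 volume :=
      memLp_two_of_lintegral hai.1 (hale.trans_lt (ENNReal.mul_lt_top ENNReal.ofReal_lt_top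
        (lintegral_enorm_sq_lt_top (hh2.restrict _))))
    have hcont : Continuous fun x => (chiSmall M d ℓ u u' x : ℂ) := by
      have : Continuous fun x => (chiBig M ℓ u x : ℂ) * (chiBig M (d * ℓ) u' x : ℂ) :=
        (hχm ℓ u).mul (hχm (d * ℓ) u')
      simpa [chiSmall] using this
    have hbi : Integrable fun x => c * (chiSmall M d ℓ u u' x : ℂ) := by
      refine (hcont.integrable_of_hasCompactSupport ?_).const_mul c
      refine HasCompactSupport.intro (K := bigBox ℓ u) (isCompact_cube _ _) fun x hx => ?_
      rw [chiSmall, chiBig_eq_zero hℓ hx, zero_mul, Complex.ofReal_zero]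
    refine (dispersionL_sub_le hai ha2 hbi hη0).trans ?_
    rw [add_assoc]
    refine add_le_add le_rfl (add_le_add (mul_le_mul_right hale _) ?_)
    refine (lintegral_remainder_le_tail ht0 hη0 _ (M - 2)).trans ?_
    rw [Nat.sub_add_cancel hM, momentL_const_mul]
    -- Cauchy–Schwarz for the mean `c` makes the remainder a local `L²` norm of `Q_u f`, which adds
    -- up over the small boxes.
    have hcS : ‖c‖ₑ ^ 2 * volume S ≤ ∫⁻ x in bigBox (d * ℓ) u', ‖g x‖ₑ ^ 2 := by
      have hSr : S ⊆ bigBox (d * ℓ) u' := Set.inter_subset_right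
      refine le_trans ?_ (lintegral_mono_set hSr)
      by_cases h0 : volume.real S = 0
      · rw [(measureReal_eq_zero_iff hS').1 h0, mul_zero]; exact zero_le
      have hV : 0 < volume.real S := lt_of_le_of_ne measureReal_nonneg (Ne.symm h0)
      have hn := norm_setIntegral_sq_le hS' (hg2.restrict S)
      rw [hc' h0, enorm_sq_eq_ofReal, ← ofReal_measureReal hS', ← ENNReal.ofReal_mul (by positivity)]
      simp_rw [enorm_sq_eq_ofReal]
      rw [← ofReal_integral_eq_lintegral_ofReal ((hg2.restrict S).integrable_norm_pow (by norm_num))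
        (Eventually.of_forall fun _ => by positivity)]
      refine ENNReal.ofReal_le_ofReal ?_
      rw [norm_mul, Complex.norm_real, Real.norm_of_nonneg (by positivity), mul_pow]
      calc _ ≤ (volume.real S)⁻¹ ^ 2 * (volume.real S * ∫ x in S, ‖g x‖ ^ 2) * volume.real S :=
            mul_le_mul_of_nonneg_right (mul_le_mul_of_nonneg_left hn (by positivity)) hV.le
        _ = _ := by field_simp
    calc _ ≤ ENNReal.ofReal (t⁻¹ ^ (2 * (M - 2 + 1)) + t⁻¹ ^ (2 * (M - 2)) / η)
          * (‖c‖ₑ ^ 2 * (ENNReal.ofReal (C₂ * (d * ℓ)⁻¹ ^ (2 * M)) * volume S)) :=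
          mul_le_mul_right (mul_le_mul_right (hsm d ℓ hd hd1 hℓ u u') _) _
      _ = ENNReal.ofReal ((t⁻¹ ^ (2 * (M - 2 + 1)) + t⁻¹ ^ (2 * (M - 2)) / η) * (C₂ * (d * ℓ)⁻¹ ^ (2 * M)))
          * (‖c‖ₑ ^ 2 * volume S) := by
          rw [ENNReal.ofReal_mul (q := C₂ * (d * ℓ)⁻¹ ^ (2 * M)) (by positivity)]; ring
      _ ≤ _ := by
          refine mul_le_mul' (ENNReal.ofReal_le_ofReal ?_) hcS
          obtain ⟨n, rfl⟩ := Nat.exists_eq_add_of_le' hM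
          simp only [Nat.add_sub_cancel] at hη ⊢
          have e1 : t⁻¹ ^ (2 * (n + 1)) * (d * ℓ)⁻¹ ^ (2 * (n + 2)) = s ^ n * s ^ 2 * η := by
            rw [ht, hη]; simp only [inv_pow, inv_inv, mul_pow]; field_simp; try ring
          have e2 : t⁻¹ ^ (2 * n) / η * (d * ℓ)⁻¹ ^ (2 * (n + 2)) = η := by
            rw [ht, hη]; simp only [inv_pow, inv_inv, mul_pow]; field_simp; try ring
          have e3 : s ^ n * s ^ 2 ≤ 1 := mul_le_one₀ (pow_le_one₀ hs.le hs1) (by positivity)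
            (pow_le_one₀ hs.le hs1)
          calc _ = C₂ * (t⁻¹ ^ (2 * (n + 1)) * (d * ℓ)⁻¹ ^ (2 * (n + 2))
                + t⁻¹ ^ (2 * n) / η * (d * ℓ)⁻¹ ^ (2 * (n + 2))) := by ring
            _ = C₂ * (s ^ n * s ^ 2 * η + η) := by rw [e1, e2]
            _ ≤ C₂ * (1 * η + η) := by gcongr
            _ = _ := by ring
  -- the sum over the small boxes
  have hmh : Measurable fun x => ‖h x‖ₑ ^ 2 := hhm.measurable.enorm.pow_const 2
  have hmg : Measurable fun x => ‖g x‖ₑ ^ 2 := hgm.measurable.enorm.pow_const 2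
  have hmW : Measurable fun u' => dispersionL t (fun x => (chiBig M (d * ℓ) u' x : ℂ) * h x) := by
    refine measurable_dispersionL_param (F := fun u' x => (chiBig M (d * ℓ) u' x : ℂ) * h x) ?_ t
    exact (measurable_chiBig_param measurable_id M (d * ℓ)).stronglyMeasurable.mul
      (hhm.comp_measurable measurable_snd)
  have hmQ : Measurable fun u' => ENNReal.ofReal (formQ (smallBox d ℓ u u') f) := by
    refine (stronglyMeasurable_formQ (T := {p : E3 × E3 | p.2 ∈ smallBox d ℓ u p.1}) (F := fun _ => f)
      ?_ (hfm.comp_measurable measurable_snd)).measurable.ennreal_ofReal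
    exact (hBm.preimage measurable_snd).inter (measurableSet_setOf_mem_bigBox (d * ℓ))
  have hmQ' : Measurable fun u' => ENNReal.ofReal (εT * (1 + (Real.pi ^ 2)⁻¹)⁻¹ * ((d * ℓ) ^ 2)⁻¹)
      * ENNReal.ofReal (formQ (smallBox d ℓ u u') f) := hmQ.const_mul _
  have hmIh : Measurable fun u' => ∫⁻ x in bigBox (d * ℓ) u', ‖h x‖ₑ ^ 2 := by
    have : Measurable fun p : E3 × E3 =>
        {p : E3 × E3 | p.2 ∈ bigBox (d * ℓ) p.1}.indicator (fun p => ‖h p.2‖ₑ ^ 2) p :=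
      (hmh.comp measurable_snd).indicator (measurableSet_setOf_mem_bigBox (d * ℓ))
    refine (congrArg Measurable (funext fun u' => ?_)).mp (this.lintegral_prod_right' (ν := (volume : Measure E3)))
    rw [← lintegral_indicator (measurableSet_bigBox _ _)]
    rfl
  have hmIh' : Measurable fun u' => ENNReal.ofReal η
      * (ENNReal.ofReal (C₃ ^ 2) * ∫⁻ x in bigBox (d * ℓ) u', ‖h x‖ₑ ^ 2) :=
    (hmIh.const_mul _).const_mul _
  have hsum : ∫⁻ u', dispersionL t
        (fun x => (chiSmall M d ℓ u u' x : ℂ) * projQ (smallBox d ℓ u u') f x)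
      ≤ dispersionL (1 / 2 * t) h + ENNReal.ofReal ((1 - κ) * b * (ℓ ^ 2)⁻¹) * P := by
    refine (lintegral_mono hone).trans ?_
    rw [lintegral_add_left hmW, lintegral_add_left hmIh', lintegral_const_mul' _ _ ENNReal.ofReal_ne_top,
      lintegral_const_mul' _ _ ENNReal.ofReal_ne_top, lintegral_const_mul' _ _ ENNReal.ofReal_ne_top,
      lintegral_lintegral_bigBox hr hmh.aemeasurable, lintegral_lintegral_bigBox hr hmg.aemeasurable, hgP]
    have h1 := hw (d * ℓ) s hr hs hCs1 h hhm hhi hh2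
    rw [ht'] at h1
    -- The error from averaging the window has the higher power of `s`; the subtraction of the mean
    -- determines the order `s^(M-2)`.
    have h2 : s ^ (2 * (M - 1)) * ((d * ℓ) ^ 2)⁻¹ ≤ η := by
      rw [hη]
      exact mul_le_mul_of_nonneg_right (pow_le_pow_of_le_one hs.le hs1 (by omega)) (by positivity)
    calc _ ≤ dispersionL (1 / 2 * t) h
            + ENNReal.ofReal (C₁ * s ^ (2 * (M - 1)) * ((d * ℓ) ^ 2)⁻¹) * (ENNReal.ofReal (C₃ ^ 2) * P)
          + (ENNReal.ofReal η * (ENNReal.ofReal (C₃ ^ 2) * (ENNReal.ofReal (C₃ ^ 2) * P))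
            + ENNReal.ofReal (2 * C₂ * η) * P) := by
          gcongr
          exact h1.trans (add_le_add le_rfl (mul_le_mul_right hhP _))
      _ = dispersionL (1 / 2 * t) h + ENNReal.ofReal (C₁ * s ^ (2 * (M - 1)) * ((d * ℓ) ^ 2)⁻¹ * C₃ ^ 2
            + (η * C₃ ^ 2 * C₃ ^ 2 + 2 * C₂ * η)) * P := by
          rw [ENNReal.ofReal_add (by positivity) (by positivity),
            ENNReal.ofReal_add (by positivity) (by positivity), ENNReal.ofReal_mul (q := C₃ ^ 2) (by positivity),
            ENNReal.ofReal_mul (q := C₃ ^ 2) (by positivity), ENNReal.ofReal_mul (q := C₃ ^ 2) (by positivity)]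
          ring
      _ ≤ _ := by
          refine add_le_add le_rfl (mul_le_mul_left (ENNReal.ofReal_le_ofReal ?_) _)
          calc _ = C₁ * C₃ ^ 2 * (s ^ (2 * (M - 1)) * ((d * ℓ) ^ 2)⁻¹) + (C₃ ^ 4 + 2 * C₂) * η := by ring
            _ ≤ C₁ * C₃ ^ 2 * η + (C₃ ^ 4 + 2 * C₂) * η := by gcongr
            _ = (C₁ * C₃ ^ 2 + C₃ ^ 4 + 2 * C₂) * s ^ (M - 2) * (d ^ 2)⁻¹ * (ℓ ^ 2)⁻¹ := by
                rw [hη, mul_pow, mul_inv]; ring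
            _ ≤ _ := mul_le_mul_of_nonneg_right hCκ (by positivity)
  -- conclusion
  have hκ0 : 0 ≤ (1 - κ) * b := le_trans (by positivity) hCκ
  have htt : 1 / 2 * (s * ℓ)⁻¹ ≤ 1 / 2 * t := by
    rw [ht]
    refine mul_le_mul_of_nonneg_left (inv_anti₀ (by positivity) ?_) (by norm_num)
    have : d * (s * ℓ) ≤ 1 * (s * ℓ) := mul_le_mul_of_nonneg_right hd1 (by positivity)
    linarith
  have hfin' : dispersionL (1 / 2 * t) h ≠ ⊤ := ne_top_of_le_ne_top hfin (dispersionL_anti htt h)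
  have hD := ofReal_dispersionForm hhi hfin
  have hD' := ofReal_dispersionForm hhi hfin'
  have hDD : dispersionForm (1 / 2 * t) h ≤ dispersionForm (1 / 2 * (s * ℓ)⁻¹) h := by
    have := dispersionL_anti htt h
    rw [← hD, ← hD'] at this
    exact (ENNReal.ofReal_le_ofReal_iff (dispersionForm_nonneg _ _)).1 this
  have hrat := neumannRatioForm_nonneg (U := interior (bigBox ℓ u)) (μ := ((d * ℓ) ^ 2)⁻¹)
    (by positivity) (hf2.restrict _)
  have hQ0 := formQ_nonneg hBm hB' hfB
  have hDn := dispersionForm_nonneg (1 / 2 * t) h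
  have hsm0 : ∀ u', ENNReal.ofReal (kinSmall M s d ℓ εT u u' f)
      ≤ ENNReal.ofReal (εT * (1 + (Real.pi ^ 2)⁻¹)⁻¹ * ((d * ℓ) ^ 2)⁻¹)
          * ENNReal.ofReal (formQ (smallBox d ℓ u u') f)
        + dispersionL t (fun x => (chiSmall M d ℓ u u' x : ℂ) * projQ (smallBox d ℓ u u') f x) := fun u' => by
    rw [kinSmall]
    refine ENNReal.ofReal_add_le.trans (add_le_add ?_ (ofReal_dispersionForm_le _ _))
    rw [ENNReal.ofReal_mul (by positivity)]
  refine (lintegral_mono hsm0).trans ?_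
  rw [lintegral_add_left hmQ', lintegral_const_mul' _ _ ENNReal.ofReal_ne_top]
  refine (add_le_add (mul_le_mul_right (lintegral_formQ_smallBox_le hd hℓ u hfB) _) hsum).trans ?_
  rw [← hD', hP, ← ENNReal.ofReal_mul (by positivity), ← ENNReal.ofReal_mul (by positivity),
    ← ENNReal.ofReal_mul (by positivity), ← ENNReal.ofReal_add hDn (by positivity),
    ← ENNReal.ofReal_add (by positivity) (by positivity)]
  refine ENNReal.ofReal_le_ofReal ?_
  have hπ : (1 + (Real.pi ^ 2)⁻¹)⁻¹ * (1 + (Real.pi ^ 2)⁻¹) = 1 := inv_mul_cancel₀ (by positivity)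
  rw [kinBig]
  have e : εT * (1 + (Real.pi ^ 2)⁻¹)⁻¹ * ((d * ℓ) ^ 2)⁻¹ * ((1 + (Real.pi ^ 2)⁻¹)
      * neumannRatioForm (interior (bigBox ℓ u)) ((d * ℓ) ^ 2)⁻¹ f)
      = εT * ((d * ℓ) ^ 2)⁻¹ * neumannRatioForm (interior (bigBox ℓ u)) ((d * ℓ) ^ 2)⁻¹ f := by
    calc _ = (1 + (Real.pi ^ 2)⁻¹)⁻¹ * (1 + (Real.pi ^ 2)⁻¹) * (εT * ((d * ℓ) ^ 2)⁻¹
          * neumannRatioForm (interior (bigBox ℓ u)) ((d * ℓ) ^ 2)⁻¹ f) := by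
          generalize 1 + (Real.pi ^ 2)⁻¹ = w
          ring
      _ = _ := by rw [hπ, one_mul]
  -- The dispersion decreases with the threshold, so the convex combination of the two dispersions
  -- in the large box dominates the one with the higher threshold.
  have hlow : dispersionForm (1 / 2 * t) h
      ≤ (1 - εT) * dispersionForm (1 / 2 * (s * ℓ)⁻¹) h + εT * dispersionForm (1 / 2 * t) h := by
    have := mul_le_mul_of_nonneg_left hDD (by linarith : 0 ≤ 1 - εT)
    linarith
  rw [e]
  linarith

/-! ### Functions of one variable in the form domain -/

/-- The sequence `φ` of test functions in `U` converges in `H¹` to `f`, whose gradient is `G`. -/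
structure IsTestApprox (U : Set E3) (f : E3 → ℂ) (G : E3 → EuclideanSpace ℂ (Fin 3))
    (φ : ℕ → E3 → ℂ) : Prop where
  memLp : MemLp f 2 volume
  memLp_grad : MemLp G 2 volume
  contDiff : ∀ n, ContDiff ℝ ∞ (φ n)
  compact : ∀ n, HasCompactSupport (φ n)
  support : ∀ n, tsupport (φ n) ⊆ U
  tendsto : Tendsto (fun n => eLpNorm (fun x => φ n x - f x) 2 volume) atTop (𝓝 0)
  tendsto_grad : ∀ k, Tendsto (fun n => eLpNorm (fun x =>
    fderiv ℝ (φ n) x (EuclideanSpace.single k 1) - G x k) 2 volume) atTop (𝓝 0)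

lemma tendsto_integral_mul {g : ℕ → E3 → ℂ} {f η : E3 → ℂ} (hg : ∀ n, MemLp (g n) 2 volume)
    (hf : MemLp f 2 volume) (hη : MemLp η 2 volume)
    (h : Tendsto (fun n => eLpNorm (fun x => g n x - f x) 2 volume) atTop (𝓝 0)) :
    Tendsto (fun n => ∫ x, g n x * η x) atTop (𝓝 (∫ x, f x * η x)) := by
  rw [tendsto_iff_edist_tendsto_0]
  have hlim : Tendsto (fun n => eLpNorm (fun x => g n x - f x) 2 volume * eLpNorm η 2 volume) atTop
      (𝓝 0) := by
    simpa using ENNReal.Tendsto.mul_const h (Or.inr hη.2.ne)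
  refine tendsto_of_tendsto_of_tendsto_of_le_of_le tendsto_const_nhds hlim (fun _ => zero_le) fun n => ?_
  have h1 : Integrable (fun x => g n x * η x) := (hg n).integrable_mul hη
  have h2 : Integrable (fun x => f x * η x) := hf.integrable_mul hη
  rw [edist_eq_enorm_sub, ← integral_sub h1 h2]
  refine (enorm_integral_le_lintegral_enorm _).trans ?_
  have := eLpNorm_smul_le_mul_eLpNorm (p := 2) (q := 2) (r := 1) hη.1 ((hg n).sub hf).1
  rw [eLpNorm_one_eq_lintegral_enorm] at this
  refine le_trans (le_of_eq (lintegral_congr fun x => ?_)) this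
  simp [sub_mul]

/-- Convergence in `L¹` gives pointwise convergence of the Fourier integrals, and Fatou's lemma
gives lower semicontinuity of the moments. -/
lemma momentL_le_of_tendsto {φ : ℕ → E3 → ℂ} {f : E3 → ℂ} (hφ : ∀ n, Integrable (φ n))
    (hf : Integrable f) (h : Tendsto (fun n => ∫⁻ x, ‖φ n x - f x‖ₑ) atTop (𝓝 0)) {j : ℕ}
    {B : ℕ → ENNReal} {c : ENNReal} (hB : ∀ n, momentL j (φ n) ≤ B n) (hc : Tendsto B atTop (𝓝 c)) :
    momentL j f ≤ c := by
  have hpt : ∀ ξ, Tendsto (fun n => 𝓕 (φ n) ξ) atTop (𝓝 (𝓕 f ξ)) := fun ξ => by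
    rw [tendsto_iff_edist_tendsto_0]
    refine tendsto_of_tendsto_of_tendsto_of_le_of_le tendsto_const_nhds h (fun _ => zero_le) fun n => ?_
    have hi : ∀ g : E3 → ℂ, Integrable g → Integrable fun x => planeWave (-ξ) x * g x := fun g hg => by
      refine hg.bdd_mul (c := 1) ?_ (Eventually.of_forall fun x => (norm_planeWave (-ξ) x).le)
      exact (continuous_planeWave.comp (by fun_prop : Continuous fun x : E3 => (-ξ, x))).aestronglyMeasurable
    simp only [edist_eq_enorm_sub, fourier_eq_planeWave]
    rw [← integral_sub (hi _ (hφ n)) (hi _ hf)]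
    refine (enorm_integral_le_lintegral_enorm _).trans_eq (lintegral_congr fun x => ?_)
    rw [← mul_sub, enorm_mul, ← ofReal_norm, norm_planeWave, ENNReal.ofReal_one, one_mul]
  have hm : ∀ n, Measurable fun ξ => ENNReal.ofReal ((2 * Real.pi * ‖ξ‖) ^ (2 * j)) * ‖𝓕 (φ n) ξ‖ₑ ^ 2 :=
    fun n => (by fun_prop : Measurable fun ξ : E3 => ENNReal.ofReal ((2 * Real.pi * ‖ξ‖) ^ (2 * j))).mul
      ((continuous_fourier (hφ n)).measurable.enorm.pow_const 2)
  calc momentL j f = ∫⁻ ξ, liminf (fun n =>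
        ENNReal.ofReal ((2 * Real.pi * ‖ξ‖) ^ (2 * j)) * ‖𝓕 (φ n) ξ‖ₑ ^ 2) atTop := by
        refine lintegral_congr fun ξ => (Tendsto.liminf_eq ?_).symm
        refine ENNReal.Tendsto.const_mul ?_ (Or.inr ENNReal.ofReal_ne_top)
        exact ((ENNReal.continuous_pow 2).tendsto _).comp (hpt ξ).enorm
    _ ≤ liminf (fun n => momentL j (φ n)) atTop := lintegral_liminf_le hm
    _ ≤ liminf B atTop := liminf_le_liminf (Eventually.of_forall hB)
    _ = c := hc.liminf_eq

lemma lintegral_sum_sq_le {φ : E3 → ℂ} (hφ : ContDiff ℝ 1 φ) {G : E3 → EuclideanSpace ℂ (Fin 3)}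
    (hG : AEStronglyMeasurable G) :
    ∫⁻ x, ∑ k, ‖fderiv ℝ φ x (EuclideanSpace.single k 1)‖ₑ ^ 2
      ≤ ∑ k, (eLpNorm (fun x => G x k) 2 volume
        + eLpNorm (fun x => fderiv ℝ φ x (EuclideanSpace.single k 1) - G x k) 2 volume) ^ 2 := by
  have hc : ∀ k : Fin 3, Continuous fun x => fderiv ℝ φ x (EuclideanSpace.single k 1) := fun k =>
    (hφ.continuous_fderiv (by norm_num)).clm_apply continuous_const
  have hGk : ∀ k, AEStronglyMeasurable (fun x => G x k) := fun k =>
    (by fun_prop : Continuous fun z : EuclideanSpace ℂ (Fin 3) => z k).comp_aestronglyMeasurable hG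
  rw [lintegral_finsetSum _ fun k _ => ((hc k).measurable.enorm.pow_const 2)]
  refine Finset.sum_le_sum fun k _ => ?_
  rw [lintegral_enorm_sq]
  refine pow_le_pow_left₀ zero_le ?_ 2
  have := eLpNorm_add_le (p := 2) (hGk k) ((hc k).aestronglyMeasurable.sub (hGk k)) (by norm_num)
  rw [add_sub_cancel] at this
  exact this

namespace IsTestApprox

variable {U : Set E3} {f : E3 → ℂ} {G : E3 → EuclideanSpace ℂ (Fin 3)} {φ : ℕ → E3 → ℂ}

lemma contDiff_one (h : IsTestApprox U f G φ) (n : ℕ) : ContDiff ℝ 1 (φ n) :=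
  (h.contDiff n).of_le (by exact_mod_cast le_top)

lemma memLp_test (h : IsTestApprox U f G φ) (n : ℕ) : MemLp (φ n) 2 volume :=
  (h.contDiff n).continuous.memLp_of_hasCompactSupport (h.compact n)

lemma continuous_partial (h : IsTestApprox U f G φ) (n : ℕ) (k : Fin 3) :
    Continuous fun x => fderiv ℝ (φ n) x (EuclideanSpace.single k 1) :=
  ((h.contDiff_one n).continuous_fderiv (by norm_num)).clm_apply continuous_const

lemma memLp_partial (h : IsTestApprox U f G φ) (n : ℕ) (k : Fin 3) :
    MemLp (fun x => fderiv ℝ (φ n) x (EuclideanSpace.single k 1)) 2 volume :=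
  (h.continuous_partial n k).memLp_of_hasCompactSupport ((h.compact n).fderiv_apply ℝ _)

lemma hasH1Gradient (h : IsTestApprox U f G φ) : HasH1Gradient Set.univ f G := by
  refine ⟨by simpa using h.memLp, by simpa using h.memLp_grad, fun η h1 h2 _ k => ?_⟩
  rw [Measure.restrict_univ]
  have hη1 : Continuous fun x => ((η x : ℝ) : ℂ) := Complex.continuous_ofReal.comp h1.continuous
  have hηc : HasCompactSupport fun x => ((η x : ℝ) : ℂ) := h2.comp_left Complex.ofReal_zero
  have hη : ContDiff ℝ ∞ fun x => ((η x : ℝ) : ℂ) := Complex.ofRealCLM.contDiff.comp h1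
  have hfd : ∀ x, fderiv ℝ (fun x => ((η x : ℝ) : ℂ)) x (EuclideanSpace.single k 1)
      = ((fderiv ℝ η x (EuclideanSpace.single k 1) : ℝ) : ℂ) := fun x => by
    have hd : DifferentiableAt ℝ η x := (h1.differentiable (by simp)) x
    have := (Complex.ofRealCLM.hasFDerivAt.comp x hd.hasFDerivAt).fderiv
    have e : (fun x => ((η x : ℝ) : ℂ)) = Complex.ofRealCLM ∘ η := rfl
    rw [e, this]
    rfl
  have hdc : Continuous fun x => fderiv ℝ (fun x => ((η x : ℝ) : ℂ)) x (EuclideanSpace.single k 1) :=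
    (hη.continuous_fderiv (by simp)).clm_apply continuous_const
  have hds : HasCompactSupport fun x => fderiv ℝ (fun x => ((η x : ℝ) : ℂ)) x (EuclideanSpace.single k 1) :=
    hηc.fderiv_apply ℝ _
  have hd2 : MemLp (fun x => fderiv ℝ (fun x => ((η x : ℝ) : ℂ)) x (EuclideanSpace.single k 1)) 2 volume :=
    hdc.memLp_of_hasCompactSupport hds
  have hη2 : MemLp (fun x => ((η x : ℝ) : ℂ)) 2 volume := hη1.memLp_of_hasCompactSupport hηc
  have hGk : MemLp (fun x => G x k) 2 volume := h.memLp_grad.eval_piLp k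
  have l1 := tendsto_integral_mul h.memLp_test h.memLp hd2 h.tendsto
  have l2 := tendsto_integral_mul (fun n => h.memLp_partial n k) hGk hη2 (h.tendsto_grad k)
  have e : ∀ n, ∫ x, φ n x * fderiv ℝ (fun x => ((η x : ℝ) : ℂ)) x (EuclideanSpace.single k 1)
      = - ∫ x, fderiv ℝ (φ n) x (EuclideanSpace.single k 1) * ((η x : ℝ) : ℂ) := fun n =>
    integral_mul_fderiv_eq_neg_fderiv_mul_of_integrable
      ((h.memLp_partial n k).integrable_mul hη2) ((h.memLp_test n).integrable_mul hd2)
      ((h.memLp_test n).integrable_mul hη2) (fun x _ => ((h.contDiff n).differentiable (by simp)) x)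
      (fun x _ => (hη.differentiable (by simp)) x)
  simp_rw [e] at l1
  have := tendsto_nhds_unique l1 l2.neg
  simp_rw [hfd] at this
  exact this

lemma ae_eq_zero (h : IsTestApprox U f G φ) (hU : MeasurableSet U) : ∀ᵐ x, x ∉ U → f x = 0 := by
  have h0 : eLpNorm f 2 (volume.restrict Uᶜ) = 0 := by
    refine le_antisymm (ge_of_tendsto h.tendsto (Eventually.of_forall fun n => ?_)) zero_le
    refine le_trans (le_of_eq ?_) (eLpNorm_mono_measure _ (Measure.restrict_le_self (s := Uᶜ)))
    refine eLpNorm_congr_norm_ae ((ae_restrict_iff' hU.compl).2 (Eventually.of_forall fun x hx => ?_))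
    rw [image_eq_zero_of_notMem_tsupport fun hx' => hx (h.support n hx'), zero_sub, norm_neg]
  have := (eLpNorm_eq_zero_iff h.memLp.1.restrict (by norm_num)).1 h0
  have := (ae_restrict_iff' hU.compl).1 this
  exact this

/-- The function vanishes outside a set of finite measure, so `L²` implies `L¹` and the Fourier
integral is meaningful. -/
lemma integrable (h : IsTestApprox U f G φ) (hU : MeasurableSet U) (hU' : volume U ≠ ⊤) :
    Integrable f := by
  have : IsFiniteMeasure (volume.restrict U) := ⟨by simpa using hU'.lt_top⟩
  have h1 : IntegrableOn f U := (h.memLp.restrict U).integrable (by norm_num)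
  refine (h1.integrable_indicator hU).congr ?_
  filter_upwards [h.ae_eq_zero hU] with x hx
  by_cases hxU : x ∈ U
  · rw [Set.indicator_of_mem hxU]
  · rw [Set.indicator_of_notMem hxU, hx hxU]

lemma integrable_test (h : IsTestApprox U f G φ) (n : ℕ) : Integrable (φ n) :=
  (h.contDiff n).continuous.integrable_of_hasCompactSupport (h.compact n)

lemma tendsto_lintegral (h : IsTestApprox U f G φ) (hU : MeasurableSet U) (hU' : volume U ≠ ⊤) :
    Tendsto (fun n => ∫⁻ x, ‖φ n x - f x‖ₑ) atTop (𝓝 0) := by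
  have hlim : Tendsto (fun n => eLpNorm (fun x => φ n x - f x) 2 volume
      * volume U ^ (1 / (1 : ENNReal).toReal - 1 / (2 : ENNReal).toReal)) atTop (𝓝 0) := by
    simpa using ENNReal.Tendsto.mul_const h.tendsto
      (Or.inr (ENNReal.rpow_ne_top_of_nonneg (by norm_num) hU'))
  refine tendsto_of_tendsto_of_tendsto_of_le_of_le tendsto_const_nhds hlim (fun _ => zero_le) fun n => ?_
  have hm : AEStronglyMeasurable (fun x => φ n x - f x) volume := (h.memLp_test n).1.sub h.memLp.1
  have h1 : ∫⁻ x, ‖φ n x - f x‖ₑ = ∫⁻ x in U, ‖φ n x - f x‖ₑ := by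
    rw [← lintegral_indicator hU]
    refine lintegral_congr_ae ?_
    filter_upwards [h.ae_eq_zero hU] with x hx
    by_cases hxU : x ∈ U
    · rw [Set.indicator_of_mem hxU]
    · rw [Set.indicator_of_notMem hxU, hx hxU,
        image_eq_zero_of_notMem_tsupport fun hx' => hxU (h.support n hx')]
      simp
  have h2 := eLpNorm_le_eLpNorm_mul_rpow_measure_univ (p := 1) (q := 2) (by norm_num)
    (hm.restrict (s := U))
  rw [eLpNorm_one_eq_lintegral_enorm, Measure.restrict_apply_univ, ← h1] at h2
  exact h2.trans (mul_le_mul_left (eLpNorm_mono_measure _ Measure.restrict_le_self) _)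

lemma tendsto_bound (h : IsTestApprox U f G φ) :
    Tendsto (fun n => ∑ k, (eLpNorm (fun x => G x k) 2 volume + eLpNorm (fun x =>
      fderiv ℝ (φ n) x (EuclideanSpace.single k 1) - G x k) 2 volume) ^ 2) atTop
      (𝓝 (∫⁻ x, ‖G x‖ₑ ^ 2)) := by
  have e : ∫⁻ x, ‖G x‖ₑ ^ 2 = ∑ k, (eLpNorm (fun x => G x k) 2 volume + 0) ^ 2 := by
    simp_rw [← sum_enorm_sq_grad, add_zero, ← lintegral_enorm_sq]
    exact lintegral_finsetSum' _ fun k _ => ((h.memLp_grad.eval_piLp k).1.enorm.pow_const 2)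
  rw [e]
  refine tendsto_finsetSum _ fun k _ => ?_
  exact ((ENNReal.continuous_pow 2).tendsto _).comp (tendsto_const_nhds.add (h.tendsto_grad k))

/-- For test functions this is an identity, and the moment is lower semicontinuous. Here the
Dirichlet condition on `Λ` enters: extended by zero, the function has no additional energy at the
boundary. -/
theorem momentL_one_le (h : IsTestApprox U f G φ) (hU : MeasurableSet U) (hU' : volume U ≠ ⊤) :
    momentL 1 f ≤ ∫⁻ x, ‖G x‖ₑ ^ 2 := by
  refine momentL_le_of_tendsto h.integrable_test (h.integrable hU hU') (h.tendsto_lintegral hU hU')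
    (fun n => ?_) h.tendsto_bound
  rw [momentL_one (h.contDiff_one n) (h.compact n)]
  exact lintegral_sum_sq_le (h.contDiff_one n) h.memLp_grad.1

/-- Product rule for the approximating test functions and passage to the limit. Only finiteness will
matter, hence the crude constants; `6` counts three directions with a factor `2` each. -/
lemma momentL_one_mul_le (h : IsTestApprox U f G φ) (hU : MeasurableSet U) (hU' : volume U ≠ ⊤)
    {w : E3 → ℂ} (hw : ContDiff ℝ 1 w) (hwc : HasCompactSupport w) {A B : ℝ} (hA : ∀ x, ‖w x‖ ≤ A)
    (hB : ∀ x, ‖fderiv ℝ w x‖ ≤ B) : momentL 1 (fun x => w x * f x)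
      ≤ ENNReal.ofReal (2 * A ^ 2) * (∫⁻ x, ‖G x‖ₑ ^ 2) + ENNReal.ofReal (6 * B ^ 2) * ∫⁻ x, ‖f x‖ₑ ^ 2 := by
  have hA0 : 0 ≤ A := (norm_nonneg _).trans (hA 0)
  have hB0 : 0 ≤ B := (norm_nonneg _).trans (hB 0)
  have hAe : ∀ x, ‖w x‖ₑ ≤ ENNReal.ofReal A := fun x => by
    rw [← ofReal_norm]; exact ENNReal.ofReal_le_ofReal (hA x)
  have hi : ∀ g : E3 → ℂ, Integrable g → Integrable fun x => w x * g x := fun g hg =>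
    (integrable_mul_of_bounded hg hw.continuous.aestronglyMeasurable hA).congr
      (Eventually.of_forall fun x => mul_comm _ _)
  have hL1 : Tendsto (fun n => ∫⁻ x, ‖w x * φ n x - w x * f x‖ₑ) atTop (𝓝 0) := by
    have hlim : Tendsto (fun n => ENNReal.ofReal A * ∫⁻ x, ‖φ n x - f x‖ₑ) atTop (𝓝 0) := by
      simpa using ENNReal.Tendsto.const_mul (h.tendsto_lintegral hU hU') (Or.inr ENNReal.ofReal_ne_top)
    refine tendsto_of_tendsto_of_tendsto_of_le_of_le tendsto_const_nhds hlim (fun _ => zero_le) fun n => ?_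
    rw [← lintegral_const_mul' _ _ ENNReal.ofReal_ne_top]
    refine lintegral_mono fun x => ?_
    rw [← mul_sub, enorm_mul]
    exact mul_le_mul_left (hAe x) _
  set β : ℕ → ENNReal := fun n => ENNReal.ofReal (2 * A ^ 2)
      * (∑ k, (eLpNorm (fun x => G x k) 2 volume + eLpNorm (fun x =>
        fderiv ℝ (φ n) x (EuclideanSpace.single k 1) - G x k) 2 volume) ^ 2)
    + ENNReal.ofReal (6 * B ^ 2) * (eLpNorm f 2 volume + eLpNorm (fun x => φ n x - f x) 2 volume) ^ 2 with hβ
  have hβl : Tendsto β atTop (𝓝 (ENNReal.ofReal (2 * A ^ 2) * (∫⁻ x, ‖G x‖ₑ ^ 2)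
      + ENNReal.ofReal (6 * B ^ 2) * ∫⁻ x, ‖f x‖ₑ ^ 2)) := by
    have e : ∫⁻ x, ‖f x‖ₑ ^ 2 = (eLpNorm f 2 volume + 0) ^ 2 := by rw [add_zero, lintegral_enorm_sq]
    rw [e]
    refine Tendsto.add (ENNReal.Tendsto.const_mul h.tendsto_bound (Or.inr ENNReal.ofReal_ne_top))
      (ENNReal.Tendsto.const_mul ?_ (Or.inr ENNReal.ofReal_ne_top))
    exact ((ENNReal.continuous_pow 2).tendsto _).comp (tendsto_const_nhds.add h.tendsto)
  refine momentL_le_of_tendsto (fun n => hi _ (h.integrable_test n))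
    (hi _ (h.integrable hU hU')) hL1 (B := β) (fun n => ?_) hβl
  · rw [momentL_one (hw.mul (h.contDiff_one n)) (hwc.mul_right)]
    have hφm : Measurable (φ n) := (h.contDiff n).continuous.measurable
    have hdm := fun k => (h.continuous_partial n k).measurable
    have hpt : ∀ x, ∑ k, ‖fderiv ℝ (fun x => w x * φ n x) x (EuclideanSpace.single k 1)‖ₑ ^ 2
        ≤ ENNReal.ofReal (2 * A ^ 2) * (∑ k, ‖fderiv ℝ (φ n) x (EuclideanSpace.single k 1)‖ₑ ^ 2)
          + ENNReal.ofReal (6 * B ^ 2) * ‖φ n x‖ₑ ^ 2 := fun x => by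
      have hdw : DifferentiableAt ℝ w x := (hw.differentiable (by norm_num)) x
      have hdφ : DifferentiableAt ℝ (φ n) x := ((h.contDiff_one n).differentiable (by norm_num)) x
      have hk : ∀ k : Fin 3, ‖fderiv ℝ (fun x => w x * φ n x) x (EuclideanSpace.single k 1)‖ₑ ^ 2
          ≤ ENNReal.ofReal (2 * A ^ 2) * ‖fderiv ℝ (φ n) x (EuclideanSpace.single k 1)‖ₑ ^ 2
            + ENNReal.ofReal (2 * B ^ 2) * ‖φ n x‖ₑ ^ 2 := fun k => by
        have e : fderiv ℝ (fun x => w x * φ n x) x (EuclideanSpace.single k 1)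
            = w x * fderiv ℝ (φ n) x (EuclideanSpace.single k 1)
              + φ n x * fderiv ℝ w x (EuclideanSpace.single k 1) := by
          rw [fderiv_fun_mul hdw hdφ]; rfl
        rw [e]
        refine (enorm_add_sq_le _ _ one_pos).trans ?_
        have hb : ‖fderiv ℝ w x (EuclideanSpace.single k 1)‖ ≤ B := by
          refine (ContinuousLinearMap.le_opNorm _ _).trans ?_
          rw [PiLp.norm_single, norm_one, mul_one]
          exact hB x
        simp only [enorm_sq_eq_ofReal, norm_mul, mul_pow]
        rw [← ENNReal.ofReal_mul (by positivity), ← ENNReal.ofReal_mul (by positivity),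
          ← ENNReal.ofReal_mul (by positivity), ← ENNReal.ofReal_mul (by positivity)]
        refine add_le_add (ENNReal.ofReal_le_ofReal ?_) (ENNReal.ofReal_le_ofReal ?_)
        · have := pow_le_pow_left₀ (norm_nonneg _) (hA x) 2
          have := mul_le_mul_of_nonneg_right this
            (sq_nonneg ‖fderiv ℝ (φ n) x (EuclideanSpace.single k 1)‖)
          norm_num
          linarith
        · have := pow_le_pow_left₀ (norm_nonneg _) hb 2
          have := mul_le_mul_of_nonneg_left this (sq_nonneg ‖φ n x‖)
          norm_num
          linarith
      refine (Finset.sum_le_sum fun k _ => hk k).trans_eq ?_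
      rw [Finset.sum_add_distrib, ← Finset.mul_sum, Finset.sum_const, Finset.card_univ, Fintype.card_fin,
        nsmul_eq_mul, show 6 * B ^ 2 = 3 * (2 * B ^ 2) by ring, ENNReal.ofReal_mul (by norm_num : (0:ℝ) ≤ 3),
        ENNReal.ofReal_ofNat, ← mul_assoc]
      norm_num
    refine (lintegral_mono hpt).trans ?_
    have hm2 : Measurable fun x => ENNReal.ofReal (6 * B ^ 2) * ‖φ n x‖ₑ ^ 2 :=
      (hφm.enorm.pow_const 2).const_mul _
    rw [lintegral_add_right _ hm2, lintegral_const_mul' _ _ ENNReal.ofReal_ne_top,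
      lintegral_const_mul' _ _ ENNReal.ofReal_ne_top]
    refine add_le_add (mul_le_mul_right (lintegral_sum_sq_le (h.contDiff_one n) h.memLp_grad.1) _)
      (mul_le_mul_right ?_ _)
    rw [lintegral_enorm_sq]
    refine pow_le_pow_left₀ zero_le ?_ 2
    have := eLpNorm_add_le (p := 2) h.memLp.1 ((h.memLp_test n).1.sub h.memLp.1) (by norm_num)
    rw [add_sub_cancel] at this
    exact this

end IsTestApprox

/-- A qualitative bound, with a constant depending on all parameters. It ensures that the dispersion
form of the large box is a genuine integral, not the default value `0`, when it serves as an upper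
bound for the small boxes. -/
theorem exists_dispersionL_localized_le {U : Set E3} (hU : MeasurableSet U) (hU' : volume U ≠ ⊤)
    {M : ℕ} (hM : 2 ≤ M) {ℓ t : ℝ} (hℓ : 0 < ℓ) (ht : 0 < t) (u : E3) :
    ∃ K : ENNReal, K ≠ ⊤ ∧ ∀ f G φ, IsTestApprox U f G φ →
      dispersionL t (fun x => (chiBig M ℓ u x : ℂ) * projQ (bigBox ℓ u) f x)
        ≤ K * ((∫⁻ x, ‖f x‖ₑ ^ 2) + ∫⁻ x, ‖G x‖ₑ ^ 2) := by
  set w : E3 → ℂ := fun x => (chiBig M ℓ u x : ℂ) with hw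
  have hwM : ContDiff ℝ M w := contDiff_chiBig M ℓ u
  have hw2 : ContDiff ℝ (2 : ℕ) w := hwM.of_le (by exact_mod_cast hM)
  have hw1 : ContDiff ℝ (1 : ℕ) w := hwM.of_le (by exact_mod_cast (by omega : 1 ≤ M))
  have hwc : HasCompactSupport w := HasCompactSupport.intro (K := bigBox ℓ u) (isCompact_cube _ _)
    fun x hx => by simp only [hw]; rw [chiBig_eq_zero hℓ hx, Complex.ofReal_zero]
  have hts : tsupport w ⊆ bigBox ℓ u := closure_minimal (fun x hx => by
    by_contra hc; exact hx (by simp only [hw]; rw [chiBig_eq_zero hℓ hc, Complex.ofReal_zero]))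
    (isClosed_bigBox _ _)
  have hB' : volume (bigBox ℓ u) ≠ ⊤ := volume_cube_ne_top _ hℓ.le
  have hV : 0 < volume.real (bigBox ℓ u) := by rw [bigBox, volume_real_cube _ hℓ.le]; positivity
  obtain ⟨A, hA⟩ := hw1.continuous.bounded_above_of_compact_support hwc
  obtain ⟨B, hB⟩ := (hw1.continuous_fderiv (by norm_num)).bounded_above_of_compact_support
    (hwc.fderiv (𝕜 := ℝ))
  have hA0 : 0 ≤ A := (norm_nonneg _).trans (hA 0)
  have hwi : Integrable w := hw1.continuous.integrable_of_hasCompactSupport hwc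
  have hmom : ∀ j ≤ 2, momentL j w ≠ ⊤ := fun j hj => by
    have hwj : ContDiff ℝ j w := hw2.of_le (by exact_mod_cast hj)
    obtain ⟨B, hB⟩ := (hwj.continuous_iteratedFDeriv le_rfl).bounded_above_of_compact_support
      (hwc.iteratedFDeriv j)
    exact ne_top_of_le_ne_top (ENNReal.mul_ne_top ENNReal.ofReal_ne_top hB')
      (momentL_le_of_bound hwj hwc hB hts)
  have hm1 := hmom 1 (by norm_num)
  have hm2 := hmom 2 le_rfl
  set V := ENNReal.ofReal (volume.real (bigBox ℓ u))⁻¹ with hVd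
  refine ⟨ENNReal.ofReal (2 * A ^ 2) + (ENNReal.ofReal (6 * B ^ 2) + ENNReal.ofReal 1 * ENNReal.ofReal (A ^ 2)
    + V * (momentL 1 w + ENNReal.ofReal 1⁻¹ * momentL 2 w)), by finiteness, fun f G φ h => ?_⟩
  have hi : Integrable fun x => w x * f x :=
    (integrable_mul_of_bounded (h.integrable hU hU') hw1.continuous.aestronglyMeasurable hA).congr
      (Eventually.of_forall fun x => mul_comm _ _)
  have hi2 : MemLp (fun x => w x * f x) 2 volume := by
    refine h.memLp.of_le_mul (c := A) hi.1 (Eventually.of_forall fun x => ?_)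
    rw [norm_mul]
    exact mul_le_mul_of_nonneg_right (hA x) (norm_nonneg _)
  have hi2n : ∫⁻ x, ‖w x * f x‖ₑ ^ 2 ≤ ENNReal.ofReal (A ^ 2) * ∫⁻ x, ‖f x‖ₑ ^ 2 := by
    rw [← lintegral_const_mul' _ _ ENNReal.ofReal_ne_top]
    refine lintegral_mono fun x => ?_
    rw [ofReal_mul_enorm_sq (by positivity), enorm_sq_eq_ofReal, norm_mul, mul_pow]
    exact ENNReal.ofReal_le_ofReal (mul_le_mul_of_nonneg_right
      (pow_le_pow_left₀ (norm_nonneg _) (hA x) 2) (by positivity))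
  set m : ℂ := ((volume.real (bigBox ℓ u))⁻¹ : ℝ) * ∫ z in bigBox ℓ u, f z with hm
  have hmn : ‖m‖ₑ ^ 2 ≤ V * ∫⁻ x, ‖f x‖ₑ ^ 2 := by
    have hn := norm_setIntegral_sq_le hB' (h.memLp.restrict (bigBox ℓ u))
    have e1 : ∫⁻ x in bigBox ℓ u, ‖f x‖ₑ ^ 2 ≤ ∫⁻ x, ‖f x‖ₑ ^ 2 := setLIntegral_le_lintegral _ _
    refine le_trans ?_ (mul_le_mul_right e1 _)
    simp_rw [enorm_sq_eq_ofReal]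
    rw [← ofReal_integral_eq_lintegral_ofReal ((h.memLp.restrict _).integrable_norm_pow (by norm_num))
        (Eventually.of_forall fun _ => by positivity), hVd, ← ENNReal.ofReal_mul (by positivity)]
    refine ENNReal.ofReal_le_ofReal ?_
    rw [hm, norm_mul, Complex.norm_real, Real.norm_of_nonneg (by positivity), mul_pow]
    calc _ ≤ (volume.real (bigBox ℓ u))⁻¹ ^ 2 * (volume.real (bigBox ℓ u) * ∫ x in bigBox ℓ u, ‖f x‖ ^ 2) :=
          mul_le_mul_of_nonneg_left hn (by positivity)
      _ = _ := by field_simp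
  have e : (fun x => w x * projQ (bigBox ℓ u) f x) = fun x => w x * f x - m * w x := by
    ext x
    by_cases hx : x ∈ bigBox ℓ u
    · rw [projQ, Set.indicator_of_mem hx]; ring
    · simp only [hw]; rw [chiBig_eq_zero hℓ hx]; simp
  rw [e]
  set F := ∫⁻ x, ‖f x‖ₑ ^ 2 with hF
  set D := ∫⁻ x, ‖G x‖ₑ ^ 2 with hD
  have h1 : dispersionL t (fun x => w x * f x)
      ≤ ENNReal.ofReal (2 * A ^ 2) * D + ENNReal.ofReal (6 * B ^ 2) * F := by
    refine (dispersionL_le_momentL ht 0 _).trans ?_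
    simp only [mul_zero, pow_zero, ENNReal.ofReal_one, one_mul, zero_add]
    exact h.momentL_one_mul_le hU hU' hw1 hwc hA hB
  have h2 := lintegral_remainder_le ht.le one_pos (hwi.const_mul m)
  rw [momentL_const_mul, momentL_const_mul] at h2
  have h3 := dispersionL_sub_le (t := t) hi hi2 (hwi.const_mul m) one_pos
  calc _ ≤ _ := h3
    _ ≤ (ENNReal.ofReal (2 * A ^ 2) * D + ENNReal.ofReal (6 * B ^ 2) * F)
        + ENNReal.ofReal 1 * (ENNReal.ofReal (A ^ 2) * F)
        + (‖m‖ₑ ^ 2 * momentL 1 w + ENNReal.ofReal 1⁻¹ * (‖m‖ₑ ^ 2 * momentL 2 w)) :=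
        add_le_add (add_le_add h1 (mul_le_mul_right hi2n _)) h2
    _ ≤ (ENNReal.ofReal (2 * A ^ 2) * D + ENNReal.ofReal (6 * B ^ 2) * F)
        + ENNReal.ofReal 1 * (ENNReal.ofReal (A ^ 2) * F)
        + (V * F * momentL 1 w + ENNReal.ofReal 1⁻¹ * (V * F * momentL 2 w)) := by gcongr
    _ = ENNReal.ofReal (2 * A ^ 2) * D + (ENNReal.ofReal (6 * B ^ 2) + ENNReal.ofReal 1 * ENNReal.ofReal (A ^ 2)
        + V * (momentL 1 w + ENNReal.ofReal 1⁻¹ * momentL 2 w)) * F := by ring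
    _ ≤ _ := by
        generalize ENNReal.ofReal (6 * B ^ 2) + ENNReal.ofReal 1 * ENNReal.ofReal (A ^ 2)
          + V * (momentL 1 w + ENNReal.ofReal 1⁻¹ * momentL 2 w) = y
        rw [add_mul, mul_add, mul_add]
        exact add_le_add le_add_self le_self_add

/-! ### Slices of many-particle functions -/

/-- Along indices with integrals at most `2⁻ⁿ` the sum of the functions is almost everywhere finite,
so its terms tend to zero. The indices need not increase. -/
lemma exists_seq_ae_tendsto_zero {α : Type*} [MeasurableSpace α] {ν : Measure α} {D : ℕ → α → ENNReal}
    (hm : ∀ n, AEMeasurable (D n) ν) (h : Tendsto (fun n => ∫⁻ a, D n a ∂ν) atTop (𝓝 0)) :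
    ∃ ns : ℕ → ℕ, ∀ᵐ a ∂ν, Tendsto (fun n => D (ns n) a) atTop (𝓝 0) := by
  have h1 : ∀ n : ℕ, ∃ m, ∫⁻ a, D m a ∂ν ≤ 2⁻¹ ^ n := fun n => by
    have hp : (0 : ENNReal) < 2⁻¹ ^ n := ENNReal.pow_pos (by simp) n
    exact (h.eventually (ge_mem_nhds hp)).exists
  choose ns hns using h1
  refine ⟨ns, ?_⟩
  have h2 : ∫⁻ a, ∑' n, D (ns n) a ∂ν ≠ ⊤ := by
    rw [lintegral_tsum fun n => hm (ns n)]
    refine ne_top_of_le_ne_top ?_ (ENNReal.tsum_le_tsum hns)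
    rw [ENNReal.tsum_geometric]
    simp
  filter_upwards [ae_lt_top' (AEMeasurable.tsum fun n => hm (ns n)) h2] with a ha
  exact ENNReal.tendsto_atTop_zero_of_tsum_ne_top ha.ne

section

variable {N : ℕ}

lemma measurable_insertAt (i : Fin N) :
    Measurable fun p : ({j : Fin N // j ≠ i} → E3) × E3 => insertAt i p.2 p.1 := by
  refine measurable_pi_lambda _ fun j => ?_
  by_cases h : j = i
  · simpa only [insertAt, dif_pos h] using measurable_snd
  · simp only [insertAt, dif_neg h]
    fun_prop

lemma measurePreserving_insertAt (i : Fin N) :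
    MeasurePreserving (fun p : ({j : Fin N // j ≠ i} → E3) × E3 => insertAt i p.2 p.1)
      (volume.prod volume) volume := by
  have h1 : MeasurePreserving
      (MeasurableEquiv.piEquivPiSubtypeProd (fun _ : Fin N => E3) (fun j => j = i)).symm volume volume := by
    convert (volume_preserving_piEquivPiSubtypeProd (fun _ : Fin N => E3) (fun j => j = i)).symm <;> rfl
  have h2 : MeasurePreserving (MeasurableEquiv.funUnique {j : Fin N // j = i} E3).symm volume volume := by
    convert (volume_preserving_funUnique {j : Fin N // j = i} E3).symm
  have h3 : MeasurePreserving (Prod.map (MeasurableEquiv.funUnique {j : Fin N // j = i} E3).symm id ∘ Prod.swap)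
      ((volume : Measure ({j : Fin N // ¬ j = i} → E3)).prod (volume : Measure E3)) volume :=
    (h2.prod (MeasurePreserving.id (volume : Measure ({j : Fin N // ¬ j = i} → E3)))).comp
      Measure.measurePreserving_swap
  have h4 := h1.comp h3
  refine (congrArg (fun g => MeasurePreserving g (volume.prod volume) volume) (funext fun p => ?_)).mp h4
  ext j : 1
  by_cases h : j = i
  · simp [insertAt, h, MeasurableEquiv.piEquivPiSubtypeProd, Equiv.piEquivPiSubtypeProd]
  · simp [insertAt, h, MeasurableEquiv.piEquivPiSubtypeProd, Equiv.piEquivPiSubtypeProd]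

lemma lintegral_insertAt (i : Fin N) {F : Config N → ENNReal} (hF : AEMeasurable F) :
    ∫⁻ X : {j : Fin N // j ≠ i} → E3, ∫⁻ x, F (insertAt i x X) = ∫⁻ x, F x := by
  have h := measurePreserving_insertAt i
  have hF' : AEMeasurable F (Measure.map (fun p : ({j : Fin N // j ≠ i} → E3) × E3 => insertAt i p.2 p.1)
      (volume.prod volume)) := by rwa [h.map_eq]
  have e1 := lintegral_map' hF' h.measurable.aemeasurable
  rw [h.map_eq] at e1
  rw [e1]
  exact (lintegral_prod _ (hF'.comp_measurable h.measurable)).symm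

lemma insertAt_eq_add (i : Fin N) (x : E3) (X : {j : Fin N // j ≠ i} → E3) :
    insertAt i x X = Pi.single i x + insertAt i 0 X := by
  ext j : 1
  by_cases h : j = i
  · subst h; simp [insertAt]
  · simp [insertAt, h]

lemma contDiff_insertAt (i : Fin N) (X : {j : Fin N // j ≠ i} → E3) :
    ContDiff ℝ ∞ fun x => insertAt i x X := by
  refine contDiff_pi.2 fun j => ?_
  by_cases h : j = i
  · simpa only [insertAt, dif_pos h] using contDiff_fun_id
  · simpa only [insertAt, dif_neg h] using contDiff_const

lemma hasFDerivAt_insertAt (i : Fin N) (X : {j : Fin N // j ≠ i} → E3) (x : E3) :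
    HasFDerivAt (fun x => insertAt i x X) (ContinuousLinearMap.single ℝ (fun _ : Fin N => E3) i) x := by
  have h := (ContinuousLinearMap.single ℝ (fun _ : Fin N => E3) i).hasFDerivAt (x := x)
  have e : (fun x => insertAt i x X)
      = fun x => ContinuousLinearMap.single ℝ (fun _ : Fin N => E3) i x + insertAt i 0 X :=
    funext fun x => insertAt_eq_add i x X
  rw [e]
  exact h.add_const _

/-- The `i`-th coordinate is a continuous left inverse. Closedness keeps supports compact when test
functions are restricted to a slice. -/
lemma isClosedEmbedding_insertAt (i : Fin N) (X : {j : Fin N // j ≠ i} → E3) :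
    Topology.IsClosedEmbedding fun x => insertAt i x X := by
  refine Function.LeftInverse.isClosedEmbedding (f := fun z : Config N => z i) (fun x => ?_)
    (continuous_apply i) (contDiff_insertAt i X).continuous
  simp [insertAt]

end

section

variable {N : ℕ}

lemma measurable_insertAt_left (i : Fin N) (X : {j : Fin N // j ≠ i} → E3) :
    Measurable fun x => insertAt i x X := (contDiff_insertAt i X).continuous.measurable

lemma ae_memLp_slice {F : Type*} [NormedAddCommGroup F] {Φ : Config N → F} (hm : StronglyMeasurable Φ)
    (h : MemLp Φ 2 volume) (i : Fin N) :
    ∀ᵐ X : {j : Fin N // j ≠ i} → E3, MemLp (fun x => Φ (insertAt i x X)) 2 volume := by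
  have hlt := lintegral_enorm_sq_lt_top h
  have hm2 : Measurable fun p : ({j : Fin N // j ≠ i} → E3) × E3 => ‖Φ (insertAt i p.2 p.1)‖ₑ ^ 2 :=
    (hm.comp_measurable (measurable_insertAt i)).enorm.pow_const 2
  rw [← lintegral_insertAt i (hm.enorm.pow_const 2).aemeasurable] at hlt
  filter_upwards [ae_lt_top (hm2.lintegral_prod_right' (ν := (volume : Measure E3))) hlt.ne] with X hX
  exact memLp_two_of_lintegral
    (hm.comp_measurable (measurable_insertAt_left i X)).aestronglyMeasurable hX

lemma interior_boxes_subset (L : ℝ) (i : Fin N) (X : {j : Fin N // j ≠ i} → E3) :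
    (fun x => insertAt i x X) ⁻¹' interior {x : Config N | ∀ i, x i ∈ Lam L} ⊆ interior (Lam L) := by
  intro x hx
  have e : {x : Config N | ∀ i, x i ∈ Lam L} = Set.univ.pi fun _ => Lam L := by ext; simp
  rw [Set.mem_preimage, e, interior_pi_set Set.finite_univ] at hx
  have := hx i (Set.mem_univ i)
  simpa [insertAt] using this

lemma tendsto_zero_of_pow {x : ℕ → ENNReal} (h : Tendsto (fun n => x n ^ 2) atTop (𝓝 0)) :
    Tendsto x atTop (𝓝 0) := by
  have := ((ENNReal.continuous_rpow_const (y := 1 / 2)).tendsto 0).comp h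
  rw [ENNReal.zero_rpow_of_pos (by norm_num)] at this
  refine this.congr fun n => ?_
  simp only [Function.comp]
  rw [← ENNReal.rpow_natCast, ← ENNReal.rpow_mul]
  norm_num

/-- Almost all slices of a function in the form domain are in the one-particle form domain. -/
theorem exists_slices {L : ℝ} {Ψ : Config N → ℂ} (hΨm : StronglyMeasurable Ψ)
    (hΨ : MemH10 (interior {x : Config N | ∀ i, x i ∈ Lam L}) Ψ) :
    ∃ G : Fin N → Config N → EuclideanSpace ℂ (Fin 3), (∀ i, StronglyMeasurable (G i)) ∧
      (∀ i, MemLp (G i) 2 volume) ∧ ∀ i, ∀ᵐ X : {j : Fin N // j ≠ i} → E3, ∃ φ,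
        IsTestApprox (interior (Lam L)) (fun x => Ψ (insertAt i x X)) (fun x => G i (insertAt i x X)) φ := by
  obtain ⟨h2, D₀, hD₀, φ, hφ, hφ0, hφ1⟩ := hΨ
  -- A strongly measurable representative, so that every slice is measurable.
  set D := hD₀.1.mk D₀ with hDd
  have hDm : StronglyMeasurable D := hD₀.1.stronglyMeasurable_mk
  have hDe : D₀ =ᵐ[volume] D := hD₀.1.ae_eq_mk
  have hD2 : MemLp D 2 volume := (memLp_congr_ae hDe).1 hD₀
  have hDt : Tendsto (fun n => eLpNorm (fderiv ℝ (φ n) - D) 2 volume) atTop (𝓝 0) :=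
    hφ1.congr fun n => eLpNorm_congr_ae ((ae_eq_refl _).sub hDe)
  set e : Fin N → Fin 3 → Config N := fun i k => Pi.single i (EuclideanSpace.single k 1) with he
  have he1 : ∀ i k, ‖e i k‖ ≤ 1 := fun i k => by
    rw [he]; simp only; rw [Pi.norm_single, PiLp.norm_single, norm_one]
  set G : Fin N → Config N → EuclideanSpace ℂ (Fin 3) := fun i z => WithLp.toLp 2 fun k => D z (e i k) with hG
  have hDe' : ∀ i k, StronglyMeasurable fun z => D z (e i k) := fun i k =>
    (by fun_prop : Continuous fun T : Config N →L[ℝ] ℂ => T (e i k)).comp_stronglyMeasurable hDm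
  have hGm : ∀ i, StronglyMeasurable (G i) := fun i =>
    ((PiLp.continuous_toLp 2 _).measurable.comp
      (measurable_pi_lambda _ fun k => (hDe' i k).measurable)).stronglyMeasurable
  have hop : ∀ (T : Config N →L[ℝ] ℂ) i k, ‖T (e i k)‖ ≤ ‖T‖ := fun T i k =>
    (T.le_opNorm _).trans (mul_le_of_le_one_right (norm_nonneg _) (he1 i k))
  have hG2 : ∀ i, MemLp (G i) 2 volume := fun i => by
    refine memLp_two_of_lintegral (hGm i).aestronglyMeasurable ?_
    have hlt := lintegral_enorm_sq_lt_top hD2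
    have hle : ∀ z, ‖G i z‖ₑ ^ 2 ≤ 3 * ‖D z‖ₑ ^ 2 := fun z => by
      have h3 : ‖G i z‖ₑ ^ 2 = ∑ k, ‖D z (e i k)‖ₑ ^ 2 := by
        simp only [enorm_sq_eq_ofReal]
        rw [← ENNReal.ofReal_sum_of_nonneg fun _ _ => by positivity, ← ofReal_norm,
          ← ENNReal.ofReal_pow (norm_nonneg _), EuclideanSpace.norm_sq_eq]
      rw [h3]
      calc _ ≤ ∑ _k : Fin 3, ‖D z‖ₑ ^ 2 := Finset.sum_le_sum fun k _ => by
            refine pow_le_pow_left₀ zero_le ?_ 2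
            rw [← ofReal_norm, ← ofReal_norm]
            exact ENNReal.ofReal_le_ofReal (hop _ _ _)
        _ = _ := by simp
    refine (lintegral_mono hle).trans_lt ?_
    rw [lintegral_const_mul' _ _ (by simp)]
    exact ENNReal.mul_lt_top (by simp) hlt
  refine ⟨G, hGm, hG2, fun i => ?_⟩
  have hφc : ∀ n, Continuous (φ n) := fun n => (hφ n).1.continuous
  have hφd : ∀ n, Continuous (fderiv ℝ (φ n)) := fun n => (hφ n).1.continuous_fderiv (by simp)
  -- the distances of the slices
  set d₀ : ℕ → Config N → ENNReal := fun n z => ‖φ n z - Ψ z‖ₑ ^ 2 with hd₀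
  set d₁ : ℕ → Config N → ENNReal := fun n z => ‖fderiv ℝ (φ n) z - D z‖ₑ ^ 2 with hd₁
  have m₀ : ∀ n, Measurable (d₀ n) := fun n =>
    ((hφc n).stronglyMeasurable.sub hΨm).enorm.pow_const 2
  have m₁ : ∀ n, Measurable (d₁ n) := fun n =>
    ((hφd n).stronglyMeasurable.sub hDm).enorm.pow_const 2
  have mX : ∀ F : Config N → ENNReal, Measurable F →
      Measurable fun X : {j : Fin N // j ≠ i} → E3 => ∫⁻ x, F (insertAt i x X) := fun F hF =>
    (hF.comp (measurable_insertAt i)).lintegral_prod_right' (ν := (volume : Measure E3))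
  -- By Tonelli the squared `H¹` distances of the slices have integrals tending to zero. A suitable
  -- sequence of indices then works for almost every slice, for the function and its gradient
  -- together.
  have hsum : Tendsto (fun n => ∫⁻ X : {j : Fin N // j ≠ i} → E3,
      ((∫⁻ x, d₀ n (insertAt i x X)) + ∫⁻ x, d₁ n (insertAt i x X))) atTop (𝓝 0) := by
    have e1 : ∀ n, ∫⁻ X : {j : Fin N // j ≠ i} → E3,
        ((∫⁻ x, d₀ n (insertAt i x X)) + ∫⁻ x, d₁ n (insertAt i x X))
        = eLpNorm (φ n - Ψ) 2 volume ^ 2 + eLpNorm (fderiv ℝ (φ n) - D) 2 volume ^ 2 := fun n => by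
      rw [lintegral_add_left (mX _ (m₀ n)), lintegral_insertAt i (m₀ n).aemeasurable,
        lintegral_insertAt i (m₁ n).aemeasurable, ← lintegral_enorm_sq, ← lintegral_enorm_sq]
      rfl
    simp_rw [e1]
    have := (((ENNReal.continuous_pow 2).tendsto _).comp hφ0).add
      (((ENNReal.continuous_pow 2).tendsto _).comp hDt)
    simpa using this
  obtain ⟨ns, hns⟩ := exists_seq_ae_tendsto_zero
    (fun n => ((mX _ (m₀ n)).add (mX _ (m₁ n))).aemeasurable) hsum
  filter_upwards [hns, ae_memLp_slice hΨm h2 i, ae_memLp_slice (hGm i) (hG2 i) i] with X hX hX1 hX2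
  have hem := isClosedEmbedding_insertAt i X
  have hfd : ∀ n x k, fderiv ℝ (fun x => φ (ns n) (insertAt i x X)) x (EuclideanSpace.single k 1)
      = fderiv ℝ (φ (ns n)) (insertAt i x X) (e i k) := fun n x k => by
    have hd : DifferentiableAt ℝ (φ (ns n)) (insertAt i x X) :=
      ((hφ (ns n)).1.differentiable (by simp)) _
    have := (hd.hasFDerivAt.comp x (hasFDerivAt_insertAt i X x)).fderiv
    have e2 : (fun x => φ (ns n) (insertAt i x X)) = φ (ns n) ∘ fun x => insertAt i x X := rfl
    rw [e2, this]
    rfl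
  refine ⟨fun n x => φ (ns n) (insertAt i x X), hX1, hX2, fun n => (hφ _).1.comp (contDiff_insertAt i X),
    fun n => (hφ (ns n)).2.1.comp_isClosedEmbedding hem, fun n => ?_, ?_, fun k => ?_⟩
  · refine (tsupport_comp_subset_preimage _ hem.continuous).trans ?_
    exact (Set.preimage_mono (hφ (ns n)).2.2).trans (interior_boxes_subset L i X)
  · refine tendsto_zero_of_pow (tendsto_of_tendsto_of_tendsto_of_le_of_le tendsto_const_nhds hX
      (fun _ => zero_le) fun n => ?_)
    simp only
    rw [← lintegral_enorm_sq]
    exact le_self_add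
  · refine tendsto_zero_of_pow (tendsto_of_tendsto_of_tendsto_of_le_of_le tendsto_const_nhds hX
      (fun _ => zero_le) fun n => ?_)
    simp only
    rw [← lintegral_enorm_sq]
    refine le_trans (lintegral_mono fun x => ?_) le_add_self
    simp only [hd₁]
    refine pow_le_pow_left₀ zero_le ?_ 2
    rw [hfd, ← ofReal_norm, ← ofReal_norm]
    exact ENNReal.ofReal_le_ofReal (hop (fderiv ℝ (φ (ns n)) (insertAt i x X) - D (insertAt i x X)) i k)

end

/-! ### Forms of almost everywhere equal functions -/

lemma projQ_congr_ae {S : Set E3} {f g : E3 → ℂ} (h : f =ᵐ[volume] g) : projQ S f =ᵐ[volume] projQ S g := by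
  have e : ∫ z in S, f z = ∫ z in S, g z := integral_congr_ae (ae_restrict_of_ae h)
  filter_upwards [h] with x hx
  by_cases hS : x ∈ S
  · rw [projQ, projQ, Set.indicator_of_mem hS, Set.indicator_of_mem hS, hx, e]
  · rw [projQ_eq_zero f hS, projQ_eq_zero g hS]

lemma formQ_congr_ae {S : Set E3} {f g : E3 → ℂ} (h : f =ᵐ[volume] g) : formQ S f = formQ S g := by
  rw [formQ, formQ]
  congr 1
  refine integral_congr_ae ?_
  filter_upwards [h, projQ_congr_ae (S := S) h] with x h1 h2
  rw [h1, h2]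

lemma dispersionForm_congr_ae {t : ℝ} {f g : E3 → ℂ} (h : f =ᵐ[volume] g) :
    dispersionForm t f = dispersionForm t g := by
  rw [dispersionForm, dispersionForm, fourier_congr_ae h]

lemma localized_congr_ae {w : E3 → ℂ} {S : Set E3} {f g : E3 → ℂ} (h : f =ᵐ[volume] g) :
    (fun x => w x * projQ S f x) =ᵐ[volume] fun x => w x * projQ S g x := by
  filter_upwards [projQ_congr_ae (S := S) h] with x hx
  rw [hx]

/-- Functions that agree almost everywhere have the same weak gradients as a predicate, so the
choice in the definition is literally the same. The same argument covers resolvents below. -/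
lemma gradEnergy_congr_ae {U : Set E3} {f g : E3 → ℂ} (h : f =ᵐ[volume] g) :
    gradEnergy U f = gradEnergy U g := by
  have e : HasH1Gradient U f = HasH1Gradient U g := by
    have key : ∀ {f g : E3 → ℂ}, f =ᵐ[volume] g → ∀ G, HasH1Gradient U f G → HasH1Gradient U g G :=
      fun {f g} h G hG => by
        have hr : f =ᵐ[volume.restrict U] g := ae_restrict_of_ae h
        refine ⟨(memLp_congr_ae hr).1 hG.memLp, hG.memLp_grad, fun φ h1 h2 h3 k => ?_⟩
        rw [← hG.weak φ h1 h2 h3 k]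
        refine integral_congr_ae ?_
        filter_upwards [hr] with x hx
        rw [hx]
    exact funext fun G => propext ⟨key h G, key h.symm G⟩
  unfold gradEnergy
  rw [e]

lemma neumannRatioForm_congr_ae {U : Set E3} {μ : ℝ} {f g : E3 → ℂ} (h : f =ᵐ[volume] g) :
    neumannRatioForm U μ f = neumannRatioForm U μ g := by
  have hr : f =ᵐ[volume.restrict U] g := ae_restrict_of_ae h
  have e : IsNeumannResolvent U μ f = IsNeumannResolvent U μ g := by
    ext k
    have : ∀ h : E3 → ℂ, ∫ x in U, conj (h x) * f x = ∫ x in U, conj (h x) * g x := fun h => by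
      refine integral_congr_ae ?_
      filter_upwards [hr] with x hx
      rw [hx]
    simp only [IsNeumannResolvent, this]
  unfold neumannRatioForm
  rw [e]
  split_ifs with hex
  · congr 1
    refine integral_congr_ae ?_
    filter_upwards [hr] with x hx
    rw [hx]
  · rfl

lemma kinBig_congr_ae {M : ℕ} {b s d ℓ εT : ℝ} {u : E3} {f g : E3 → ℂ} (h : f =ᵐ[volume] g) :
    kinBig M b s d ℓ εT u f = kinBig M b s d ℓ εT u g := by
  rw [kinBig, kinBig, neumannRatioForm_congr_ae h, formQ_congr_ae h,
    dispersionForm_congr_ae (localized_congr_ae h), dispersionForm_congr_ae (localized_congr_ae h)]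

lemma kinSmall_congr_ae {M : ℕ} {s d ℓ εT : ℝ} {u u' : E3} {f g : E3 → ℂ} (h : f =ᵐ[volume] g) :
    kinSmall M s d ℓ εT u u' f = kinSmall M s d ℓ εT u u' g := by
  rw [kinSmall, kinSmall, formQ_congr_ae h, dispersionForm_congr_ae (localized_congr_ae h)]

section

variable {N : ℕ} {Ψ : Config N → ℂ}

lemma secondQuant_congr {q : (E3 → ℂ) → ℝ} (hq : ∀ f g, f =ᵐ[volume] g → q f = q g) {Ψ' : Config N → ℂ}
    (h : Ψ =ᵐ[volume] Ψ') : secondQuant q Ψ = secondQuant q Ψ' := by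
  refine Finset.sum_congr rfl fun i _ => integral_congr_ae ?_
  have h1 := (measurePreserving_insertAt i).quasiMeasurePreserving.ae h
  filter_upwards [Measure.ae_ae_of_ae_prod h1] with X hX
  exact hq _ _ hX

lemma secondQuant_eq_sum {q : (E3 → ℂ) → ℝ} {K : ∀ i : Fin N, ({j : Fin N // j ≠ i} → E3) → ℝ}
    (h : ∀ i, ∀ᵐ X, q (fun x => Ψ (insertAt i x X)) = K i X) :
    secondQuant q Ψ = ∑ i, ∫ X, K i X :=
  Finset.sum_congr rfl fun i _ => integral_congr_ae (h i)

/-- The average over a parameter of a second quantized nonnegative form. -/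
theorem integrable_secondQuant {q : E3 → (E3 → ℂ) → ℝ}
    {K : ∀ i : Fin N, E3 → ({j : Fin N // j ≠ i} → E3) → ℝ}
    (hKm : ∀ i, StronglyMeasurable (Function.uncurry (K i)))
    (hK : ∀ i, ∀ᵐ X, ∀ u, q u (fun x => Ψ (insertAt i x X)) = K i u X)
    (hK0 : ∀ i, ∀ᵐ X, ∀ u, 0 ≤ K i u X)
    {c : ∀ i : Fin N, ({j : Fin N // j ≠ i} → E3) → ENNReal}
    (hc : ∀ i, ∀ᵐ X, ∫⁻ u, ENNReal.ofReal (q u (fun x => Ψ (insertAt i x X))) ≤ c i X)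
    (hfin : ∑ i, ∫⁻ X, c i X ≠ ⊤) :
    (∀ u, 0 ≤ secondQuant (q u) Ψ) ∧ Integrable (fun u => secondQuant (q u) Ψ) ∧
      ∫ u, secondQuant (q u) Ψ ≤ (∑ i, ∫⁻ X, c i X).toReal := by
  have hS : ∀ u, secondQuant (q u) Ψ = ∑ i, ∫ X, K i u X := fun u =>
    secondQuant_eq_sum fun i => by filter_upwards [hK i] with X hX using hX u
  have hnn : ∀ u, 0 ≤ secondQuant (q u) Ψ := fun u => by
    rw [hS]
    refine Finset.sum_nonneg fun i _ => integral_nonneg_of_ae ?_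
    filter_upwards [hK0 i] with X hX using hX u
  have hm : StronglyMeasurable fun u => secondQuant (q u) Ψ := by
    simp_rw [hS]
    refine Finset.stronglyMeasurable_fun_sum _ fun i _ => ?_
    exact StronglyMeasurable.integral_prod_right (ν := volume) (hKm i)
  have hmo : ∀ i, Measurable fun p : E3 × ({j : Fin N // j ≠ i} → E3) => ENNReal.ofReal (K i p.1 p.2) :=
    fun i => (hKm i).measurable.ennreal_ofReal
  have hle : ∫⁻ u, ENNReal.ofReal (secondQuant (q u) Ψ) ≤ ∑ i, ∫⁻ X, c i X := by
    calc _ ≤ ∫⁻ u, ∑ i, ∫⁻ X, ENNReal.ofReal (K i u X) := by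
          refine lintegral_mono fun u => ?_
          rw [hS, ENNReal.ofReal_sum_of_nonneg fun i _ => integral_nonneg_of_ae (by
            filter_upwards [hK0 i] with X hX using hX u)]
          refine Finset.sum_le_sum fun i _ => ?_
          -- If the integral over the other particles does not exist, its value is `0`, which is
          -- harmless in an upper bound.
          by_cases hi : Integrable (fun X => K i u X)
          · rw [ofReal_integral_eq_lintegral_ofReal hi (by
              filter_upwards [hK0 i] with X hX using hX u)]
          · rw [integral_undef hi]; simp
      _ = ∑ i, ∫⁻ X, ∫⁻ u, ENNReal.ofReal (K i u X) := by
          rw [lintegral_finsetSum _ fun i _ => (hmo i).lintegral_prod_right' (ν := volume)]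
          exact Finset.sum_congr rfl fun i _ => lintegral_lintegral_swap (hmo i).aemeasurable
      _ ≤ _ := by
          refine Finset.sum_le_sum fun i _ => lintegral_mono_ae ?_
          filter_upwards [hK i, hc i] with X h1 h2
          simpa only [h1] using h2
  refine ⟨hnn, ⟨hm.aestronglyMeasurable, ?_⟩, ?_⟩
  · rw [hasFiniteIntegral_iff_ofReal (Eventually.of_forall hnn)]
    exact hle.trans_lt hfin.lt_top
  · rw [integral_eq_lintegral_of_nonneg_ae (Eventually.of_forall hnn) hm.aestronglyMeasurable]
    exact ENNReal.toReal_mono hfin hle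

end

/-! ### Kinetic energy of many particles -/

section

variable {α : Type*} [MeasurableSpace α] {v v' : α → E3} {F : α → E3 → ℂ}

lemma exists_measurable_kinBig (M : ℕ) (b s : ℝ) {d ℓ : ℝ} (hd : 0 < d) (hℓ : 0 < ℓ) (εT : ℝ)
    (hv : Measurable v) (hF : StronglyMeasurable (Function.uncurry F)) :
    ∃ K : α → ℝ, StronglyMeasurable K ∧ ∀ a, MemLp (F a) 2 volume →
      kinBig M b s d ℓ εT (v a) (F a) = K a := by
  obtain ⟨R, hR, hRe⟩ := exists_measurable_neumannRatio (ℓ := ℓ) (μ := ((d * ℓ) ^ 2)⁻¹)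
    (by positivity) hv hF
  have hT := measurableSet_bigBox_param hv ℓ
  have h1 : StronglyMeasurable fun a => formQ (bigBox ℓ (v a)) (F a) := stronglyMeasurable_formQ hT hF
  have h2 : ∀ t, StronglyMeasurable fun a => dispersionForm t
      (fun x => (chiBig M ℓ (v a) x : ℂ) * projQ (bigBox ℓ (v a)) (F a) x) := fun t =>
    stronglyMeasurable_dispersionForm_param
      (F := fun a x => (chiBig M ℓ (v a) x : ℂ) * projQ (bigBox ℓ (v a)) (F a) x)
      ((measurable_chiBig_param hv M ℓ).stronglyMeasurable.mul (stronglyMeasurable_projQ hT hF)) t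
  refine ⟨fun a => εT * ((d * ℓ) ^ 2)⁻¹ * (R a).toReal + b * (ℓ ^ 2)⁻¹ * formQ (bigBox ℓ (v a)) (F a)
    + ((1 - εT) * dispersionForm (1 / 2 * (s * ℓ)⁻¹)
          (fun x => (chiBig M ℓ (v a) x : ℂ) * projQ (bigBox ℓ (v a)) (F a) x)
      + εT * dispersionForm (1 / 2 * (d * s * ℓ)⁻¹)
          (fun x => (chiBig M ℓ (v a) x : ℂ) * projQ (bigBox ℓ (v a)) (F a) x)), ?_, fun a ha => ?_⟩
  · exact ((hR.ennreal_toReal.stronglyMeasurable.const_mul _).add (h1.const_mul _)).add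
      (((h2 _).const_mul _).add ((h2 _).const_mul _))
  · simp only [kinBig]
    rw [← hRe a ha, ENNReal.toReal_ofReal
      (neumannRatioForm_nonneg (by positivity) (ha.restrict _))]

lemma stronglyMeasurable_kinSmall (M : ℕ) (s d ℓ εT : ℝ) (hv : Measurable v) (hv' : Measurable v')
    (hF : StronglyMeasurable (Function.uncurry F)) :
    StronglyMeasurable fun a => kinSmall M s d ℓ εT (v a) (v' a) (F a) := by
  have hT : MeasurableSet {p : α × E3 | p.2 ∈ smallBox d ℓ (v p.1) (v' p.1)} :=
    (measurableSet_bigBox_param hv ℓ).inter (measurableSet_bigBox_param hv' (d * ℓ))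
  have h1 : StronglyMeasurable fun a => formQ (smallBox d ℓ (v a) (v' a)) (F a) :=
    stronglyMeasurable_formQ hT hF
  have hχ : Measurable fun p : α × E3 => (chiSmall M d ℓ (v p.1) (v' p.1) p.2 : ℂ) := by
    simp only [chiSmall, Complex.ofReal_mul]
    exact (measurable_chiBig_param hv M ℓ).mul (measurable_chiBig_param hv' M (d * ℓ))
  have h2 : ∀ t, StronglyMeasurable fun a => dispersionForm t
      (fun x => (chiSmall M d ℓ (v a) (v' a) x : ℂ) * projQ (smallBox d ℓ (v a) (v' a)) (F a) x) := fun t =>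
    stronglyMeasurable_dispersionForm_param
      (F := fun a x => (chiSmall M d ℓ (v a) (v' a) x : ℂ) * projQ (smallBox d ℓ (v a) (v' a)) (F a) x)
      (hχ.stronglyMeasurable.mul (stronglyMeasurable_projQ hT hF)) t
  exact (h1.const_mul _).add (h2 _)

end

lemma neumannRatioForm_le_lintegral {U : Set E3} {μ : ℝ} (hμ : 0 < μ) {f : E3 → ℂ}
    (hf : MemLp f 2 volume) : ENNReal.ofReal (neumannRatioForm U μ f) ≤ ∫⁻ x, ‖f x‖ₑ ^ 2 := by
  have h0 : HasH1Gradient U (fun _ => 0) (fun _ => 0) :=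
    ⟨MemLp.zero, MemLp.zero, fun φ _ _ _ k => by simp⟩
  refine (ofReal_neumannRatioForm_le hμ (hf.restrict U) h0).trans ?_
  simp only [trialEnergy, sub_zero, enorm_zero, ne_eq, OfNat.ofNat_ne_zero, not_false_eq_true, zero_pow,
    lintegral_zero, mul_zero, add_zero]
  exact setLIntegral_le_lintegral _ _

lemma formQ_le_lintegral {S : Set E3} (hS : MeasurableSet S) (hS' : volume S ≠ ⊤) {f : E3 → ℂ}
    (hf : MemLp f 2 volume) : ENNReal.ofReal (formQ S f) ≤ ∫⁻ x, ‖f x‖ₑ ^ 2 := by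
  rw [formQ_eq hS hS' (hf.restrict S)]
  refine (ENNReal.ofReal_le_ofReal (sub_le_self _ (by positivity))).trans ?_
  rw [ofReal_integral_eq_lintegral_ofReal ((hf.restrict S).integrable_norm_pow (by norm_num))
    (Eventually.of_forall fun _ => by positivity)]
  simp_rw [← enorm_sq_eq_ofReal]
  exact setLIntegral_le_lintegral _ _

lemma kinSmall_nonneg (M : ℕ) (s d : ℝ) {ℓ εT : ℝ} (hℓ : 0 < ℓ) (hε : 0 ≤ εT) (u u' : E3)
    {f : E3 → ℂ} (hf : MemLp f 2 volume) : 0 ≤ kinSmall M s d ℓ εT u u' f := by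
  have h1 := formQ_nonneg (measurableSet_smallBox d ℓ u u') (volume_smallBox_ne_top d hℓ.le u u')
    (hf.restrict _)
  have h2 := dispersionForm_nonneg (d * s * ℓ)⁻¹
    (fun x => (chiSmall M d ℓ u u' x : ℂ) * projQ (smallBox d ℓ u u') f x)
  unfold kinSmall
  positivity

/-- Needed for a fixed box only, to make the slice energies integrable in the positions of the other
particles. -/
lemma exists_kinBig_le (M : ℕ) (hM : 2 ≤ M) {U : Set E3} (hU : MeasurableSet U) (hU' : volume U ≠ ⊤)
    {b s d ℓ εT : ℝ} (hb : 0 ≤ b) (hs : 0 < s) (hd : 0 < d) (hℓ : 0 < ℓ) (hε : 0 ≤ εT) (hε1 : εT ≤ 1)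
    (u : E3) : ∃ K : ENNReal, K ≠ ⊤ ∧ ∀ f G φ, IsTestApprox U f G φ →
      ENNReal.ofReal (kinBig M b s d ℓ εT u f) ≤ K * ((∫⁻ x, ‖f x‖ₑ ^ 2) + ∫⁻ x, ‖G x‖ₑ ^ 2) := by
  obtain ⟨K₁, hK₁, h₁⟩ := exists_dispersionL_localized_le hU hU' hM (t := 1 / 2 * (s * ℓ)⁻¹) hℓ
    (by positivity) u
  obtain ⟨K₂, hK₂, h₂⟩ := exists_dispersionL_localized_le hU hU' hM (t := 1 / 2 * (d * s * ℓ)⁻¹) hℓ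
    (by positivity) u
  refine ⟨ENNReal.ofReal (εT * ((d * ℓ) ^ 2)⁻¹) + ENNReal.ofReal (b * (ℓ ^ 2)⁻¹)
    + (ENNReal.ofReal (1 - εT) * K₁ + ENNReal.ofReal εT * K₂), by finiteness, fun f G φ h => ?_⟩
  set I := (∫⁻ x, ‖f x‖ₑ ^ 2) + ∫⁻ x, ‖G x‖ₑ ^ 2 with hI
  have hfI : ∫⁻ x, ‖f x‖ₑ ^ 2 ≤ I := le_self_add
  have h1 : ENNReal.ofReal (εT * ((d * ℓ) ^ 2)⁻¹ * neumannRatioForm (interior (bigBox ℓ u)) ((d * ℓ) ^ 2)⁻¹ f)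
      ≤ ENNReal.ofReal (εT * ((d * ℓ) ^ 2)⁻¹) * I := by
    rw [ENNReal.ofReal_mul (by positivity)]
    exact mul_le_mul_right ((neumannRatioForm_le_lintegral (by positivity) h.memLp).trans hfI) _
  have h2 : ENNReal.ofReal (b * (ℓ ^ 2)⁻¹ * formQ (bigBox ℓ u) f) ≤ ENNReal.ofReal (b * (ℓ ^ 2)⁻¹) * I := by
    rw [ENNReal.ofReal_mul (by positivity)]
    exact mul_le_mul_right ((formQ_le_lintegral (measurableSet_bigBox ℓ u) (volume_cube_ne_top _ hℓ.le)
      h.memLp).trans hfI) _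
  have h3 : ENNReal.ofReal ((1 - εT) * dispersionForm (1 / 2 * (s * ℓ)⁻¹)
      (fun x => (chiBig M ℓ u x : ℂ) * projQ (bigBox ℓ u) f x)) ≤ ENNReal.ofReal (1 - εT) * (K₁ * I) := by
    rw [ENNReal.ofReal_mul (by linarith)]
    exact mul_le_mul_right ((ofReal_dispersionForm_le _ _).trans (h₁ f G φ h)) _
  have h4 : ENNReal.ofReal (εT * dispersionForm (1 / 2 * (d * s * ℓ)⁻¹)
      (fun x => (chiBig M ℓ u x : ℂ) * projQ (bigBox ℓ u) f x)) ≤ ENNReal.ofReal εT * (K₂ * I) := by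
    rw [ENNReal.ofReal_mul hε]
    exact mul_le_mul_right ((ofReal_dispersionForm_le _ _).trans (h₂ f G φ h)) _
  rw [kinBig]
  refine (ENNReal.ofReal_add_le.trans (add_le_add (ENNReal.ofReal_add_le.trans (add_le_add h1 h2))
    (ENNReal.ofReal_add_le.trans (add_le_add h3 h4)))).trans_eq ?_
  ring

section

variable {N : ℕ} {L : ℝ} {Ψ : Config N → ℂ} {G : Fin N → Config N → EuclideanSpace ℂ (Fin 3)}

/-- The total kinetic energy of the gradients `G`. -/
def totalEnergy (G : Fin N → Config N → EuclideanSpace ℂ (Fin 3)) : ENNReal := ∑ i, ∫⁻ z, ‖G i z‖ₑ ^ 2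

lemma measurableSet_interior_Lam (L : ℝ) : MeasurableSet (interior (Lam L)) := isOpen_interior.measurableSet

lemma volume_interior_Lam_ne_top {L : ℝ} (hL : 0 ≤ L) : volume (interior (Lam L)) ≠ ⊤ :=
  measure_ne_top_of_subset interior_subset (volume_cube_ne_top _ hL)

lemma totalEnergy_eq (hGm : ∀ i, StronglyMeasurable (G i)) :
    totalEnergy G = ∑ i, ∫⁻ X : {j : Fin N // j ≠ i} → E3, ∫⁻ x, ‖G i (insertAt i x X)‖ₑ ^ 2 :=
  Finset.sum_congr rfl fun i _ => (lintegral_insertAt i ((hGm i).enorm.pow_const 2).aemeasurable).symm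

lemma totalEnergy_ne_top (hG2 : ∀ i, MemLp (G i) 2 volume) : totalEnergy G ≠ ⊤ :=
  (ENNReal.sum_lt_top.2 fun i _ => lintegral_enorm_sq_lt_top (hG2 i)).ne

lemma stronglyMeasurable_slice {F : Type*} [TopologicalSpace F] {β : Type*} [MeasurableSpace β]
    {Φ : Config N → F} (h : StronglyMeasurable Φ) (i : Fin N) {w : β → ({j : Fin N // j ≠ i} → E3)}
    (hw : Measurable w) :
    StronglyMeasurable (Function.uncurry fun (a : β) (x : E3) => Φ (insertAt i x (w a))) :=
  h.comp_measurable ((measurable_insertAt i).comp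
    ((hw.comp measurable_fst).prodMk measurable_snd))

theorem secondQuant_gradEnergy (hGm : ∀ i, StronglyMeasurable (G i)) (hG2 : ∀ i, MemLp (G i) 2 volume)
    (hs : ∀ i, ∀ᵐ X : {j : Fin N // j ≠ i} → E3, ∃ φ, IsTestApprox (interior (Lam L))
      (fun x => Ψ (insertAt i x X)) (fun x => G i (insertAt i x X)) φ) :
    secondQuant (gradEnergy Set.univ) Ψ = (totalEnergy G).toReal := by
  have hfin := totalEnergy_ne_top hG2
  have hmX : ∀ i, Measurable fun X : {j : Fin N // j ≠ i} → E3 => ∫⁻ x, ‖G i (insertAt i x X)‖ₑ ^ 2 := fun i =>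
    ((stronglyMeasurable_slice (hGm i) i measurable_id).enorm.pow_const 2).lintegral_prod_right'
      (ν := (volume : Measure E3))
  rw [totalEnergy_eq hGm] at hfin ⊢
  have hfi := fun i => (ENNReal.sum_ne_top.1 hfin) i (Finset.mem_univ i)
  rw [ENNReal.toReal_sum fun i _ => hfi i]
  refine Finset.sum_congr rfl fun i _ => ?_
  rw [← integral_toReal (hmX i).aemeasurable (ae_lt_top (hmX i) (hfi i))]
  refine integral_congr_ae ?_
  filter_upwards [hs i] with X ⟨φ, hφ⟩
  have hm2 : AEStronglyMeasurable (fun x => ‖G i (insertAt i x X)‖ ^ 2) volume :=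
    hφ.memLp_grad.1.norm.pow 2
  rw [hφ.hasH1Gradient.gradEnergy_eq isOpen_univ, Measure.restrict_univ,
    integral_eq_lintegral_of_nonneg_ae (Eventually.of_forall fun _ => by positivity) hm2]
  refine congrArg _ (lintegral_congr fun x => ?_)
  rw [← ofReal_norm, ENNReal.ofReal_pow (norm_nonneg _)]

end

/-! ### Averages of the kinetic energies of many particles -/

/-- `Ψ` and its gradients `G` in the single variables are measurable and square integrable, and
almost every slice of `Ψ` is approximated by test functions in the interior of `Λ`. -/
structure HasSlices (L : ℝ) {N : ℕ} (Ψ : Config N → ℂ) (G : Fin N → Config N → EuclideanSpace ℂ (Fin 3)) :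
    Prop where
  meas : StronglyMeasurable Ψ
  memLp : MemLp Ψ 2 volume
  meas_grad : ∀ i, StronglyMeasurable (G i)
  memLp_grad : ∀ i, MemLp (G i) 2 volume
  slices : ∀ i, ∀ᵐ X : {j : Fin N // j ≠ i} → E3, ∃ φ, IsTestApprox (interior (Lam L))
    (fun x => Ψ (insertAt i x X)) (fun x => G i (insertAt i x X)) φ

namespace HasSlices

variable {N : ℕ} {L : ℝ} {Ψ : Config N → ℂ} {G : Fin N → Config N → EuclideanSpace ℂ (Fin 3)}

lemma meas_slice (h : HasSlices L Ψ G) (i : Fin N) (X : {j : Fin N // j ≠ i} → E3) :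
    StronglyMeasurable fun x => Ψ (insertAt i x X) :=
  (stronglyMeasurable_slice h.meas i (measurable_const (a := X))).comp_measurable
    (measurable_prodMk_left (x := X))

/-- On the interior of a box the weak gradient is the restriction of the global one, so the Neumann
energies of the boxes average to the full Dirichlet integral. -/
theorem neumann_le (h : HasSlices L Ψ G) {ℓ : ℝ} (hℓ : 0 < ℓ) :
    (∀ u, 0 ≤ secondQuant (neumannForm ℓ u) Ψ) ∧ Integrable (fun u => secondQuant (neumannForm ℓ u) Ψ) ∧
      ∫ u, secondQuant (neumannForm ℓ u) Ψ ≤ (totalEnergy G).toReal := by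
  have hfin := totalEnergy_ne_top h.memLp_grad
  rw [totalEnergy_eq h.meas_grad] at hfin ⊢
  refine integrable_secondQuant
    (K := fun i u X => ∫ x, (bigBox ℓ u).indicator (fun x => ‖G i (insertAt i x X)‖ ^ 2) x)
    (fun i => ?_) (fun i => ?_) (fun i => Eventually.of_forall fun X u => integral_nonneg fun x =>
      Set.indicator_nonneg (fun _ _ => by positivity) x) (fun i => ?_) hfin
  · have h1 : StronglyMeasurable fun p : (E3 × ({j : Fin N // j ≠ i} → E3)) × E3 =>
        ‖G i (insertAt i p.2 p.1.2)‖ ^ 2 :=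
      (stronglyMeasurable_slice (h.meas_grad i) i
        (measurable_snd : Measurable fun p : E3 × ({j : Fin N // j ≠ i} → E3) => p.2)).norm.pow 2
    have h2 : StronglyMeasurable fun p : (E3 × ({j : Fin N // j ≠ i} → E3)) × E3 =>
        (bigBox ℓ p.1.1).indicator (fun x => ‖G i (insertAt i x p.1.2)‖ ^ 2) p.2 :=
      h1.indicator (measurableSet_bigBox_param (v := fun p : E3 × ({j : Fin N // j ≠ i} → E3) => p.1)
        measurable_fst ℓ)
    exact StronglyMeasurable.integral_prod_right (ν := (volume : Measure E3)) h2
  · filter_upwards [h.slices i] with X ⟨φ, hφ⟩ u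
    rw [neumannForm, (hφ.hasH1Gradient.mono (Set.subset_univ _)
      MeasurableSet.univ).gradEnergy_eq isOpen_interior, bigBox, restrict_interior_cube,
      integral_indicator (measurableSet_cube _ _)]
  · filter_upwards [h.slices i] with X ⟨φ, hφ⟩
    have hm : AEMeasurable (fun x => ‖G i (insertAt i x X)‖ₑ ^ 2) := hφ.memLp_grad.1.enorm.pow_const 2
    rw [← lintegral_lintegral_bigBox hℓ hm]
    refine lintegral_mono fun u => ?_
    rw [neumannForm, (hφ.hasH1Gradient.mono (Set.subset_univ _)
      MeasurableSet.univ).gradEnergy_eq isOpen_interior, bigBox, restrict_interior_cube,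
      ofReal_integral_eq_lintegral_ofReal ((hφ.memLp_grad.restrict _).integrable_norm_pow (by norm_num))
        (Eventually.of_forall fun _ => by positivity)]
    refine lintegral_mono fun x => le_of_eq ?_
    rw [← ofReal_norm, ENNReal.ofReal_pow (norm_nonneg _)]

theorem kinBig_le (h : HasSlices L Ψ G) (hL : 0 ≤ L) {M : ℕ} {b s d ℓ εT : ℝ} (hb : 0 ≤ b)
    (hd : 0 < d) (hℓ : 0 < ℓ) (hε : 0 ≤ εT) (hε1 : εT ≤ 1)
    (hle : ∀ f, StronglyMeasurable f → Integrable f → MemLp f 2 volume →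
      ∫⁻ u, ENNReal.ofReal (kinBig M b s d ℓ εT u f) ≤ momentL 1 f) :
    (∀ u, 0 ≤ secondQuant (kinBig M b s d ℓ εT u) Ψ) ∧
      Integrable (fun u => secondQuant (kinBig M b s d ℓ εT u) Ψ) ∧
      ∫ u, secondQuant (kinBig M b s d ℓ εT u) Ψ ≤ (totalEnergy G).toReal := by
  have hfin := totalEnergy_ne_top h.memLp_grad
  rw [totalEnergy_eq h.meas_grad] at hfin ⊢
  choose K hKm hK using fun i : Fin N => exists_measurable_kinBig M b s hd hℓ εT
    (v := fun p : E3 × ({j : Fin N // j ≠ i} → E3) => p.1) measurable_fst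
    (stronglyMeasurable_slice h.meas i
      (measurable_snd : Measurable fun p : E3 × ({j : Fin N // j ≠ i} → E3) => p.2))
  refine integrable_secondQuant (K := fun i u X => K i (u, X)) (fun i => hKm i) (fun i => ?_)
    (fun i => ?_) (fun i => ?_) hfin
  · filter_upwards [h.slices i] with X ⟨φ, hφ⟩ u using hK i (u, X) hφ.memLp
  · filter_upwards [h.slices i] with X ⟨φ, hφ⟩ u
    rw [← hK i (u, X) hφ.memLp]
    exact kinBig_nonneg M hb hd hℓ hε hε1 u hφ.memLp
  · filter_upwards [h.slices i] with X ⟨φ, hφ⟩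
    exact (hle _ (h.meas_slice i X) (hφ.integrable (measurableSet_interior_Lam L)
      (volume_interior_Lam_ne_top hL)) hφ.memLp).trans
      (hφ.momentL_one_le (measurableSet_interior_Lam L) (volume_interior_Lam_ne_top hL))

lemma lintegral_slices_ne_top (h : HasSlices L Ψ G) (i : Fin N) :
    ∫⁻ X : {j : Fin N // j ≠ i} → E3, ((∫⁻ x, ‖Ψ (insertAt i x X)‖ₑ ^ 2)
      + ∫⁻ x, ‖G i (insertAt i x X)‖ₑ ^ 2) ≠ ⊤ := by
  have hm : Measurable fun X : {j : Fin N // j ≠ i} → E3 => ∫⁻ x, ‖Ψ (insertAt i x X)‖ₑ ^ 2 :=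
    ((stronglyMeasurable_slice h.meas i measurable_id).enorm.pow_const 2).lintegral_prod_right'
      (ν := (volume : Measure E3))
  rw [lintegral_add_left hm, lintegral_insertAt i (F := fun z => ‖Ψ z‖ₑ ^ 2)
    (h.meas.enorm.pow_const 2).aemeasurable, lintegral_insertAt i (F := fun z => ‖G i z‖ₑ ^ 2)
    ((h.meas_grad i).enorm.pow_const 2).aemeasurable]
  exact ENNReal.add_ne_top.2 ⟨(lintegral_enorm_sq_lt_top h.memLp).ne,
    (lintegral_enorm_sq_lt_top (h.memLp_grad i)).ne⟩

/-- The one-particle inequality on almost every slice, integrated over the other particles. The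
large-box terms stand on the right, so integrability of the slice energies has to be shown before
the difference can be integrated. -/
theorem kinSmall_le (h : HasSlices L Ψ G) (hL : 0 ≤ L) {M : ℕ} (hM : 2 ≤ M) {b s d ℓ εT κ : ℝ} (hb : 0 ≤ b)
    (hκ : κ ≤ 1) (hs : 0 < s) (hd : 0 < d) (hℓ : 0 < ℓ) (hε : 0 ≤ εT) (hε1 : εT ≤ 1) {u : E3}
    (hle : ∀ f, StronglyMeasurable f → MemLp f 2 volume →
      dispersionL (1 / 2 * (s * ℓ)⁻¹) (fun x => (chiBig M ℓ u x : ℂ) * projQ (bigBox ℓ u) f x) ≠ ⊤ →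
      ∫⁻ u', ENNReal.ofReal (kinSmall M s d ℓ εT u u' f)
        ≤ ENNReal.ofReal (kinBig M b s d ℓ εT u f - κ * b * (ℓ ^ 2)⁻¹ * formQ (bigBox ℓ u) f)) :
    0 ≤ secondQuant (formQ (bigBox ℓ u)) Ψ ∧
    Integrable (fun u' => secondQuant (kinSmall M s d ℓ εT u u') Ψ) ∧
      ∫ u', secondQuant (kinSmall M s d ℓ εT u u') Ψ
        ≤ secondQuant (kinBig M b s d ℓ εT u) Ψ
          - κ * b * (ℓ ^ 2)⁻¹ * secondQuant (formQ (bigBox ℓ u)) Ψ := by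
  have hU := measurableSet_interior_Lam L
  have hU' := volume_interior_Lam_ne_top hL
  have hB := measurableSet_bigBox ℓ u
  have hB' : volume (bigBox ℓ u) ≠ ⊤ := volume_cube_ne_top _ hℓ.le
  obtain ⟨K₀, hK₀, hKle⟩ := exists_kinBig_le M hM hU hU' (b := b) (d := d) (εT := εT) hb hs hd hℓ hε hε1 u
  obtain ⟨K₁, hK₁, hK₁le⟩ := exists_dispersionL_localized_le hU hU' hM (t := 1 / 2 * (s * ℓ)⁻¹) hℓ
    (by positivity) u
  choose K hKm hK₂ using fun i : Fin N => exists_measurable_kinBig M b s hd hℓ εT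
    (v := fun _ : {j : Fin N // j ≠ i} → E3 => u) measurable_const
    (stronglyMeasurable_slice h.meas i measurable_id)
  have hK : ∀ i X, MemLp (fun x => Ψ (insertAt i x X)) 2 volume →
      kinBig M b s d ℓ εT u (fun x => Ψ (insertAt i x X)) = K i X := fun i X hX => hK₂ i X hX
  have hFm : ∀ i : Fin N, StronglyMeasurable fun X : {j : Fin N // j ≠ i} → E3 =>
      formQ (bigBox ℓ u) (fun x => Ψ (insertAt i x X)) := fun i =>
    stronglyMeasurable_formQ (T := {p : ({j : Fin N // j ≠ i} → E3) × E3 | p.2 ∈ bigBox ℓ u})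
      (measurableSet_bigBox_param (v := fun _ : {j : Fin N // j ≠ i} → E3 => u) measurable_const ℓ)
      (stronglyMeasurable_slice h.meas i measurable_id)
  have hKnn : ∀ i : Fin N, ∀ᵐ X : {j : Fin N // j ≠ i} → E3, 0 ≤ K i X := fun i => by
    filter_upwards [h.slices i] with X ⟨φ, hφ⟩
    rw [← hK i X hφ.memLp]
    exact kinBig_nonneg M hb hd hℓ hε hε1 u hφ.memLp
  have hFnn : ∀ i : Fin N, ∀ᵐ X : {j : Fin N // j ≠ i} → E3,
      0 ≤ formQ (bigBox ℓ u) (fun x => Ψ (insertAt i x X)) := fun i => by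
    filter_upwards [h.slices i] with X ⟨φ, hφ⟩
    exact formQ_nonneg hB hB' (hφ.memLp.restrict _)
  have hKi : ∀ i, Integrable (K i) := fun i => by
    refine ⟨(hKm i).aestronglyMeasurable, ?_⟩
    rw [hasFiniteIntegral_iff_ofReal (hKnn i)]
    have hlt := (ENNReal.mul_ne_top hK₀ (h.lintegral_slices_ne_top i)).lt_top
    rw [← lintegral_const_mul' _ _ hK₀] at hlt
    refine lt_of_le_of_lt (lintegral_mono_ae ?_) hlt
    filter_upwards [h.slices i] with X ⟨φ, hφ⟩
    rw [← hK i X hφ.memLp]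
    exact hKle _ _ _ hφ
  have hFi : ∀ i : Fin N, Integrable fun X : {j : Fin N // j ≠ i} → E3 =>
      formQ (bigBox ℓ u) (fun x => Ψ (insertAt i x X)) := fun i => by
    refine ⟨(hFm i).aestronglyMeasurable, ?_⟩
    rw [hasFiniteIntegral_iff_ofReal (hFnn i)]
    refine lt_of_le_of_lt (lintegral_mono_ae ?_) (h.lintegral_slices_ne_top i).lt_top
    filter_upwards [h.slices i] with X ⟨φ, hφ⟩
    exact (formQ_le_lintegral hB hB' hφ.memLp).trans le_self_add
  have hnn : ∀ i : Fin N, ∀ᵐ X : {j : Fin N // j ≠ i} → E3,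
      0 ≤ K i X - κ * b * (ℓ ^ 2)⁻¹ * formQ (bigBox ℓ u) (fun x => Ψ (insertAt i x X)) := fun i => by
    filter_upwards [h.slices i] with X ⟨φ, hφ⟩
    -- The difference is the kinetic energy with `b` replaced by `(1-κ)b`, hence nonnegative.
    have := kinBig_nonneg M (s := s) (mul_nonneg (sub_nonneg.2 hκ) hb) hd hℓ hε hε1 u hφ.memLp
    rw [← hK i X hφ.memLp]
    simp only [kinBig] at this ⊢
    linarith
  have hi : ∀ i : Fin N, Integrable fun X : {j : Fin N // j ≠ i} → E3 =>
      K i X - κ * b * (ℓ ^ 2)⁻¹ * formQ (bigBox ℓ u) (fun x => Ψ (insertAt i x X)) := fun i =>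
    (hKi i).sub ((hFi i).const_mul _)
  have hdiff : secondQuant (kinBig M b s d ℓ εT u) Ψ - κ * b * (ℓ ^ 2)⁻¹ * secondQuant (formQ (bigBox ℓ u)) Ψ
      = ∑ i, ∫ X, (K i X - κ * b * (ℓ ^ 2)⁻¹ * formQ (bigBox ℓ u) (fun x => Ψ (insertAt i x X))) := by
    rw [secondQuant_eq_sum (K := K) (fun i => by
      filter_upwards [h.slices i] with X ⟨φ, hφ⟩ using hK i X hφ.memLp), secondQuant, Finset.mul_sum,
      ← Finset.sum_sub_distrib]
    refine Finset.sum_congr rfl fun i _ => ?_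
    rw [← integral_const_mul, ← integral_sub (hKi i) ((hFi i).const_mul _)]
  have hnn' : 0 ≤ secondQuant (kinBig M b s d ℓ εT u) Ψ
      - κ * b * (ℓ ^ 2)⁻¹ * secondQuant (formQ (bigBox ℓ u)) Ψ := by
    rw [hdiff]
    exact Finset.sum_nonneg fun i _ => integral_nonneg_of_ae (hnn i)
  have hsum : ∑ i, ∫⁻ X : {j : Fin N // j ≠ i} → E3, ENNReal.ofReal
      (K i X - κ * b * (ℓ ^ 2)⁻¹ * formQ (bigBox ℓ u) (fun x => Ψ (insertAt i x X)))
      = ENNReal.ofReal (secondQuant (kinBig M b s d ℓ εT u) Ψ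
          - κ * b * (ℓ ^ 2)⁻¹ * secondQuant (formQ (bigBox ℓ u)) Ψ) := by
    rw [hdiff, ENNReal.ofReal_sum_of_nonneg fun i _ => integral_nonneg_of_ae (hnn i)]
    exact Finset.sum_congr rfl fun i _ => (ofReal_integral_eq_lintegral_ofReal (hi i) (hnn i)).symm
  refine ⟨Finset.sum_nonneg fun i _ => integral_nonneg_of_ae (hFnn i), ?_⟩
  have := (integrable_secondQuant (q := fun u' => kinSmall M s d ℓ εT u u') (Ψ := Ψ)
    (K := fun i u' X => kinSmall M s d ℓ εT u u' (fun x => Ψ (insertAt i x X)))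
    (c := fun i X => ENNReal.ofReal
      (K i X - κ * b * (ℓ ^ 2)⁻¹ * formQ (bigBox ℓ u) (fun x => Ψ (insertAt i x X))))
    (fun i => ?_) (fun i => Eventually.of_forall fun X u => rfl)
    (fun i => ?_) (fun i => ?_) (by rw [hsum]; exact ENNReal.ofReal_ne_top)).2
  · rwa [hsum, ENNReal.toReal_ofReal hnn'] at this
  · exact stronglyMeasurable_kinSmall M s d ℓ εT (v := fun _ : E3 × ({j : Fin N // j ≠ i} → E3) => u)
      (v' := fun p => p.1) measurable_const measurable_fst (stronglyMeasurable_slice h.meas i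
      (measurable_snd : Measurable fun p : E3 × ({j : Fin N // j ≠ i} → E3) => p.2))
  · filter_upwards [h.slices i] with X ⟨φ, hφ⟩ u'
    exact kinSmall_nonneg M s d hℓ hε u u' hφ.memLp
  · filter_upwards [h.slices i] with X ⟨φ, hφ⟩
    rw [← hK i X hφ.memLp]
    refine hle _ (h.meas_slice i X) hφ.memLp (ne_top_of_le_ne_top ?_ (hK₁le _ _ _ hφ))
    exact ENNReal.mul_ne_top hK₁ (ENNReal.add_ne_top.2 ⟨(lintegral_enorm_sq_lt_top hφ.memLp).ne,
      (lintegral_enorm_sq_lt_top hφ.memLp_grad).ne⟩)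

end HasSlices

/-! ### Localized potentials -/

lemma continuous_chiConv (M : ℕ) : Continuous (chiConv M) :=
  (hasCompactSupport_chi M).continuous_convolution_right (ContinuousLinearMap.mul ℝ ℝ)
    (continuous_chi M).locallyIntegrable (continuous_chi M)

/-- At the midpoint `y = z/2` both factors of the integrand are evaluated in the open unit cube. -/
lemma chiConv_pos {M : ℕ} {z : E3} (hz : ‖z‖ < 1) : 0 < chiConv M z := by
  have hc : Continuous fun y => chi M y * chi M (z - y) :=
    (continuous_chi M).mul ((continuous_chi M).comp (by fun_prop))
  refine hc.integral_pos_of_hasCompactSupport_nonneg_nonzero ((hasCompactSupport_chi M).mul_right)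
    (fun y => mul_nonneg (chi_nonneg M _) (chi_nonneg M _)) (x := (2 : ℝ)⁻¹ • z) ?_
  have h1 : ∀ k, |((2 : ℝ)⁻¹ • z) k| < 1 / 2 := fun k => by
    have h2 : |z k| ≤ ‖z‖ := by simpa using PiLp.norm_apply_le z k
    rw [PiLp.smul_apply, smul_eq_mul, abs_mul, abs_of_pos (by norm_num : (0 : ℝ) < 2⁻¹)]
    linarith
  have e : z - (2 : ℝ)⁻¹ • z = (2 : ℝ)⁻¹ • z := by module
  simp only [e]
  exact (mul_pos (chi_pos h1) (chi_pos h1)).ne'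

lemma chiBig_nonneg (M : ℕ) (r : ℝ) (u x : E3) : 0 ≤ chiBig M r u x := chi_nonneg M _

lemma exists_chi_le (M : ℕ) : ∃ B : ℝ, 0 ≤ B ∧ ∀ x, chi M x ≤ B := by
  obtain ⟨B, hB⟩ := (continuous_chi M).bounded_above_of_compact_support (hasCompactSupport_chi M)
  exact ⟨B, (norm_nonneg _).trans (hB 0), fun x => (le_abs_self _).trans (hB x)⟩

/-- Evenness of `χ` turns the average over the box positions into a convolution. This identity makes
the localization of the potentials exact. -/
lemma integral_chiBig_mul (M : ℕ) (r : ℝ) (x y : E3) :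
    ∫ u, chiBig M r u x * chiBig M r u y = chiConv M (r⁻¹ • (x - y)) := by
  rw [chiConv, ← integral_sub_left_eq_self (fun t => chi M t * chi M (r⁻¹ • (x - y) - t)) volume (r⁻¹ • x)]
  refine integral_congr_ae (Eventually.of_forall fun u => ?_)
  simp only [chiBig]
  rw [← chi_neg M (r⁻¹ • y - u)]
  congr 2
  module

lemma integrable_chiBig_mul (M : ℕ) (r : ℝ) (x y : E3) :
    Integrable fun u => chiBig M r u x * chiBig M r u y := by
  have hc : HasCompactSupport fun u => chiBig M r u x :=
    (hasCompactSupport_chi M).comp_homeomorph (Homeomorph.subLeft (r⁻¹ • x))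
  refine Continuous.integrable_of_hasCompactSupport ?_ hc.mul_right
  exact ((continuous_chi M).comp (by fun_prop)).mul ((continuous_chi M).comp (by fun_prop))

/-- A continuous function with support in the ball of radius `R`. -/
structure IsShortRange (R : ℝ) (W : E3 → ℝ) : Prop where
  nonneg : ∀ x, 0 ≤ W x
  continuous : Continuous W
  eq_zero : ∀ x, R < ‖x‖ → W x = 0

lemma AdmissiblePotential.isShortRange {v₁ : E3 → ℝ} (h : AdmissiblePotential v₁) {R : ℝ} (hR : 0 < R) :
    IsShortRange R (vR v₁ R) where
  nonneg x := mul_nonneg (by positivity) (h.nonneg _)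
  continuous := continuous_const.mul (h.continuous.comp (by fun_prop))
  eq_zero x hx := by
    rw [vR, image_eq_zero_of_notMem_tsupport (f := v₁) (x := R⁻¹ • x) (fun hx' => ?_), mul_zero]
    have := h.support hx'
    rw [mem_closedBall_zero_iff, norm_smul, norm_inv, Real.norm_of_nonneg hR.le, inv_mul_le_iff₀ hR] at this
    linarith

namespace IsShortRange

variable {R : ℝ} {W : E3 → ℝ}

lemma hasCompactSupport (h : IsShortRange R W) : HasCompactSupport W :=
  HasCompactSupport.intro (isCompact_closedBall 0 R) fun x hx => h.eq_zero x (by simpa using hx)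

lemma integrable (h : IsShortRange R W) : Integrable W :=
  h.continuous.integrable_of_hasCompactSupport h.hasCompactSupport

lemma chiConv_pos (M : ℕ) {r : ℝ} (hr : 0 < r) (hRr : R < r) {x : E3} (hx : ‖x‖ ≤ R) :
    0 < chiConv M (r⁻¹ • x) := by
  refine BoseLoc.chiConv_pos ?_
  rw [norm_smul, norm_inv, Real.norm_of_nonneg hr.le, inv_mul_lt_iff₀ hr]
  linarith

/-- Since `R < r`, the denominator is positive on the closed ball of radius `R`. At any point
outside, the quotient vanishes in a neighbourhood, whether or not the denominator does. -/
lemma div_chiConv (h : IsShortRange R W) (M : ℕ) {r : ℝ} (hr : 0 < r) (hRr : R < r) :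
    IsShortRange R fun x => W x / chiConv M (r⁻¹ • x) where
  nonneg x := div_nonneg (h.nonneg x) (integral_nonneg fun y => mul_nonneg (chi_nonneg M _) (chi_nonneg M _))
  continuous := by
    refine continuous_iff_continuousAt.2 fun x => ?_
    by_cases hx : ‖x‖ ≤ R
    · exact h.continuous.continuousAt.div
        ((continuous_chiConv M).comp (by fun_prop : Continuous fun x : E3 => r⁻¹ • x)).continuousAt
        (chiConv_pos M hr hRr hx).ne'
    · have : ∀ᶠ y in 𝓝 x, R < ‖y‖ := continuous_norm.continuousAt.eventually (lt_mem_nhds (not_le.1 hx))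
      refine ContinuousAt.congr (f := fun _ => (0 : ℝ)) continuousAt_const ?_
      filter_upwards [this] with y hy
      rw [h.eq_zero y hy, zero_div]
  eq_zero x hx := by rw [h.eq_zero x hx, zero_div]

lemma div_chiConv_mul (h : IsShortRange R W) (M : ℕ) {r : ℝ} (hr : 0 < r) (hRr : R < r) (x : E3) :
    W x / chiConv M (r⁻¹ • x) * chiConv M (r⁻¹ • x) = W x := by
  by_cases hx : ‖x‖ ≤ R
  · exact div_mul_cancel₀ _ (chiConv_pos M hr hRr hx).ne'
  · rw [h.eq_zero x (not_le.1 hx), zero_div, zero_mul]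

end IsShortRange

/-- The interaction in the box of side length `r` around `r u`, with additional weight `A`. -/
def boxKernel (A W : E3 → ℝ) (M : ℕ) (r : ℝ) (u x y : E3) : ℝ :=
  A x * chiBig M r u x * W (x - y) * (A y * chiBig M r u y)

section

variable {A W V : E3 → ℝ} {M : ℕ} {R r B : ℝ}

lemma continuous_boxKernel (hA : Continuous A) (hW : Continuous W) :
    Continuous fun p : E3 × E3 × E3 => boxKernel A W M r p.1 p.2.1 p.2.2 := by
  have h1 : Continuous fun p : E3 × E3 × E3 => chiBig M r p.1 p.2.1 :=
    (continuous_chi M).comp (by fun_prop : Continuous fun p : E3 × E3 × E3 => r⁻¹ • p.2.1 - p.1)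
  have h2 : Continuous fun p : E3 × E3 × E3 => chiBig M r p.1 p.2.2 :=
    (continuous_chi M).comp (by fun_prop : Continuous fun p : E3 × E3 × E3 => r⁻¹ • p.2.2 - p.1)
  have h3 : Continuous fun p : E3 × E3 × E3 => A p.2.1 := hA.comp (by fun_prop)
  have h4 : Continuous fun p : E3 × E3 × E3 => A p.2.2 := hA.comp (by fun_prop)
  have h5 : Continuous fun p : E3 × E3 × E3 => W (p.2.1 - p.2.2) := hW.comp (by fun_prop)
  exact ((h3.mul h1).mul h5).mul (h4.mul h2)

lemma boxKernel_nonneg (hA : ∀ x, 0 ≤ A x) (hW : ∀ x, 0 ≤ W x) (u x y : E3) :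
    0 ≤ boxKernel A W M r u x y :=
  mul_nonneg (mul_nonneg (mul_nonneg (hA x) (chiBig_nonneg M r u x)) (hW _))
    (mul_nonneg (hA y) (chiBig_nonneg M r u y))

lemma boxKernel_eq (u x y : E3) :
    boxKernel A W M r u x y = A x * W (x - y) * A y * (chiBig M r u x * chiBig M r u y) := by
  rw [boxKernel]; ring

lemma integrable_boxKernel (x y : E3) : Integrable fun u => boxKernel A W M r u x y := by
  simp_rw [boxKernel_eq]
  exact (integrable_chiBig_mul M r x y).const_mul _

lemma integral_boxKernel (hV : ∀ x, W x * chiConv M (r⁻¹ • x) = V x) (x y : E3) :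
    ∫ u, boxKernel A W M r u x y = A x * V (x - y) * A y := by
  simp_rw [boxKernel_eq]
  rw [integral_const_mul, integral_chiBig_mul, ← hV]
  ring

lemma integrable_boxKernel_right (hA : Continuous A) (hW : IsShortRange R W) (x : E3) :
    Integrable fun p : E3 × E3 => boxKernel A W M r p.1 x p.2 := by
  refine Continuous.integrable_of_hasCompactSupport ((continuous_boxKernel hA hW.continuous).comp
    (by fun_prop : Continuous fun p : E3 × E3 => (p.1, x, p.2))) ?_
  refine HasCompactSupport.intro
    (((isCompact_cube 0 1).image (by fun_prop : Continuous fun t : E3 => r⁻¹ • x - t)).prod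
    ((isCompact_closedBall (0 : E3) R).image (by fun_prop : Continuous fun t : E3 => x - t))) fun p hp => ?_
  rw [Set.mem_prod, not_and_or] at hp
  simp only [boxKernel_eq]
  rcases hp with hp | hp
  · rw [chiBig, chi_eq_zero fun h => hp ⟨_, h, sub_sub_cancel _ _⟩]
    ring
  · rw [hW.eq_zero (x - p.2) (not_le.1 fun h => hp ⟨_, by simpa using h, sub_sub_cancel _ _⟩)]
    ring

lemma integral_integral_boxKernel (hA : Continuous A) (hW : IsShortRange R W)
    (hV : ∀ x, W x * chiConv M (r⁻¹ • x) = V x) (x : E3) :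
    ∫ u, ∫ y, boxKernel A W M r u x y = ∫ y, A x * V (x - y) * A y := by
  rw [integral_integral_swap (integrable_boxKernel_right hA hW x)]
  simp_rw [integral_boxKernel hV]

lemma integrable_boxKernel_pair (hA : Continuous A) (hA' : HasCompactSupport A)
    (hW : Continuous W) :
    Integrable fun p : E3 × E3 × E3 => boxKernel A W M r p.1 p.2.1 p.2.2 := by
  refine Continuous.integrable_of_hasCompactSupport (continuous_boxKernel hA hW) ?_
  refine HasCompactSupport.intro ((((hA'.isCompact.prod (isCompact_cube 0 1))).image
    (by fun_prop : Continuous fun p : E3 × E3 => r⁻¹ • p.1 - p.2)).prod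
    (hA'.isCompact.prod hA'.isCompact)) fun p hp => ?_
  rw [Set.mem_prod, Set.mem_prod, not_and_or, not_and_or] at hp
  by_cases h1 : p.2.1 ∈ tsupport A
  · by_cases h2 : p.2.2 ∈ tsupport A
    · have hp1 := hp.resolve_right (by tauto)
      have h3 : r⁻¹ • p.2.1 - p.1 ∉ cube 0 1 := fun h =>
        hp1 ⟨(p.2.1, r⁻¹ • p.2.1 - p.1), ⟨h1, h⟩, sub_sub_cancel _ _⟩
      rw [boxKernel_eq, chiBig, chi_eq_zero h3]
      ring
    · rw [boxKernel_eq, image_eq_zero_of_notMem_tsupport h2]; ring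
  · rw [boxKernel_eq, image_eq_zero_of_notMem_tsupport h1]; ring

lemma integral_pair_boxKernel (hA : Continuous A) (hA' : HasCompactSupport A)
    (hW : Continuous W) (hV : ∀ x, W x * chiConv M (r⁻¹ • x) = V x) (hVc : Continuous V) :
    Integrable (fun u => ∫ y, ∫ z, boxKernel A W M r u y z) ∧
    ∫ u, ∫ y, ∫ z, boxKernel A W M r u y z = ∫ y, ∫ z, A y * V (y - z) * A z := by
  have hi := integrable_boxKernel_pair (M := M) (r := r) hA hA' hW
  have hae : ∀ᵐ u, ∫ p : E3 × E3, boxKernel A W M r u p.1 p.2 = ∫ y, ∫ z, boxKernel A W M r u y z := by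
    filter_upwards [hi.prod_right_ae] with u hu
    exact integral_prod _ hu
  have hk : Integrable fun p : E3 × E3 => A p.1 * V (p.1 - p.2) * A p.2 := by
    refine Continuous.integrable_of_hasCompactSupport (by fun_prop) ?_
    refine HasCompactSupport.intro (hA'.isCompact.prod hA'.isCompact) fun p hp => ?_
    rw [Set.mem_prod, not_and_or] at hp
    rcases hp with hp | hp
    · rw [image_eq_zero_of_notMem_tsupport hp]; ring
    · rw [image_eq_zero_of_notMem_tsupport hp]; ring
  refine ⟨hi.integral_prod_left.congr hae, ?_⟩
  rw [← integral_congr_ae hae, integral_integral_swap hi]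
  simp_rw [integral_boxKernel hV]
  exact integral_prod _ hk

lemma integral_kernel_le (hA0 : ∀ x, 0 ≤ A x) (hAB : ∀ x, A x ≤ B) (hV : IsShortRange R V) (x : E3) :
    ∫ y, A x * V (x - y) * A y ≤ B ^ 2 * ∫ y, V y := by
  rw [← integral_sub_left_eq_self V volume x, ← integral_const_mul]
  refine integral_mono_of_nonneg (Eventually.of_forall fun y =>
    mul_nonneg (mul_nonneg (hA0 x) (hV.nonneg _)) (hA0 y)) ((hV.integrable.comp_sub_left x).const_mul _)
    (Eventually.of_forall fun y => ?_)
  have h1 := mul_le_mul (hAB x) (hAB y) (hA0 y) ((hA0 x).trans (hAB x))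
  have h2 := mul_le_mul_of_nonneg_right h1 (hV.nonneg (x - y))
  simp only
  nlinarith

end

/-! ### Averages of potential energies -/

section

variable {N : ℕ} {μ : Measure E3} [SFinite μ]

/-- By nonnegativity, a bound on the average over `u` that is uniform in the configuration is all
that is needed on the product space. -/
lemma integrable_prod_mul_of_integral_le {h : E3 → Config N → ℝ} (hm : StronglyMeasurable (Function.uncurry h))
    (h0 : ∀ u x, 0 ≤ h u x) (hi : ∀ x, Integrable (fun u => h u x) μ) {C : ℝ}
    (hC : ∀ x, ∫ u, h u x ∂μ ≤ C) {p : Config N → ℝ} (hp : Integrable p) (hp0 : ∀ x, 0 ≤ p x) :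
    Integrable (fun q : E3 × Config N => h q.1 q.2 * p q.2) (μ.prod volume) := by
  have hm' : AEStronglyMeasurable (fun q : E3 × Config N => h q.1 q.2 * p q.2) (μ.prod volume) :=
    hm.aestronglyMeasurable.mul hp.1.comp_snd
  rw [integrable_prod_iff' hm']
  refine ⟨Eventually.of_forall fun x => (hi x).mul_const (p x), ?_⟩
  have hs : StronglyMeasurable fun x => ∫ u, h u x ∂μ :=
    StronglyMeasurable.integral_prod_left hm
  have e : ∀ x, ∫ u, ‖h u x * p x‖ ∂μ = (∫ u, h u x ∂μ) * p x := fun x => by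
    rw [← integral_mul_const]
    refine integral_congr_ae (Eventually.of_forall fun u => ?_)
    exact Real.norm_of_nonneg (mul_nonneg (h0 u x) (hp0 x))
  simp only [e]
  refine (hp.const_mul C).mono' (hs.aestronglyMeasurable.mul hp.1) (Eventually.of_forall fun x => ?_)
  rw [Real.norm_of_nonneg (mul_nonneg (integral_nonneg fun u => h0 u x) (hp0 x))]
  exact mul_le_mul_of_nonneg_right (hC x) (hp0 x)

/-- The average of the potential energy in a family of boxes. -/
theorem integral_potentialForm_boxPotential {w : E3 → E3 → E3 → ℝ} (hw0 : ∀ u x y, 0 ≤ w u x y)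
    (hwc : Continuous fun p : E3 × E3 × E3 => w p.1 p.2.1 p.2.2)
    (hi2 : ∀ x y, Integrable (fun u => w u x y) μ) {C₁ C₂ : ℝ} (hC2 : ∀ x y, ∫ u, w u x y ∂μ ≤ C₂)
    (hi1 : ∀ x, Integrable (fun u => ∫ y, w u x y) μ) (hC1 : ∀ x, ∫ u, ∫ y, w u x y ∂volume ∂μ ≤ C₁)
    (hi0 : Integrable (fun u => ∫ y, ∫ z, w u y z) μ) {Ψ : Config N → ℂ} (hΨ : MemLp Ψ 2 volume) (ρ : ℝ) :
    Integrable (fun u => potentialForm (boxPotential ρ (w u)) Ψ) μ ∧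
    Integrable (fun x : Config N => ((∑ i, -(ρ * ∫ u, ∫ y, w u (x i) y ∂volume ∂μ))
      + (∑ i, ∑ j ∈ Finset.Ioi i, ∫ u, w u (x i) (x j) ∂μ)
      + 1 / 2 * ρ ^ 2 * ∫ u, ∫ y, ∫ z, w u y z ∂volume ∂volume ∂μ) * ‖Ψ x‖ ^ 2) ∧
    ∫ u, potentialForm (boxPotential ρ (w u)) Ψ ∂μ
      = ∫ x : Config N, ((∑ i, -(ρ * ∫ u, ∫ y, w u (x i) y ∂volume ∂μ))
      + (∑ i, ∑ j ∈ Finset.Ioi i, ∫ u, w u (x i) (x j) ∂μ)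
      + 1 / 2 * ρ ^ 2 * ∫ u, ∫ y, ∫ z, w u y z ∂volume ∂volume ∂μ) * ‖Ψ x‖ ^ 2 := by
  have hp : Integrable fun x => ‖Ψ x‖ ^ 2 := hΨ.integrable_norm_pow (by norm_num)
  have hp0 : ∀ x, 0 ≤ ‖Ψ x‖ ^ 2 := fun _ => by positivity
  have hf : StronglyMeasurable fun p : E3 × E3 => ∫ y, w p.1 p.2 y := by
    have hc : Continuous fun q : (E3 × E3) × E3 => w q.1.1 q.1.2 q.2 :=
      hwc.comp (by fun_prop : Continuous fun q : (E3 × E3) × E3 => (q.1.1, q.1.2, q.2))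
    exact StronglyMeasurable.integral_prod_right (ν := (volume : Measure E3))
      (f := fun (p : E3 × E3) y => w p.1 p.2 y) hc.stronglyMeasurable
  have hone : ∀ i : Fin N, Integrable (fun q : E3 × Config N => (∫ y, w q.1 (q.2 i) y) * ‖Ψ q.2‖ ^ 2)
      (μ.prod volume) := fun i =>
    integrable_prod_mul_of_integral_le (h := fun u x => ∫ y, w u (x i) y)
      (hf.comp_measurable (by fun_prop : Measurable fun q : E3 × Config N => (q.1, q.2 i)))
      (fun u x => integral_nonneg fun y => hw0 _ _ _) (fun x => hi1 _) (fun x => hC1 _) hp hp0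
  have htwo : ∀ i j : Fin N, Integrable (fun q : E3 × Config N => w q.1 (q.2 i) (q.2 j) * ‖Ψ q.2‖ ^ 2)
      (μ.prod volume) := fun i j =>
    integrable_prod_mul_of_integral_le (h := fun u x => w u (x i) (x j))
      (hwc.comp (by fun_prop : Continuous fun q : E3 × Config N => (q.1, q.2 i, q.2 j))).stronglyMeasurable
      (fun u x => hw0 _ _ _) (fun x => hi2 _ _) (fun x => hC2 _ _) hp hp0
  have hzero : Integrable (fun q : E3 × Config N => (∫ y, ∫ z, w q.1 y z) * ‖Ψ q.2‖ ^ 2)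
      (μ.prod volume) := hi0.mul_prod hp
  have hall : Integrable (fun q : E3 × Config N => boxPotential ρ (w q.1) q.2 * ‖Ψ q.2‖ ^ 2)
      (μ.prod volume) := by
    have h1 := integrable_finsetSum Finset.univ fun i _ => (hone i).const_mul (-ρ)
    have h2 := integrable_finsetSum Finset.univ fun i _ =>
      integrable_finsetSum (Finset.Ioi i) fun j _ => htwo i j
    have h3 := hzero.const_mul (1 / 2 * ρ ^ 2)
    refine ((h1.add h2).add h3).congr (Eventually.of_forall fun q => ?_)
    simp only [Pi.add_apply, boxPotential, add_mul, Finset.sum_mul]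
    congr 1
    · congr 1
      exact Finset.sum_congr rfl fun i _ => by ring
    · ring
  have hx : ∀ x : Config N, ∫ u, boxPotential ρ (w u) x * ‖Ψ x‖ ^ 2 ∂μ
      = ((∑ i, -(ρ * ∫ u, ∫ y, w u (x i) y ∂volume ∂μ))
      + (∑ i, ∑ j ∈ Finset.Ioi i, ∫ u, w u (x i) (x j) ∂μ)
      + 1 / 2 * ρ ^ 2 * ∫ u, ∫ y, ∫ z, w u y z ∂volume ∂volume ∂μ) * ‖Ψ x‖ ^ 2 := fun x => by
    have h1 : ∀ i, Integrable (fun u => -(ρ * ∫ y, w u (x i) y)) μ := fun i => ((hi1 (x i)).const_mul ρ).neg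
    have h1' := integrable_finsetSum Finset.univ fun i _ => h1 i
    have h2 := integrable_finsetSum Finset.univ fun i _ =>
      integrable_finsetSum (Finset.Ioi i) fun j _ => hi2 (x i) (x j)
    have h3 := hi0.const_mul (1 / 2 * ρ ^ 2)
    rw [integral_mul_const]
    congr 1
    simp only [boxPotential]
    have h12 : Integrable (fun u => (∑ i, -(ρ * ∫ y, w u (x i) y))
        + ∑ i, ∑ j ∈ Finset.Ioi i, w u (x i) (x j)) μ := h1'.add h2
    rw [integral_add h12 h3, integral_add h1' h2, integral_finsetSum _ fun i _ => h1 i,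
      integral_finsetSum _ fun i _ => integrable_finsetSum (Finset.Ioi i) fun j _ => hi2 (x i) (x j),
      integral_const_mul]
    congr 2
    · exact Finset.sum_congr rfl fun i _ => by rw [integral_neg, integral_const_mul]
    · exact Finset.sum_congr rfl fun i _ => integral_finsetSum _ fun j _ => hi2 (x i) (x j)
  refine ⟨hall.integral_prod_left, ?_, ?_⟩
  · exact hall.integral_prod_right.congr (Eventually.of_forall hx)
  · simp only [potentialForm]
    rw [integral_integral_swap hall]
    exact integral_congr_ae (Eventually.of_forall hx)

end

/-! ### The potential energy in small boxes -/

section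

variable {M : ℕ} {v₁ : E3 → ℝ} {R d ℓ : ℝ}

lemma wBig_nonneg (h : IsShortRange R (Wb M v₁ R ℓ)) (u x y : E3) : 0 ≤ wBig M v₁ R ℓ u x y :=
  mul_nonneg (mul_nonneg (chiBig_nonneg M ℓ u x) (h.nonneg _)) (chiBig_nonneg M ℓ u y)

/-- The small-box interaction is a box kernel of scale `dℓ` with weight `χ_u`, and its average is
`w_{B(u)}`. Equality holds for the constant term too, because the compact support of `χ_u` makes the
total self-energy finite. -/
theorem integral_potentialForm_wSmall (hv : AdmissiblePotential v₁) (hR : 0 < R) (hd : 0 < d) (hℓ : 0 < ℓ)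
    (hRd : R < d * ℓ) (hRℓ : R < ℓ) (ρ : ℝ) (u : E3) {N : ℕ} {Ψ : Config N → ℂ} (hΨ : MemLp Ψ 2 volume) :
    Integrable (fun u' => potentialForm (boxPotential ρ (wSmall M v₁ R d ℓ u u')) Ψ) ∧
      ∫ u', potentialForm (boxPotential ρ (wSmall M v₁ R d ℓ u u')) Ψ
        = potentialForm (boxPotential ρ (wBig M v₁ R ℓ u)) Ψ := by
  have hVb : IsShortRange R (Wb M v₁ R ℓ) := (hv.isShortRange hR).div_chiConv M hℓ hRℓ
  have hVs : IsShortRange R (Ws M v₁ R d ℓ) := hVb.div_chiConv M (mul_pos hd hℓ) hRd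
  have hmul : ∀ x, Ws M v₁ R d ℓ x * chiConv M ((d * ℓ)⁻¹ • x) = Wb M v₁ R ℓ x :=
    hVb.div_chiConv_mul M (mul_pos hd hℓ) hRd
  set A : E3 → ℝ := chiBig M ℓ u with hA
  have hAc : Continuous A := (continuous_chi M).comp (by fun_prop)
  have hAs : HasCompactSupport A := HasCompactSupport.intro (K := bigBox ℓ u) (isCompact_cube _ _)
    fun x hx => chiBig_eq_zero hℓ hx
  obtain ⟨B, hB0, hB⟩ := exists_chi_le M
  have hA0 : ∀ x, 0 ≤ A x := chiBig_nonneg M ℓ u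
  have hAB : ∀ x, A x ≤ B := fun x => hB _
  have hw : wSmall M v₁ R d ℓ u = boxKernel A (Ws M v₁ R d ℓ) M (d * ℓ) := rfl
  have hk : ∀ x y, A x * Wb M v₁ R ℓ (x - y) * A y = wBig M v₁ R ℓ u x y := fun x y => rfl
  obtain ⟨D, hD⟩ := hVb.continuous.bounded_above_of_compact_support hVb.hasCompactSupport
  have e0 := integral_pair_boxKernel hAc hAs hVs.continuous hmul hVb.continuous
  have e1 := integral_integral_boxKernel hAc hVs hmul
  have e2 := integral_boxKernel (A := A) hmul
  have key := integral_potentialForm_boxPotential (μ := volume) (w := boxKernel A (Ws M v₁ R d ℓ) M (d * ℓ))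
    (boxKernel_nonneg hA0 hVs.nonneg) (continuous_boxKernel hAc hVs.continuous) integrable_boxKernel
    (C₂ := B * D * B) (C₁ := B ^ 2 * ∫ y, Wb M v₁ R ℓ y) (fun x y => ?_)
    (fun x => (integrable_boxKernel_right hAc hVs x).integral_prod_left)
    (fun x => (e1 x).trans_le (integral_kernel_le hA0 hAB hVb x)) e0.1 hΨ ρ
  · rw [hw]
    refine ⟨key.1, key.2.2.trans ?_⟩
    simp only [e1, e2, e0.2, hk]
    rfl
  · rw [e2]
    have hW : Wb M v₁ R ℓ (x - y) ≤ D := (le_abs_self _).trans (hD _)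
    exact mul_le_mul (mul_le_mul (hAB x) hW (hVb.nonneg _) hB0) (hAB y) (hA0 y)
      (mul_nonneg hB0 ((hVb.nonneg _).trans hW))

end

/-! ### The potential energy in large boxes -/

lemma cube_add_cube {r t : ℝ} (hr : 0 < r) (ht : 0 < t) : cube 0 r + cube 0 t = cube 0 (r + t) := by
  ext x
  simp only [Set.mem_add, cube, Set.mem_ofPred_eq, PiLp.zero_apply, sub_zero]
  constructor
  · rintro ⟨y, hy, z, hz, rfl⟩ k
    rw [PiLp.add_apply]
    linarith [abs_add_le (y k) (z k), hy k, hz k]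
  · intro h
    have hs : 0 < r + t := by positivity
    refine ⟨(r / (r + t)) • x, fun k => ?_, (t / (r + t)) • x, fun k => ?_, ?_⟩
    · rw [PiLp.smul_apply, smul_eq_mul, abs_mul, abs_of_pos (by positivity)]
      calc _ ≤ r / (r + t) * ((r + t) / 2) := mul_le_mul_of_nonneg_left (h k) (by positivity)
        _ = r / 2 := by field_simp
    · rw [PiLp.smul_apply, smul_eq_mul, abs_mul, abs_of_pos (by positivity)]
      calc _ ≤ t / (r + t) * ((r + t) / 2) := mul_le_mul_of_nonneg_left (h k) (by positivity)
        _ = t / 2 := by field_simp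
    · rw [← add_smul, ← add_div, div_self hs.ne', one_smul]

lemma mem_smul_Lam' {L ℓ : ℝ} (hℓ : 0 < ℓ) {M : ℕ} {u x : E3} (hx : x ∈ Lam L)
    (h : chiBig M ℓ u x ≠ 0) : u ∈ ℓ⁻¹ • Lam' L ℓ := by
  rw [Set.mem_smul_set_iff_inv_smul_mem₀ (inv_ne_zero hℓ.ne'), inv_inv]
  refine ⟨x, hx, ℓ • u - x, fun k => ?_, add_sub_cancel _ _⟩
  have hmem : x ∈ bigBox ℓ u := by_contra fun hc => h (chiBig_eq_zero hℓ hc)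
  have := hmem k
  simp only [PiLp.sub_apply, PiLp.zero_apply, sub_zero]
  rwa [abs_sub_comm]

lemma volume_smul_Lam' {L ℓ : ℝ} (hL : 0 < L) (hℓ : 0 < ℓ) :
    volume (ℓ⁻¹ • Lam' L ℓ) = ENNReal.ofReal ((ℓ ^ 3)⁻¹ * (L + ℓ) ^ 3) := by
  rw [Lam', Lam, cube_add_cube hL hℓ, Measure.addHaar_smul, volume_cube _ (by positivity),
    ← ENNReal.ofReal_mul (by positivity), finrank_euclideanSpace_fin, abs_of_pos (by positivity), inv_pow]

lemma ae_eq_zero_of_memH10 {V : Type*} [NormedAddCommGroup V] [NormedSpace ℝ V] [MeasureSpace V]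
    {U : Set V} (hU : MeasurableSet U) {f : V → ℂ} (h : MemH10 U f) : ∀ᵐ x, x ∉ U → f x = 0 := by
  obtain ⟨hf, G, hG, φ, hφ, ht, -⟩ := h
  have h0 : eLpNorm f 2 (volume.restrict Uᶜ) = 0 := by
    refine le_antisymm (ge_of_tendsto ht (Eventually.of_forall fun n => ?_)) zero_le
    refine le_trans (le_of_eq ?_) (eLpNorm_mono_measure _ (Measure.restrict_le_self (s := Uᶜ)))
    refine eLpNorm_congr_norm_ae ((ae_restrict_iff' hU.compl).2 (Eventually.of_forall fun x hx => ?_))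
    rw [Pi.sub_apply, image_eq_zero_of_notMem_tsupport fun hx' => hx ((hφ n).2.2 hx'), zero_sub, norm_neg]
  exact (ae_restrict_iff' hU.compl).1 ((eLpNorm_eq_zero_iff hf.1.restrict (by norm_num)).1 h0)

section

variable {M : ℕ} {v₁ : E3 → ℝ} {R ℓ L : ℝ}

lemma integral_chiBig_mul_chiBig_sub (M : ℕ) {ℓ : ℝ} (hℓ : 0 < ℓ) (u t : E3) :
    ∫ y, chiBig M ℓ u y * chiBig M ℓ u (y - t) = ℓ ^ 3 * chiConv M (ℓ⁻¹ • t) := by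
  have h1 := Measure.integral_comp_inv_smul volume (fun v : E3 => chi M (v - u) * chi M (ℓ⁻¹ • t - (v - u))) ℓ
  have h2 := integral_sub_right_eq_self (fun v => chi M v * chi M (ℓ⁻¹ • t - v)) (μ := volume) u
  rw [h2, finrank_euclideanSpace_fin, abs_of_pos (by positivity), smul_eq_mul] at h1
  rw [chiConv, ← h1]
  refine integral_congr_ae (Eventually.of_forall fun y => ?_)
  simp only [chiBig]
  rw [← chi_neg M (ℓ⁻¹ • (y - t) - u)]
  congr 2
  module

/-- In the relative coordinate `t = y - z` the integral over `y` gives `ℓ³(χ*χ)(t/ℓ)`, which cancels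
the denominator of `W_b`. The self-energy is thus the same for all boxes. -/
lemma integral_pair_wBig (hv : AdmissiblePotential v₁) (hR : 0 < R) (hℓ : 0 < ℓ) (hRℓ : R < ℓ) (u : E3) :
    ∫ y, ∫ z, wBig M v₁ R ℓ u y z = ℓ ^ 3 * ∫ y, vR v₁ R y := by
  have hVb : IsShortRange R (Wb M v₁ R ℓ) := (hv.isShortRange hR).div_chiConv M hℓ hRℓ
  have hmul : ∀ x, Wb M v₁ R ℓ x * chiConv M (ℓ⁻¹ • x) = vR v₁ R x :=
    (hv.isShortRange hR).div_chiConv_mul M hℓ hRℓ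
  have hWc := hVb.continuous
  have hχ : Continuous (chiBig M ℓ u) := (continuous_chi M).comp (by fun_prop)
  have hi : Integrable fun p : E3 × E3 => chiBig M ℓ u p.1 * Wb M v₁ R ℓ p.2 * chiBig M ℓ u (p.1 - p.2) := by
    refine Continuous.integrable_of_hasCompactSupport (by fun_prop) ?_
    refine HasCompactSupport.intro ((isCompact_cube (ℓ • u) ℓ).prod (isCompact_closedBall (0 : E3) R))
      fun p hp => ?_
    rw [Set.mem_prod, not_and_or] at hp
    rcases hp with hp | hp
    · rw [chiBig_eq_zero hℓ hp]; ring
    · rw [hVb.eq_zero p.2 (by simpa using hp)]; ring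
  have e : ∀ y, ∫ z, wBig M v₁ R ℓ u y z
      = ∫ t, chiBig M ℓ u y * Wb M v₁ R ℓ t * chiBig M ℓ u (y - t) := fun y => by
    rw [← integral_sub_left_eq_self (fun z => wBig M v₁ R ℓ u y z) volume y]
    refine integral_congr_ae (Eventually.of_forall fun t => ?_)
    simp only [wBig, sub_sub_cancel]
  simp_rw [e]
  rw [integral_integral_swap hi, ← integral_const_mul]
  refine integral_congr_ae (Eventually.of_forall fun t => ?_)
  have e2 : ∀ y, chiBig M ℓ u y * Wb M v₁ R ℓ t * chiBig M ℓ u (y - t)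
      = Wb M v₁ R ℓ t * (chiBig M ℓ u y * chiBig M ℓ u (y - t)) := fun y => by ring
  simp only [e2]
  rw [integral_const_mul, integral_chiBig_mul_chiBig_sub M hℓ, ← hmul t]
  ring

/-- For particles in `Λ`, the functions `χ_u(x_i)` vanish unless `u ∈ ℓ⁻¹Λ'`, so restricting the
average to this set leaves the one- and two-body terms exact; this matters for the one-body term,
which is negative. The constants give `(L+ℓ)³` against `|Λ''| = (L+2ℓ)³`. -/
theorem integral_potentialForm_wBig_le (hv : AdmissiblePotential v₁) (hR : 0 < R) (hℓ : 0 < ℓ)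
    (hRℓ : R < ℓ) (hL : 0 < L) (ρ : ℝ) {N : ℕ} {Ψ : Config N → ℂ} (hΨ : MemLp Ψ 2 volume)
    (hz : ∀ᵐ x : Config N, (∀ i, x i ∈ Lam L) ∨ Ψ x = 0) :
    IntegrableOn (fun u => potentialForm (boxPotential ρ (wBig M v₁ R ℓ u)) Ψ) (ℓ⁻¹ • Lam' L ℓ) ∧
      ∫ u in ℓ⁻¹ • Lam' L ℓ, potentialForm (boxPotential ρ (wBig M v₁ R ℓ u)) Ψ
        ≤ potentialForm (backgroundPotential v₁ R ρ ℓ L) Ψ := by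
  have hV := hv.isShortRange hR
  have hVb : IsShortRange R (Wb M v₁ R ℓ) := hV.div_chiConv M hℓ hRℓ
  have hmul : ∀ x, Wb M v₁ R ℓ x * chiConv M (ℓ⁻¹ • x) = vR v₁ R x := hV.div_chiConv_mul M hℓ hRℓ
  set S := ℓ⁻¹ • Lam' L ℓ with hS
  have hSv : volume S = ENNReal.ofReal ((ℓ ^ 3)⁻¹ * (L + ℓ) ^ 3) := volume_smul_Lam' hL hℓ
  have hfin : IsFiniteMeasure (volume.restrict S) := ⟨by
    rw [Measure.restrict_apply_univ, hSv]; exact ENNReal.ofReal_lt_top⟩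
  have hw : wBig M v₁ R ℓ = boxKernel (fun _ => 1) (Wb M v₁ R ℓ) M ℓ := by
    funext u x y; simp [wBig, boxKernel]
  have hA : Continuous fun _ : E3 => (1 : ℝ) := continuous_const
  have hw0 : ∀ u x y, 0 ≤ wBig M v₁ R ℓ u x y := wBig_nonneg hVb
  have hi2 : ∀ x y, Integrable fun u => wBig M v₁ R ℓ u x y := fun x y => by
    rw [hw]; exact integrable_boxKernel x y
  have hi1 : ∀ x, Integrable fun u => ∫ y, wBig M v₁ R ℓ u x y := fun x => by
    rw [hw]; exact (integrable_boxKernel_right hA hVb x).integral_prod_left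
  have e2 : ∀ x y, ∫ u, wBig M v₁ R ℓ u x y = vR v₁ R (x - y) := fun x y => by
    rw [hw, integral_boxKernel hmul]; ring
  have e1 : ∀ x, ∫ u, ∫ y, wBig M v₁ R ℓ u x y = ∫ y, vR v₁ R y := fun x => by
    rw [hw, integral_integral_boxKernel hA hVb hmul, ← integral_sub_left_eq_self (vR v₁ R) volume x]
    simp only [one_mul, mul_one]
  have e0 := integral_pair_wBig (M := M) hv hR hℓ hRℓ
  obtain ⟨D, hD⟩ := hV.continuous.bounded_above_of_compact_support hV.hasCompactSupport
  have hDle : ∀ x, vR v₁ R x ≤ D := fun x => (le_abs_self _).trans (hD x)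
  have key := integral_potentialForm_boxPotential (μ := volume.restrict S) (w := wBig M v₁ R ℓ) hw0
    (by rw [hw]; exact continuous_boxKernel hA hVb.continuous) (fun x y => (hi2 x y).integrableOn)
    (C₂ := D) (C₁ := ∫ y, vR v₁ R y)
    (fun x y => ((setIntegral_le_integral (hi2 x y) (Eventually.of_forall fun u => hw0 u x y)).trans_eq
      (e2 x y)).trans (hDle _))
    (fun x => (hi1 x).integrableOn)
    (fun x => (setIntegral_le_integral (hi1 x) (Eventually.of_forall fun u =>
      integral_nonneg fun y => hw0 u x y)).trans_eq (e1 x))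
    (by simp only [e0]; exact integrable_const _) hΨ ρ
  refine ⟨key.1, ?_⟩
  rw [key.2.2]
  have hp : Integrable fun x => ‖Ψ x‖ ^ 2 := hΨ.integrable_norm_pow (by norm_num)
  have hc : Continuous fun x : Config N => ∑ i, ∑ j ∈ Finset.Ioi i, vR v₁ R (x i - x j) :=
    continuous_finsetSum _ fun i _ => continuous_finsetSum _ fun j _ => hV.continuous.comp (by fun_prop)
  have hbi : Integrable fun x : Config N => backgroundPotential v₁ R ρ ℓ L x * ‖Ψ x‖ ^ 2 := by
    have h2 : Integrable fun x : Config N => (∑ i, ∑ j ∈ Finset.Ioi i, vR v₁ R (x i - x j)) * ‖Ψ x‖ ^ 2 := by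
      refine hp.bdd_mul (c := ∑ i : Fin N, ∑ j ∈ Finset.Ioi i, D) hc.aestronglyMeasurable
        (Eventually.of_forall fun x => ?_)
      refine (norm_sum_le _ _).trans (Finset.sum_le_sum fun i _ => (norm_sum_le _ _).trans
        (Finset.sum_le_sum fun j _ => hD _))
    refine (((hp.const_mul (∑ _i : Fin N, -(ρ * ∫ y, vR v₁ R y))).add h2).add
      (hp.const_mul (1 / 2 * ρ ^ 2 * volume.real (Lam'' L ℓ) * ∫ y, vR v₁ R y))).congr
      (Eventually.of_forall fun x => ?_)
    simp only [Pi.add_apply, backgroundPotential, add_mul]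
  refine integral_mono_ae key.2.1 hbi ?_
  filter_upwards [hz] with x hx
  rcases hx with hx | hx
  · refine mul_le_mul_of_nonneg_right ?_ (by positivity)
    have hχ : ∀ i, ∀ u ∉ S, chiBig M ℓ u (x i) = 0 := fun i u hu => by
      by_contra h
      exact hu (mem_smul_Lam' hℓ (hx i) h)
    have s1 : ∀ i, ∫ u in S, ∫ y, wBig M v₁ R ℓ u (x i) y = ∫ y, vR v₁ R y := fun i => by
      rw [← e1 (x i)]
      refine setIntegral_eq_integral_of_forall_compl_eq_zero fun u hu => ?_
      simp [wBig, hχ i u hu]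
    have s2 : ∀ i j, ∫ u in S, wBig M v₁ R ℓ u (x i) (x j) = vR v₁ R (x i - x j) := fun i j => by
      rw [← e2]
      refine setIntegral_eq_integral_of_forall_compl_eq_zero fun u hu => ?_
      simp [wBig, hχ i u hu]
    simp only [s1, s2, e0, backgroundPotential]
    refine add_le_add le_rfl ?_
    have hv0 : 0 ≤ ∫ y, vR v₁ R y := integral_nonneg hV.nonneg
    have hvol : volume.real (Lam'' L ℓ) = (L + 2 * ℓ) ^ 3 := by
      rw [Lam'', Lam, cube_add_cube hL (by positivity), volume_real_cube _ (by positivity)]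
    rw [integral_const, measureReal_restrict_apply_univ, smul_eq_mul, Measure.real, hSv,
      ENNReal.toReal_ofReal (by positivity), hvol]
    have h3 : (ℓ ^ 3)⁻¹ * (L + ℓ) ^ 3 * (ℓ ^ 3 * ∫ y, vR v₁ R y) = (L + ℓ) ^ 3 * ∫ y, vR v₁ R y := by
      field_simp
    rw [h3, ← mul_assoc]
    gcongr
    linarith
  · simp [hx]

end

/-! ### The form domain -/

lemma MemH10.congr_ae {V : Type*} [NormedAddCommGroup V] [NormedSpace ℝ V] [MeasureSpace V]
    {U : Set V} {f g : V → ℂ} (h : MemH10 U f) (e : f =ᵐ[volume] g) : MemH10 U g := by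
  obtain ⟨hf, G, hG, φ, hφ, ht, ht'⟩ := h
  refine ⟨(memLp_congr_ae e).1 hf, G, hG, φ, hφ, ht.congr fun n => eLpNorm_congr_ae ?_, ht'⟩
  filter_upwards [e] with x hx
  simp [hx]

lemma potentialForm_congr_ae {N : ℕ} {V : Config N → ℝ} {Ψ Ψ' : Config N → ℂ} (h : Ψ =ᵐ[volume] Ψ') :
    potentialForm V Ψ = potentialForm V Ψ' := by
  refine integral_congr_ae ?_
  filter_upwards [h] with x hx
  rw [hx]

/-- A function in the form domain agrees almost everywhere with one whose slices have gradients. -/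
lemma BosonDomain.exists_slices {L : ℝ} {N : ℕ} {Ψ : Config N → ℂ} (h : BosonDomain L Ψ) :
    ∃ Ψ' G, Ψ =ᵐ[volume] Ψ' ∧ HasSlices L Ψ' G ∧ ∀ᵐ x : Config N, (∀ i, x i ∈ Lam L) ∨ Ψ' x = 0 := by
  have hm := h.1.1.1
  have hΨ := h.1.congr_ae hm.ae_eq_mk
  obtain ⟨G, h1, h2, h3⟩ := BoseLoc.exists_slices hm.stronglyMeasurable_mk hΨ
  refine ⟨hm.mk Ψ, G, hm.ae_eq_mk, ⟨hm.stronglyMeasurable_mk, hΨ.1, h1, h2, h3⟩, ?_⟩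
  filter_upwards [ae_eq_zero_of_memH10 isOpen_interior.measurableSet hΨ] with x hx
  by_cases hx' : x ∈ interior {x : Config N | ∀ i, x i ∈ Lam L}
  · exact Or.inl (interior_subset hx')
  · exact Or.inr (hx hx')

/-! ### Localization of the Hamiltonian -/

section

variable {N : ℕ} {Ψ Ψ' : Config N → ℂ} {M : ℕ} {v₁ : E3 → ℝ} {b R ρ s d ℓ εT ε₀ L : ℝ}
  {G : Fin N → Config N → EuclideanSpace ℂ (Fin 3)}

lemma Hrho_congr_ae (h : Ψ =ᵐ[volume] Ψ') : Hrho v₁ R ρ ℓ L Ψ = Hrho v₁ R ρ ℓ L Ψ' := by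
  rw [Hrho, Hrho, secondQuant_congr (fun _ _ => gradEnergy_congr_ae) h, potentialForm_congr_ae h]

lemma Hbig_congr_ae (h : Ψ =ᵐ[volume] Ψ') (u : E3) :
    Hbig M v₁ b R ρ s d ℓ εT ε₀ u Ψ = Hbig M v₁ b R ρ s d ℓ εT ε₀ u Ψ' := by
  rw [Hbig, Hbig, secondQuant_congr (fun _ _ => kinBig_congr_ae) h, potentialForm_congr_ae h]

lemma Hsmall_congr_ae (h : Ψ =ᵐ[volume] Ψ') (u u' : E3) :
    Hsmall M v₁ R ρ s d ℓ εT ε₀ u u' Ψ = Hsmall M v₁ R ρ s d ℓ εT ε₀ u u' Ψ' := by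
  rw [Hsmall, Hsmall, secondQuant_congr (fun _ _ => kinSmall_congr_ae) h, potentialForm_congr_ae h]

/-- The Neumann energy and the localized kinetic energy each average to at most the Dirichlet
energy, so their convex combination with weights `ε₀` and `1 - ε₀` does too. Nonnegativity allows
the restriction to `u ∈ ℓ⁻¹Λ'`. -/
theorem HasSlices.integral_Hbig_le (h : HasSlices L Ψ G) (hL : 0 < L)
    (hz : ∀ᵐ x : Config N, (∀ i, x i ∈ Lam L) ∨ Ψ x = 0) (hv : AdmissiblePotential v₁)
    (hR : 0 < R) (hd : 0 < d) (hℓ : 0 < ℓ) (hRℓ : R < ℓ) (hb : 0 ≤ b) (hε : 0 ≤ εT) (hε1 : εT ≤ 1)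
    (h0 : 0 ≤ ε₀) (h1 : ε₀ ≤ 1)
    (hle : ∀ f, StronglyMeasurable f → Integrable f → MemLp f 2 volume →
      ∫⁻ u, ENNReal.ofReal (kinBig M b s d ℓ εT u f) ≤ momentL 1 f) :
    IntegrableOn (fun u => ε₀ * secondQuant (neumannForm ℓ u) Ψ + Hbig M v₁ b R ρ s d ℓ εT ε₀ u Ψ)
      (ℓ⁻¹ • Lam' L ℓ) ∧
    ∫ u in ℓ⁻¹ • Lam' L ℓ, (ε₀ * secondQuant (neumannForm ℓ u) Ψ + Hbig M v₁ b R ρ s d ℓ εT ε₀ u Ψ)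
      ≤ Hrho v₁ R ρ ℓ L Ψ := by
  obtain ⟨n1, n2, n3⟩ := h.neumann_le hℓ
  obtain ⟨k1, k2, k3⟩ := h.kinBig_le hL.le hb hd hℓ hε hε1 hle
  obtain ⟨p1, p2⟩ := integral_potentialForm_wBig_le (M := M) hv hR hℓ hRℓ hL ρ h.memLp hz
  set S := ℓ⁻¹ • Lam' L ℓ
  have i1 : IntegrableOn (fun u => ε₀ * secondQuant (neumannForm ℓ u) Ψ) S := (n2.const_mul ε₀).integrableOn
  have i2 : IntegrableOn (fun u => (1 - ε₀) * secondQuant (kinBig M b s d ℓ εT u) Ψ) S :=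
    (k2.const_mul (1 - ε₀)).integrableOn
  have i3 : IntegrableOn (fun u => Hbig M v₁ b R ρ s d ℓ εT ε₀ u Ψ) S := i2.add p1
  refine ⟨i1.add i3, ?_⟩
  have e : ∫ u in S, Hbig M v₁ b R ρ s d ℓ εT ε₀ u Ψ
      = (1 - ε₀) * (∫ u in S, secondQuant (kinBig M b s d ℓ εT u) Ψ)
        + ∫ u in S, potentialForm (boxPotential ρ (wBig M v₁ R ℓ u)) Ψ := by
    rw [← integral_const_mul]
    exact integral_add i2 p1
  rw [integral_add i1 i3, e, integral_const_mul, Hrho, secondQuant_gradEnergy h.meas_grad h.memLp_grad h.slices]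
  have a1 := (setIntegral_le_integral (s := S) n2 (Eventually.of_forall n1)).trans n3
  have a2 := (setIntegral_le_integral (s := S) k2 (Eventually.of_forall k1)).trans k3
  have a3 := mul_le_mul_of_nonneg_left a1 h0
  have a4 := mul_le_mul_of_nonneg_left a2 (sub_nonneg.2 h1)
  linarith

/-- The factor `1 - ε₀` of the kinetic energy also multiplies the retained gap. Leaving `c` free
covers both forms of the small-box inequality. -/
theorem HasSlices.integral_Hsmall_le (h : HasSlices L Ψ G) (hL : 0 < L) (hv : AdmissiblePotential v₁)
    (hM : 2 ≤ M) {κ : ℝ} (hκ : κ ≤ 1) (hR : 0 < R) (hs : 0 < s) (hd : 0 < d) (hℓ : 0 < ℓ)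
    (hRd : R < d * ℓ) (hRℓ : R < ℓ) (hb : 0 ≤ b) (hε : 0 ≤ εT) (hε1 : εT ≤ 1) (h1 : ε₀ ≤ 1) {u : E3}
    (hle : ∀ f, StronglyMeasurable f → MemLp f 2 volume →
      dispersionL (1 / 2 * (s * ℓ)⁻¹) (fun x => (chiBig M ℓ u x : ℂ) * projQ (bigBox ℓ u) f x) ≠ ⊤ →
      ∫⁻ u', ENNReal.ofReal (kinSmall M s d ℓ εT u u' f)
        ≤ ENNReal.ofReal (kinBig M b s d ℓ εT u f - κ * b * (ℓ ^ 2)⁻¹ * formQ (bigBox ℓ u) f)) :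
    Integrable (fun u' => Hsmall M v₁ R ρ s d ℓ εT ε₀ u u' Ψ) ∧
      ∀ c ≤ (1 - ε₀) * κ * b, ∫ u', Hsmall M v₁ R ρ s d ℓ εT ε₀ u u' Ψ
        ≤ Hbig M v₁ b R ρ s d ℓ εT ε₀ u Ψ - c * (ℓ ^ 2)⁻¹ * secondQuant (formQ (bigBox ℓ u)) Ψ := by
  obtain ⟨q1, k2, k3⟩ := h.kinSmall_le hL.le hM hb hκ hs hd hℓ hε hε1 hle
  obtain ⟨p1, p2⟩ := integral_potentialForm_wSmall (M := M) hv hR hd hℓ hRd hRℓ ρ u h.memLp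
  have i2 := k2.const_mul (1 - ε₀)
  refine ⟨i2.add p1, fun c hc => ?_⟩
  have e : ∫ u', Hsmall M v₁ R ρ s d ℓ εT ε₀ u u' Ψ
      = (1 - ε₀) * (∫ u', secondQuant (kinSmall M s d ℓ εT u u') Ψ)
        + ∫ u', potentialForm (boxPotential ρ (wSmall M v₁ R d ℓ u u')) Ψ := by
    rw [← integral_const_mul]
    exact integral_add i2 p1
  rw [e, p2, Hbig]
  have a1 := mul_le_mul_of_nonneg_left k3 (sub_nonneg.2 h1)
  have a2 := mul_le_mul_of_nonneg_right hc (mul_nonneg (inv_nonneg.2 (sq_nonneg ℓ)) q1)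
  linarith

end

/-! ### Consequences of the conditions on the parameters -/

lemma LengthScaleCondition.d_lt {δ a R ρ s d ℓ : ℝ} (h : LengthScaleCondition δ a R ρ s d ℓ) (hδ : δ ≤ 1) :
    d < 1 := by
  obtain ⟨ha, -, hρ, hs, hd, hℓ, -, -, -, hsδ, h1, -, h2⟩ := h
  have hδ0 : 0 < δ := hs.trans hsδ
  have hq : 0 < (ρ * a) ^ (1 / 2 : ℝ) := by positivity
  rw [Real.rpow_neg (by positivity)] at h2
  set q := (ρ * a) ^ (1 / 2 : ℝ)
  rw [← mul_inv, inv_lt_comm₀ (by positivity) hδ0] at h2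
  have h3 : 1 < δ * (q * (s * ℓ)) := by
    have := mul_lt_mul_of_pos_left h2 hδ0
    rwa [mul_inv_cancel₀ hδ0.ne'] at this
  -- The conditions on `dℓ(ρa)^(1/2)` and `(ρa)^(-1/2)/(sℓ)` multiply to `d < δ²s`; here the weaker
  -- `d < 1` is read off.
  calc d = d * 1 := (mul_one d).symm
    _ < d * (δ * (q * (s * ℓ))) := mul_lt_mul_of_pos_left h3 hd
    _ = d * ℓ * q * (δ * s) := by ring
    _ ≤ 1 * (1 * 1) := by
        refine mul_le_mul (h1.le.trans hδ) ?_ (by positivity) zero_le_one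
        exact mul_le_mul hδ (hsδ.le.trans hδ) hs.le zero_le_one
    _ = 1 := by norm_num

lemma LengthScaleCondition.range_lt {δ a R ρ s d ℓ : ℝ} (h : LengthScaleCondition δ a R ρ s d ℓ)
    (hδ : δ ≤ 1) : R < d * ℓ := by
  obtain ⟨ha, -, hρ, hs, hd, hℓ, -, -, -, hsδ, -, h1, -⟩ := h
  rw [← div_eq_mul_inv, div_lt_iff₀ (by positivity)] at h1
  calc R < δ * (d * s * ℓ) := h1
    _ = δ * s * (d * ℓ) := by ring
    _ ≤ 1 * (d * ℓ) := by
        refine mul_le_mul_of_nonneg_right ?_ (by positivity)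
        exact mul_le_one₀ hδ hs.le (hsδ.le.trans hδ)
    _ = _ := one_mul _

/-- The summand `s⁻²` alone gives `s^(M-2) d⁻² ≤ δ s²`, which is more than needed since `s ≤ 1`. -/
lemma KineticCondition.pow_le {δ : ℝ} {M : ℕ} {s d εT : ℝ} (h : KineticCondition δ M s d εT) (hM : 2 ≤ M)
    (hs : 0 < s) (hs1 : s ≤ 1) (hd : 0 < d) (hδ : 0 ≤ δ) : s ^ (M - 2) * (d ^ 2)⁻¹ ≤ δ := by
  have h1 := h.smooth
  obtain ⟨m, rfl⟩ := Nat.exists_eq_add_of_le hM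
  rw [Nat.add_sub_cancel_left]
  have e : (s ^ 2)⁻¹ * ((d * s) ^ 2)⁻¹ * s ^ (2 + m) = s ^ m * (d ^ 2)⁻¹ * (s ^ 2)⁻¹ := by
    rw [pow_add]; field_simp
  have h2 : s ^ m * (d ^ 2)⁻¹ * (s ^ 2)⁻¹ ≤ δ := by
    rw [← e]
    refine le_trans ?_ h1
    gcongr
    exact le_add_of_nonneg_right (by positivity)
  have h3 : s ^ m * (d ^ 2)⁻¹ ≤ δ * s ^ 2 := by
    rwa [← div_eq_mul_inv, div_le_iff₀ (by positivity)] at h2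
  exact h3.trans (mul_le_of_le_one_right hδ (pow_le_one₀ hs.le hs1))

end BoseLoc
end

/-! ### The localization theorem -/

open BoseLoc MeasureTheory
theorem theorem3p9 :
    ∃ b₀ : ℝ, 0 < b₀ ∧ ∀ b : ℝ, 0 < b → b ≤ b₀ →
    ∀ M : ℕ, 8 ≤ M → ∀ v₁ : E3 → ℝ, AdmissiblePotential v₁ → ∀ εbar : ℝ, εbar < 1 / 2 →
    ∃ δ : ℝ, 0 < δ ∧ δ < 1 ∧
    ∀ a R ρ s d ℓ εT ε₀ : ℝ, IsScatteringLength (vR v₁ R) a →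
      LengthScaleCondition δ a R ρ s d ℓ → KineticCondition δ M s d εT →
      0 ≤ ε₀ → ε₀ ≤ 1 / 2 →
      (∀ (L : ℝ), 0 < L → ∀ (N : ℕ) (Ψ : Config N → ℂ), BosonDomain L Ψ →
        -- localization into large boxes
        (IntegrableOn (fun u => ε₀ * secondQuant (neumannForm ℓ u) Ψ
              + Hbig M v₁ b R ρ s d ℓ εT ε₀ u Ψ) (ℓ⁻¹ • Lam' L ℓ) ∧
          ∫ u in ℓ⁻¹ • Lam' L ℓ, (ε₀ * secondQuant (neumannForm ℓ u) Ψ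
              + Hbig M v₁ b R ρ s d ℓ εT ε₀ u Ψ)
            ≤ Hrho v₁ R ρ ℓ L Ψ) ∧
        -- localization of a large box into small boxes
        ∀ u : E3,
          Integrable (fun u' => Hsmall M v₁ R ρ s d ℓ εT ε₀ u u' Ψ) ∧
          ∫ u', Hsmall M v₁ R ρ s d ℓ εT ε₀ u u' Ψ
            ≤ Hbig M v₁ b R ρ s d ℓ εT ε₀ u Ψ
              - (1 - ε₀) * (b / 2) * (ℓ ^ 2)⁻¹ * secondQuant (formQ (bigBox ℓ u)) Ψ ∧
          (ε₀ ≤ εbar →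
            ∫ u', Hsmall M v₁ R ρ s d ℓ εT ε₀ u u' Ψ
              ≤ Hbig M v₁ b R ρ s d ℓ εT ε₀ u Ψ
                - b / 2 * (ℓ ^ 2)⁻¹ * secondQuant (formQ (bigBox ℓ u)) Ψ)) ∧
      -- the Neumann gap in the small boxes
      ∀ (u u' : E3) (f : E3 → ℂ), MemLp f 2 →
        εT * (1 + (Real.pi ^ 2)⁻¹)⁻¹ * ((d * ℓ) ^ 2)⁻¹ * formQ (smallBox d ℓ u u') f
          ≤ kinSmall M s d ℓ εT u u' f := by
  -- The universal bound on `b` is the one from the symbol inequality, which does not involve the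
  -- constants depending on `M`.
  refine ⟨1 / 8, by norm_num, fun b hb hb8 M hM v₁ hv εbar hεbar => ?_⟩
  have hM2 : 2 ≤ M := by omega
  obtain ⟨C₁, hC₁, hbig⟩ := exists_lintegral_kinBig_le M hM2
  obtain ⟨C₂, hC₂, hsmall⟩ := exists_lintegral_kinSmall_le M hM2
  -- `κ` is the fraction of the gap that is kept. The strict inequality `εbar < 1/2` leaves room for
  -- `κ < 1`, and the remaining fraction pays for the localization into small boxes. The maximum
  -- with `0` keeps `κ ≥ 1/2` for negative `εbar`.
  obtain ⟨κ, hκ0, hκ1, hκ⟩ : ∃ κ : ℝ, 1 / 2 ≤ κ ∧ κ < 1 ∧ ∀ ε₀ : ℝ, ε₀ ≤ εbar → 1 / 2 ≤ (1 - ε₀) * κ := by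
    have he : max εbar 0 < 1 / 2 := max_lt hεbar (by norm_num)
    have he0 : 0 ≤ max εbar 0 := le_max_right _ _
    have he1 : εbar ≤ max εbar 0 := le_max_left _ _
    have hp : 0 < 2 * (1 - max εbar 0) := by linarith
    refine ⟨(2 * (1 - max εbar 0))⁻¹, ?_, ?_, fun ε₀ hε₀ => ?_⟩
    · rw [one_div]
      exact inv_anti₀ hp (by linarith)
    · exact inv_lt_one_of_one_lt₀ (by linarith)
    · rw [← div_eq_mul_inv, le_div_iff₀ hp]
      linarith
  have hκb : 0 < (1 - κ) * b := mul_pos (by linarith) hb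
  have hC₁0 : 0 < C₁ := by linarith
  have hC₂0 : 0 < C₂ := by linarith
  -- The conditions serve, in order: `εT ≤ 1/2`, smallness of `s` in the large boxes (with `32² ≥
  -- 512`), smallness of `s` in the small boxes, and the payment of the errors by the fraction `1-κ`
  -- of the gap.
  obtain ⟨δ, hδ0, hδ1, hδ2, hδ3, hδ4⟩ : ∃ δ : ℝ, 0 < δ ∧ δ ≤ 1 / 2 ∧ 32 * C₁ * δ ≤ 1 ∧ C₂ * δ ≤ 1 ∧
      C₂ * δ ≤ (1 - κ) * b := by
    refine ⟨min (32 * C₁)⁻¹ (min C₂⁻¹ ((1 - κ) * b / C₂)), by positivity, ?_, ?_, ?_, ?_⟩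
    · refine (min_le_left _ _).trans ?_
      rw [one_div]
      exact inv_anti₀ (by norm_num) (by linarith)
    · calc _ ≤ 32 * C₁ * (32 * C₁)⁻¹ := mul_le_mul_of_nonneg_left (min_le_left _ _) (by positivity)
        _ = 1 := mul_inv_cancel₀ (by positivity)
    · calc _ ≤ C₂ * C₂⁻¹ := mul_le_mul_of_nonneg_left
            ((min_le_right _ _).trans (min_le_left _ _)) hC₂0.le
        _ = 1 := mul_inv_cancel₀ hC₂0.ne'
    · calc _ ≤ C₂ * ((1 - κ) * b / C₂) := mul_le_mul_of_nonneg_left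
            ((min_le_right _ _).trans (min_le_right _ _)) hC₂0.le
        _ = (1 - κ) * b := by field_simp
  refine ⟨δ, hδ0, by linarith, fun a R ρ s d ℓ εT ε₀ _ hls hkin h0 h1 => ?_⟩
  have hs := hls.s_pos
  have hd := hls.d_pos
  have hℓ := hls.ℓ_pos
  have hsδ := hls.s_small
  have hd1 := hls.d_lt (by linarith)
  have hRd := hls.range_lt (by linarith)
  have hRℓ : R < ℓ := hRd.trans (mul_lt_of_lt_one_left hℓ hd1)
  have hε := hkin.εT_pos
  have hε2 : εT ≤ 1 / 2 := hkin.εT_small.le.trans hδ1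
  have hs1 : 512 * C₁ ^ 2 * s ^ 2 ≤ 1 := by
    have : 32 * C₁ * s ≤ 1 := (mul_le_mul_of_nonneg_left hsδ.le (by positivity)).trans hδ2
    have := pow_le_one₀ (n := 2) (by positivity) this
    nlinarith
  have hs2 : C₂ * s ^ 2 ≤ 1 := by
    refine le_trans (mul_le_mul_of_nonneg_left ?_ hC₂0.le) hδ3
    nlinarith
  have hpow := hkin.pow_le hM2 hs (by linarith) hd hδ0.le
  have hs3 : C₂ * s ^ (M - 2) * (d ^ 2)⁻¹ ≤ (1 - κ) * b := by
    rw [mul_assoc]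
    exact (mul_le_mul_of_nonneg_left hpow hC₂0.le).trans hδ4
  refine ⟨fun L hL N Ψ hΨ => ?_, fun u u' f _ => ?_⟩
  · obtain ⟨Ψ', G, he, hsl, hz⟩ := hΨ.exists_slices
    simp only [Hrho_congr_ae he, Hbig_congr_ae he, Hsmall_congr_ae he,
      secondQuant_congr (fun _ _ => formQ_congr_ae) he,
      secondQuant_congr (q := neumannForm ℓ _) (fun _ _ => gradEnergy_congr_ae) he]
    refine ⟨hsl.integral_Hbig_le hL hz hv hls.R_pos hd hℓ hRℓ hb.le hε.le (by linarith) h0 (by linarith)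
      (hbig b s d ℓ εT hb hb8 hs hd hd1.le hℓ hε hε2 hs1), fun u => ?_⟩
    obtain ⟨hi, hle⟩ := hsl.integral_Hsmall_le (ρ := ρ) (ε₀ := ε₀) hL hv hM2 hκ1.le hls.R_pos hs hd hℓ hRd hRℓ
      hb.le hε.le (by linarith) (by linarith)
      (hsmall b s d ℓ εT κ hb hs hd hd1.le hℓ hε (by linarith) hs2 hs3 u)
    refine ⟨hi, hle _ ?_, fun hεb => hle _ ?_⟩
    · have := mul_le_mul_of_nonneg_left hκ0 (mul_nonneg (by linarith : (0 : ℝ) ≤ 1 - ε₀) hb.le)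
      linarith
    · have := mul_le_mul_of_nonneg_right (hκ ε₀ hεb) hb.le
      linarith
  · exact le_add_of_nonneg_right (dispersionForm_nonneg _ _)
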